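/- Let $H_{el}=-\Delta-V(x)$ be a self-adjoint Schrödinger operator on $L^2(\mathbb R^3)$, $V$ real, whose negative spectrum consists of a single simple eigenvalue $e_0<0$. Let $\mathcal F$ be the bosonic Fock space over $L^2(\mathbb R^3)$, $\omega(k)=|k|$, $H_f=\int\omega(k)a^*(k)a(k)\,dk$, and, for an operator-valued function $G$, $W(G)=\int\{G(k)\otimes a^*(k)+G(k)^*\otimes a(k)\}\,dk$. Let $G\in L^2(\mathbb R^3;\mathcal B(L^2(\mathbb R^3)))$ satisfy $\int(1+\omega(k)^{-2})\|G(k)\|^2dk\le 1$, and let $H_g=H_{el}\otimes 1+1\otimes H_f+gW(G)$ on $L^2(\mathbb R^3)\otimes\mathcal F$. Theorem A.1. There are $g_0>0$ and, for $|g|<g_0$, functions $h_g\in L^2(\mathbb R^3)$ with $\omega h_g\in L^2(\mathbb R^3)$, bounded self-adjoint operators $\Delta V=\Delta V_g$ on $L^2(\mathbb R^3)$, numbers $e_g<0$, and orthogonal projections $\Pi_g$, such that, with the unitary (Weyl) operator $$U_g=1\otimes e^{ig\,(a^*(ih_g)+a(ih_g))},$$ the following holds for all $|g|<g_0$ (in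 particular for all small $g>0$). 1. $U_gH_gU_g^*=\widetilde H_{el}\otimes 1+1\otimes H_f+g\widetilde W$, including equality of domains, where $\widetilde H_{el}=H_{el}+g^2\Delta V$ and $\widetilde W=W(G)+1\otimes\{a^*(\omega h_g)+a(\omega h_g)\}$. 2. $e_g$ is a simple eigenvalue of $\widetilde H_{el}$, $e_g<-g^2$, it is the only point of the spectrum of $\widetilde H_{el}$ in $(-\infty,-g^2)$, and $\Pi_g$ is its (one-dimensional) eigenprojection. If moreover $0$ is not an eigenvalue of $H_{el}$ and $G(k)$ is relatively compact with respect to $H_{el}$ for almost every $k$ (for instance, if $G(k)|x|^\gamma$ is bounded for some $\gamma>0$), then $e_g$ is the only point of the spectrum of $\widetilde H_{el}$ in $(-\infty,0)$, so that $\widetilde H_{el}$ has a single, simple negative eigenvalue ($g_0$ may depend on $H_{el}$ and $G$). 3. $(\Pi_g\otimes 1)\,\widetilde W\,(\Pi_g\otimes 1)=0$, and $h_g$ solves the fixed point equation $h_g(k)=-\omega(k)^{-1}\langle\varphi_g,G(k)\varphi_g\rangle$ for almost every $k$, where $\varphi_g$ is any normalized eigenvector of $\widetilde H_{el}$ for $e_g$.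 4. If $G(k)$ is a multiplication operator for almost every $k$, then $\Delta V$ is multiplication by a real function. 5. $e_g$, $\Delta V_g$ and $\Pi_g$ (in operator norm), $h_g$ and $\omega h_g$ (in $L^2$) are real analytic in $g\in(-g_0,g_0)$; so are $g\mapsto U_g\Psi$ for every vector $\Psi$ with finitely many photons, and $g\mapsto\widetilde W\Psi$ for every $\Psi$ in the domain of $1\otimes H_f$. -/

import Mathlib

open MeasureTheory Set Filter Topology
open scoped ENNReal ContDiff InnerProductSpace

namespace PhotonField

noncomputable section

/-! ### Unbounded operators on a complex Hilbert space -/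

section Operators

variable {X : Type*} [NormedAddCommGroup X] [InnerProductSpace ℂ X]

/-- The spectrum of a (possibly unbounded) operator: the set of all `z` for which
`A - z : dom A → X` is not bijective. (For closed `A`, in particular for self-adjoint `A`, the
inverse of a bijective `A - z` is automatically bounded.) -/
def opSpectrum (A : X →ₗ.[ℂ] X) : Set ℂ :=
  {z | ¬ Function.Bijective fun x : A.domain => A x - z • (x : X)}

/-- The eigenspace `{ψ ∈ dom A | A ψ = z ψ}`. -/
def opEigenspace (A : X →ₗ.[ℂ] X) (z : ℂ) : Submodule ℂ X :=
  (LinearMap.ker (A.toFun - z • A.domain.subtype)).map A.domain.subtype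

/-- Below the threshold `c`, the spectrum of `A` consists of the single point `e`, and `e` is a
simple eigenvalue of `A`. -/
structure HasSingleEigenvalueBelow (A : X →ₗ.[ℂ] X) (c e : ℝ) : Prop where
  lt : e < c
  spectrum_below : ∀ t : ℝ, t < c → ((t : ℂ) ∈ opSpectrum A ↔ t = e)
  simple : Module.finrank ℂ (opEigenspace A (e : ℂ)) = 1

/-- The bounded operator `B` is `A`-compact: it maps the unit ball of the graph norm of `A` to a
relatively compact set. -/
def IsRelCompact (A : X →ₗ.[ℂ] X) (B : X →L[ℂ] X) : Prop :=
  IsCompact (closure (B '' {ψ | ∃ hψ : ψ ∈ A.domain, ‖ψ‖ ≤ 1 ∧ ‖A ⟨ψ, hψ⟩‖ ≤ 1}))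

/-- The operator `A + B`, for `B` bounded, with domain `dom A`. -/
def addBounded (A : X →ₗ.[ℂ] X) (B : X →L[ℂ] X) : X →ₗ.[ℂ] X :=
  (B : X →ₗ[ℂ] X) +ᵥ A

/-- The operator `U A U*`, with domain `U (dom A)`. -/
def unitaryConj (U : X ≃ₗᵢ[ℂ] X) (A : X →ₗ.[ℂ] X) : X →ₗ.[ℂ] X where
  domain := A.domain.comap (U.symm.toLinearEquiv : X →ₗ[ℂ] X)
  toFun :=
    { toFun := fun x => U (A ⟨U.symm (x : X), x.2⟩)
      map_add' := by
        intro x y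
        have h : (⟨U.symm ((x + y : _) : X), (x + y).2⟩ : A.domain)
            = ⟨U.symm (x : X), x.2⟩ + ⟨U.symm (y : X), y.2⟩ := by
          exact Subtype.ext (map_add U.symm (x : X) (y : X))
        rw [h, A.map_add, map_add]
      map_smul' := by
        intro c x
        have h : (⟨U.symm ((c • x : _) : X), (c • x).2⟩ : A.domain)
            = c • ⟨U.symm (x : X), x.2⟩ := by
          exact Subtype.ext (map_smul U.symm c (x : X))
        rw [h, A.map_smul, map_smul]
        rfl }

end Operators

/-! ### The electron -/

/-- Three-dimensional space (electron positions, photon momenta). -/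
abbrev Space : Type := EuclideanSpace ℝ (Fin 3)

/-- The electron Hilbert space `L²(ℝ³)`. -/
abbrev Electron : Type := Lp ℂ 2 (volume : Measure Space)

/-- The operator `A` on `L²(ℝ³)` acts as `-Δ - V` in the sense of distributions. A self-adjoint
operator with this property is a self-adjoint realization of `-Δ - V`. -/
def ActsAsSchrodinger (V : Space → ℝ) (A : Electron →ₗ.[ℂ] Electron) : Prop :=
  ∀ ψ : A.domain,
    LocallyIntegrable (fun x => (V x : ℂ) * (ψ : Electron) x) volume ∧
    ∀ φ : Space → ℂ, ContDiff ℝ ∞ φ → HasCompactSupport φ →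
      ∫ x, φ x * (A ψ : Electron) x =
        (∫ x, -(Laplacian.laplacian φ x) * (ψ : Electron) x)
          - ∫ x, φ x * ((V x : ℂ) * (ψ : Electron) x)

/-- The bounded operator `B` on `L²(ℝ³)` is multiplication by a (measurable) function. -/
def IsMultiplication (B : Electron →L[ℂ] Electron) : Prop :=
  ∃ m : Space → ℂ, AEStronglyMeasurable m volume ∧
    ∀ ψ : Electron, (B ψ : Space → ℂ) =ᵐ[volume] fun x => m x * ψ x

/-- The bounded operator `B` on `L²(ℝ³)` is a potential, i.e. multiplication by a real-valued
(measurable) function. -/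
def IsPotential (B : Electron →L[ℂ] Electron) : Prop :=
  ∃ v : Space → ℝ, AEStronglyMeasurable v volume ∧
    ∀ ψ : Electron, (B ψ : Space → ℂ) =ᵐ[volume] fun x => (v x : ℂ) * ψ x

/-! ### The Hilbert space of the atom-photon system

The tensor product of `L²(ℝ³)` with the bosonic Fock space over `L²(ℝ³)` is realized in the usual
way: its vectors are the square-integrable sequences `Ψ = (Ψ⟨n, ·⟩)`, `n = 0, 1, 2, …`, of square
integrable functions `Ψ⟨n, (k₁, …, kₙ)⟩` of `n` photon momenta with values in `L²(ℝ³)`, which are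
totally symmetric in `k₁, …, kₙ`. -/

/-- Configurations of an arbitrary finite number of photon momenta. -/
abbrev Config : Type := Σ n : ℕ, (Fin n → Space)

/-- Lebesgue measure on each of the `n`-photon configuration spaces `(ℝ³)ⁿ`. -/
def configMeasure : Measure Config :=
  Measure.sum fun n : ℕ => (volume : Measure (Fin n → Space)).map (Sigma.mk n)

lemma measurableEmbedding_mk (n : ℕ) :
    MeasurableEmbedding (fun k : Fin n → Space => (⟨n, k⟩ : Config)) where
  injective := fun a b hab => by simpa using hab
  measurable := by
    intro s hs
    exact (MeasurableSpace.measurableSet_iInf.1 hs) n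
  measurableSet_image' := by
    intro s hs
    refine MeasurableSpace.measurableSet_iInf.2 fun m => ?_
    change MeasurableSet {k : Fin m → Space | (⟨m, k⟩ : Config) ∈
      (fun k : Fin n → Space => (⟨n, k⟩ : Config)) '' s}
    by_cases h : m = n
    · subst h
      convert hs using 1
      ext k
      simp
    · convert MeasurableSet.empty using 1
      ext k
      simp only [Set.mem_image, Set.mem_ofPred_eq, Set.mem_empty_iff_false, iff_false]
      rintro ⟨k', -, hk⟩
      exact h (congrArg Sigma.fst hk).symm

lemma ae_config_iff {p : Config → Prop} :
    (∀ᵐ q ∂configMeasure, p q) ↔ ∀ n : ℕ, ∀ᵐ k : Fin n → Space, p ⟨n, k⟩ := by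
  rw [configMeasure, Measure.ae_sum_iff]
  exact forall_congr' fun n => (measurableEmbedding_mk n).ae_map_iff

/-- Square-integrable `L²(ℝ³)`-valued functions of the photon configuration. -/
abbrev FullFock : Type := Lp Electron 2 configMeasure

lemma ae_perm {n : ℕ} {p : (Fin n → Space) → Prop} (σ : Equiv.Perm (Fin n))
    (h : ∀ᵐ k : Fin n → Space, p k) : ∀ᵐ k : Fin n → Space, p (k ∘ σ) := by
  have := (volume_measurePreserving_piCongrLeft (fun _ : Fin n => Space) σ.symm)
  have h2 := this.quasiMeasurePreserving.ae h
  refine h2.mono fun k hk => ?_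
  convert hk using 1
  ext i j
  simp [MeasurableEquiv.piCongrLeft, Equiv.piCongrLeft, Equiv.piCongrLeft']

/-- The vectors that are totally symmetric in the photon momenta. -/
def symmetricSubspace : Submodule ℂ FullFock where
  carrier := {Ψ | ∀ (n : ℕ) (σ : Equiv.Perm (Fin n)), ∀ᵐ k : Fin n → Space,
    Ψ ⟨n, k ∘ σ⟩ = Ψ ⟨n, k⟩}
  zero_mem' := by
    intro n σ
    have h := ae_config_iff.1 (Lp.coeFn_zero Electron 2 configMeasure) n
    filter_upwards [h, ae_perm σ h] with k h1 h2
    rw [h1, h2]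
    rfl
  add_mem' := by
    intro Ψ Φ hΨ hΦ n σ
    have h := ae_config_iff.1 (Lp.coeFn_add Ψ Φ) n
    filter_upwards [h, ae_perm σ h, hΨ n σ, hΦ n σ] with k h1 h2 h3 h4
    rw [h1, h2, Pi.add_apply, Pi.add_apply, h3, h4]
  smul_mem' := by
    intro c Ψ hΨ n σ
    have h := ae_config_iff.1 (Lp.coeFn_smul c Ψ) n
    filter_upwards [h, ae_perm σ h, hΨ n σ] with k h1 h2 h3
    rw [h1, h2, Pi.smul_apply, Pi.smul_apply, h3]

/-- The Hilbert space of the atom-photon system. -/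
abbrev Fock : Type := symmetricSubspace

/-- The value of a vector at a photon configuration. -/
def val (Ψ : Fock) : Config → Electron := ((Ψ : FullFock) : Config → Electron)

lemma val_zero : val 0 =ᵐ[configMeasure] fun _ => 0 :=
  Lp.coeFn_zero Electron 2 configMeasure

lemma val_add (Ψ Φ : Fock) : val (Ψ + Φ) =ᵐ[configMeasure] fun q => val Ψ q + val Φ q :=
  Lp.coeFn_add (Ψ : FullFock) (Φ : FullFock)

lemma val_smul (c : ℂ) (Ψ : Fock) : val (c • Ψ) =ᵐ[configMeasure] fun q => c • val Ψ q :=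
  Lp.coeFn_smul c (Ψ : FullFock)

lemma eq_zero_of_val {Ψ : Fock} (h : ∀ᵐ q ∂configMeasure, val Ψ q = 0) : Ψ = 0 := by
  apply Subtype.ext
  apply Lp.ext
  filter_upwards [h, Lp.coeFn_zero Electron 2 configMeasure] with q h1 h2
  rw [Submodule.coe_zero, h2]
  exact h1

/-- Vectors with at most finitely many photons. -/
def IsFiniteParticle (Ψ : Fock) : Prop :=
  ∃ N : ℕ, ∀ᵐ q ∂configMeasure, N < q.1 → val Ψ q = 0

/-- The bounded operator `B ⊗ 1`, for `B` a bounded operator of the electron. -/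
def liftBounded (B : Electron →L[ℂ] Electron) : Fock →L[ℂ] Fock :=
  ((B.compLpL 2 configMeasure).comp symmetricSubspace.subtypeL).codRestrict symmetricSubspace (by
    intro Ψ n σ
    have h := ae_config_iff.1 (B.coeFn_compLpL (p := 2) (μ := configMeasure) (Ψ : FullFock)) n
    filter_upwards [h, ae_perm σ h, Ψ.2 n σ] with k h1 h2 h3
    change (B.compLpL 2 configMeasure (Ψ : FullFock)) ⟨n, k ∘ σ⟩
      = (B.compLpL 2 configMeasure (Ψ : FullFock)) ⟨n, k⟩
    rw [h1, h2, h3])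

/-- The operator `A ⊗ 1`: it maps `Ψ` to `Φ` iff `Φ(q) = A (Ψ(q))` for almost all photon
configurations `q`, with maximal domain. -/
def electronGraph (A : Electron →ₗ.[ℂ] Electron) : Submodule ℂ (Fock × Fock) where
  carrier := {P | ∀ᵐ q ∂configMeasure, (val P.1 q, val P.2 q) ∈ A.graph}
  zero_mem' := by
    filter_upwards [val_zero] with q h
    change (val 0 q, val 0 q) ∈ A.graph
    rw [h]
    exact A.graph.zero_mem
  add_mem' := by
    rintro ⟨Ψ, Φ⟩ ⟨Ψ', Φ'⟩ h h'
    filter_upwards [h, h', val_add Ψ Ψ', val_add Φ Φ'] with q h1 h2 h3 h4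
    change (val (Ψ + Ψ') q, val (Φ + Φ') q) ∈ A.graph
    rw [h3, h4]
    exact A.graph.add_mem h1 h2
  smul_mem' := by
    rintro c ⟨Ψ, Φ⟩ h
    filter_upwards [h, val_smul c Ψ, val_smul c Φ] with q h1 h3 h4
    change (val (c • Ψ) q, val (c • Φ) q) ∈ A.graph
    rw [h3, h4]
    exact A.graph.smul_mem c h1

/-- The operator `A ⊗ 1`, for `A` a (possibly unbounded) operator of the electron. -/
def liftElectron (A : Electron →ₗ.[ℂ] Electron) : Fock →ₗ.[ℂ] Fock :=
  (electronGraph A).toLinearPMap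

/-- The total photon energy `ω(k₁) + ⋯ + ω(kₙ)`, where `ω(k) = |k|`. -/
def photonEnergy (q : Config) : ℝ := ∑ i : Fin q.1, ‖q.2 i‖

/-- The graph of `1 ⊗ H_f`. -/
def fieldEnergyGraph : Submodule ℂ (Fock × Fock) where
  carrier := {P | ∀ᵐ q ∂configMeasure, val P.2 q = (photonEnergy q : ℂ) • val P.1 q}
  zero_mem' := by
    filter_upwards [val_zero] with q h
    change val 0 q = _ • val 0 q
    rw [h, smul_zero]
  add_mem' := by
    rintro ⟨Ψ, Φ⟩ ⟨Ψ', Φ'⟩ h h'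
    filter_upwards [h, h', val_add Ψ Ψ', val_add Φ Φ'] with q h1 h2 h3 h4
    change val (Φ + Φ') q = _ • val (Ψ + Ψ') q
    rw [h3, h4, smul_add]
    exact congrArg₂ _ h1 h2
  smul_mem' := by
    rintro c ⟨Ψ, Φ⟩ h
    filter_upwards [h, val_smul c Ψ, val_smul c Φ] with q h1 h3 h4
    change val (c • Φ) q = _ • val (c • Ψ) q
    rw [h3, h4, smul_comm]
    exact congrArg _ h1

/-- The field energy `1 ⊗ H_f`, `H_f = ∫ ω(k) a*(k) a(k) dk`: multiplication by the total photon
energy, with maximal domain. -/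
def fieldEnergy : Fock →ₗ.[ℂ] Fock := fieldEnergyGraph.toLinearPMap

/-! ### Creation and annihilation operators with operator-valued coupling functions -/

/-- `(∫ G(k) ⊗ a*(k) dk Ψ)ₙ(k₁, …, kₙ) = n^{-1/2} ∑ⱼ G(kⱼ) Ψₙ₋₁(k₁, …, k̸ⱼ, …, kₙ)`. -/
def creationFun (G : Space → Electron →L[ℂ] Electron) (Ψ : Config → Electron) :
    Config → Electron
  | ⟨0, _⟩ => 0
  | ⟨n + 1, k⟩ => ((Real.sqrt (n + 1) : ℂ))⁻¹ •
      ∑ j : Fin (n + 1), G (k j) (Ψ ⟨n, fun i => k (j.succAbove i)⟩)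

/-- The integrand of `annihilationFun`. -/
def annihilationIntegrand (G : Space → Electron →L[ℂ] Electron) (Ψ : Config → Electron)
    (q : Config) (k : Space) : Electron :=
  (ContinuousLinearMap.adjoint (G k)) (Ψ ⟨q.1 + 1, Fin.cons k q.2⟩)

/-- `(∫ G(k)* ⊗ a(k) dk Ψ)ₙ(k₁, …, kₙ) = (n+1)^{1/2} ∫ G(k)* Ψₙ₊₁(k, k₁, …, kₙ) dk`. -/
def annihilationFun (G : Space → Electron →L[ℂ] Electron) (Ψ : Config → Electron) :
    Config → Electron :=
  fun q => (Real.sqrt (q.1 + 1) : ℂ) • ∫ k, annihilationIntegrand G Ψ q k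

lemma ae_removeNth {n : ℕ} {p : (Fin n → Space) → Prop} (j : Fin (n + 1))
    (h : ∀ᵐ k : Fin n → Space, p k) :
    ∀ᵐ k : Fin (n + 1) → Space, p (fun i => k (j.succAbove i)) :=
  (Measure.quasiMeasurePreserving_snd.comp
    (volume_preserving_piFinSuccAbove (fun _ : Fin (n + 1) => Space) j).quasiMeasurePreserving).ae h

lemma ae_cons {n : ℕ} {p : (Fin (n + 1) → Space) → Prop}
    (h : ∀ᵐ k : Fin (n + 1) → Space, p k) :
    ∀ᵐ k : Fin n → Space, ∀ᵐ q : Space, p (Fin.cons q k) := by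
  have h1 := (volume_preserving_piFinSuccAbove
    (fun _ : Fin (n + 1) => Space) 0).symm.quasiMeasurePreserving.ae h
  have h2 := (Measure.measurePreserving_swap (μ := (volume : Measure (Fin n → Space)))
    (ν := (volume : Measure Space))).quasiMeasurePreserving.ae h1
  refine (Measure.ae_ae_of_ae_prod h2).mono fun k hk => hk.mono fun q hq => ?_
  convert hq using 1
  simp [MeasurableEquiv.piFinSuccAbove, Fin.insertNthEquiv, Prod.swap]

lemma creationFun_congr (G : Space → Electron →L[ℂ] Electron) {Ψ Φ : Config → Electron}
    (h : Ψ =ᵐ[configMeasure] Φ) : creationFun G Ψ =ᵐ[configMeasure] creationFun G Φ := by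
  refine ae_config_iff.2 fun n => ?_
  cases n with
  | zero => exact Eventually.of_forall fun k => rfl
  | succ n =>
    have h1 := ae_config_iff.1 h n
    have h2 := ae_all_iff.2 fun j : Fin (n + 1) => ae_removeNth j h1
    filter_upwards [h2] with k hk
    simp only [creationFun, hk]

lemma creationFun_add (G : Space → Electron →L[ℂ] Electron) (Ψ Φ : Config → Electron)
    (q : Config) :
    creationFun G (fun r => Ψ r + Φ r) q = creationFun G Ψ q + creationFun G Φ q := by
  rcases q with ⟨_ | n, k⟩
  · simp [creationFun]
  · simp [creationFun, Finset.sum_add_distrib]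

lemma creationFun_smul (G : Space → Electron →L[ℂ] Electron) (c : ℂ) (Ψ : Config → Electron)
    (q : Config) : creationFun G (fun r => c • Ψ r) q = c • creationFun G Ψ q := by
  rcases q with ⟨_ | n, k⟩
  · simp [creationFun]
  · simp only [creationFun, map_smul, ← Finset.smul_sum]
    rw [smul_comm]

lemma annihilationIntegrand_congr (G : Space → Electron →L[ℂ] Electron)
    {Ψ Φ : Config → Electron} (h : Ψ =ᵐ[configMeasure] Φ) :
    ∀ᵐ q ∂configMeasure, annihilationIntegrand G Ψ q =ᵐ[volume] annihilationIntegrand G Φ q := by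
  refine ae_config_iff.2 fun n => ?_
  filter_upwards [ae_cons (ae_config_iff.1 h (n + 1))] with k hk
  filter_upwards [hk] with q hq
  simp only [annihilationIntegrand, hq]

/-- The graph of `∫ G(k) ⊗ a*(k) dk`, with maximal domain. -/
def creationGraph (G : Space → Electron →L[ℂ] Electron) : Submodule ℂ (Fock × Fock) where
  carrier := {P | val P.2 =ᵐ[configMeasure] creationFun G (val P.1)}
  zero_mem' := by
    have h := creationFun_congr G val_zero
    filter_upwards [h, val_zero] with q h1 h2
    change val 0 q = creationFun G (val 0) q
    rw [h1, h2]
    have := creationFun_smul G 0 (fun _ => 0) q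
    simp only [smul_zero, zero_smul] at this
    exact this.symm
  add_mem' := by
    rintro ⟨Ψ, Φ⟩ ⟨Ψ', Φ'⟩ h h'
    filter_upwards [h, h', creationFun_congr G (val_add Ψ Ψ'), val_add Φ Φ'] with q h1 h2 h3 h4
    change val (Φ + Φ') q = creationFun G (val (Ψ + Ψ')) q
    rw [h3, h4, creationFun_add]
    exact congrArg₂ _ h1 h2
  smul_mem' := by
    rintro c ⟨Ψ, Φ⟩ h
    filter_upwards [h, creationFun_congr G (val_smul c Ψ), val_smul c Φ] with q h1 h3 h4
    change val (c • Φ) q = creationFun G (val (c • Ψ)) q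
    rw [h3, h4, creationFun_smul]
    exact congrArg _ h1

/-- The creation operator `∫ G(k) ⊗ a*(k) dk`. -/
def creation (G : Space → Electron →L[ℂ] Electron) : Fock →ₗ.[ℂ] Fock :=
  (creationGraph G).toLinearPMap

/-- The graph of `∫ G(k)* ⊗ a(k) dk`, with maximal domain. -/
def annihilationGraph (G : Space → Electron →L[ℂ] Electron) : Submodule ℂ (Fock × Fock) where
  carrier := {P | ∀ᵐ q ∂configMeasure, Integrable (annihilationIntegrand G (val P.1) q) volume ∧
    val P.2 q = annihilationFun G (val P.1) q}
  zero_mem' := by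
    filter_upwards [annihilationIntegrand_congr G val_zero, val_zero] with q h1 h2
    have h3 : annihilationIntegrand G (fun _ => 0) q = fun _ => 0 := by
      funext k
      simp [annihilationIntegrand]
    rw [h3] at h1
    refine ⟨(integrable_zero _ _ _).congr h1.symm, ?_⟩
    change val 0 q = annihilationFun G (val 0) q
    rw [annihilationFun, integral_congr_ae h1, h2]
    simp
  add_mem' := by
    rintro ⟨Ψ, Φ⟩ ⟨Ψ', Φ'⟩ h h'
    filter_upwards [h, h', annihilationIntegrand_congr G (val_add Ψ Ψ'), val_add Φ Φ']
      with q h1 h2 h3 h4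
    have h5 : annihilationIntegrand G (fun r => val Ψ r + val Ψ' r) q
        = fun k => annihilationIntegrand G (val Ψ) q k + annihilationIntegrand G (val Ψ') q k := by
      funext k
      simp [annihilationIntegrand]
    rw [h5] at h3
    refine ⟨(h1.1.add h2.1).congr h3.symm, ?_⟩
    change val (Φ + Φ') q = annihilationFun G (val (Ψ + Ψ')) q
    rw [annihilationFun, integral_congr_ae h3, integral_add h1.1 h2.1, h4, smul_add]
    exact congrArg₂ _ h1.2 h2.2
  smul_mem' := by
    rintro c ⟨Ψ, Φ⟩ h
    filter_upwards [h, annihilationIntegrand_congr G (val_smul c Ψ), val_smul c Φ]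
      with q h1 h3 h4
    have h5 : annihilationIntegrand G (fun r => c • val Ψ r) q
        = fun k => c • annihilationIntegrand G (val Ψ) q k := by
      funext k
      simp [annihilationIntegrand]
    rw [h5] at h3
    refine ⟨(h1.1.smul c).congr h3.symm, ?_⟩
    change val (c • Φ) q = annihilationFun G (val (c • Ψ)) q
    rw [annihilationFun, integral_congr_ae h3, integral_smul, h4, smul_comm]
    exact congrArg _ h1.2

/-- The annihilation operator `∫ G(k)* ⊗ a(k) dk`. -/
def annihilation (G : Space → Electron →L[ℂ] Electron) : Fock →ₗ.[ℂ] Fock :=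
  (annihilationGraph G).toLinearPMap

/-! The four relations above are graphs of operators. -/

lemma mem_liftElectron_graph {A : Electron →ₗ.[ℂ] Electron} {P : Fock × Fock} :
    P ∈ (liftElectron A).graph ↔ ∀ᵐ q ∂configMeasure, (val P.1 q, val P.2 q) ∈ A.graph := by
  rw [liftElectron, Submodule.toLinearPMap_graph_eq]
  · rfl
  · rintro ⟨Ψ, Φ⟩ h (rfl : Ψ = 0)
    refine eq_zero_of_val ?_
    have h' : ∀ᵐ q ∂configMeasure, (val 0 q, val Φ q) ∈ A.graph := h
    filter_upwards [h', val_zero] with q h1 h2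
    exact A.graph_fst_eq_zero_snd h1 h2

lemma mem_fieldEnergy_graph {P : Fock × Fock} :
    P ∈ fieldEnergy.graph ↔
      ∀ᵐ q ∂configMeasure, val P.2 q = (photonEnergy q : ℂ) • val P.1 q := by
  rw [fieldEnergy, Submodule.toLinearPMap_graph_eq]
  · rfl
  · rintro ⟨Ψ, Φ⟩ h (rfl : Ψ = 0)
    refine eq_zero_of_val ?_
    have h' : ∀ᵐ q ∂configMeasure, val Φ q = (photonEnergy q : ℂ) • val 0 q := h
    filter_upwards [h', val_zero] with q h1 h2
    rw [h1, h2, smul_zero]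

lemma mem_creation_graph {G : Space → Electron →L[ℂ] Electron} {P : Fock × Fock} :
    P ∈ (creation G).graph ↔ val P.2 =ᵐ[configMeasure] creationFun G (val P.1) := by
  rw [creation, Submodule.toLinearPMap_graph_eq]
  · rfl
  · rintro ⟨Ψ, Φ⟩ h (rfl : Ψ = 0)
    refine eq_zero_of_val ?_
    have h' : val Φ =ᵐ[configMeasure] creationFun G (val 0) := h
    have h0 : val 0 =ᵐ[configMeasure] creationFun G (val 0) := (creationGraph G).zero_mem
    filter_upwards [h', h0, val_zero] with q h1 h2 h3
    rw [h1, ← h2, h3]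

lemma mem_annihilation_graph {G : Space → Electron →L[ℂ] Electron} {P : Fock × Fock} :
    P ∈ (annihilation G).graph ↔
      ∀ᵐ q ∂configMeasure, Integrable (annihilationIntegrand G (val P.1) q) volume ∧
        val P.2 q = annihilationFun G (val P.1) q := by
  rw [annihilation, Submodule.toLinearPMap_graph_eq]
  · rfl
  · rintro ⟨Ψ, Φ⟩ h (rfl : Ψ = 0)
    refine eq_zero_of_val ?_
    have h' : ∀ᵐ q ∂configMeasure, Integrable (annihilationIntegrand G (val 0) q) volume ∧
      val Φ q = annihilationFun G (val 0) q := h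
    have h0 : ∀ᵐ q ∂configMeasure, Integrable (annihilationIntegrand G (val 0) q) volume ∧
      val 0 q = annihilationFun G (val 0) q := (annihilationGraph G).zero_mem
    filter_upwards [h', h0, val_zero] with q h1 h2 h3
    rw [h1.2, ← h2.2, h3]

/-! ### Interaction, Hamiltonian, Weyl operators -/

/-- The interaction `∫ {G(k) ⊗ a*(k) + G(k)* ⊗ a(k)} dk`. -/
def interaction (G : Space → Electron →L[ℂ] Electron) : Fock →ₗ.[ℂ] Fock :=
  creation G + annihilation G

/-- The Hamiltonian `A ⊗ 1 + 1 ⊗ H_f + g ∫ {G(k) ⊗ a*(k) + G(k)* ⊗ a(k)} dk`, on the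
intersection of the domains of its three terms. -/
def hamiltonian (A : Electron →ₗ.[ℂ] Electron) (G : Space → Electron →L[ℂ] Electron) (g : ℝ) :
    Fock →ₗ.[ℂ] Fock :=
  liftElectron A + fieldEnergy + (g : ℂ) • interaction G

/-- A complex-valued function, regarded as a coupling function with scalar values. -/
def scalarCoupling (f : Space → ℂ) : Space → Electron →L[ℂ] Electron :=
  fun k => f k • ContinuousLinearMap.id ℂ Electron

/-- The field operator `1 ⊗ {a*(f) + a(f)}`, where `a*(f) = ∫ f(k) a*(k) dk` and
`a(f) = ∫ conj f(k) a(k) dk`. -/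
def fieldOperator (f : Space → ℂ) : Fock →ₗ.[ℂ] Fock := interaction (scalarCoupling f)

/-- `U = 1 ⊗ exp (i g (a*(f) + a(f)))`: the exponential series converges to `U Ψ` on every vector
`Ψ` with finitely many photons. (These vectors are dense, and they are analytic vectors of the
field operator, so the unitary operator `U` is determined by this.) -/
def IsWeylOperator (g : ℝ) (f : Space → ℂ) (U : Fock ≃ₗᵢ[ℂ] Fock) : Prop :=
  ∀ Ψ : Fock, IsFiniteParticle Ψ → ∃ Φ : ℕ → Fock, Φ 0 = Ψ ∧
    (∀ n, (Φ n, Φ (n + 1)) ∈ (fieldOperator f).graph) ∧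
    HasSum (fun n => ((Complex.I * (g : ℂ)) ^ n / (n.factorial : ℂ)) • Φ n) (U Ψ)

end

end PhotonField

open PhotonField

namespace PhotonField

noncomputable section

section

/-! ### Self-adjoint operators: resolvents, form bounds, isolated eigenvalues -/

section SelfAdjoint

variable {X : Type*} [NormedAddCommGroup X] [InnerProductSpace ℂ X]

/-! Let `h` and `ωh` be square integrable. Conjugation by the Weyl operator with parameter `i g h`
moves `a*(G)` and `a(G)` by bounded operators of the electron, and moves `H_f` by `g (a*(ωh) +
a(ωh))` plus the number `g² ⟨h, ωh⟩`. So the transformation formula holds for every such `h`, with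
`ΔV = ⟨h, ωh⟩ + ∫ (conj h G + h G*) dk`. What remains is the choice of `h`. Between ground states
`φ` of the new electron operator the new coupling has the matrix element `⟨φ, (G(k) + ωh(k)) φ⟩`,
which vanishes exactly if `h = -ω⁻¹ ⟨φ, G φ⟩`. But `φ` is the ground state of an operator that
depends on `h`: this is a nonlinear eigenvalue problem.

`exists_dressed_ground_state` solves it for the eigenvector instead of `h`. Through `formFactor` and
`inducedPotential`, `h` and `ΔV` are real analytic functions of an unnormalised vector `ψ ≠ 0`. Put
`ψ = φ + χ`, where `φ` is the unperturbed ground state and `χ` is orthogonal to it. Splitting the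
eigenvalue equation along `φ` and its complement (Lyapunov–Schmidt) gives `e = e₀ + g² ⟨φ, ΔV(ψ) ψ⟩`
and `χ = g² N(χ)`, with the reduced resolvent inside `N`. The analytic inverse function theorem
(`exists_analytic_fixed_point`) yields `χ` as an analytic function of `g`, and the remaining
electron data are analytic functions of `ψ`.

The unperturbed operator is nonnegative on the complement of `φ`, and the normalisation of `G` gives
`ΔV ≥ -1` (`norm_couplingIntegral_formFactor_le`). So the new operator is at least `-g²` on a space
of codimension one; together with one eigenvector below `-g²` this determines the spectrum there
(`hasSingleEigenvalueBelow_of_formBoundOn`). To reach the threshold `0`, the positive number `⟨h,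
ωh⟩` is used: a vector of energy at least `g² ‖x‖²` absorbs the perturbation, while on vectors of
less energy the relatively compact part of `ΔV` is small and the positive number wins
(`exists_relCompact_small`, `form_nonneg_of_small`). If `h = 0` at `g = 0`, then `ψ = φ` and `ΔV =
0` for all `g`.

On the Fock space side, a product of `n` field operators on vectors with at most `N` photons has
norm of order `√((N + n)!)` up to a geometric factor, so the exponential series converges and is
entire in the coupling function (`FieldSystem`). Commutator identities such as `T Aⁿ = Aⁿ T + n Aⁿ⁻¹
C`, summed inside closed graphs, give the Weyl transformation on finitely many photons, and
truncation extends it to full domains. Equality of domains holds because the interaction is defined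
on the domain of `H_f` (`exists_creation_of_fieldEnergy`, `exists_annihilation_of_fieldEnergy`),
which each Weyl operator in question and its inverse preserve. -/

lemma mem_addBounded_graph {A : X →ₗ.[ℂ] X} {B : X →L[ℂ] X} {x y : X} :
    (x, y) ∈ (addBounded A B).graph ↔ (x, y - B x) ∈ A.graph := by
  simp only [addBounded, LinearPMap.mem_graph_iff]
  constructor
  · rintro ⟨u, hu, hy⟩
    refine ⟨u, hu, ?_⟩
    rw [← hy, ← hu, LinearPMap.vadd_apply]
    simp
  · rintro ⟨u, hu, hy⟩
    refine ⟨u, hu, ?_⟩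
    rw [LinearPMap.vadd_apply, hy, ← hu]
    simp

lemma mem_opEigenspace_iff {A : X →ₗ.[ℂ] X} {z : ℂ} {x : X} :
    x ∈ opEigenspace A z ↔ (x, z • x) ∈ A.graph := by
  simp only [opEigenspace, Submodule.mem_map, LinearMap.mem_ker, LinearPMap.mem_graph_iff]
  constructor
  · rintro ⟨u, hu, rfl⟩
    refine ⟨u, rfl, ?_⟩
    simpa [sub_eq_zero] using hu
  · rintro ⟨u, hu, hy⟩
    refine ⟨u, ?_, hu⟩
    have : A u - z • (u : X) = 0 := by rw [hy, hu, sub_self]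
    simpa using this

/-- Unbounded operators are handled through their graphs from here on, so that resolvent equations
can be manipulated without carrying proofs of domain membership. -/
lemma notMem_opSpectrum_iff {A : X →ₗ.[ℂ] X} {z : ℂ} :
    z ∉ opSpectrum A ↔ ∀ y, ∃! x, (x, y + z • x) ∈ A.graph := by
  simp only [opSpectrum, Set.mem_ofPred_eq, not_not, Function.bijective_iff_existsUnique]
  refine forall_congr' fun y => ?_
  constructor
  · rintro ⟨u, hu, huniq⟩
    refine ⟨u, ?_, ?_⟩
    · exact (LinearPMap.mem_graph_iff _).2 ⟨u, rfl, by simp only at hu ⊢; rw [← hu]; abel⟩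
    · intro x hx
      obtain ⟨v, hv, hy⟩ := (LinearPMap.mem_graph_iff _).1 hx
      simp only at hv hy
      rw [← hv]
      exact congrArg _ (huniq v (by simp only; rw [hy, hv]; abel))
  · rintro ⟨x, hx, huniq⟩
    obtain ⟨v, hv, hy⟩ := (LinearPMap.mem_graph_iff _).1 hx
    simp only at hv hy
    refine ⟨v, by simp only; rw [hy, hv]; abel, ?_⟩
    intro u hu
    refine Subtype.ext ?_
    rw [hv]
    refine huniq u ((LinearPMap.mem_graph_iff _).2 ⟨u, rfl, ?_⟩)
    simp only at hu ⊢
    rw [← hu]; abel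

/-- The quadratic form of `A` is bounded below by `c`. -/
def FormBound (A : X →ₗ.[ℂ] X) (c : ℝ) : Prop :=
  ∀ x y, (x, y) ∈ A.graph → c * ‖x‖ ^ 2 ≤ (inner ℂ x y).re

/-- The quadratic form of `A` is bounded below by `c` on the orthogonal complement of `φ`. -/
def FormBoundOn (A : X →ₗ.[ℂ] X) (φ : X) (c : ℝ) : Prop :=
  ∀ x y, (x, y) ∈ A.graph → inner ℂ φ x = 0 → c * ‖x‖ ^ 2 ≤ (inner ℂ x y).re

lemma re_inner_smul_self (t : ℝ) (x : X) : (inner ℂ x ((t : ℂ) • x)).re = t * ‖x‖ ^ 2 := by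
  rw [inner_smul_right, Complex.re_ofReal_mul]
  exact congrArg _ (inner_self_eq_norm_sq (𝕜 := ℂ) x)

lemma eq_of_form_gt {A : X →ₗ.[ℂ] X} {c t : ℝ} (hb : FormBound A c) (ht : t < c) {x : X}
    (h : (x, (t : ℂ) • x) ∈ A.graph) : x = 0 := by
  have h1 := hb _ _ h
  rw [re_inner_smul_self] at h1
  have h3 : (c - t) * ‖x‖ ^ 2 ≤ 0 := by linarith
  have : ‖x‖ ^ 2 ≤ 0 := by
    by_contra hx
    push Not at hx
    nlinarith
  exact norm_eq_zero.1 (by nlinarith [norm_nonneg x])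

variable [CompleteSpace X]

lemma inner_graph_symm {A : X →ₗ.[ℂ] X} (hA : IsSelfAdjoint A) {x y x' y' : X}
    (h : (x, y) ∈ A.graph) (h' : (x', y') ∈ A.graph) : inner ℂ y x' = inner ℂ x y' := by
  obtain ⟨u, rfl, rfl⟩ := (LinearPMap.mem_graph_iff _).1 h
  obtain ⟨v, rfl, rfl⟩ := (LinearPMap.mem_graph_iff _).1 h'
  have := LinearPMap.adjoint_isFormalAdjoint hA.dense_domain
  rw [LinearPMap.isSelfAdjoint_def.1 hA] at this
  exact this u v

/-- A self-adjoint operator equals its adjoint, so membership in its graph can be tested by pairing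
with the graph. This is the maximality that yields surjectivity statements below. -/
lemma mem_graph_of_forall_inner {A : X →ₗ.[ℂ] X} (hA : IsSelfAdjoint A) {u v : X}
    (h : ∀ x y, (x, y) ∈ A.graph → inner ℂ y u = inner ℂ x v) : (u, v) ∈ A.graph := by
  rw [← LinearPMap.isSelfAdjoint_def.1 hA,
    LinearPMap.adjoint_graph_eq_graph_adjoint hA.dense_domain, Submodule.mem_adjoint_iff]
  intro a b hab
  rw [sub_eq_zero]
  exact h a b hab

lemma isSelfAdjoint_addBounded {A : X →ₗ.[ℂ] X} (hA : IsSelfAdjoint A) {B : X →L[ℂ] X}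
    (hB : IsSelfAdjoint B) : IsSelfAdjoint (addBounded A B) := by
  have hd : Dense ((addBounded A B).domain : Set X) := hA.dense_domain
  rw [LinearPMap.isSelfAdjoint_def]
  apply LinearPMap.eq_of_eq_graph
  have hBs : ∀ x y, inner ℂ (B x) y = inner ℂ x (B y) := fun x y => by
    rw [← ContinuousLinearMap.adjoint_inner_right, ← ContinuousLinearMap.star_eq_adjoint, hB.star_eq]
  rw [LinearPMap.adjoint_graph_eq_graph_adjoint hd]
  ext ⟨u, v⟩
  rw [Submodule.mem_adjoint_iff, mem_addBounded_graph]
  constructor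
  · intro h
    refine mem_graph_of_forall_inner hA fun x y hxy => ?_
    have := h x (y + B x) (mem_addBounded_graph.2 (by simpa using hxy))
    simp only [inner_add_left, inner_sub_right, hBs] at this ⊢
    linear_combination this
  · intro h a b hab
    have := inner_graph_symm hA (mem_addBounded_graph.1 hab) h
    simp only [inner_sub_left, inner_sub_right, hBs] at this ⊢
    linear_combination this

lemma inner_graph_real {A : X →ₗ.[ℂ] X} (hA : IsSelfAdjoint A) {x y : X}
    (h : (x, y) ∈ A.graph) : (inner ℂ x y).im = 0 := by
  have h1 := inner_graph_symm hA h h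
  rw [← inner_conj_symm] at h1
  exact Complex.conj_eq_iff_im.1 h1

/-- A self-adjoint operator with a lower form bound has no spectrum below that bound. -/
lemma notMem_opSpectrum_of_formBound {A : X →ₗ.[ℂ] X} (hA : IsSelfAdjoint A) {c t : ℝ}
    (hb : FormBound A c) (ht : t < c) : (t : ℂ) ∉ opSpectrum A := by
  rw [notMem_opSpectrum_iff]
  -- the lower bound
  have hlow : ∀ x y, (x, y) ∈ A.graph → (c - t) * ‖x‖ ≤ ‖y - (t : ℂ) • x‖ := by
    intro x y h
    have h1 := hb x y h
    have h2 : (inner ℂ x (y - (t : ℂ) • x)).re = (inner ℂ x y).re - t * ‖x‖ ^ 2 := by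
      rw [inner_sub_right, Complex.sub_re, re_inner_smul_self]
    have h3 : (inner ℂ x (y - (t : ℂ) • x)).re ≤ ‖x‖ * ‖y - (t : ℂ) • x‖ :=
      (Complex.re_le_norm _).trans (norm_inner_le_norm _ _)
    rcases (norm_nonneg x).eq_or_lt with h0 | h0
    · rw [← h0]; simp
    · have : ‖x‖ * ((c - t) * ‖x‖) ≤ ‖x‖ * ‖y - (t : ℂ) • x‖ := by nlinarith
      exact le_of_mul_le_mul_left this h0
  -- `K` is the range of `A - t`. The lower bound makes it closed, and a vector orthogonal to it
  -- solves `A u = t u` by self-adjointness, hence vanishes.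
  let K : Submodule ℂ X :=
    { carrier := {y | ∃ x, (x, y + (t : ℂ) • x) ∈ A.graph}
      zero_mem' := ⟨0, by simp⟩
      add_mem' := by
        rintro a b ⟨x, hx⟩ ⟨x', hx'⟩
        refine ⟨x + x', ?_⟩
        convert A.graph.add_mem hx hx' using 1
        simp only [Prod.mk_add_mk, smul_add, Prod.mk.injEq, true_and]
        abel
      smul_mem' := by
        rintro a b ⟨x, hx⟩
        refine ⟨a • x, ?_⟩
        convert A.graph.smul_mem a hx using 1
        simp only [Prod.smul_mk, smul_add, Prod.mk.injEq, true_and]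
        rw [smul_comm] }
  have hAcl : IsClosed (A.graph : Set (X × X)) := hA.isClosed
  have hKcl : IsClosed (K : Set X) := by
    rw [← isSeqClosed_iff_isClosed]
    intro ys y hys hy
    choose xs hxs using hys
    have hc : CauchySeq xs := by
      have hcy := hy.cauchySeq
      rw [Metric.cauchySeq_iff] at hcy ⊢
      intro ε hε
      obtain ⟨N, hN⟩ := hcy ((c - t) * ε) (mul_pos (by linarith) hε)
      refine ⟨N, fun m hm n hn => ?_⟩
      have h1 := hN m hm n hn
      rw [dist_eq_norm] at h1 ⊢
      have h2 := hlow (xs m - xs n) (ys m + (t : ℂ) • xs m - (ys n + (t : ℂ) • xs n))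
        (A.graph.sub_mem (hxs m) (hxs n))
      have h3 : ys m + (t : ℂ) • xs m - (ys n + (t : ℂ) • xs n) - (t : ℂ) • (xs m - xs n)
          = ys m - ys n := by rw [smul_sub]; abel
      rw [h3] at h2
      exact lt_of_mul_lt_mul_left (h2.trans_lt h1) (by linarith)
    obtain ⟨x, hx⟩ := cauchySeq_tendsto_of_complete hc
    exact ⟨x, hAcl.mem_of_tendsto (hx.prodMk_nhds (hy.add (hx.const_smul _)))
      (Eventually.of_forall hxs)⟩
  have hKtop : K = ⊤ := by
    have : CompleteSpace K := hKcl.completeSpace_coe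
    rw [← Submodule.orthogonal_eq_bot_iff, Submodule.eq_bot_iff]
    intro u hu
    refine eq_of_form_gt hb ht (mem_graph_of_forall_inner hA fun x y hxy => ?_)
    have := hu (y - (t : ℂ) • x) ⟨x, by simpa using hxy⟩
    rw [inner_sub_left, inner_smul_left, sub_eq_zero] at this
    rw [this, inner_smul_right, Complex.conj_ofReal]
  intro y
  have hy : y ∈ K := hKtop ▸ Submodule.mem_top
  obtain ⟨x, hx⟩ := hy
  refine ⟨x, hx, fun x' hx' => ?_⟩
  have h4 := A.graph.sub_mem hx' hx
  rw [← sub_eq_zero]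
  refine eq_of_form_gt hb ht ?_
  convert h4 using 1
  simp only [Prod.mk_sub_mk, Prod.mk.injEq, true_and]
  rw [smul_sub]; abel

/-- The resolvent of a self-adjoint operator at a real point outside the spectrum. -/
lemma exists_resolvent {A : X →ₗ.[ℂ] X} (hA : IsSelfAdjoint A) {t : ℝ}
    (ht : (t : ℂ) ∉ opSpectrum A) :
    ∃ R : X →L[ℂ] X, IsSelfAdjoint R ∧
      ∀ x y, (x, y) ∈ A.graph ↔ x = R (y - (t : ℂ) • x) := by
  rw [notMem_opSpectrum_iff] at ht
  choose f hf huniq using ht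
  simp only at hf huniq
  have hiff : ∀ x y, (x, y) ∈ A.graph ↔ x = f (y - (t : ℂ) • x) := by
    intro x y
    constructor
    · intro h
      exact huniq _ x (by simpa using h)
    · intro h
      have h1 := hf (y - (t : ℂ) • x)
      rw [← h] at h1
      simpa using h1
  let L : X →ₗ[ℂ] X :=
    { toFun := f
      map_add' := fun a b => by
        symm
        refine huniq (a + b) _ ?_
        convert A.graph.add_mem (hf a) (hf b) using 1
        simp only [Prod.mk_add_mk, smul_add, Prod.mk.injEq, true_and]
        abel
      map_smul' := fun a b => by
        symm
        refine huniq (a • b) _ ?_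
        convert A.graph.smul_mem a (hf b) using 1
        simp only [Prod.smul_mk, smul_add, Prod.mk.injEq, true_and, RingHom.id_apply]
        rw [smul_comm] }
  have hsym : L.IsSymmetric := by
    intro a b
    have := inner_graph_symm hA (hf a) (hf b)
    simp only [inner_add_left, inner_add_right, inner_smul_left, inner_smul_right,
      Complex.conj_ofReal] at this
    change inner ℂ (f a) b = inner ℂ a (f b)
    linear_combination -this
  -- Hellinger–Toeplitz: an everywhere defined symmetric operator is bounded.
  refine ⟨⟨L, hsym.continuous⟩, ?_, hiff⟩
  rw [ContinuousLinearMap.isSelfAdjoint_iff_isSymmetric]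
  exact hsym

end SelfAdjoint

end

section

/-! ### Spectrum below a threshold: lowest eigenvalue, reduced resolvent, form criterion. -/

section SelfAdjointSpectrum

open InnerProductSpace (rankOne rankOne_apply)

variable {X : Type*} [NormedAddCommGroup X] [InnerProductSpace ℂ X]

lemma notMem_opSpectrum_of_injective_surjective {A : X →ₗ.[ℂ] X} {z : ℂ}
    (hinj : ∀ x, (x, z • x) ∈ A.graph → x = 0) (hsurj : ∀ y, ∃ x, (x, y + z • x) ∈ A.graph) :
    z ∉ opSpectrum A := by
  rw [notMem_opSpectrum_iff]
  intro y
  obtain ⟨x, hx⟩ := hsurj y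
  refine ⟨x, hx, fun x' hx' => ?_⟩
  have h4 := A.graph.sub_mem hx' hx
  rw [← sub_eq_zero]
  refine hinj _ ?_
  convert h4 using 1
  simp only [Prod.mk_sub_mk, Prod.mk.injEq, true_and]
  rw [smul_sub]; abel

lemma eq_zero_of_notMem_opSpectrum {A : X →ₗ.[ℂ] X} {z : ℂ} (hz : z ∉ opSpectrum A) {x : X}
    (hx : (x, z • x) ∈ A.graph) : x = 0 :=
  ((notMem_opSpectrum_iff.1 hz) 0).unique (by simpa using hx) (by simp)

lemma mem_graph_smul_eigenvector {A : X →ₗ.[ℂ] X} {z : ℂ} {φ : X} (h : (φ, z • φ) ∈ A.graph)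
    (a : ℂ) : (a • φ, z • a • φ) ∈ A.graph := by
  have := A.graph.smul_mem a h
  rwa [Prod.smul_mk, smul_comm] at this

lemma resolvent_identity {A : X →ₗ.[ℂ] X} {s t : ℝ} {R Q : X →L[ℂ] X}
    (hR : ∀ x y, (x, y) ∈ A.graph ↔ x = R (y - (s : ℂ) • x))
    (hQ : ∀ x y, (x, y) ∈ A.graph ↔ x = Q (y - (t : ℂ) • x)) (y : X) :
    Q y - R y = ((t : ℂ) - s) • R (Q y) := by
  have h1 : (Q y, y + (t : ℂ) • Q y) ∈ A.graph := (hQ _ _).2 (by simp)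
  have h2 := (hR _ _).1 h1
  have h3 : y + (t : ℂ) • Q y - (s : ℂ) • Q y = y + ((t : ℂ) - s) • Q y := by
    rw [sub_smul]; abel
  rw [h3, map_add, map_smul] at h2
  rw [sub_eq_iff_eq_add']
  exact h2

lemma sub_projection_orthogonal {φ : X} (hφ : ‖φ‖ = 1) (x : X) :
    inner ℂ φ (x - inner ℂ φ x • φ) = 0 := by
  rw [inner_sub_right, inner_smul_right, inner_self_eq_norm_sq_to_K, hφ]
  simp

lemma mem_addBounded_rankOne_graph {A : X →ₗ.[ℂ] X} {φ : X} {s : ℂ} {x y : X} :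
    (x, y) ∈ (addBounded A (s • rankOne ℂ φ φ)).graph ↔
      (x, y - (s * inner ℂ φ x) • φ) ∈ A.graph := by
  rw [mem_addBounded_graph, mul_smul]
  rfl

variable [CompleteSpace X]

/-- If `A` has no spectrum below `c` except possibly at `e`, and `e` is not an eigenvalue, then
`A ≥ c`. -/
lemma formBound_of_spectrum {A : X →ₗ.[ℂ] X} (hA : IsSelfAdjoint A) {c e : ℝ}
    (hspec : ∀ t : ℝ, t < c → t ≠ e → (t : ℂ) ∉ opSpectrum A)
    (hinj : ∀ x, (x, (e : ℂ) • x) ∈ A.graph → x = 0) : FormBound A c := by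
  -- Any point below both `e` and `c` would do. The map `λ ↦ (λ - t₁)⁻¹` of the resolvent `R` takes
  -- `[c, ∞)` to `(0, a]` and `e` to `μ₀`.
  set t₁ : ℝ := min e c - 1 with ht₁
  have ht₁c : t₁ < c := by have := min_le_right e c; linarith
  have ht₁e : t₁ < e := by have := min_le_left e c; linarith
  obtain ⟨R, hRs, hR⟩ := exists_resolvent hA (hspec t₁ ht₁c ht₁e.ne)
  set a : ℝ := (c - t₁)⁻¹ with ha
  have ha0 : 0 < a := inv_pos.2 (by linarith)
  set μ₀ : ℝ := (e - t₁)⁻¹ with hμ₀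
  have hμ₀0 : 0 < μ₀ := inv_pos.2 (by linarith)
  -- The inequality encodes `0 ≤ μ ≤ a`. Any other `μ` corresponds to `t = t₁ + μ⁻¹ < c`, which is
  -- outside the spectrum of `A` unless `t = e`, that is, `μ = μ₀`.
  have hsp : ∀ μ ∈ spectrum ℝ R, 0 ≤ a * μ - μ ^ 2 ∨ μ = μ₀ := by
    intro μ hμ
    by_contra hcon
    push Not at hcon
    obtain ⟨h1, h2⟩ := hcon
    have hμ0 : μ ≠ 0 := by rintro rfl; simp at h1
    set t : ℝ := t₁ + μ⁻¹ with ht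
    have hte : t ≠ e := by
      intro h
      apply h2
      rw [hμ₀, ← h, ht]; simp
    have htc : t < c := by
      rcases lt_or_gt_of_ne hμ0 with h | h
      · have : μ⁻¹ < 0 := inv_lt_zero.2 h
        linarith
      · have h3 : a < μ := by nlinarith
        have h4 : μ⁻¹ < a⁻¹ := inv_strictAnti₀ ha0 h3
        rw [ha, inv_inv] at h4
        linarith
    obtain ⟨Q, -, hQ⟩ := exists_resolvent hA (hspec t htc hte)
    have htt : (t : ℂ) - t₁ = (μ : ℂ)⁻¹ := by rw [ht]; push_cast; ring
    have hμC : (μ : ℂ) ≠ 0 := by exact_mod_cast hμ0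
    have e1 := fun y => resolvent_identity hR hQ y
    have e2 := fun y => resolvent_identity hQ hR y
    rw [htt] at e1
    have htt' : (t₁ : ℂ) - t = -(μ : ℂ)⁻¹ := by rw [← htt]; ring
    rw [htt'] at e2
    apply spectrum.notMem_iff.2 _ hμ
    -- The inverse of `μ - R`, read off from `(μ - (λ - t₁)⁻¹)⁻¹ = μ⁻¹ + μ⁻² (λ - t)⁻¹`.
    let S : X →L[ℂ] X := (μ : ℂ)⁻¹ • ContinuousLinearMap.id ℂ X + ((μ : ℂ)⁻¹) ^ 2 • Q
    have hal : ∀ y, (algebraMap ℝ (X →L[ℂ] X) μ) y = (μ : ℂ) • y := by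
      intro y
      rw [Algebra.algebraMap_eq_smul_one]
      change (μ : ℝ) • y = _
      exact (Complex.coe_smul μ y).symm
    have hQR : ∀ y, R (Q y) = (μ : ℂ) • (Q y - R y) := fun y => by
      rw [e1, smul_smul, mul_inv_cancel₀ hμC, one_smul]
    have hQR' : ∀ y, Q (R y) = (μ : ℂ) • (Q y - R y) := fun y => by
      have := e2 y
      rw [← neg_sub (R y), this, smul_neg, neg_smul, smul_neg, neg_neg, smul_smul,
        mul_inv_cancel₀ hμC, one_smul]
    refine isUnit_iff_exists.2 ⟨S, ?_, ?_⟩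
    · ext y
      change (algebraMap ℝ (X →L[ℂ] X) μ) ((μ : ℂ)⁻¹ • y + ((μ : ℂ)⁻¹) ^ 2 • Q y) -
        R ((μ : ℂ)⁻¹ • y + ((μ : ℂ)⁻¹) ^ 2 • Q y) = y
      rw [hal, map_add, map_smul, map_smul, hQR, smul_sub, smul_sub]
      match_scalars <;> field_simp <;> ring
    · ext y
      change (μ : ℂ)⁻¹ • ((algebraMap ℝ (X →L[ℂ] X) μ) y - R y) +
        ((μ : ℂ)⁻¹) ^ 2 • Q ((algebraMap ℝ (X →L[ℂ] X) μ) y - R y) = y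
      rw [hal, map_sub, map_smul, hQR']
      match_scalars <;> field_simp <;> ring
  -- the spectral projection at `μ₀` vanishes
  have hzero : cfc (fun x : ℝ => max (x ^ 2 - a * x) 0) R = 0 := by
    set Q := cfc (fun x : ℝ => max (x ^ 2 - a * x) 0) R with hQdef
    have h1 : (R - algebraMap ℝ (X →L[ℂ] X) μ₀) * Q = 0 := by
      have e1 : cfc (fun x : ℝ => x - μ₀) R = R - algebraMap ℝ (X →L[ℂ] X) μ₀ := by
        rw [cfc_sub (fun x : ℝ => x) (fun _ => μ₀) R, cfc_id' ℝ R, cfc_const μ₀ R]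
      rw [← e1, hQdef, ← cfc_mul _ _ R (by fun_prop) (by fun_prop), ← cfc_zero ℝ R]
      refine cfc_congr fun x hx => ?_
      rcases hsp x hx with h | h
      · have : max (x ^ 2 - a * x) 0 = 0 := max_eq_right (by linarith)
        simp [this]
      · simp [h]
    ext y
    have h2 : R (Q y) = (μ₀ : ℂ) • Q y := by
      have h3 := congrArg (fun T : X →L[ℂ] X => T y) h1
      change R (Q y) - (algebraMap ℝ (X →L[ℂ] X) μ₀) (Q y) = 0 at h3
      rw [sub_eq_zero] at h3
      rw [h3, Algebra.algebraMap_eq_smul_one]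
      exact (Complex.coe_smul μ₀ (Q y)).symm
    refine hinj _ ((hR _ _).2 ?_)
    have hμC : (μ₀ : ℂ) ≠ 0 := by exact_mod_cast hμ₀0.ne'
    have h4 : (e : ℂ) • Q y - (t₁ : ℂ) • Q y = (μ₀ : ℂ)⁻¹ • Q y := by
      rw [← sub_smul, hμ₀]; push_cast; rw [inv_inv]
    rw [h4, map_smul, h2, smul_smul, inv_mul_cancel₀ hμC, one_smul]
  -- Evaluated at `(A - t₁) x` this reads `‖x‖² ≤ a ⟨x, (A - t₁) x⟩`, which is the bound `A ≥ c`
  -- because `a = (c - t₁)⁻¹`.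
  have hpos : 0 ≤ a • R - R ^ 2 := by
    have e1 : cfc (fun x : ℝ => a * x - x ^ 2) R = a • R - R ^ 2 := by
      rw [cfc_sub (fun x : ℝ => a * x) (fun x => x ^ 2) R, cfc_const_mul a (fun x => x) R,
        cfc_id' ℝ R, cfc_pow_id R 2]
    rw [← e1, cfc_nonneg_iff _ R (by fun_prop) hRs]
    intro x hx
    rw [← cfc_zero ℝ R, cfc_eq_cfc_iff_eqOn] at hzero
    have h5 := hzero hx
    simp only [Pi.zero_apply] at h5
    have := le_max_left (x ^ 2 - a * x) 0
    linarith
  rw [ContinuousLinearMap.nonneg_iff_isPositive] at hpos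
  intro x w hxw
  have hx := (hR x w).1 hxw
  have h6 := hpos.re_inner_nonneg_right (w - (t₁ : ℂ) • x)
  have h7 : (a • R - R ^ 2) (w - (t₁ : ℂ) • x) = (a : ℂ) • x - R x := by
    change a • R (w - (t₁ : ℂ) • x) - R (R (w - (t₁ : ℂ) • x)) = _
    rw [← hx, Complex.coe_smul]
  have hsym : ∀ u v, inner ℂ (R u) v = inner ℂ u (R v) := fun u v => (ContinuousLinearMap.isSelfAdjoint_iff_isSymmetric.1 hRs) u v
  have h8 : inner ℂ (w - (t₁ : ℂ) • x) (R x) = inner ℂ x x := by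
    rw [← hsym, ← hx]
  have h9 : (inner ℂ (w - (t₁ : ℂ) • x) x).re = (inner ℂ x w).re - t₁ * ‖x‖ ^ 2 := by
    rw [inner_sub_left, Complex.sub_re, ← re_inner_smul_self]
    congr 1
    · exact inner_re_symm (𝕜 := ℂ) w x
    · exact inner_re_symm (𝕜 := ℂ) _ x
  rw [h7, inner_sub_right, inner_smul_right, h8] at h6
  have h10 : (inner ℂ x x).re = ‖x‖ ^ 2 := inner_self_eq_norm_sq (𝕜 := ℂ) x
  have h11 : 0 ≤ a * ((inner ℂ x w).re - t₁ * ‖x‖ ^ 2) - ‖x‖ ^ 2 := by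
    rw [← h9, ← h10, ← Complex.re_ofReal_mul, ← Complex.sub_re]
    exact h6
  have h12 : (c - t₁) * a = 1 := mul_inv_cancel₀ (by linarith)
  have h13 : 0 ≤ (c - t₁) * (a * ((inner ℂ x w).re - t₁ * ‖x‖ ^ 2) - ‖x‖ ^ 2) :=
    mul_nonneg (by linarith) h11
  nlinarith

/-- Shifting a simple eigenvalue does not affect the rest of the spectrum. -/
lemma notMem_opSpectrum_shift {A A' : X →ₗ.[ℂ] X} {φ : X} (hφ : ‖φ‖ = 1) {e s t : ℂ}
    (hA' : ∀ x y, (x, y) ∈ A'.graph ↔ (x, y - (s * inner ℂ φ x) • φ) ∈ A.graph)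
    (hsym : ∀ x y, (x, y) ∈ A.graph → inner ℂ φ y = e * inner ℂ φ x)
    (he : (φ, e • φ) ∈ A.graph) (hte : t ≠ e) (hts : t ≠ e + s)
    (ht : t ∉ opSpectrum A) : t ∉ opSpectrum A' := by
  have hφφ : inner ℂ φ φ = (1 : ℂ) := by
    rw [inner_self_eq_norm_sq_to_K, hφ]; simp
  refine notMem_opSpectrum_of_injective_surjective ?_ ?_
  · intro x hx
    have h1 := (hA' _ _).1 hx
    have h2 := hsym _ _ h1
    rw [inner_sub_right, inner_smul_right, inner_smul_right, hφφ] at h2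
    have h3 : (t - (e + s)) * inner ℂ φ x = 0 := by linear_combination h2
    have h4 : inner ℂ φ x = 0 := (mul_eq_zero.1 h3).resolve_left (sub_ne_zero.2 hts)
    rw [h4, mul_zero, zero_smul, sub_zero] at h1
    exact eq_zero_of_notMem_opSpectrum ht h1
  · intro y
    obtain ⟨x, hx, -⟩ := (notMem_opSpectrum_iff.1 ht) (y - inner ℂ φ y • φ)
    have h1 := hsym _ _ hx
    rw [inner_add_right, sub_projection_orthogonal hφ, inner_smul_right, zero_add] at h1
    have h2 : inner ℂ φ x = 0 := by
      have : (t - e) * inner ℂ φ x = 0 := by linear_combination h1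
      exact (mul_eq_zero.1 this).resolve_left (sub_ne_zero.2 hte)
    have h3 : e + s - t ≠ 0 := sub_ne_zero.2 (Ne.symm hts)
    -- On the complement of `φ` the two operators agree; on `φ` the shifted one is multiplication by
    -- `e + s`. Hence the `φ`-component of `y` is divided by `e + s - t`.
    refine ⟨x + (inner ℂ φ y / (e + s - t)) • φ, (hA' _ _).2 ?_⟩
    have h4 := A.graph.add_mem hx (mem_graph_smul_eigenvector he (inner ℂ φ y / (e + s - t)))
    convert h4 using 1
    simp only [Prod.mk_add_mk, Prod.mk.injEq, true_and]
    rw [inner_add_right, h2, inner_smul_right, hφφ]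
    match_scalars <;> field_simp <;> ring

lemma inner_eigenvector_graph {A : X →ₗ.[ℂ] X} (hA : IsSelfAdjoint A) {e : ℝ} {φ x y : X}
    (he : (φ, (e : ℂ) • φ) ∈ A.graph) (h : (x, y) ∈ A.graph) :
    inner ℂ φ y = (e : ℂ) * inner ℂ φ x := by
  rw [← inner_graph_symm hA he h, inner_smul_left, Complex.conj_ofReal]

lemma isSelfAdjoint_real_smul_rankOne (s : ℝ) (φ : X) :
    IsSelfAdjoint ((s : ℂ) • rankOne ℂ φ φ) := by
  rw [ContinuousLinearMap.isSelfAdjoint_iff_isSymmetric]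
  intro x y
  change inner ℂ ((s : ℂ) • inner ℂ φ x • φ) y = inner ℂ x ((s : ℂ) • inner ℂ φ y • φ)
  simp only [inner_smul_left, inner_smul_right, Complex.conj_ofReal, inner_conj_symm]
  ring

/-- The normalized eigenvector of an isolated simple lowest eigenvalue; moving the eigenvalue up to
`c` yields an operator bounded below by `c`. -/
lemma exists_ground_state {A : X →ₗ.[ℂ] X} (hA : IsSelfAdjoint A) {c e : ℝ}
    (h : HasSingleEigenvalueBelow A c e) :
    ∃ φ : X, ‖φ‖ = 1 ∧ (φ, (e : ℂ) • φ) ∈ A.graph ∧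
      FormBound (addBounded A (((c - e : ℝ) : ℂ) • rankOne ℂ φ φ)) c := by
  obtain ⟨v, hv0, hv⟩ := finrank_eq_one_iff'.1 h.simple
  have hv0' : (v : X) ≠ 0 := fun h => hv0 (Subtype.ext h)
  have hnv : ‖(v : X)‖ ≠ 0 := norm_ne_zero_iff.2 hv0'
  set φ : X := (‖(v : X)‖ : ℂ)⁻¹ • (v : X) with hφdef
  have hφ : ‖φ‖ = 1 := by
    rw [hφdef, norm_smul, norm_inv, Complex.norm_real, norm_norm, inv_mul_cancel₀ hnv]
  have heφ : (φ, (e : ℂ) • φ) ∈ A.graph :=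
    mem_opEigenspace_iff.1 ((opEigenspace A e).smul_mem _ v.2)
  have hspan : ∀ x, (x, (e : ℂ) • x) ∈ A.graph → ∃ a : ℂ, x = a • φ := by
    intro x hx
    obtain ⟨a, ha⟩ := hv ⟨x, mem_opEigenspace_iff.2 hx⟩
    refine ⟨a * ‖(v : X)‖, ?_⟩
    have ha' : a • (v : X) = x := congrArg Subtype.val ha
    rw [hφdef, smul_smul, mul_assoc, mul_inv_cancel₀ (by exact_mod_cast hnv), mul_one, ha']
  refine ⟨φ, hφ, heφ, ?_⟩
  have hφφ : inner ℂ φ φ = (1 : ℂ) := by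
    rw [inner_self_eq_norm_sq_to_K, hφ]; simp
  -- The shift carries the eigenvalue from `e` to `c` and creates no other spectrum; simplicity
  -- guarantees that no eigenvector is left at `e`.
  refine formBound_of_spectrum (e := e)
    (isSelfAdjoint_addBounded hA (isSelfAdjoint_real_smul_rankOne _ _)) ?_ ?_
  · intro t ht hte
    refine notMem_opSpectrum_shift hφ (fun x y => mem_addBounded_rankOne_graph)
      (fun x y hxy => inner_eigenvector_graph hA heφ hxy) heφ (by exact_mod_cast hte) ?_ ?_
    · rw [← Complex.ofReal_add, add_sub_cancel]
      exact_mod_cast ht.ne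
    · rw [h.spectrum_below t ht]
      exact hte
  · intro x hx
    have h1 := mem_addBounded_rankOne_graph.1 hx
    have h2 := inner_eigenvector_graph hA heφ h1
    rw [inner_sub_right, inner_smul_right, inner_smul_right, hφφ] at h2
    have h4 : inner ℂ φ x = 0 := by
      have h3 : ((c - e : ℝ) : ℂ) * inner ℂ φ x = 0 := by linear_combination -h2
      refine (mul_eq_zero.1 h3).resolve_left ?_
      have := h.lt
      exact_mod_cast (sub_pos.2 this).ne'
    rw [h4, mul_zero, zero_smul, sub_zero] at h1
    obtain ⟨a, rfl⟩ := hspan x h1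
    rw [inner_smul_right, hφφ, mul_one] at h4
    rw [h4, zero_smul]

lemma formBoundOn_of_formBound_shift {A : X →ₗ.[ℂ] X} {c s : ℝ} {φ : X}
    (h : FormBound (addBounded A ((s : ℂ) • rankOne ℂ φ φ)) c) : FormBoundOn A φ c := by
  intro x y hxy h0
  exact h x y (mem_addBounded_rankOne_graph.2 (by simpa [h0] using hxy))

/-- The reduced resolvent at an isolated simple eigenvalue. -/
lemma exists_reducedResolvent {A : X →ₗ.[ℂ] X} (hA : IsSelfAdjoint A) {c e : ℝ} (hec : e < c)
    {φ : X} (hφ : ‖φ‖ = 1) (he : (φ, (e : ℂ) • φ) ∈ A.graph)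
    (hb : FormBound (addBounded A (((c - e : ℝ) : ℂ) • rankOne ℂ φ φ)) c) :
    ∃ S : X →L[ℂ] X, (∀ y, inner ℂ φ (S y) = 0) ∧
      ∀ y, inner ℂ φ y = 0 → (S y, y + (e : ℂ) • S y) ∈ A.graph := by
  have hφφ : inner ℂ φ φ = (1 : ℂ) := by
    rw [inner_self_eq_norm_sq_to_K, hφ]; simp
  have hA' := isSelfAdjoint_addBounded hA (isSelfAdjoint_real_smul_rankOne (c - e) φ)
  obtain ⟨R, -, hR⟩ := exists_resolvent hA' (notMem_opSpectrum_of_formBound hA' hb hec)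
  have hg : ∀ y, (R y, y + (e : ℂ) • R y) ∈
      (addBounded A (((c - e : ℝ) : ℂ) • rankOne ℂ φ φ)).graph := fun y => (hR _ _).2 (by simp)
  have horth : ∀ y, inner ℂ φ y = 0 → inner ℂ φ (R y) = 0 := by
    intro y hy
    have h1 := inner_eigenvector_graph hA he (mem_addBounded_rankOne_graph.1 (hg y))
    rw [inner_sub_right, inner_add_right, inner_smul_right, inner_smul_right, hφφ, hy] at h1
    have h3 : ((c - e : ℝ) : ℂ) * inner ℂ φ (R y) = 0 := by linear_combination -h1
    refine (mul_eq_zero.1 h3).resolve_left ?_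
    exact_mod_cast (sub_pos.2 hec).ne'
  -- `R` is the resolvent at `e` of the shifted operator, whose form bound `c` lies above `e`. On
  -- the complement of `φ` the shift is invisible, so projecting first yields the reduced resolvent.
  refine ⟨R ∘L (ContinuousLinearMap.id ℂ X - rankOne ℂ φ φ), fun y => ?_, fun y hy => ?_⟩
  · exact horth _ (sub_projection_orthogonal hφ y)
  · have h1 : (R ∘L (ContinuousLinearMap.id ℂ X - rankOne ℂ φ φ)) y = R y := by
      change R (y - inner ℂ φ y • φ) = R y
      rw [hy, zero_smul, sub_zero]
    rw [h1]
    have h2 := mem_addBounded_rankOne_graph.1 (hg y)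
    rwa [horth y hy, mul_zero, zero_smul, sub_zero] at h2

/-- The form bound on the complement of one vector, together with one eigenvector below the bound,
determine the spectrum below the bound. -/
lemma formBoundOn_eigenvector {A : X →ₗ.[ℂ] X} (hA : IsSelfAdjoint A) {c e : ℝ} (hec : e < c)
    {φ ψ : X} (hb : FormBoundOn A φ c) (hψ : (ψ, (e : ℂ) • ψ) ∈ A.graph) (hψ0 : ψ ≠ 0) :
    FormBoundOn A ψ c := by
  intro x y hxy hx
  by_contra hlt
  push Not at hlt
  have hψn : 0 < ‖ψ‖ ^ 2 := by positivity
  have hψy : inner ℂ ψ y = 0 := by rw [inner_eigenvector_graph hA hψ hxy, hx, mul_zero]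
  have hxψ : inner ℂ x ψ = 0 := by rw [← inner_conj_symm, hx, map_zero]
  set a := inner ℂ φ x with ha
  set b := inner ℂ φ ψ with hb'
  -- The combination of `ψ` and `x` that is orthogonal to `φ`. Since `ψ` and `x` are orthogonal also
  -- with respect to the form, its energy is a sum of two terms, both below the bound. This forces
  -- `b = 0`, and then `ψ` itself is orthogonal to `φ`, against `e < c`.
  have hz : (a • ψ - b • x, (e : ℂ) • a • ψ - b • y) ∈ A.graph :=
    A.graph.sub_mem (mem_graph_smul_eigenvector hψ a) (A.graph.smul_mem b hxy)
  have h1 := hb _ _ hz (by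
    rw [inner_sub_right, inner_smul_right, inner_smul_right, ← ha, ← hb']; ring)
  have h2 : ‖a • ψ - b • x‖ ^ 2 = ‖a‖ ^ 2 * ‖ψ‖ ^ 2 + ‖b‖ ^ 2 * ‖x‖ ^ 2 := by
    rw [norm_sub_sq (𝕜 := ℂ), inner_smul_left, inner_smul_right, hx, norm_smul, norm_smul]
    simp
    ring
  have h3 : (inner ℂ (a • ψ - b • x) ((e : ℂ) • a • ψ - b • y)).re =
      e * (‖a‖ ^ 2 * ‖ψ‖ ^ 2) + ‖b‖ ^ 2 * (inner ℂ x y).re := by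
    rw [inner_sub_left, inner_sub_right, inner_sub_right]
    have e1 : inner ℂ (a • ψ) (b • y) = 0 := by
      rw [inner_smul_left, inner_smul_right, hψy]; simp
    have e2 : inner ℂ (b • x) ((e : ℂ) • a • ψ) = 0 := by
      rw [inner_smul_left, inner_smul_right, inner_smul_right, hxψ]; simp
    have e3 : inner ℂ (b • x) (b • y) = ((‖b‖ ^ 2 : ℝ) : ℂ) * inner ℂ x y := by
      rw [inner_smul_left, inner_smul_right, ← mul_assoc, Complex.conj_mul']
      push_cast; rfl
    rw [e1, e2, e3, sub_zero, zero_sub, sub_neg_eq_add, Complex.add_re, Complex.re_ofReal_mul,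
      re_inner_smul_self, norm_smul, mul_pow]
  rw [h2, h3] at h1
  have h4 : 0 ≤ ‖a‖ ^ 2 * ‖ψ‖ ^ 2 * (e - c) + ‖b‖ ^ 2 * ((inner ℂ x y).re - c * ‖x‖ ^ 2) := by
    nlinarith
  have h5 : ‖a‖ ^ 2 * ‖ψ‖ ^ 2 * (e - c) ≤ 0 :=
    mul_nonpos_of_nonneg_of_nonpos (by positivity) (by linarith)
  have h6 : ‖b‖ ^ 2 = 0 := by
    by_contra hb0
    have : 0 < ‖b‖ ^ 2 := lt_of_le_of_ne (by positivity) (Ne.symm hb0)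
    nlinarith
  have h7 : b = 0 := by simpa using h6
  have h8 := hb _ _ hψ h7
  rw [re_inner_smul_self] at h8
  nlinarith

/-- A min-max argument. The vector `φ` is only an approximate ground state; the bound is first
transferred to the complement of the true eigenvector `ψ`. Raising the eigenvalue to `c` then gives
an operator that is at least `c` everywhere, and lowering it back to `e` creates only the point `e`
below `c`. -/
lemma hasSingleEigenvalueBelow_of_formBoundOn {A : X →ₗ.[ℂ] X} (hA : IsSelfAdjoint A) {c e : ℝ}
    (hec : e < c) {φ ψ : X} (hb : FormBoundOn A φ c) (hψ : (ψ, (e : ℂ) • ψ) ∈ A.graph)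
    (hψ0 : ψ ≠ 0) :
    HasSingleEigenvalueBelow A c e ∧ opEigenspace A (e : ℂ) = Submodule.span ℂ {ψ} := by
  have hn : ‖ψ‖ ≠ 0 := norm_ne_zero_iff.2 hψ0
  have hb1 := formBoundOn_eigenvector hA hec hb hψ hψ0
  set η : X := (‖ψ‖ : ℂ)⁻¹ • ψ with hηdef
  have hη : ‖η‖ = 1 := by
    rw [hηdef, norm_smul, norm_inv, Complex.norm_real, norm_norm, inv_mul_cancel₀ hn]
  have hηη : inner ℂ η η = (1 : ℂ) := by
    rw [inner_self_eq_norm_sq_to_K, hη]; simp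
  have hηe : (η, (e : ℂ) • η) ∈ A.graph := mem_graph_smul_eigenvector hψ _
  have hbη : FormBoundOn A η c := by
    intro x y hxy hx
    refine hb1 x y hxy ?_
    rw [hηdef, inner_smul_left] at hx
    refine (mul_eq_zero.1 hx).resolve_left ?_
    simpa using hψ0
  have hspan : opEigenspace A (e : ℂ) = Submodule.span ℂ {ψ} := by
    apply le_antisymm
    · intro x hx
      rw [mem_opEigenspace_iff] at hx
      have h1 := A.graph.sub_mem hx (mem_graph_smul_eigenvector hηe (inner ℂ η x))
      have h1' : (x - inner ℂ η x • η, (e : ℂ) • (x - inner ℂ η x • η)) ∈ A.graph := by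
        rw [smul_sub]; exact h1
      have h2 := hbη _ _ h1' (sub_projection_orthogonal hη x)
      rw [re_inner_smul_self] at h2
      have h3 : ‖x - inner ℂ η x • η‖ ^ 2 ≤ 0 := by
        by_contra hcon
        push Not at hcon
        nlinarith
      have h4 : x - inner ℂ η x • η = 0 := by
        rw [← norm_eq_zero]
        nlinarith [norm_nonneg (x - inner ℂ η x • η)]
      rw [sub_eq_zero.1 h4, hηdef]
      exact Submodule.smul_mem _ _ (Submodule.smul_mem _ _ (Submodule.mem_span_singleton_self ψ))
    · rw [Submodule.span_singleton_le_iff_mem, mem_opEigenspace_iff]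
      exact hψ
  refine ⟨⟨hec, ?_, ?_⟩, hspan⟩
  · intro t ht
    constructor
    · intro hmem
      by_contra hte
      refine absurd hmem ?_
      set A' := addBounded A (((c - e : ℝ) : ℂ) • rankOne ℂ η η) with hA'def
      have hA' : IsSelfAdjoint A' :=
        isSelfAdjoint_addBounded hA (isSelfAdjoint_real_smul_rankOne (c - e) η)
      have hgr : ∀ x y, (x, y) ∈ A'.graph ↔
          (x, y - (((c - e : ℝ) : ℂ) * inner ℂ η x) • η) ∈ A.graph :=
        fun x y => mem_addBounded_rankOne_graph
      have hηc : (η, (c : ℂ) • η) ∈ A'.graph := by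
        rw [hgr, hηη, mul_one, ← sub_smul]
        convert hηe using 3
        push_cast; ring
      have hbA' : FormBound A' c := by
        intro x y hxy
        have hperp := A'.graph.sub_mem hxy (mem_graph_smul_eigenvector hηc (inner ℂ η x))
        have h0 := sub_projection_orthogonal hη x
        set p := x - inner ℂ η x • η with hp
        have hpA : (p, y - (c : ℂ) • inner ℂ η x • η) ∈ A.graph := by
          have := (hgr _ _).1 hperp
          rwa [h0, mul_zero, zero_smul, sub_zero] at this
        have h2 := hbη _ _ hpA h0
        set q := y - (c : ℂ) • inner ℂ η x • η with hq
        have hηq : inner ℂ η q = 0 := by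
          rw [inner_eigenvector_graph hA hηe hpA, h0, mul_zero]
        have hpη : inner ℂ p η = 0 := by rw [← inner_conj_symm, h0, map_zero]
        have hx : x = p + inner ℂ η x • η := by rw [hp]; abel
        have hy : y = q + (c : ℂ) • inner ℂ η x • η := by rw [hq]; abel
        set a := inner ℂ η x with ha
        have e1 : ‖x‖ ^ 2 = ‖p‖ ^ 2 + ‖a‖ ^ 2 := by
          rw [hx, norm_add_sq (𝕜 := ℂ), inner_smul_right, hpη, norm_smul, hη]
          simp
        have e2 : (inner ℂ x y).re = (inner ℂ p q).re + c * ‖a‖ ^ 2 := by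
          have e3 : inner ℂ x y = inner ℂ p q + inner ℂ (a • η) ((c : ℂ) • a • η) := by
            rw [hy]
            nth_rewrite 1 [hx]
            rw [inner_add_left, inner_add_right, inner_add_right, inner_smul_left (𝕜 := ℂ) η q,
              hηq, inner_smul_right p, inner_smul_right p, hpη]
            ring
          rw [e3, Complex.add_re, re_inner_smul_self, norm_smul, hη, mul_one]
        rw [e1, e2]
        linarith
      have htA' := notMem_opSpectrum_of_formBound hA' hbA' ht
      refine notMem_opSpectrum_shift (A := A') (e := (c : ℂ)) (s := ((e - c : ℝ) : ℂ)) hη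
        (fun x y => ?_) (fun x y hxy => inner_eigenvector_graph hA' hηc hxy) hηc
        (by exact_mod_cast ht.ne) ?_ htA'
      · rw [hgr, sub_sub, ← add_smul, ← add_mul]
        rw [show ((e - c : ℝ) : ℂ) + ((c - e : ℝ) : ℂ) = 0 by push_cast; ring]
        simp
      · rw [← Complex.ofReal_add, add_sub_cancel]
        exact_mod_cast hte
    · rintro rfl
      by_contra hnot
      exact hψ0 (eq_zero_of_notMem_opSpectrum hnot hψ)
  · rw [hspan, finrank_span_singleton hψ0]

end SelfAdjointSpectrum

end

section

/-! ### The fixed point equation -/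

/-- Analytic solution of `x = g² N(x)` near `g = 0`. -/
lemma exists_analytic_fixed_point {E : Type*} [NormedAddCommGroup E] [NormedSpace ℝ E]
    [CompleteSpace E] {N : E → E} (hN : ContDiffAt ℝ ω N 0) :
    ∃ r > 0, ∃ χ : ℝ → E, χ 0 = 0 ∧ (∀ g ∈ Ioo (-r) r, ContDiffAt ℝ ω χ g) ∧
      (∀ g ∈ Ioo (-r) r, χ g = g ^ 2 • N (χ g)) ∧ (N 0 = 0 → ∀ g, χ g = 0) := by
  -- Here the zero function is chosen explicitly, because the last clause demands vanishing for
  -- every `g`.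
  by_cases h0 : N 0 = 0
  · exact ⟨1, one_pos, fun _ => 0, rfl, fun _ _ => contDiffAt_const,
      fun g _ => by rw [h0, smul_zero], fun _ _ => rfl⟩
  -- The parameter is carried along. As `g²` has zero derivative at `0`, the derivative of `Φ` at
  -- the origin is the identity whatever the derivative of `N` is. The solution is the second
  -- component of the local inverse at `(g, 0)`.
  let Φ : ℝ × E → ℝ × E := fun p => (p.1, p.2 - p.1 ^ 2 • N p.2)
  have hN' : ContDiffAt ℝ ω (fun p : ℝ × E => N p.2) (0, 0) :=
    ContDiffAt.comp (0, 0) (g := N) (f := Prod.snd) hN contDiffAt_snd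
  have hΦ : ContDiffAt ℝ ω Φ (0, 0) :=
    contDiffAt_fst.prodMk (contDiffAt_snd.sub ((contDiffAt_fst.pow 2).smul hN'))
  have hΦ' : HasFDerivAt Φ ((ContinuousLinearEquiv.refl ℝ (ℝ × E) : ℝ × E →L[ℝ] ℝ × E)) (0, 0) := by
    have h1 : HasFDerivAt (fun p : ℝ × E => N p.2) (fderiv ℝ (fun p : ℝ × E => N p.2) (0, 0)) (0, 0) :=
      (hN'.differentiableAt (by simp)).hasFDerivAt
    have h2 : HasFDerivAt (fun p : ℝ × E => p.1 ^ 2)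
        ((2 * (0 : ℝ) ^ (2 - 1)) • ContinuousLinearMap.fst ℝ ℝ E) ((0, 0) : ℝ × E) := by
      simpa using (hasFDerivAt_fst (𝕜 := ℝ) (p := ((0, 0) : ℝ × E))).pow 2
    have h3 := (hasFDerivAt_fst (𝕜 := ℝ) (p := ((0, 0) : ℝ × E))).prodMk
      ((hasFDerivAt_snd (𝕜 := ℝ) (p := ((0, 0) : ℝ × E))).sub (h2.smul h1))
    refine h3.congr_fderiv ?_
    ext x <;> simp
  set Ψ := hΦ.localInverse hΦ' (by simp) with hΨ
  have hΦ0 : Φ (0, 0) = (0, 0) := by simp [Φ]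
  have hΨ0 : Ψ (0, 0) = (0, 0) := by
    have := hΦ.localInverse_apply_image hΦ' (by simp)
    rwa [hΦ0] at this
  have hΨc : ContDiffAt ℝ ω Ψ (0, 0) := by
    have := hΦ.to_localInverse hΦ' (by simp)
    rwa [hΦ0] at this
  have hinv : ∀ᶠ y in 𝓝 ((0, 0) : ℝ × E), Φ (Ψ y) = y := by
    have := (hΦ.hasStrictFDerivAt' hΦ' (by simp)).eventually_right_inverse
    rw [hΦ0] at this
    exact this
  have hlin : Tendsto (fun g : ℝ => ((g, 0) : ℝ × E)) (𝓝 0) (𝓝 (0, 0)) :=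
    (by fun_prop : Continuous fun g : ℝ => ((g, 0) : ℝ × E)).tendsto 0
  have hev := hlin.eventually (hinv.and (hΨc.eventually (by simp)))
  obtain ⟨r, hr, hball⟩ := Metric.eventually_nhds_iff_ball.1 hev
  have hIoo : ∀ g ∈ Ioo (-r) r, g ∈ Metric.ball (0 : ℝ) r := by
    intro g hg
    rw [Real.ball_eq_Ioo]; simpa using hg
  refine ⟨r, hr, fun g => (Ψ (g, 0)).2, by simp [hΨ0], ?_, ?_, fun h => absurd h h0⟩
  · intro g hg
    have h1 := (hball g (hIoo g hg)).2
    have h2 : ContDiffAt ℝ ω (fun g : ℝ => ((g, 0) : ℝ × E)) g :=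
      contDiffAt_id.prodMk contDiffAt_const
    exact contDiffAt_snd.comp g (ContDiffAt.comp (f := fun g : ℝ => ((g, 0) : ℝ × E)) g h1 h2)
  · intro g hg
    have h1 := (hball g (hIoo g hg)).1
    have h2 := congrArg Prod.fst h1
    have h3 := congrArg Prod.snd h1
    simp only [Φ] at h2 h3
    rw [h2, sub_eq_zero] at h3
    exact h3

/-- Bounded operators of the electron. -/
abbrev BOp : Type := Electron →L[ℂ] Electron

/-- The functional `T ↦ ⟪ψ, T χ⟫`. -/
def vecFunctional (ψ χ : Electron) : BOp →L[ℂ] ℂ :=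
  (innerSL ℂ ψ).comp (ContinuousLinearMap.apply ℂ Electron χ)

@[simp] lemma vecFunctional_apply (ψ χ : Electron) (T : BOp) :
    vecFunctional ψ χ T = inner ℂ ψ (T χ) := rfl

lemma norm_vecFunctional_le (ψ χ : Electron) : ‖vecFunctional ψ χ‖ ≤ ‖ψ‖ * ‖χ‖ := by
  refine ContinuousLinearMap.opNorm_le_bound _ (by positivity) fun T => ?_
  rw [vecFunctional_apply]
  calc ‖inner ℂ ψ (T χ)‖ ≤ ‖ψ‖ * ‖T χ‖ := norm_inner_le_norm _ _
    _ ≤ ‖ψ‖ * (‖T‖ * ‖χ‖) := by gcongr; exact T.le_opNorm χ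
    _ = ‖ψ‖ * ‖χ‖ * ‖T‖ := by ring

lemma real_smul_electron (c : ℝ) (x : Electron) : c • x = (c : ℂ) • x :=
  (Complex.coe_smul c x).symm

lemma vecFunctional_add_left (x₁ x₂ y : Electron) :
    vecFunctional (x₁ + x₂) y = vecFunctional x₁ y + vecFunctional x₂ y := by
  ext T
  simp [inner_add_left]

lemma vecFunctional_add_right (x y₁ y₂ : Electron) :
    vecFunctional x (y₁ + y₂) = vecFunctional x y₁ + vecFunctional x y₂ := by
  ext T
  simp [inner_add_right]

lemma vecFunctional_smul_left (c : ℝ) (x y : Electron) :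
    vecFunctional (c • x) y = (c : ℂ) • vecFunctional x y := by
  ext T
  simp only [vecFunctional_apply, real_smul_electron, inner_smul_left, Complex.conj_ofReal]
  rfl

lemma vecFunctional_smul_right (c : ℝ) (x y : Electron) :
    vecFunctional x (c • y) = (c : ℂ) • vecFunctional x y := by
  ext T
  simp only [vecFunctional_apply, real_smul_electron, inner_smul_right, map_smul]
  rfl

lemma real_smul_Lp (c : ℝ) (x : Lp ℂ 2 (volume : Measure Space)) : c • x = (c : ℂ) • x :=
  (Complex.coe_smul c x).symm

/-- `F ↦ ⟪x, F(·) y⟫` as a bounded real-bilinear function of `x`, `y`. -/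
def matrixElement (F : Lp BOp 2 (volume : Measure Space)) :
    Electron →L[ℝ] Electron →L[ℝ] Lp ℂ 2 (volume : Measure Space) :=
  LinearMap.mkContinuous₂
    (LinearMap.mk₂ ℝ (fun x y => (vecFunctional x y).compLp F)
      (fun x₁ x₂ y => by
        rw [vecFunctional_add_left, ContinuousLinearMap.add_compLp])
      (fun c x y => by
        rw [vecFunctional_smul_left, ContinuousLinearMap.smul_compLp, real_smul_Lp])
      (fun x y₁ y₂ => by
        rw [vecFunctional_add_right, ContinuousLinearMap.add_compLp])
      (fun c x y => by
        rw [vecFunctional_smul_right, ContinuousLinearMap.smul_compLp, real_smul_Lp]))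
    ‖F‖ (fun x y => by
      calc ‖(vecFunctional x y).compLp F‖ ≤ ‖vecFunctional x y‖ * ‖F‖ :=
            ContinuousLinearMap.norm_compLp_le _ _
        _ ≤ (‖x‖ * ‖y‖) * ‖F‖ := by
            gcongr
            exact norm_vecFunctional_le x y
        _ = ‖F‖ * ‖x‖ * ‖y‖ := by ring)

/-- The expression is conjugate linear in one entry, so analyticity holds over the reals only: it is
the diagonal of the bounded real-bilinear map `matrixElement F`. -/
lemma contDiff_vecFunctional_compLp (F : Lp BOp 2 (volume : Measure Space)) :
    ContDiff ℝ ω fun ψ : Electron => (vecFunctional ψ ψ).compLp F := by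
  have h : ContDiff ℝ ω fun ψ : Electron => matrixElement F ψ ψ :=
    (matrixElement F).contDiff.clm_apply contDiff_id
  exact h

/-- `k ↦ -⟪ψ, F(k) ψ⟫ / ‖ψ‖²`. -/
def formFactor (F : Lp BOp 2 (volume : Measure Space)) (ψ : Electron) :
    Lp ℂ 2 (volume : Measure Space) :=
  (-(‖ψ‖ ^ 2)⁻¹ : ℝ) • (vecFunctional ψ ψ).compLp F

lemma contDiffAt_formFactor (F : Lp BOp 2 (volume : Measure Space)) {ψ : Electron} (hψ : ψ ≠ 0) :
    ContDiffAt ℝ ω (formFactor F) ψ := by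
  unfold formFactor
  refine ContDiffAt.smul (ContDiffAt.neg (ContDiffAt.inv (contDiffAt_id.norm_sq ℂ) ?_))
    (contDiff_vecFunctional_compLp F).contDiffAt
  simpa using hψ

lemma coeFn_formFactor (F : Lp BOp 2 (volume : Measure Space)) (ψ : Electron) :
    (formFactor F ψ : Space → ℂ) =ᵐ[volume]
      fun k => -((‖ψ‖ : ℂ) ^ 2)⁻¹ * inner ℂ ψ (F k ψ) := by
  unfold formFactor
  filter_upwards [Lp.coeFn_smul (-(‖ψ‖ ^ 2)⁻¹ : ℝ) ((vecFunctional ψ ψ).compLp F),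
    (vecFunctional ψ ψ).coeFn_compLp F] with k h1 h2
  rw [h1, Pi.smul_apply, h2, vecFunctional_apply, Complex.real_smul]
  push_cast
  rfl

/-- `h ↦ ∫ conj (h(k)) G(k) dk`. -/
def couplingIntegral (G : Lp BOp 2 (volume : Measure Space)) :
    Lp ℂ 2 (volume : Measure Space) →L[ℝ] BOp :=
  ((ContinuousLinearMap.lpPairing (volume : Measure Space) 2 2
    ((ContinuousLinearMap.lsmul ℝ ℂ : ℂ →L[ℝ] BOp →L[ℝ] BOp).comp
      (Complex.conjCLE : ℂ →L[ℝ] ℂ))).flip G)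

lemma couplingIntegral_apply (G : Lp BOp 2 (volume : Measure Space))
    (h : Lp ℂ 2 (volume : Measure Space)) :
    couplingIntegral G h = ∫ k, (starRingEnd ℂ (h k)) • G k := by
  unfold couplingIntegral
  rw [ContinuousLinearMap.flip_apply, ContinuousLinearMap.lpPairing_eq_integral]
  rfl

/-- The effective potential `⟪h, ωh⟫ + ∫ (conj h G + h G*) dk`, for `h = -⟪ψ, F ψ⟫ / ‖ψ‖²`,
where `F = ω⁻¹ G`. -/
def inducedPotential (G F : Lp BOp 2 (volume : Measure Space)) (ψ : Electron) : BOp :=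
  (inner ℂ (formFactor F ψ) (formFactor G ψ)).re • (1 : BOp) +
    (couplingIntegral G (formFactor F ψ) + star (couplingIntegral G (formFactor F ψ)))

lemma real_smul_bop (c : ℝ) (T : BOp) : c • T = (c : ℂ) • T :=
  (Complex.coe_smul c T).symm

/-- The adjoint as a real-linear map. -/
def adjointReal : BOp →L[ℝ] BOp :=
  LinearMap.mkContinuous
    { toFun := fun T => star T
      map_add' := fun S T => star_add S T
      map_smul' := fun c T => by
        rw [real_smul_bop, star_smul, RingHom.id_apply, real_smul_bop]
        congr 1
        exact Complex.conj_ofReal c } 1 (fun T => by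
      change ‖star T‖ ≤ 1 * ‖T‖
      rw [one_mul, ContinuousLinearMap.star_eq_adjoint]
      exact (ContinuousLinearMap.adjoint.norm_map T).le)

lemma contDiffAt_inducedPotential (G F : Lp BOp 2 (volume : Measure Space)) {ψ : Electron}
    (hψ : ψ ≠ 0) : ContDiffAt ℝ ω (inducedPotential G F) ψ := by
  have h1 := contDiffAt_formFactor F hψ
  have h2 := contDiffAt_formFactor G hψ
  have h3 : ContDiffAt ℝ ω (fun ψ => couplingIntegral G (formFactor F ψ)) ψ :=
    (couplingIntegral G).contDiff.contDiffAt.comp ψ h1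
  have h4 : ContDiffAt ℝ ω (fun ψ => star (couplingIntegral G (formFactor F ψ))) ψ :=
    adjointReal.contDiff.contDiffAt.comp ψ h3
  have h5 : ContDiffAt ℝ ω (fun ψ => (inner ℂ (formFactor F ψ) (formFactor G ψ)).re) ψ :=
    Complex.reCLM.contDiff.contDiffAt.comp ψ (h1.inner ℂ h2)
  exact (h5.smul contDiffAt_const).add (h3.add h4)

lemma isSelfAdjoint_inducedPotential (G F : Lp BOp 2 (volume : Measure Space)) (ψ : Electron) :
    IsSelfAdjoint (inducedPotential G F ψ) := by
  unfold inducedPotential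
  refine IsSelfAdjoint.add ?_ (IsSelfAdjoint.add_star_self _)
  rw [real_smul_bop, isSelfAdjoint_iff, star_smul, star_one]
  congr 1
  exact Complex.conj_ofReal _

lemma re_inner_inducedPotential (G F : Lp BOp 2 (volume : Measure Space)) (ψ x : Electron) :
    (inner ℂ x (inducedPotential G F ψ x)).re =
      (inner ℂ (formFactor F ψ) (formFactor G ψ)).re * ‖x‖ ^ 2 +
        2 * (inner ℂ x (couplingIntegral G (formFactor F ψ) x)).re := by
  set c := (inner ℂ (formFactor F ψ) (formFactor G ψ)).re with hc
  set M := couplingIntegral G (formFactor F ψ) with hM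
  have h1 : inducedPotential G F ψ x = (c : ℂ) • x + (M x + star M x) := by
    rw [← real_smul_electron]; rfl
  rw [h1, inner_add_right, inner_add_right, Complex.add_re, Complex.add_re, re_inner_smul_self,
    ContinuousLinearMap.star_eq_adjoint, ContinuousLinearMap.adjoint_inner_right]
  have : (inner ℂ (M x) x).re = (inner ℂ x (M x)).re := inner_re_symm (𝕜 := ℂ) (M x) x
  rw [this]; ring

end

section

/-! ### Relatively compact perturbations at the threshold -/

section Threshold

variable {X : Type*} [NormedAddCommGroup X] [InnerProductSpace ℂ X] [CompleteSpace X]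

/-- A compact operator is small on vectors on which an injective self-adjoint operator is small. -/
lemma exists_compact_small {C T : X →L[ℂ] X} (hC : IsCompactOperator C) (hT : IsSelfAdjoint T)
    (hinj : ∀ x, T x = 0 → x = 0) {ε : ℝ} (hε : 0 < ε) :
    ∃ δ > 0, ∀ x, ‖T x‖ ≤ δ * ‖x‖ → ‖C x‖ ≤ ε * ‖x‖ := by
  by_contra hcon
  push Not at hcon
  have hsym : ∀ u v, inner ℂ (T u) v = inner ℂ u (T v) :=
    fun u v => (ContinuousLinearMap.isSelfAdjoint_iff_isSymmetric.1 hT) u v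
  have hseq : ∀ n : ℕ, ∃ x, ‖x‖ = 1 ∧ ‖T x‖ ≤ 1 / ((n : ℝ) + 1) ∧ ε ≤ ‖C x‖ := by
    intro n
    obtain ⟨x, hx1, hx2⟩ := hcon (1 / ((n : ℝ) + 1)) (by positivity)
    have hx0 : ‖x‖ ≠ 0 := by
      intro h0
      rw [norm_eq_zero] at h0
      simp [h0] at hx2
    have hxp : 0 < ‖x‖ := lt_of_le_of_ne (norm_nonneg _) (Ne.symm hx0)
    refine ⟨(‖x‖ : ℂ)⁻¹ • x, ?_, ?_, ?_⟩
    · rw [norm_smul, norm_inv, Complex.norm_real, norm_norm, inv_mul_cancel₀ hx0]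
    · rw [map_smul, norm_smul, norm_inv, Complex.norm_real, norm_norm, inv_mul_le_iff₀ hxp]
      linarith
    · rw [map_smul, norm_smul, norm_inv, Complex.norm_real, norm_norm, le_inv_mul_iff₀ hxp]
      linarith
  choose x hx1 hx2 hx3 using hseq
  have hTx : Tendsto (fun n => T (x n)) atTop (𝓝 0) :=
    squeeze_zero_norm hx2 tendsto_one_div_add_atTop_nhds_zero_nat
  have hdense : ∀ u, (∀ v, inner ℂ (T v) u = 0) → u = 0 := by
    intro u hu
    refine hinj u ?_
    rw [← inner_self_eq_zero (𝕜 := ℂ), ← hsym]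
    exact hu _
  -- An injective self-adjoint operator has dense range, so `T (x n) → 0` and `‖x n‖ = 1` imply that
  -- `x n` tends to zero weakly. The compact operator turns this into norm convergence along a
  -- subsequence, against `ε ≤ ‖C (x n)‖`.
  have hclos : (LinearMap.range (T : X →ₗ[ℂ] X)).topologicalClosure = ⊤ := by
    rw [Submodule.topologicalClosure_eq_top_iff, Submodule.eq_bot_iff]
    intro u hu
    exact hdense u fun v => hu _ ⟨v, rfl⟩
  have hweak : ∀ w, Tendsto (fun n => inner ℂ w (x n)) atTop (𝓝 0) := by
    intro w
    rw [Metric.tendsto_atTop]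
    intro η hη
    have hw : w ∈ closure (LinearMap.range (T : X →ₗ[ℂ] X) : Set X) := by
      rw [← Submodule.topologicalClosure_coe, hclos]; trivial
    obtain ⟨v, ⟨u, rfl⟩, hv⟩ := Metric.mem_closure_iff.1 hw (η / 2) (by positivity)
    have hlim : Tendsto (fun n => inner ℂ u (T (x n))) atTop (𝓝 0) := by
      have := (tendsto_const_nhds (x := u)).inner (𝕜 := ℂ) hTx
      simpa using this
    obtain ⟨N, hN⟩ := Metric.tendsto_atTop.1 hlim (η / 2) (by positivity)
    refine ⟨N, fun n hn => ?_⟩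
    have h1 := hN n hn
    rw [dist_zero_right] at h1 ⊢
    have h2 : inner ℂ w (x n) = inner ℂ (w - T u) (x n) + inner ℂ u (T (x n)) := by
      rw [inner_sub_left, hsym]; ring
    rw [h2]
    calc _ ≤ ‖inner ℂ (w - T u) (x n)‖ + ‖inner ℂ u (T (x n))‖ := norm_add_le _ _
      _ ≤ ‖w - T u‖ * ‖x n‖ + ‖inner ℂ u (T (x n))‖ := by
          gcongr; exact norm_inner_le_norm _ _
      _ < η := by
          rw [hx1, mul_one, ← dist_eq_norm]
          have : dist w (T u) < η / 2 := hv
          linarith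
  have hcomp : IsCompact (closure (C '' Metric.closedBall 0 1)) :=
    hC.isCompact_closure_image_closedBall 1
  obtain ⟨y, -, s, hs, hy⟩ := hcomp.tendsto_subseq (x := fun n => C (x n)) (fun n =>
    subset_closure ⟨x n, by simp [hx1 n], rfl⟩)
  have hy0 : y = 0 := by
    rw [← inner_self_eq_zero (𝕜 := ℂ)]
    have h1 : Tendsto (fun n => inner ℂ y (C (x (s n)))) atTop (𝓝 (inner ℂ y y)) :=
      (tendsto_const_nhds (x := y)).inner hy
    have h2 : Tendsto (fun n => inner ℂ y (C (x (s n)))) atTop (𝓝 0) := by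
      have := (hweak (ContinuousLinearMap.adjoint C y)).comp hs.tendsto_atTop
      refine this.congr fun n => ?_
      simp [ContinuousLinearMap.adjoint_inner_left]
    exact tendsto_nhds_unique h1 h2
  rw [hy0] at hy
  have h3 := hy.norm
  rw [norm_zero] at h3
  have h4 := ge_of_tendsto h3 (Eventually.of_forall fun n => hx3 (s n))
  linarith

/-- The part of `x` away from the bottom of the spectrum is controlled by the form. -/
lemma norm_sub_resolvent_sq_le {A : X →ₗ.[ℂ] X} (hA : IsSelfAdjoint A) (hb : FormBound A 0)
    {R : X →L[ℂ] X}
    (hR : ∀ x y, (x, y) ∈ A.graph ↔ x = R (y - ((-1 : ℝ) : ℂ) • x)) {x y : X}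
    (hxy : (x, y) ∈ A.graph) : ‖x - R x‖ ^ 2 ≤ (inner ℂ x y).re := by
  set u := R x with hu
  -- Here `R = (A + 1)⁻¹`, hence `A u = x - u`. Expanding `⟨x, A x⟩` along `x = (x - u) + u`, each
  -- of the two cross terms equals `‖x - u‖²`, and the diagonal terms are nonnegative.
  have h1 : (u, x - u) ∈ A.graph := by
    rw [hR, hu]; simp
  have h2 : (x - u, y - (x - u)) ∈ A.graph := A.graph.sub_mem hxy h1
  have e1 := hb _ _ h2
  have e2 := hb _ _ h1
  have e3 := inner_graph_symm hA h1 h2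
  -- x = (x - u) + u,  y = (y - (x - u)) + (x - u)
  have h3 : (inner ℂ x y).re = (inner ℂ (x - u) (y - (x - u))).re +
      (inner ℂ (x - u) (x - u)).re + (inner ℂ u (y - (x - u))).re + (inner ℂ u (x - u)).re := by
    rw [← Complex.add_re, ← Complex.add_re, ← Complex.add_re]
    congr 1
    simp only [inner_sub_left, inner_sub_right]
    ring
  have h4 : (inner ℂ (x - u) (x - u)).re = ‖x - u‖ ^ 2 := inner_self_eq_norm_sq (𝕜 := ℂ) _
  rw [h3, ← e3, h4]
  nlinarith [sq_nonneg ‖x - u‖]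

/-- The operator `K` plays the role of `A R`. As it is bounded, `R` maps the unit ball into a
multiple of the graph norm unit ball, on which `B` is compact. -/
lemma isCompactOperator_comp_resolvent {A : X →ₗ.[ℂ] X} {B R : X →L[ℂ] X}
    (hB : IsRelCompact A B) {K : X →L[ℂ] X} (hR : ∀ x, (R x, K x) ∈ A.graph) :
    IsCompactOperator (B ∘L R) := by
  set C : ℝ := ‖R‖ + ‖K‖ + 1 with hC
  have hC0 : 0 < C := by positivity
  refine (isCompactOperator_iff_isCompact_closure_image_closedBall
    ((B ∘L R : X →L[ℂ] X) : X →ₗ[ℂ] X) one_pos).2 ?_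
  have hK : IsCompact ((fun x : X => (C : ℂ) • x) ''
      closure (B '' {ψ | ∃ hψ : ψ ∈ A.domain, ‖ψ‖ ≤ 1 ∧ ‖A ⟨ψ, hψ⟩‖ ≤ 1})) :=
    hB.image (by fun_prop)
  refine hK.closure_of_subset ?_
  rintro _ ⟨x, hx, rfl⟩
  rw [mem_closedBall_zero_iff] at hx
  refine ⟨B ((C : ℂ)⁻¹ • R x), subset_closure ⟨(C : ℂ)⁻¹ • R x, ?_, rfl⟩, ?_⟩
  · have hg : ((C : ℂ)⁻¹ • R x, (C : ℂ)⁻¹ • K x) ∈ A.graph := A.graph.smul_mem _ (hR x)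
    obtain ⟨v, hv, hy⟩ := (LinearPMap.mem_graph_iff _).1 hg
    simp only at hv hy
    have hmem : (C : ℂ)⁻¹ • R x ∈ A.domain := hv ▸ v.2
    have hv' : v = ⟨_, hmem⟩ := Subtype.ext hv
    refine ⟨hmem, ?_, ?_⟩
    · rw [norm_smul, norm_inv, Complex.norm_real, Real.norm_of_nonneg hC0.le, inv_mul_le_iff₀ hC0]
      have := R.le_opNorm x
      nlinarith [norm_nonneg R, norm_nonneg K]
    · rw [← hv', hy, norm_smul, norm_inv, Complex.norm_real, Real.norm_of_nonneg hC0.le,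
        inv_mul_le_iff₀ hC0]
      have := K.le_opNorm x
      nlinarith [norm_nonneg R, norm_nonneg K]
  · simp only [map_smul]
    rw [smul_smul, mul_inv_cancel₀ (by exact_mod_cast hC0.ne'), one_smul]
    rfl

end Threshold

/-- The measure may be infinite, so the integral is not an average. Instead, a functional separating
the integral from `K` would be bounded above on a subspace, hence zero on `K`, hence zero on the
integral. -/
lemma integral_mem_of_isClosed {α E : Type*} [MeasurableSpace α] {μ : Measure α}
    [NormedAddCommGroup E] [NormedSpace ℝ E] [CompleteSpace E] {f : α → E} (K : Submodule ℝ E)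
    (hK : IsClosed (K : Set E)) (hf : Integrable f μ) (h : ∀ᵐ a ∂μ, f a ∈ K) :
    ∫ a, f a ∂μ ∈ K := by
  by_contra hnot
  obtain ⟨L, u, hu, hx⟩ := geometric_hahn_banach_closed_point K.convex hK hnot
  have hu0 : 0 < u := by simpa using hu 0 K.zero_mem
  have hL : ∀ a ∈ K, L a = 0 := by
    intro a ha
    by_contra h0
    have := hu ((u / L a) • a) (K.smul_mem _ ha)
    rw [map_smul, smul_eq_mul, div_mul_cancel₀ _ h0] at this
    exact lt_irrefl _ this
  rw [← L.integral_comp_comm hf] at hx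
  have : ∫ a, L (f a) ∂μ = 0 := by
    rw [← integral_zero α ℝ (μ := μ)]
    exact integral_congr_ae (h.mono fun a ha => hL _ ha)
  linarith

/-- Compact operators form a closed subspace containing almost every `conj h(k) G(k) R`, so the
integral stays in it. Without integrability the integral is zero by convention. -/
lemma isCompactOperator_couplingIntegral_comp {G : Lp BOp 2 (volume : Measure Space)} {R : BOp}
    (hG : ∀ᵐ k, IsCompactOperator (G k ∘L R)) (h : Lp ℂ 2 (volume : Measure Space)) :
    IsCompactOperator (couplingIntegral G h ∘L R) := by
  rw [couplingIntegral_apply]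
  let K : Submodule ℂ BOp := compactOperator (RingHom.id ℂ) Electron Electron
  have hK : IsClosed (K : Set BOp) := isClosed_setOfPred_isCompactOperator
  let c : BOp →L[ℂ] BOp := ContinuousLinearMap.precomp Electron R
  by_cases hint : Integrable (fun k => (starRingEnd ℂ (h k)) • G k) volume
  · have h1 : c (∫ k, (starRingEnd ℂ (h k)) • G k) = ∫ k, c ((starRingEnd ℂ (h k)) • G k) :=
      (c.integral_comp_comm hint).symm
    have h2 : ∫ k, c ((starRingEnd ℂ (h k)) • G k) ∈ K.restrictScalars ℝ := by
      refine integral_mem_of_isClosed _ hK (c.integrable_comp hint) ?_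
      filter_upwards [hG] with k hk
      rw [map_smul]
      exact K.smul_mem _ hk
    rw [← h1] at h2
    exact h2
  · rw [integral_undef hint, ContinuousLinearMap.zero_comp]
    exact isCompactOperator_zero

end

/-! ### The nonlinear eigenvalue problem of the electron. -/

section

open InnerProductSpace (rankOne rankOne_apply)

lemma formBoundOn_addBounded {X : Type*} [NormedAddCommGroup X] [InnerProductSpace ℂ X]
    {A : X →ₗ.[ℂ] X} {B : X →L[ℂ] X} {φ : X} {c : ℝ}
    (h : ∀ x y, (x, y) ∈ A.graph → inner ℂ φ x = 0 →
      c * ‖x‖ ^ 2 ≤ (inner ℂ x y).re + (inner ℂ x (B x)).re) :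
    FormBoundOn (addBounded A B) φ c := by
  intro x y hxy h0
  have h1 := h x _ (mem_addBounded_graph.1 hxy) h0
  rwa [← Complex.add_re, ← inner_add_right, sub_add_cancel] at h1

lemma re_inner_real_smul_apply (c : ℝ) (B : BOp) (x : Electron) :
    (inner ℂ x (((c : ℂ) • B) x)).re = c * (inner ℂ x (B x)).re := by
  change (inner ℂ x ((c : ℂ) • B x)).re = _
  rw [inner_smul_right, Complex.re_ofReal_mul]

lemma abs_re_inner_apply_le (B : BOp) (x : Electron) :
    |(inner ℂ x (B x)).re| ≤ ‖B‖ * ‖x‖ ^ 2 := by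
  calc |(inner ℂ x (B x)).re| ≤ ‖inner ℂ x (B x)‖ := Complex.abs_re_le_norm _
    _ ≤ ‖x‖ * ‖B x‖ := norm_inner_le_norm _ _
    _ ≤ ‖x‖ * (‖B‖ * ‖x‖) := by gcongr; exact B.le_opNorm x
    _ = ‖B‖ * ‖x‖ ^ 2 := by ring

/-- A relatively compact operator is small on vectors of small energy, if `0` is no eigenvalue. -/
lemma exists_relCompact_small {A : Electron →ₗ.[ℂ] Electron} (hA : IsSelfAdjoint A) {e : ℝ}
    {φ : Electron}
    (hb : FormBound (addBounded A (((0 - e : ℝ) : ℂ) • rankOne ℂ φ φ)) 0)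
    (h0 : opEigenspace A 0 = ⊥) {G : Lp BOp 2 (volume : Measure Space)}
    (hG : ∀ᵐ k, IsRelCompact A (G k)) (h : Lp ℂ 2 (volume : Measure Space)) {ε : ℝ} (hε : 0 < ε) :
    ∃ δ > 0, ∀ x y, (x, y) ∈ A.graph → inner ℂ φ x = 0 → (inner ℂ x y).re ≤ δ * ‖x‖ ^ 2 →
      ‖couplingIntegral G h x‖ ≤ ε * ‖x‖ := by
  -- One unit of the rank one operator more than in `hb`. The form is then at least `‖⟨φ, x⟩‖²`, so
  -- a kernel vector is orthogonal to `φ` and lies in the kernel of `A`, which is trivial.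
  set B : BOp := ((1 - e : ℝ) : ℂ) • rankOne ℂ φ φ with hB
  set A' := addBounded A B with hA'def
  have hA' : IsSelfAdjoint A' :=
    isSelfAdjoint_addBounded hA (isSelfAdjoint_real_smul_rankOne (1 - e) φ)
  have hform : ∀ x y, (x, y) ∈ A'.graph → ‖inner ℂ φ x‖ ^ 2 ≤ (inner ℂ x y).re := by
    intro x y hxy
    have h1 := mem_addBounded_rankOne_graph.1 hxy
    have h2 : (x, y - (inner ℂ φ x : ℂ) • φ) ∈
        (addBounded A (((0 - e : ℝ) : ℂ) • rankOne ℂ φ φ)).graph := by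
      rw [mem_addBounded_rankOne_graph, sub_sub, ← add_smul]
      convert h1 using 4
      push_cast; ring
    have h3 := hb _ _ h2
    rw [inner_sub_right, inner_smul_right, Complex.sub_re, zero_mul, sub_nonneg] at h3
    have h4 : (inner ℂ φ x * inner ℂ x φ : ℂ) = ((‖(inner ℂ φ x : ℂ)‖ ^ 2 : ℝ) : ℂ) := by
      rw [← inner_conj_symm x φ, Complex.mul_conj']
      push_cast; rfl
    rw [h4, Complex.ofReal_re] at h3
    exact h3
  have hb' : FormBound A' 0 := by
    intro x y hxy
    rw [zero_mul]
    exact (sq_nonneg _).trans (hform x y hxy)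
  have hker : ∀ x, (x, (0 : Electron)) ∈ A'.graph → x = 0 := by
    intro x hx
    have h1 := hform x 0 hx
    rw [inner_zero_right, Complex.zero_re] at h1
    have h2 : (inner ℂ φ x : ℂ) = 0 := by
      rw [← norm_eq_zero]
      nlinarith [norm_nonneg (inner ℂ φ x : ℂ)]
    have h3 := mem_addBounded_rankOne_graph.1 hx
    rw [h2, mul_zero, zero_smul, sub_zero] at h3
    have h4 : x ∈ opEigenspace A 0 := by
      rw [mem_opEigenspace_iff, zero_smul]; exact h3
    rw [h0] at h4
    exact h4
  obtain ⟨R, hRs, hR⟩ := exists_resolvent hA'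
    (notMem_opSpectrum_of_formBound hA' hb' (show (-1 : ℝ) < 0 by norm_num))
  have hRg : ∀ x, (R x, x - R x) ∈ A'.graph := fun x => (hR _ _).2 (by simp)
  have hcomp : IsCompactOperator (couplingIntegral G h ∘L R) := by
    refine isCompactOperator_couplingIntegral_comp ?_ h
    filter_upwards [hG] with k hk
    refine isCompactOperator_comp_resolvent
      (K := ContinuousLinearMap.id ℂ Electron - R - B ∘L R) hk fun x => ?_
    exact mem_addBounded_graph.1 (hRg x)
  -- `T = A' (A' + 1)⁻¹` is injective because `A'` is, and small on vectors of small energy by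
  -- `norm_sub_resolvent_sq_le`.
  set T : BOp := ContinuousLinearMap.id ℂ Electron - R with hT
  have hTs : IsSelfAdjoint T := (IsSelfAdjoint.one BOp).sub hRs
  have hTinj : ∀ x, T x = 0 → x = 0 := by
    intro x hx
    have hx' : x - R x = 0 := hx
    have h1 := hRg x
    rw [hx', ← sub_eq_zero.1 hx'] at h1
    exact hker x h1
  set M := couplingIntegral G h with hM
  obtain ⟨δ, hδ, hsmall⟩ := exists_compact_small hcomp hTs hTinj (show 0 < ε / 2 by positivity)
  -- In `M x = M R x + M (x - R x)` the bound `δ` serves the compact part `M R`, the other one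
  -- serves the remainder through the operator norm.
  set η : ℝ := min δ (ε / 2 / (‖M‖ + 1)) with hη
  have hη0 : 0 < η := lt_min hδ (by positivity)
  refine ⟨η ^ 2, by positivity, fun x y hxy hx hle => ?_⟩
  have hxy' : (x, y) ∈ A'.graph := mem_addBounded_rankOne_graph.2 (by simpa [hx] using hxy)
  have h1 := norm_sub_resolvent_sq_le hA' hb' hR hxy'
  have h2 : ‖x - R x‖ ≤ η * ‖x‖ := by
    refine abs_le_of_sq_le_sq' ?_ (by positivity) |>.2
    rw [mul_pow]
    exact h1.trans hle
  have h3 : ‖M (R x)‖ ≤ ε / 2 * ‖x‖ :=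
    hsmall x (h2.trans (by gcongr; exact min_le_left _ _))
  have h4 : ‖M (x - R x)‖ ≤ ε / 2 * ‖x‖ := by
    calc ‖M (x - R x)‖ ≤ ‖M‖ * ‖x - R x‖ := M.le_opNorm _
      _ ≤ (‖M‖ + 1) * (ε / 2 / (‖M‖ + 1) * ‖x‖) := by
          gcongr
          · linarith
          · exact h2.trans (by gcongr; exact min_le_right _ _)
      _ = ε / 2 * ‖x‖ := by field_simp
  calc ‖M x‖ = ‖M (R x) + M (x - R x)‖ := by rw [← map_add]; simp
    _ ≤ ‖M (R x)‖ + ‖M (x - R x)‖ := norm_add_le _ _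
    _ ≤ ε * ‖x‖ := by linarith

/-- Two regimes. If the energy `q` is at least `g² ‖x‖²`, it absorbs the perturbation, because `2
‖M‖ ≤ 1` and `d ≥ 0`. Otherwise `M₀` is small on `x`; the two bounds `c / 8` give `‖M x‖ ≤ c / 4
‖x‖`, so that `2 Re ⟨x, M x⟩` is compensated by `d ≥ c / 2`. -/
lemma form_nonneg_of_small {q c d g : ℝ} {M M₀ : BOp} {x : Electron} (hq : 0 ≤ q) (hc : 0 < c)
    (hd : c / 2 ≤ d) (hM : ‖M‖ ≤ 1 / 2) (hMM : ‖M - M₀‖ ≤ c / 8)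
    (hM₀ : q ≤ g ^ 2 * ‖x‖ ^ 2 → ‖M₀ x‖ ≤ c / 8 * ‖x‖) :
    0 ≤ q + g ^ 2 * (d * ‖x‖ ^ 2 + 2 * (inner ℂ x (M x)).re) := by
  have hx2 := sq_nonneg ‖x‖
  by_cases hbig : g ^ 2 * ‖x‖ ^ 2 ≤ q
  · have e2 := abs_re_inner_apply_le M x
    have e3 := mul_le_mul_of_nonneg_right hM hx2
    have e4 := (abs_le.1 (e2.trans e3)).1
    have e5 : 0 ≤ d * ‖x‖ ^ 2 := mul_nonneg (by linarith) hx2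
    nlinarith [sq_nonneg g]
  · push Not at hbig
    have e1 : ‖M₀ x‖ ≤ c / 8 * ‖x‖ := hM₀ hbig.le
    have e2 : ‖(M - M₀) x‖ ≤ c / 8 * ‖x‖ := ((M - M₀).le_opNorm x).trans (by gcongr)
    have e3 : ‖M x‖ ≤ c / 4 * ‖x‖ := by
      have : M x = M₀ x + (M - M₀) x := by simp
      rw [this]
      refine (norm_add_le _ _).trans ?_
      linarith
    have e4 : |(inner ℂ x (M x)).re| ≤ c / 4 * ‖x‖ ^ 2 := by
      calc |(inner ℂ x (M x)).re| ≤ ‖inner ℂ x (M x)‖ := Complex.abs_re_le_norm _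
        _ ≤ ‖x‖ * ‖M x‖ := norm_inner_le_norm _ _
        _ ≤ ‖x‖ * (c / 4 * ‖x‖) := by gcongr
        _ = c / 4 * ‖x‖ ^ 2 := by ring
    have e5 := (abs_le.1 e4).1
    have e6 : 0 ≤ d * ‖x‖ ^ 2 + 2 * (inner ℂ x (M x)).re := by nlinarith
    exact add_nonneg hq (mul_nonneg (sq_nonneg g) e6)

set_option maxHeartbeats 1000000 in
/-- The electron part of the theorem: the analytic solution of the fixed point equation. -/
theorem exists_dressed_ground_state {H : Electron →ₗ.[ℂ] Electron} (hH : IsSelfAdjoint H) {e₀ : ℝ}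
    (he₀ : HasSingleEigenvalueBelow H 0 e₀) (G F : Lp BOp 2 (volume : Measure Space))
    (hM : ∀ ψ, ‖couplingIntegral G (formFactor F ψ)‖ ≤ 1 / 2)
    (hc : ∀ ψ, 0 ≤ (inner ℂ (formFactor F ψ) (formFactor G ψ)).re)
    (hc' : ∀ ψ, formFactor F ψ ≠ 0 → 0 < (inner ℂ (formFactor F ψ) (formFactor G ψ)).re) :
    ∃ g₀ > 0, ∃ (ψ : ℝ → Electron) (e : ℝ → ℝ),
      (∀ g ∈ Ioo (-g₀) g₀, ContDiffAt ℝ ω ψ g) ∧ (∀ g ∈ Ioo (-g₀) g₀, ContDiffAt ℝ ω e g) ∧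
      (∀ g ∈ Ioo (-g₀) g₀, ψ g ≠ 0) ∧
      (∀ g ∈ Ioo (-g₀) g₀, HasSingleEigenvalueBelow
        (addBounded H (((g ^ 2 : ℝ) : ℂ) • inducedPotential G F (ψ g))) (-g ^ 2) (e g)) ∧
      (∀ g ∈ Ioo (-g₀) g₀,
        opEigenspace (addBounded H (((g ^ 2 : ℝ) : ℂ) • inducedPotential G F (ψ g))) (e g : ℂ) =
          Submodule.span ℂ {ψ g}) ∧
      (opEigenspace H 0 = ⊥ → (∀ᵐ k, IsRelCompact H (G k)) → ∀ g ∈ Ioo (-g₀) g₀,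
        HasSingleEigenvalueBelow
          (addBounded H (((g ^ 2 : ℝ) : ℂ) • inducedPotential G F (ψ g))) 0 (e g)) := by
  obtain ⟨φ, hφ, heφ, hb⟩ := exists_ground_state hH he₀
  obtain ⟨S, hSorth, hS⟩ := exists_reducedResolvent hH he₀.lt hφ heφ hb
  have hbφ := formBoundOn_of_formBound_shift hb
  have hφφ : inner ℂ φ φ = (1 : ℂ) := by rw [inner_self_eq_norm_sq_to_K, hφ]; simp
  have hφ0 : φ ≠ 0 := by rintro rfl; simp at hφ
  set D := inducedPotential G F with hD
  let ν : Electron → Electron := fun ψ => D ψ ψ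
  have hν : ∀ ψ, ψ ≠ 0 → ContDiffAt ℝ ω ν ψ := by
    intro ψ hψ
    have h1 : ContDiffAt ℝ ω (fun ψ => ContinuousLinearMap.restrictScalarsL ℂ Electron Electron ℝ ℝ
        (D ψ)) ψ :=
      (ContinuousLinearMap.restrictScalarsL ℂ Electron Electron ℝ ℝ).contDiff.contDiffAt.comp ψ
        (contDiffAt_inducedPotential G F hψ)
    exact h1.clm_apply contDiffAt_id
  -- With eigenvector `φ + x`, `x` orthogonal to `φ`, the part of the eigenvalue equation orthogonal
  -- to `φ` reads `(H - e₀) x = g² (⟨φ, ν⟩ (φ + x) - ν)`, where `ν` is taken at `φ + x`. The reduced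
  -- resolvent `S` inverts the left side.
  let N : Electron → Electron := fun x => S ((inner ℂ φ (ν (φ + x))) • (φ + x) - ν (φ + x))
  have hN : ContDiffAt ℝ ω N 0 := by
    have hadd : ContDiffAt ℝ ω (fun x : Electron => φ + x) 0 := contDiffAt_const.add contDiffAt_id
    have h1 : ContDiffAt ℝ ω (fun x => ν (φ + x)) 0 :=
      ContDiffAt.comp (g := ν) (f := fun x => φ + x) 0 (hν _ (by simpa using hφ0)) hadd
    have h2 : ContDiffAt ℝ ω (fun x => (inner ℂ φ (ν (φ + x)) : ℂ)) 0 :=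
      contDiffAt_const.inner ℂ h1
    have h3 : ContDiffAt ℝ ω (fun x => (inner ℂ φ (ν (φ + x)) : ℂ) • (φ + x)) 0 := h2.smul hadd
    exact (S.restrictScalars ℝ).contDiff.contDiffAt.comp 0 (h3.sub h1)
  obtain ⟨r, hr, χ, hχ0, hχa, hχ, hχz⟩ := exists_analytic_fixed_point hN
  set ψ : ℝ → Electron := fun g => φ + χ g with hψdef
  have hψa : ∀ g ∈ Ioo (-r) r, ContDiffAt ℝ ω ψ g := fun g hg => contDiffAt_const.add (hχa g hg)
  -- Intermediate normalisation: the correction lies in the range of `S`, which is orthogonal to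
  -- `φ`. In particular `ψ g` cannot vanish, as analyticity of the form factor requires.
  have hψφ : ∀ g ∈ Ioo (-r) r, inner ℂ φ (ψ g) = (1 : ℂ) := by
    intro g hg
    rw [hψdef]
    simp only
    rw [inner_add_right, hφφ, hχ g hg, real_smul_electron, inner_smul_right, hSorth]
    simp
  have hψ0 : ∀ g ∈ Ioo (-r) r, ψ g ≠ 0 := by
    intro g hg h
    have := hψφ g hg
    rw [h] at this
    simp at this
  -- The `φ`-component of the eigenvalue equation. Taking the real part loses nothing: the
  -- eigenvalue of the self-adjoint `Ht g` turns out to be real in `heig`.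
  set e : ℝ → ℝ := fun g => e₀ + g ^ 2 * (inner ℂ φ (ν (ψ g))).re with hedef
  have hea : ∀ g ∈ Ioo (-r) r, ContDiffAt ℝ ω e g := by
    intro g hg
    have h1 : ContDiffAt ℝ ω (fun g => ν (ψ g)) g :=
      ContDiffAt.comp g (hν _ (hψ0 g hg)) (hψa g hg)
    have h2 : ContDiffAt ℝ ω (fun g => (inner ℂ φ (ν (ψ g)) : ℂ)) g :=
      contDiffAt_const.inner ℂ h1
    exact contDiffAt_const.add ((contDiffAt_id.pow 2).mul
      (Complex.reCLM.contDiff.contDiffAt.comp g h2))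
  set Ht : ℝ → (Electron →ₗ.[ℂ] Electron) :=
    fun g => addBounded H (((g ^ 2 : ℝ) : ℂ) • D (ψ g)) with hHt
  have hHts : ∀ g, IsSelfAdjoint (Ht g) := by
    intro g
    refine isSelfAdjoint_addBounded hH ?_
    rw [isSelfAdjoint_iff, star_smul, (isSelfAdjoint_inducedPotential G F (ψ g)).star_eq]
    congr 1
    exact Complex.conj_ofReal _
  have heig : ∀ g ∈ Ioo (-r) r, (ψ g, (e g : ℂ) • ψ g) ∈ (Ht g).graph := by
    intro g hg
    set l : ℂ := inner ℂ φ (ν (ψ g)) with hl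
    have h0 : inner ℂ φ (l • ψ g - ν (ψ g)) = 0 := by
      rw [inner_sub_right, inner_smul_right, hψφ g hg, ← hl]; ring
    set w := l • ψ g - ν (ψ g) with hw
    have h2 : ((g ^ 2 : ℝ) : ℂ) • S w = χ g := by
      rw [← real_smul_electron]; exact (hχ g hg).symm
    have h1 : (χ g, ((g ^ 2 : ℝ) : ℂ) • w + (e₀ : ℂ) • χ g) ∈ H.graph := by
      have h1 := H.graph.smul_mem ((g ^ 2 : ℝ) : ℂ) (hS _ h0)
      rwa [Prod.smul_mk, smul_add, smul_comm _ (e₀ : ℂ), h2] at h1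
    have h3 := H.graph.add_mem heφ h1
    have h4 : (ψ g, ((e₀ : ℂ) + (g ^ 2 : ℝ) * l) • ψ g) ∈ (Ht g).graph := by
      rw [hHt, mem_addBounded_graph]
      convert h3 using 1
      simp only [Prod.mk_add_mk, Prod.mk.injEq]
      refine ⟨rfl, ?_⟩
      change _ - ((g ^ 2 : ℝ) : ℂ) • ν (ψ g) = _
      rw [hw]
      simp only [hψdef]
      module
    have h5 := inner_graph_real (hHts g) h4
    have h6 : ((e₀ : ℂ) + (g ^ 2 : ℝ) * l).im = 0 := by
      rw [inner_smul_right, inner_self_eq_norm_sq_to_K] at h5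
      have h7 : (((e₀ : ℂ) + (g ^ 2 : ℝ) * l) * ((‖ψ g‖ : ℂ)) ^ 2).im = 0 := h5
      rw [← Complex.ofReal_pow, Complex.im_mul_ofReal] at h7
      refine (mul_eq_zero.1 h7).resolve_right ?_
      have := hψ0 g hg
      simpa using this
    have h8 : ((e₀ : ℂ) + (g ^ 2 : ℝ) * l) = (e g : ℂ) := by
      apply Complex.ext
      · rw [Complex.add_re, Complex.re_ofReal_mul, Complex.ofReal_re, Complex.ofReal_re]
      · rw [h6, Complex.ofReal_im]
    rwa [h8] at h4
  -- The scalar part of the induced potential is nonnegative and twice the coupling integral has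
  -- norm at most `1`, so the potential is at least `-1`, uniformly in `ψ g`.
  have hform : ∀ g, FormBoundOn (Ht g) φ (-g ^ 2) := by
    intro g
    refine formBoundOn_addBounded fun x y hxy hx => ?_
    rw [re_inner_real_smul_apply, hD, re_inner_inducedPotential]
    have h1 := hbφ x y hxy hx
    have h2 := abs_re_inner_apply_le (couplingIntegral G (formFactor F (ψ g))) x
    have h3 := mul_le_mul_of_nonneg_right (hM (ψ g)) (sq_nonneg ‖x‖)
    have h4 := (abs_le.1 (h2.trans h3)).1
    have h5 := mul_nonneg (hc (ψ g)) (sq_nonneg ‖x‖)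
    nlinarith [sq_nonneg g]
  have hcont0 : ContinuousAt ψ 0 := (hψa 0 (by simpa using hr)).continuousAt
  have hψ00 : ψ 0 = φ := by simp [hψdef, hχ0]
  have hIoo : ∀ᶠ g in 𝓝 (0 : ℝ), g ∈ Ioo (-r) r := Ioo_mem_nhds (by linarith) hr
  have hlow : ∀ᶠ g in 𝓝 (0 : ℝ), e g < -g ^ 2 := by
    have h1 : ContinuousAt e 0 := (hea 0 (by simpa using hr)).continuousAt
    have h2 : ContinuousAt (fun g : ℝ => -g ^ 2) 0 := by fun_prop
    refine h1.eventually_lt h2 ?_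
    simp only [hedef]
    have := he₀.lt
    simpa using this
  have hthr : ∀ᶠ g in 𝓝 (0 : ℝ), opEigenspace H 0 = ⊥ → (∀ᵐ k, IsRelCompact H (G k)) →
      FormBoundOn (Ht g) φ 0 := by
    by_cases h0 : opEigenspace H 0 = ⊥
    swap
    · exact Eventually.of_forall fun g h => absurd h h0
    by_cases hrel : ∀ᵐ k, IsRelCompact H (G k)
    swap
    · exact Eventually.of_forall fun g _ h => absurd h hrel
    -- In this case there is no positive constant to compensate the compact part. But then `N 0 =
    -- 0`, the chosen solution is `ψ = φ` for all `g`, and the potential is zero.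
    by_cases hff : formFactor F φ = 0
    · have hDφ : D φ = 0 := by
        simp [hD, inducedPotential, hff]
      have hN0 : N 0 = 0 := by simp [N, ν, hDφ]
      refine Eventually.of_forall fun g _ _ => ?_
      have hψg : ψ g = φ := by simp [hψdef, hχz hN0 g]
      refine formBoundOn_addBounded fun x y hxy hx => ?_
      rw [hψg, hDφ]
      simpa using hbφ x y hxy hx
    · set c := (inner ℂ (formFactor F φ) (formFactor G φ)).re with hcdef
      have hcpos : 0 < c := hc' φ hff
      obtain ⟨δ, hδ, hsmall⟩ := exists_relCompact_small hH hb h0 hrel (formFactor F φ)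
        (show 0 < c / 8 by positivity)
      have hcF := (contDiffAt_formFactor F hφ0).continuousAt
      have hcG := (contDiffAt_formFactor G hφ0).continuousAt
      rw [← hψ00] at hcF hcG
      have hcF' : ContinuousAt (fun g => formFactor F (ψ g)) 0 :=
        ContinuousAt.comp (f := ψ) hcF hcont0
      have hcG' : ContinuousAt (fun g => formFactor G (ψ g)) 0 :=
        ContinuousAt.comp (f := ψ) hcG hcont0
      have hcc : ContinuousAt (fun g => (inner ℂ (formFactor F (ψ g)) (formFactor G (ψ g))).re) 0 :=
        Complex.continuous_re.continuousAt.comp (hcF'.inner hcG')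
      have hcM : ContinuousAt (fun g => couplingIntegral G (formFactor F (ψ g))) 0 :=
        (couplingIntegral G).continuous.continuousAt.comp hcF'
      have ev1 : ∀ᶠ g in 𝓝 (0 : ℝ),
          c / 2 < (inner ℂ (formFactor F (ψ g)) (formFactor G (ψ g))).re := by
        refine hcc.eventually_const_lt ?_
        simp only
        rw [hψ00]
        exact half_lt_self hcpos
      have ev2 : ∀ᶠ g in 𝓝 (0 : ℝ), ‖couplingIntegral G (formFactor F (ψ g)) -
          couplingIntegral G (formFactor F φ)‖ < c / 8 := by
        have h1 : ContinuousAt (fun g => ‖couplingIntegral G (formFactor F (ψ g)) -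
          couplingIntegral G (formFactor F φ)‖) 0 := (hcM.sub continuousAt_const).norm
        refine h1.eventually_lt_const ?_
        simp only
        rw [hψ00, sub_self, norm_zero]
        positivity
      have ev3 : ∀ᶠ g in 𝓝 (0 : ℝ), g ^ 2 < δ := by
        have h1 : ContinuousAt (fun g : ℝ => g ^ 2) 0 := by fun_prop
        exact h1.eventually_lt_const (by simpa using hδ)
      filter_upwards [ev1, ev2, ev3] with g h1 h2 h3 _ _
      refine formBoundOn_addBounded fun x y hxy hx => ?_
      rw [re_inner_real_smul_apply, hD, re_inner_inducedPotential, zero_mul]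
      have hq := hbφ x y hxy hx
      rw [zero_mul] at hq
      exact form_nonneg_of_small hq hcpos h1.le (hM (ψ g)) h2.le
        fun hle => hsmall x y hxy hx (hle.trans (by gcongr))
  obtain ⟨g₀, hg₀, hball⟩ := Metric.eventually_nhds_iff_ball.1 (hIoo.and (hlow.and hthr))
  have hall : ∀ g ∈ Ioo (-g₀) g₀, _ := fun g hg => hball g (by
    rw [Real.ball_eq_Ioo]; simpa using hg)
  refine ⟨g₀, hg₀, ψ, e, fun g hg => hψa g (hall g hg).1, fun g hg => hea g (hall g hg).1,
    fun g hg => hψ0 g (hall g hg).1, fun g hg => ?_, fun g hg => ?_, fun h0 hrel g hg => ?_⟩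
  · obtain ⟨h1, h2, -⟩ := hall g hg
    exact (hasSingleEigenvalueBelow_of_formBoundOn (hHts g) h2 (hform g) (heig g h1) (hψ0 g h1)).1
  · obtain ⟨h1, h2, -⟩ := hall g hg
    exact (hasSingleEigenvalueBelow_of_formBoundOn (hHts g) h2 (hform g) (heig g h1) (hψ0 g h1)).2
  · obtain ⟨h1, h2, h3⟩ := hall g hg
    exact (hasSingleEigenvalueBelow_of_formBoundOn (hHts g) (h2.trans_le (by nlinarith [sq_nonneg g]))
      (h3 h0 hrel) (heig g h1) (hψ0 g h1)).1

end

section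

/-! ### The coupling function and the weights -/

section Coupling

variable {G : Space → BOp}

lemma integrable_weighted_coupling (hG : MemLp G 2 volume)
    (hG1 : ∫⁻ k, ENNReal.ofReal ((1 + (‖k‖ ^ 2)⁻¹) * ‖G k‖ ^ 2) ≤ 1) :
    Integrable (fun k => (1 + (‖k‖ ^ 2)⁻¹) * ‖G k‖ ^ 2) volume ∧
      ∫ k, (1 + (‖k‖ ^ 2)⁻¹) * ‖G k‖ ^ 2 ≤ 1 := by
  have hm : AEStronglyMeasurable (fun k : Space => (1 + (‖k‖ ^ 2)⁻¹) * ‖G k‖ ^ 2) volume :=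
    AEStronglyMeasurable.mul (by fun_prop) (hG.1.norm.pow 2)
  have h0 : 0 ≤ᵐ[volume] fun k : Space => (1 + (‖k‖ ^ 2)⁻¹) * ‖G k‖ ^ 2 :=
    Eventually.of_forall fun k => by positivity
  refine ⟨(lintegral_ofReal_ne_top_iff_integrable hm h0).1 (ne_top_of_le_ne_top (by simp) hG1), ?_⟩
  rw [integral_eq_lintegral_of_nonneg_ae h0 hm]
  simpa using ENNReal.toReal_mono (by simp) hG1

lemma aestronglyMeasurable_inv_smul (hG : MemLp G 2 volume) :
    AEStronglyMeasurable (fun k : Space => ((‖k‖⁻¹ : ℝ) : ℂ) • G k) volume :=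
  AEStronglyMeasurable.smul
    (Complex.continuous_ofReal.measurable.comp measurable_norm.inv).aestronglyMeasurable hG.1

lemma memLp_inv_smul (hG : MemLp G 2 volume)
    (hG1 : ∫⁻ k, ENNReal.ofReal ((1 + (‖k‖ ^ 2)⁻¹) * ‖G k‖ ^ 2) ≤ 1) :
    MemLp (fun k : Space => ((‖k‖⁻¹ : ℝ) : ℂ) • G k) 2 volume := by
  have hm := aestronglyMeasurable_inv_smul hG
  rw [memLp_two_iff_integrable_sq_norm hm]
  refine (integrable_weighted_coupling hG hG1).1.mono' (hm.norm.pow 2) ?_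
  refine Eventually.of_forall fun k => ?_
  rw [norm_smul, Complex.norm_real, mul_pow, norm_mul, norm_pow, norm_pow, norm_norm, norm_norm,
    norm_inv, norm_norm, inv_pow]
  gcongr
  linarith

variable (hG : MemLp G 2 volume)
  (hF : MemLp (fun k : Space => ((‖k‖⁻¹ : ℝ) : ℂ) • G k) 2 volume)

/-- Pointwise `|h(k)| ‖G(k)‖ ≤ ω⁻¹ ‖G(k)‖²`, and `ω⁻¹ ≤ (1 + ω⁻²) / 2` converts the normalisation of
`G` into the constant `1 / 2`. The vector `ψ = 0` is covered through `0⁻¹ = 0`. -/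
lemma norm_couplingIntegral_formFactor_le
    (hG1 : ∫⁻ k, ENNReal.ofReal ((1 + (‖k‖ ^ 2)⁻¹) * ‖G k‖ ^ 2) ≤ 1) (ψ : Electron) :
    ‖couplingIntegral (hG.toLp G) (formFactor (hF.toLp _) ψ)‖ ≤ 1 / 2 := by
  rw [couplingIntegral_apply]
  obtain ⟨hi, hle⟩ := integrable_weighted_coupling hG hG1
  have h1 : ‖∫ k, (starRingEnd ℂ (formFactor (hF.toLp _) ψ k)) • (hG.toLp G) k‖ ≤
      ∫ k, 1 / 2 * ((1 + (‖k‖ ^ 2)⁻¹) * ‖G k‖ ^ 2) := by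
    refine norm_integral_le_of_norm_le (hi.const_mul _) ?_
    filter_upwards [coeFn_formFactor (hF.toLp _) ψ, hF.coeFn_toLp, hG.coeFn_toLp] with k h1 h2 h3
    rw [norm_smul, RCLike.norm_conj, h1, h2, h3, norm_mul, norm_neg, norm_inv, norm_pow,
      Complex.norm_real, norm_norm]
    have h4 : ‖inner ℂ ψ ((((‖k‖⁻¹ : ℝ) : ℂ) • G k) ψ)‖ ≤ ‖ψ‖ ^ 2 * (‖k‖⁻¹ * ‖G k‖) := by
      calc _ ≤ ‖ψ‖ * ‖(((‖k‖⁻¹ : ℝ) : ℂ) • G k) ψ‖ := norm_inner_le_norm _ _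
        _ ≤ ‖ψ‖ * (‖((‖k‖⁻¹ : ℝ) : ℂ) • G k‖ * ‖ψ‖) := by
            gcongr; exact ContinuousLinearMap.le_opNorm _ _
        _ = ‖ψ‖ ^ 2 * (‖k‖⁻¹ * ‖G k‖) := by
            rw [norm_smul, Complex.norm_real, norm_inv, norm_norm]; ring
    have h5 : (‖ψ‖ ^ 2)⁻¹ * ‖inner ℂ ψ ((((‖k‖⁻¹ : ℝ) : ℂ) • G k) ψ)‖ ≤ ‖k‖⁻¹ * ‖G k‖ := by
      rcases eq_or_ne ψ 0 with rfl | hψ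
      · simp only [norm_zero, ne_eq, OfNat.ofNat_ne_zero, not_false_eq_true, zero_pow, inv_zero,
          zero_mul]
        positivity
      · have : 0 < ‖ψ‖ ^ 2 := by positivity
        rw [inv_mul_le_iff₀ this]
        exact h4
    calc _ ≤ ‖k‖⁻¹ * ‖G k‖ * ‖G k‖ := by gcongr
      _ ≤ 1 / 2 * ((1 + (‖k‖ ^ 2)⁻¹) * ‖G k‖ ^ 2) := by
          have : (‖k‖ ^ 2)⁻¹ = ‖k‖⁻¹ ^ 2 := by rw [inv_pow]
          rw [this]
          nlinarith [mul_nonneg (sq_nonneg (‖k‖⁻¹ - 1)) (sq_nonneg ‖G k‖)]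
  refine h1.trans ?_
  rw [integral_const_mul]
  linarith

lemma ae_norm_ne_zero : ∀ᵐ k : Space, ‖k‖ ≠ 0 := by
  have : ∀ᵐ k : Space, k ≠ 0 := by
    rw [ae_iff]
    simp
  exact this.mono fun k hk => norm_ne_zero_iff.2 hk

lemma formFactor_eq_norm_mul (ψ : Electron) :
    (formFactor (hG.toLp G) ψ : Space → ℂ) =ᵐ[volume]
      fun k => (‖k‖ : ℂ) * formFactor (hF.toLp _) ψ k := by
  filter_upwards [coeFn_formFactor (hF.toLp _) ψ, coeFn_formFactor (hG.toLp G) ψ, hF.coeFn_toLp,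
    hG.coeFn_toLp, ae_norm_ne_zero] with k h1 h2 h3 h4 h5
  rw [h1, h2, h3, h4, smul_apply, inner_smul_right]
  have : (‖k‖ : ℂ) ≠ 0 := by exact_mod_cast h5
  push_cast
  field_simp

lemma inner_weighted {h f : Lp ℂ 2 (volume : Measure Space)}
    (hf : (f : Space → ℂ) =ᵐ[volume] fun k => (‖k‖ : ℂ) * h k) :
    inner ℂ h f = ((∫ k, ‖k‖ * ‖h k‖ ^ 2 : ℝ) : ℂ) := by
  rw [L2.inner_def]
  refine Eq.trans ?_ integral_complex_ofReal
  refine integral_congr_ae (hf.mono fun k hk => ?_)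
  simp only
  rw [hk]
  change _ * starRingEnd ℂ (h k) = _
  rw [mul_assoc, Complex.mul_conj']
  push_cast
  rfl

lemma integrable_weighted {h f : Lp ℂ 2 (volume : Measure Space)}
    (hf : (f : Space → ℂ) =ᵐ[volume] fun k => (‖k‖ : ℂ) * h k) :
    Integrable (fun k => ‖k‖ * ‖h k‖ ^ 2) volume := by
  have h1 := (L2.integrable_inner (𝕜 := ℂ) h f).norm
  refine h1.congr (hf.mono fun k hk => ?_)
  simp only
  rw [hk]
  change ‖_ * starRingEnd ℂ (h k)‖ = _
  rw [norm_mul, norm_mul, RCLike.norm_conj, Complex.norm_real, norm_norm]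
  ring

lemma inner_weighted_re_nonneg {h f : Lp ℂ 2 (volume : Measure Space)}
    (hf : (f : Space → ℂ) =ᵐ[volume] fun k => (‖k‖ : ℂ) * h k) : 0 ≤ (inner ℂ h f).re := by
  rw [inner_weighted hf, Complex.ofReal_re]
  exact integral_nonneg fun k => by positivity

/-- Strictness holds because the weight `|k|` vanishes only at one point. -/
lemma inner_weighted_re_pos {h f : Lp ℂ 2 (volume : Measure Space)}
    (hf : (f : Space → ℂ) =ᵐ[volume] fun k => (‖k‖ : ℂ) * h k) (hh : h ≠ 0) :
    0 < (inner ℂ h f).re := by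
  refine lt_of_le_of_ne (inner_weighted_re_nonneg hf) fun h0 => hh ?_
  rw [inner_weighted hf, Complex.ofReal_re, eq_comm, integral_eq_zero_iff_of_nonneg
    (fun k => by positivity) (integrable_weighted hf)] at h0
  rw [Lp.eq_zero_iff_ae_eq_zero]
  filter_upwards [h0, ae_norm_ne_zero] with k h1 h2
  simpa [h2] using h1

/-- The fixed point equation, evaluated on normalized eigenvectors. -/
lemma formFactor_eq_of_mem_span {ψ φ : Electron} (hφ : φ ∈ Submodule.span ℂ {ψ}) (hφ1 : ‖φ‖ = 1) :
    (formFactor (hF.toLp _) ψ : Space → ℂ) =ᵐ[volume]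
      fun k => -((‖k‖ : ℂ)⁻¹ * inner ℂ φ (G k φ)) := by
  obtain ⟨a, rfl⟩ := Submodule.mem_span_singleton.1 hφ
  rw [norm_smul] at hφ1
  filter_upwards [coeFn_formFactor (hF.toLp _) ψ, hF.coeFn_toLp] with k h1 h3
  rw [h1, h3, smul_apply, inner_smul_right, map_smul, inner_smul_left,
    inner_smul_right, ← mul_assoc (starRingEnd ℂ a), Complex.conj_mul']
  have h4 : (‖ψ‖ : ℂ) ≠ 0 := by
    intro h
    rw [Complex.ofReal_eq_zero] at h
    rw [h, mul_zero] at hφ1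
    exact zero_ne_one hφ1
  have h5 : (‖a‖ : ℂ) = (‖ψ‖ : ℂ)⁻¹ := by
    refine eq_inv_of_mul_eq_one_left ?_
    exact_mod_cast hφ1
  rw [h5]
  push_cast
  ring

end Coupling

/-! ### Multiplication operators -/

section Multiplication

/-- The square root of a strictly positive integrable function, which exists by σ-finiteness. One
such `p` detects the multiplier of `B` as `B p / p`. -/
lemma exists_pos_memLp : ∃ p : Electron, ∀ᵐ x, p x ≠ 0 := by
  obtain ⟨g, hg0, hgm, hg⟩ :=
    exists_pos_lintegral_lt_of_sigmaFinite (volume : Measure Space) (ε := 1) one_ne_zero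
  have hm : AEStronglyMeasurable (fun x : Space => ((Real.sqrt (g x) : ℝ) : ℂ)) volume := by
    exact (Complex.continuous_ofReal.measurable.comp
      (Real.continuous_sqrt.measurable.comp hgm.coe_nnreal_real)).aestronglyMeasurable
  have hp : MemLp (fun x : Space => ((Real.sqrt (g x) : ℝ) : ℂ)) 2 volume := by
    rw [memLp_two_iff_integrable_sq_norm hm]
    have : (fun x : Space => ‖((Real.sqrt (g x) : ℝ) : ℂ)‖ ^ 2) = fun x => (g x : ℝ) := by
      funext x
      rw [Complex.norm_real, Real.norm_of_nonneg (Real.sqrt_nonneg _), Real.sq_sqrt (g x).coe_nonneg]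
    rw [this, ← lintegral_ofReal_ne_top_iff_integrable hgm.coe_nnreal_real.aestronglyMeasurable
      (Eventually.of_forall fun x => (g x).coe_nonneg)]
    simp only [ENNReal.ofReal_coe_nnreal]
    exact (hg.trans_le le_top).ne
  refine ⟨hp.toLp _, ?_⟩
  filter_upwards [hp.coeFn_toLp] with x hx
  rw [hx]
  have := hg0 x
  exact_mod_cast ne_of_gt (Real.sqrt_pos.2 (by exact_mod_cast this))

/-- The deviation of `B` from a multiplication operator, tested on `p` and `f`. -/
def multiplicationDefect (p f : Electron) : BOp →L[ℂ] Lp ℂ 1 (volume : Measure Space) :=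
  (((ContinuousLinearMap.mul ℂ ℂ).holderL (volume : Measure Space) 2 2 1 f).comp
      (ContinuousLinearMap.apply ℂ Electron p)) -
    (((ContinuousLinearMap.mul ℂ ℂ).holderL (volume : Measure Space) 2 2 1 p).comp
      (ContinuousLinearMap.apply ℂ Electron f))

lemma multiplicationDefect_eq_zero_iff (p f : Electron) (B : BOp) :
    multiplicationDefect p f B = 0 ↔ ∀ᵐ x, f x * B p x = p x * B f x := by
  have h1 := (ContinuousLinearMap.mul ℂ ℂ).coeFn_holder (r := 1) f (B p)
  have h2 := (ContinuousLinearMap.mul ℂ ℂ).coeFn_holder (r := 1) p (B f)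
  have h3 : multiplicationDefect p f B =
    (ContinuousLinearMap.mul ℂ ℂ).holder 1 f (B p) -
      (ContinuousLinearMap.mul ℂ ℂ).holder 1 p (B f) := rfl
  rw [h3, sub_eq_zero, Lp.ext_iff]
  constructor
  · intro h
    filter_upwards [h, h1, h2] with x e1 e2 e3
    rw [e2, e3] at e1
    exact e1
  · intro h
    filter_upwards [h, h1, h2] with x e1 e2 e3
    rw [e2, e3]
    exact e1

/-- The multiplier can only be `B p / p`, and it works precisely if `f · B p = p · B f` for all `f`.
For fixed `f` this is the vanishing of a continuous linear map of `B`, so it passes to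
operator-valued integrals. -/
lemma isMultiplication_iff {p : Electron} (hp : ∀ᵐ x, p x ≠ 0) (B : BOp) :
    IsMultiplication B ↔ ∀ f, multiplicationDefect p f B = 0 := by
  simp only [multiplicationDefect_eq_zero_iff]
  constructor
  · rintro ⟨m, -, hm⟩ f
    filter_upwards [hm f, hm p] with x h1 h2
    rw [h1, h2]
    ring
  · intro h
    refine ⟨fun x => B p x / p x, ?_, fun f => ?_⟩
    · exact ((Lp.aestronglyMeasurable (B p)).aemeasurable.div
        (Lp.aestronglyMeasurable p).aemeasurable).aestronglyMeasurable
    · filter_upwards [h f, hp] with x h1 h2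
      field_simp
      linear_combination -h1

lemma isMultiplication_couplingIntegral {G : Lp BOp 2 (volume : Measure Space)}
    (hG : ∀ᵐ k, IsMultiplication (G k)) (h : Lp ℂ 2 (volume : Measure Space)) :
    IsMultiplication (couplingIntegral G h) := by
  obtain ⟨p, hp⟩ := exists_pos_memLp
  rw [isMultiplication_iff hp, couplingIntegral_apply]
  intro f
  by_cases hint : Integrable (fun k => (starRingEnd ℂ (h k)) • G k) volume
  · rw [← ContinuousLinearMap.integral_comp_comm _ hint, ← integral_zero Space _]
    refine integral_congr_ae ?_
    filter_upwards [hG] with k hk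
    rw [map_smul, (isMultiplication_iff hp _).1 hk f, smul_zero]
  · rw [integral_undef hint, map_zero]

lemma star_multiplication {B : BOp} {m : Space → ℂ} (hm : AEStronglyMeasurable m volume)
    (hB : ∀ f : Electron, (B f : Space → ℂ) =ᵐ[volume] fun x => m x * f x) (f : Electron) :
    (star B f : Space → ℂ) =ᵐ[volume] fun x => starRingEnd ℂ (m x) * f x := by
  -- The multiplier is not known to be bounded; square integrability is inherited from `B f`, which
  -- has the same modulus.
  have hmem : MemLp (fun x => starRingEnd ℂ (m x) * f x) 2 volume := by
    refine MemLp.of_le (Lp.memLp (B f)) ?_ ?_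
    · exact (Complex.continuous_conj.comp_aestronglyMeasurable hm).mul (Lp.aestronglyMeasurable f)
    · filter_upwards [hB f] with x hx
      rw [hx, norm_mul, norm_mul, RCLike.norm_conj]
  have : star B f = hmem.toLp _ := by
    refine ext_inner_left ℂ fun v => ?_
    rw [ContinuousLinearMap.star_eq_adjoint, ContinuousLinearMap.adjoint_inner_right,
      L2.inner_def, L2.inner_def]
    refine integral_congr_ae ?_
    filter_upwards [hB v, hmem.coeFn_toLp] with x h1 h2
    rw [h1, h2]
    change f x * starRingEnd ℂ (m x * v x) = starRingEnd ℂ (m x) * f x * starRingEnd ℂ (v x)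
    rw [map_mul]; ring
  rw [this]
  exact hmem.coeFn_toLp

lemma isPotential_inducedPotential {G F : Lp BOp 2 (volume : Measure Space)}
    (hG : ∀ᵐ k, IsMultiplication (G k)) (ψ : Electron) :
    IsPotential (inducedPotential G F ψ) := by
  obtain ⟨m, hm, hB⟩ := isMultiplication_couplingIntegral hG (formFactor F ψ)
  set c := (inner ℂ (formFactor F ψ) (formFactor G ψ)).re with hc
  set M := couplingIntegral G (formFactor F ψ) with hM
  refine ⟨fun x => c + 2 * (m x).re, ?_, fun f => ?_⟩
  · exact aestronglyMeasurable_const.add ((Complex.continuous_re.comp_aestronglyMeasurable hm).const_mul 2)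
  · have h1 : inducedPotential G F ψ f = (c : ℂ) • f + (M f + star M f) := by
      rw [← real_smul_electron]; rfl
    rw [h1]
    filter_upwards [Lp.coeFn_add ((c : ℂ) • f) (M f + star M f), Lp.coeFn_add (M f) (star M f),
      Lp.coeFn_smul (c : ℂ) f, hB f, star_multiplication hm hB f] with x e1 e2 e3 e4 e5
    rw [e1, Pi.add_apply, e2, Pi.add_apply, e3, Pi.smul_apply, e4, e5, smul_eq_mul]
    have : m x + starRingEnd ℂ (m x) = ((2 * (m x).re : ℝ) : ℂ) := Complex.add_conj (m x)
    rw [← add_mul, this]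
    push_cast
    ring

end Multiplication

end

section

/-! ### Measure theory of the configuration space -/

lemma lintegral_config (f : Config → ℝ≥0∞) :
    ∫⁻ q, f q ∂configMeasure = ∑' n : ℕ, ∫⁻ k : Fin n → Space, f ⟨n, k⟩ := by
  rw [configMeasure, lintegral_sum_measure]
  exact tsum_congr fun n => (measurableEmbedding_mk n).lintegral_map f

lemma aestronglyMeasurable_config_iff {E : Type*} [TopologicalSpace E]
    [TopologicalSpace.PseudoMetrizableSpace E] {f : Config → E} :
    AEStronglyMeasurable f configMeasure ↔
      ∀ n : ℕ, AEStronglyMeasurable (fun k : Fin n → Space => f ⟨n, k⟩) volume := by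
  rw [configMeasure, aestronglyMeasurable_sum_measure_iff]
  exact forall_congr' fun n => (measurableEmbedding_mk n).aestronglyMeasurable_map_iff

lemma measurable_config_iff {E : Type*} [MeasurableSpace E] {f : Config → E} :
    Measurable f ↔ ∀ n : ℕ, Measurable fun k : Fin n → Space => f ⟨n, k⟩ := by
  refine ⟨fun h n => h.comp (measurableEmbedding_mk n).measurable, fun h s hs => ?_⟩
  exact MeasurableSpace.measurableSet_iInf.2 fun n => h n hs

lemma hasSum_integral_config {f : Config → ℂ} (hf : Integrable f configMeasure) :
    HasSum (fun n : ℕ => ∫ k : Fin n → Space, f ⟨n, k⟩) (∫ q, f q ∂configMeasure) := by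
  have h := hasSum_integral_measure (μ := fun n : ℕ =>
    (volume : Measure (Fin n → Space)).map (Sigma.mk n)) (f := f) hf
  simp only [(measurableEmbedding_mk _).integral_map] at h
  exact h

lemma enorm_sq_Lp {α E : Type*} [MeasurableSpace α] {μ : Measure α} [NormedAddCommGroup E]
    (f : Lp E 2 μ) : ‖f‖ₑ ^ 2 = ∫⁻ x, ‖f x‖ₑ ^ 2 ∂μ := by
  rw [Lp.enorm_def]
  have := eLpNorm_nnreal_pow_eq_lintegral (μ := μ) (f := (f : α → E)) (p := 2) (by norm_num)
  simpa using this

lemma enorm_sq_fock (Ψ : Fock) : ‖Ψ‖ₑ ^ 2 = ∫⁻ q, ‖val Ψ q‖ₑ ^ 2 ∂configMeasure :=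
  enorm_sq_Lp (Ψ : FullFock)

lemma enorm_sq_fock_congr {Ψ : Fock} {f : Config → Electron} (h : val Ψ =ᵐ[configMeasure] f) :
    ‖Ψ‖ₑ ^ 2 = ∫⁻ q, ‖f q‖ₑ ^ 2 ∂configMeasure := by
  rw [enorm_sq_fock]
  exact lintegral_congr_ae (h.mono fun q hq => by simp only [hq])

lemma memLp_two_of_lintegral {α E : Type*} [MeasurableSpace α] {μ : Measure α}
    [NormedAddCommGroup E] {f : α → E} (hm : AEStronglyMeasurable f μ)
    (hf : ∫⁻ x, ‖f x‖ₑ ^ 2 ∂μ ≠ ⊤) : MemLp f 2 μ := by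
  refine ⟨hm, ?_⟩
  have := eLpNorm_nnreal_pow_eq_lintegral (μ := μ) (f := f) (p := 2) (by norm_num)
  simp only [NNReal.coe_ofNat, ENNReal.coe_ofNat, ENNReal.rpow_ofNat] at this
  rw [lt_top_iff_ne_top]
  intro h
  rw [h] at this
  exact hf (by rw [← this]; simp)

lemma val_aesm (Ψ : Fock) : AEStronglyMeasurable (val Ψ) configMeasure :=
  Lp.aestronglyMeasurable (Ψ : FullFock)

lemma val_aesm_sector (Ψ : Fock) (n : ℕ) :
    AEStronglyMeasurable (fun k : Fin n → Space => val Ψ ⟨n, k⟩) volume :=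
  aestronglyMeasurable_config_iff.1 (val_aesm Ψ) n

lemma val_symm (Ψ : Fock) (n : ℕ) (σ : Equiv.Perm (Fin n)) :
    ∀ᵐ k : Fin n → Space, val Ψ ⟨n, k ∘ σ⟩ = val Ψ ⟨n, k⟩ := Ψ.2 n σ

/-- A square-integrable symmetric function of the configuration is a vector. -/
lemma exists_fock {f : Config → Electron} (hm : AEStronglyMeasurable f configMeasure)
    (hs : ∀ (n : ℕ) (σ : Equiv.Perm (Fin n)), ∀ᵐ k : Fin n → Space, f ⟨n, k ∘ σ⟩ = f ⟨n, k⟩)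
    (hf : ∫⁻ q, ‖f q‖ₑ ^ 2 ∂configMeasure ≠ ⊤) : ∃ Φ : Fock, val Φ =ᵐ[configMeasure] f := by
  have h2 := memLp_two_of_lintegral hm hf
  refine ⟨⟨h2.toLp f, fun n σ => ?_⟩, h2.coeFn_toLp⟩
  have h := ae_config_iff.1 h2.coeFn_toLp n
  filter_upwards [h, ae_perm σ h, hs n σ] with k h1 h2 h3
  rw [h1, h2, h3]

lemma fock_ext {Ψ Φ : Fock} (h : val Ψ =ᵐ[configMeasure] val Φ) : Ψ = Φ :=
  Subtype.ext (Lp.ext h)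

lemma val_sub (Ψ Φ : Fock) : val (Ψ - Φ) =ᵐ[configMeasure] fun q => val Ψ q - val Φ q :=
  Lp.coeFn_sub (Ψ : FullFock) (Φ : FullFock)

lemma enorm_le_of_sq_le {α : Type*} [NormedAddCommGroup α] {β : Type*} [NormedAddCommGroup β]
    {x : α} {y : β} {C : ℝ} (hC : 0 ≤ C)
    (h : ‖x‖ₑ ^ 2 ≤ ENNReal.ofReal (C ^ 2) * ‖y‖ₑ ^ 2) : ‖x‖ ≤ C * ‖y‖ := by
  rw [← ofReal_norm, ← ofReal_norm, ← ENNReal.ofReal_pow (norm_nonneg _),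
    ← ENNReal.ofReal_pow (norm_nonneg _), ← ENNReal.ofReal_mul (by positivity),
    ENNReal.ofReal_le_ofReal_iff (by positivity), ← mul_pow] at h
  exact (pow_le_pow_iff_left₀ (norm_nonneg _) (by positivity) two_ne_zero).1 h

/-- A linear relation with a bound defines a bounded operator. -/
lemma exists_clm_of_graph {𝕜 E F : Type*} [NontriviallyNormedField 𝕜] [NormedAddCommGroup E]
    [NormedSpace 𝕜 E] [NormedAddCommGroup F] [NormedSpace 𝕜 F] (Γ : Submodule 𝕜 (E × F)) (C : ℝ)
    (h0 : ∀ y, (0, y) ∈ Γ → y = 0) (h : ∀ x, ∃ y, (x, y) ∈ Γ ∧ ‖y‖ ≤ C * ‖x‖) :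
    ∃ T : E →L[𝕜] F, (∀ x, (x, T x) ∈ Γ) ∧ ∀ x, ‖T x‖ ≤ C * ‖x‖ := by
  choose f hf using h
  have huniq : ∀ x y y', (x, y) ∈ Γ → (x, y') ∈ Γ → y = y' := fun x y y' h1 h2 =>
    sub_eq_zero.1 (h0 _ (by simpa using Γ.sub_mem h1 h2))
  refine ⟨LinearMap.mkContinuous
    { toFun := f
      map_add' := fun x y => huniq _ _ _ (hf _).1 (Γ.add_mem (hf x).1 (hf y).1)
      map_smul' := fun c x => huniq _ _ _ (hf _).1 (Γ.smul_mem c (hf x).1) } C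
      fun x => (hf x).2, fun x => (hf x).1, fun x => (hf x).2⟩

/-- Multiplication by a bounded symmetric function of the photon configuration. -/
lemma exists_mulOp {m : Config → ℂ} (hm : Measurable m)
    (hs : ∀ (n : ℕ) (σ : Equiv.Perm (Fin n)) (k : Fin n → Space), m ⟨n, k ∘ σ⟩ = m ⟨n, k⟩)
    (hb : ∀ q, ‖m q‖ ≤ 1) :
    ∃ T : Fock →L[ℂ] Fock, (∀ Ψ, val (T Ψ) =ᵐ[configMeasure] fun q => m q • val Ψ q) ∧
      ∀ Ψ, ‖T Ψ‖ ≤ ‖Ψ‖ := by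
  let Γ : Submodule ℂ (Fock × Fock) :=
    { carrier := {P | val P.2 =ᵐ[configMeasure] fun q => m q • val P.1 q}
      zero_mem' := by
        filter_upwards [val_zero] with q h
        change val 0 q = m q • val 0 q
        rw [h, smul_zero]
      add_mem' := by
        rintro ⟨Ψ, Φ⟩ ⟨Ψ', Φ'⟩ h h'
        filter_upwards [h, h', val_add Ψ Ψ', val_add Φ Φ'] with q h1 h2 h3 h4
        change val (Φ + Φ') q = _ • val (Ψ + Ψ') q
        rw [h3, h4, smul_add]
        exact congrArg₂ _ h1 h2
      smul_mem' := by
        rintro c ⟨Ψ, Φ⟩ h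
        filter_upwards [h, val_smul c Ψ, val_smul c Φ] with q h1 h3 h4
        change val (c • Φ) q = _ • val (c • Ψ) q
        rw [h3, h4, smul_comm]
        exact congrArg _ h1 }
  have hle : ∀ Ψ : Fock, ∫⁻ q, ‖m q • val Ψ q‖ₑ ^ 2 ∂configMeasure ≤ ‖Ψ‖ₑ ^ 2 := by
    intro Ψ
    rw [enorm_sq_fock]
    refine lintegral_mono fun q => ?_
    rw [enorm_smul]
    gcongr
    refine mul_le_of_le_one_left (zero_le) ?_
    rw [← ofReal_norm]
    exact ENNReal.ofReal_le_one.2 (hb q)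
  obtain ⟨T, hT, hT'⟩ := exists_clm_of_graph Γ 1 (by
    intro Φ h
    have h' : val Φ =ᵐ[configMeasure] fun q => m q • val 0 q := h
    refine eq_zero_of_val ?_
    filter_upwards [h', val_zero] with q h1 h2
    rw [h1, h2, smul_zero]) (by
    intro Ψ
    obtain ⟨Φ, hΦ⟩ := exists_fock (f := fun q => m q • val Ψ q)
      (hm.aestronglyMeasurable.smul (val_aesm Ψ)) (by
        intro n σ
        filter_upwards [val_symm Ψ n σ] with k hk
        rw [hk, hs])
      (ne_top_of_le_ne_top (by simp) (hle Ψ))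
    refine ⟨Φ, hΦ, ?_⟩
    refine enorm_le_of_sq_le zero_le_one ?_
    rw [enorm_sq_fock_congr hΦ]
    simpa using hle Ψ)
  exact ⟨T, hT, by simpa using hT'⟩

end

section

/-! ### Bounds for creation and annihilation operators -/

/-- `∑ᵢ v(kᵢ)`. -/
def weight (v : Space → ℝ≥0∞) (q : Config) : ℝ≥0∞ := ∑ i : Fin q.1, v (q.2 i)

lemma lintegral_removeNth {n : ℕ} (j : Fin (n + 1)) (f : Space × (Fin n → Space) → ℝ≥0∞) :
    ∫⁻ k : Fin (n + 1) → Space, f (k j, fun i => k (j.succAbove i)) =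
      ∫⁻ p, f p ∂((volume : Measure Space).prod (volume : Measure (Fin n → Space))) :=
  (volume_preserving_piFinSuccAbove (fun _ : Fin (n + 1) => Space) j).lintegral_comp_emb
    (MeasurableEquiv.measurableEmbedding _) f

lemma aesm_removeNth {E : Type*} [TopologicalSpace E] {n : ℕ} (j : Fin (n + 1))
    {f : (Fin n → Space) → E} (hf : AEStronglyMeasurable f volume) :
    AEStronglyMeasurable (fun k : Fin (n + 1) → Space => f fun i => k (j.succAbove i)) volume :=
  hf.comp_quasiMeasurePreserving (Measure.quasiMeasurePreserving_snd.comp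
    (volume_preserving_piFinSuccAbove (fun _ : Fin (n + 1) => Space) j).quasiMeasurePreserving)

lemma aesm_eval {E : Type*} [TopologicalSpace E] {n : ℕ} (j : Fin (n + 1))
    {f : Space → E} (hf : AEStronglyMeasurable f volume) :
    AEStronglyMeasurable (fun k : Fin (n + 1) → Space => f (k j)) volume :=
  hf.comp_quasiMeasurePreserving (Measure.quasiMeasurePreserving_fst.comp
    (volume_preserving_piFinSuccAbove (fun _ : Fin (n + 1) => Space) j).quasiMeasurePreserving)

lemma ae_eval {n : ℕ} {p : Space → Prop} (h : ∀ᵐ x, p x) :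
    ∀ᵐ k : Fin n → Space, ∀ j, p (k j) := by
  cases n with
  | zero => exact Eventually.of_forall fun k j => j.elim0
  | succ n =>
    exact ae_all_iff.2 fun j => (Measure.quasiMeasurePreserving_fst.comp
      (volume_preserving_piFinSuccAbove
        (fun _ : Fin (n + 1) => Space) j).quasiMeasurePreserving).ae h

/-- `(k, (k₁, …, kₙ)) ↦ (k, k₁, …, kₙ)` preserves measure. -/
lemma measurePreserving_cons (n : ℕ) :
    MeasurePreserving (fun p : Space × (Fin n → Space) => (Fin.cons p.1 p.2 : Fin (n + 1) → Space))
      (volume.prod volume) volume := by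
  have h : (fun p : Space × (Fin n → Space) => (Fin.cons p.1 p.2 : Fin (n + 1) → Space)) =
      (MeasurableEquiv.piFinSuccAbove (fun _ : Fin (n + 1) => Space) 0).symm := by
    funext p
    simp [MeasurableEquiv.piFinSuccAbove, Fin.insertNthEquiv]
  rw [h]
  exact (volume_preserving_piFinSuccAbove (fun _ : Fin (n + 1) => Space) 0).symm

lemma measurePreserving_cons_swap (n : ℕ) :
    MeasurePreserving (fun p : (Fin n → Space) × Space => (Fin.cons p.2 p.1 : Fin (n + 1) → Space))
      (volume.prod volume) volume :=
  (measurePreserving_cons n).comp Measure.measurePreserving_swap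

lemma aesm_creationFun {F : Space → Electron →L[ℂ] Electron} (hF : AEStronglyMeasurable F volume)
    {Ψ : Config → Electron} (hΨ : AEStronglyMeasurable Ψ configMeasure) :
    AEStronglyMeasurable (creationFun F Ψ) configMeasure := by
  rw [aestronglyMeasurable_config_iff] at hΨ ⊢
  rintro (_ | n)
  · exact aestronglyMeasurable_const
  · have : AEStronglyMeasurable (fun k : Fin (n + 1) → Space =>
        ∑ j : Fin (n + 1), F (k j) (Ψ ⟨n, fun i => k (j.succAbove i)⟩)) volume := by
      refine Finset.aestronglyMeasurable_fun_sum _ fun j _ => ?_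
      have h1 := aesm_eval j hF
      have h2 := aesm_removeNth j (hΨ n)
      exact (ContinuousLinearMap.apply ℂ Electron).aestronglyMeasurable_comp₂ h2 h1
    exact this.const_smul ((Real.sqrt (n + 1) : ℂ))⁻¹

/-- A permutation maps the complement of `j` onto that of `σ j`, and `τ` is this bijection with both
complements renumbered. It reduces the symmetry of `a* Ψ` to that of `Ψ` with one photon fewer. -/
lemma exists_perm_succAbove {n : ℕ} (σ : Equiv.Perm (Fin (n + 1))) (j : Fin (n + 1)) :
    ∃ τ : Equiv.Perm (Fin n), ∀ i, σ (j.succAbove i) = (σ j).succAbove (τ i) := by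
  let τ : Equiv.Perm (Fin n) := (finSuccAboveEquiv j).trans
    ((σ.subtypeEquiv (p := fun x => x ≠ j) (q := fun x => x ≠ σ j)
      (fun x => by simp)).trans (finSuccAboveEquiv (σ j)).symm)
  refine ⟨τ, fun i => ?_⟩
  have h : finSuccAboveEquiv (σ j) (τ i) =
      σ.subtypeEquiv (p := fun x => x ≠ j) (q := fun x => x ≠ σ j)
      (fun x => by simp) (finSuccAboveEquiv j i) := by
    simp [τ]
  exact (congrArg Subtype.val h).symm

lemma creationFun_symm (F : Space → Electron →L[ℂ] Electron) {Ψ : Config → Electron}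
    (hs : ∀ (n : ℕ) (σ : Equiv.Perm (Fin n)), ∀ᵐ k : Fin n → Space, Ψ ⟨n, k ∘ σ⟩ = Ψ ⟨n, k⟩)
    (n : ℕ) (σ : Equiv.Perm (Fin n)) :
    ∀ᵐ k : Fin n → Space, creationFun F Ψ ⟨n, k ∘ σ⟩ = creationFun F Ψ ⟨n, k⟩ := by
  cases n with
  | zero => exact Eventually.of_forall fun k => rfl
  | succ n =>
    choose τ hτ using exists_perm_succAbove σ
    have h := ae_all_iff.2 fun j : Fin (n + 1) => ae_removeNth (σ j) (hs n (τ j))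
    filter_upwards [h] with k hk
    simp only [creationFun]
    congr 1
    rw [← Equiv.sum_comp σ fun j => F (k j) (Ψ ⟨n, fun i => k (j.succAbove i)⟩)]
    refine Finset.sum_congr rfl fun j _ => ?_
    simp only [Function.comp_apply]
    congr 1
    rw [← hk j]
    congr 2
    funext i
    simp only [Function.comp_apply, hτ]

/-- Cauchy–Schwarz after splitting `x j` as `√(v j)` times `x j / √(v j)`. -/
lemma sum_sq_le_weighted {n : ℕ} (x v : Fin n → ℝ≥0∞) (hv : ∀ j, v j ≠ 0) (hv' : ∀ j, v j ≠ ⊤)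
    (hx : ∀ j, x j ≠ ⊤) : (∑ j, x j) ^ 2 ≤ (∑ j, v j) * ∑ j, x j ^ 2 * (v j)⁻¹ := by
  lift x to Fin n → NNReal using hx
  lift v to Fin n → NNReal using hv'
  have hv2 : ∀ j, v j ≠ 0 := fun j h => hv j (by simp [h])
  have h := Finset.sum_sq_le_sum_mul_sum_of_sq_le_mul (Finset.univ) (r := x) (f := v)
    (g := fun j => x j ^ 2 * (v j)⁻¹) (fun _ _ => zero_le) (fun _ _ => zero_le)
    fun j _ => le_of_eq (by have := hv2 j; field_simp)
  have h2 : ∀ j, (v j : ℝ≥0∞)⁻¹ = ((v j)⁻¹ : NNReal) := fun j => (ENNReal.coe_inv (hv2 j)).symm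
  simp only [h2]
  exact_mod_cast h

/-- Cauchy–Schwarz with the weights `v(k₁), …, v(kₙ₊₁)`. In the `j`-th term their sum is `v(kⱼ)`
plus the weight of the other photons: the first part cancels `v(kⱼ)⁻¹` and leaves `‖F‖² ‖Ψ‖²`, the
second gives the `v`-weighted norm of `Ψ`. Later `v = 1` produces number bounds and `v = |k|` energy
bounds. -/
lemma creationFun_enorm_sq_le (F : Space → Electron →L[ℂ] Electron) (v : Space → ℝ≥0∞)
    (Ψ : Config → Electron) {n : ℕ} {k : Fin (n + 1) → Space} (hv : ∀ j, v (k j) ≠ 0)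
    (hv' : ∀ j, v (k j) ≠ ⊤) :
    ‖creationFun F Ψ ⟨n + 1, k⟩‖ₑ ^ 2 ≤ ((n + 1 : ℕ) : ℝ≥0∞)⁻¹ * ∑ j : Fin (n + 1),
      (‖F (k j)‖ₑ ^ 2 * ‖Ψ ⟨n, fun i => k (j.succAbove i)⟩‖ₑ ^ 2 +
        ‖F (k j)‖ₑ ^ 2 * (v (k j))⁻¹ * (weight v ⟨n, fun i => k (j.succAbove i)⟩ *
          ‖Ψ ⟨n, fun i => k (j.succAbove i)⟩‖ₑ ^ 2)) := by
  simp only [creationFun]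
  rw [enorm_smul, mul_pow]
  have h1 : ‖((Real.sqrt (n + 1) : ℂ))⁻¹‖ₑ ^ 2 = ((n + 1 : ℕ) : ℝ≥0∞)⁻¹ := by
    rw [← ofReal_norm, ← ENNReal.ofReal_pow (norm_nonneg _), norm_inv, Complex.norm_real,
      Real.norm_of_nonneg (Real.sqrt_nonneg _), inv_pow, Real.sq_sqrt (by positivity),
      ENNReal.ofReal_inv_of_pos (by positivity)]
    norm_cast
  rw [h1]
  gcongr
  have h2 : ‖∑ j : Fin (n + 1), F (k j) (Ψ ⟨n, fun i => k (j.succAbove i)⟩)‖ₑ ≤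
      ∑ j : Fin (n + 1), ‖F (k j)‖ₑ * ‖Ψ ⟨n, fun i => k (j.succAbove i)⟩‖ₑ :=
    (enorm_sum_le _ _).trans (Finset.sum_le_sum fun j _ => ContinuousLinearMap.le_opENorm _ _)
  refine (pow_le_pow_left' h2 2).trans ?_
  refine (sum_sq_le_weighted _ (fun j => v (k j)) hv hv'
    fun j => ENNReal.mul_ne_top enorm_ne_top enorm_ne_top).trans ?_
  rw [Finset.mul_sum]
  refine Finset.sum_le_sum fun j _ => le_of_eq ?_
  have h3 : ∑ i, v (k i) = v (k j) + weight v ⟨n, fun i => k (j.succAbove i)⟩ :=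
    Fin.sum_univ_succAbove (fun i => v (k i)) j
  rw [h3, add_mul, mul_pow]
  congr 1
  · calc _ = v (k j) * (v (k j))⁻¹ * (‖F (k j)‖ₑ ^ 2 *
        ‖Ψ ⟨n, fun i => k (j.succAbove i)⟩‖ₑ ^ 2) := by ring
      _ = _ := by rw [ENNReal.mul_inv_cancel (hv j) (hv' j), one_mul]
  · ring

lemma measurable_weight {v : Space → ℝ≥0∞} (hv : Measurable v) : Measurable (weight v) := by
  refine measurable_config_iff.2 fun n => ?_
  change Measurable fun k : Fin n → Space => ∑ i : Fin n, v (k i)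
  exact Finset.measurable_fun_sum _ fun i _ => hv.comp (measurable_pi_apply i)

lemma lintegral_creationFun_sector_le {F : Space → Electron →L[ℂ] Electron}
    (hF : AEStronglyMeasurable F volume) {v : Space → ℝ≥0∞} (hvm : Measurable v)
    (hv : ∀ᵐ k, v k ≠ 0 ∧ v k ≠ ⊤) {Ψ : Config → Electron}
    (hΨ : AEStronglyMeasurable Ψ configMeasure) (n : ℕ) :
    ∫⁻ k : Fin (n + 1) → Space, ‖creationFun F Ψ ⟨n + 1, k⟩‖ₑ ^ 2 ≤
      (∫⁻ k, ‖F k‖ₑ ^ 2) * (∫⁻ k : Fin n → Space, ‖Ψ ⟨n, k⟩‖ₑ ^ 2) +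
      (∫⁻ k, ‖F k‖ₑ ^ 2 * (v k)⁻¹) *
        ∫⁻ k : Fin n → Space, weight v ⟨n, k⟩ * ‖Ψ ⟨n, k⟩‖ₑ ^ 2 := by
  have hΨn := aestronglyMeasurable_config_iff.1 hΨ n
  have hw : Measurable fun k : Fin n → Space => weight v ⟨n, k⟩ :=
    measurable_config_iff.1 (measurable_weight hvm) n
  have m1 : AEMeasurable (fun k => ‖F k‖ₑ ^ 2) volume := (hF.enorm).pow_const 2
  have m2 : AEMeasurable (fun k => ‖F k‖ₑ ^ 2 * (v k)⁻¹) volume := m1.mul hvm.inv.aemeasurable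
  have m3 : AEMeasurable (fun k : Fin n → Space => ‖Ψ ⟨n, k⟩‖ₑ ^ 2) volume :=
    (hΨn.enorm).pow_const 2
  have m4 : AEMeasurable (fun k : Fin n → Space => weight v ⟨n, k⟩ * ‖Ψ ⟨n, k⟩‖ₑ ^ 2) volume :=
    hw.aemeasurable.mul m3
  let f : Space × (Fin n → Space) → ℝ≥0∞ := fun p =>
    ‖F p.1‖ₑ ^ 2 * ‖Ψ ⟨n, p.2⟩‖ₑ ^ 2 +
      ‖F p.1‖ₑ ^ 2 * (v p.1)⁻¹ * (weight v ⟨n, p.2⟩ * ‖Ψ ⟨n, p.2⟩‖ₑ ^ 2)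
  have mf1 : AEMeasurable (fun p : Space × (Fin n → Space) =>
      ‖F p.1‖ₑ ^ 2 * ‖Ψ ⟨n, p.2⟩‖ₑ ^ 2) (volume.prod volume) := m1.comp_fst.mul m3.comp_snd
  have mf2 : AEMeasurable (fun p : Space × (Fin n → Space) =>
      ‖F p.1‖ₑ ^ 2 * (v p.1)⁻¹ * (weight v ⟨n, p.2⟩ * ‖Ψ ⟨n, p.2⟩‖ₑ ^ 2))
      (volume.prod volume) := m2.comp_fst.mul m4.comp_snd
  calc _ ≤ ∫⁻ k : Fin (n + 1) → Space, ((n + 1 : ℕ) : ℝ≥0∞)⁻¹ *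
        ∑ j : Fin (n + 1), f (k j, fun i => k (j.succAbove i)) := by
        refine lintegral_mono_ae ?_
        filter_upwards [ae_eval hv] with k hk
        exact creationFun_enorm_sq_le F v Ψ (fun j => (hk j).1) fun j => (hk j).2
    _ = ((n + 1 : ℕ) : ℝ≥0∞)⁻¹ * ∑ j : Fin (n + 1),
        ∫⁻ k : Fin (n + 1) → Space, f (k j, fun i => k (j.succAbove i)) := by
        rw [lintegral_const_mul' _ _ (by simp), lintegral_finsetSum']
        intro j _
        exact (mf1.add mf2).comp_quasiMeasurePreserving
          (volume_preserving_piFinSuccAbove (fun _ : Fin (n + 1) => Space) j).quasiMeasurePreserving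
    _ = ∫⁻ p, f p ∂(volume.prod volume) := by
        simp only [lintegral_removeNth]
        rw [Finset.sum_const, Finset.card_univ, Fintype.card_fin, nsmul_eq_mul, ← mul_assoc,
          ENNReal.inv_mul_cancel (by simp) (by simp), one_mul]
    _ = _ := by
        rw [lintegral_add_left' mf1, lintegral_prod_mul m1 m3, lintegral_prod_mul m2 m4]
    _ ≤ _ := le_rfl

lemma lintegral_creationFun_le {F : Space → Electron →L[ℂ] Electron}
    (hF : AEStronglyMeasurable F volume) {v : Space → ℝ≥0∞} (hvm : Measurable v)
    (hv : ∀ᵐ k, v k ≠ 0 ∧ v k ≠ ⊤) {Ψ : Config → Electron}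
    (hΨ : AEStronglyMeasurable Ψ configMeasure) :
    ∫⁻ q, ‖creationFun F Ψ q‖ₑ ^ 2 ∂configMeasure ≤
      (∫⁻ k, ‖F k‖ₑ ^ 2) * (∫⁻ q, ‖Ψ q‖ₑ ^ 2 ∂configMeasure) +
      (∫⁻ k, ‖F k‖ₑ ^ 2 * (v k)⁻¹) * ∫⁻ q, weight v q * ‖Ψ q‖ₑ ^ 2 ∂configMeasure := by
  simp only [lintegral_config]
  rw [tsum_eq_zero_add' ENNReal.summable, ← ENNReal.tsum_mul_left, ← ENNReal.tsum_mul_left,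
    ← ENNReal.tsum_add]
  simp only [creationFun, enorm_zero, ne_eq, OfNat.ofNat_ne_zero, not_false_eq_true, zero_pow,
    lintegral_const, zero_mul, zero_add]
  exact ENNReal.tsum_le_tsum fun n => lintegral_creationFun_sector_le hF hvm hv hΨ n

lemma measurePreserving_perm {n : ℕ} (σ : Equiv.Perm (Fin n)) :
    MeasurePreserving (fun k : Fin n → Space => k ∘ σ) volume volume := by
  have h : (fun k : Fin n → Space => k ∘ σ) =
      MeasurableEquiv.piCongrLeft (fun _ : Fin n => Space) σ.symm := by
    funext k
    ext i j
    simp [MeasurableEquiv.piCongrLeft, Equiv.piCongrLeft, Equiv.piCongrLeft']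
  rw [h]
  exact volume_measurePreserving_piCongrLeft (fun _ : Fin n => Space) σ.symm

lemma lintegral_comp_measurePreserving {α β : Type*} [MeasurableSpace α] [MeasurableSpace β]
    {μ : Measure α} {ν : Measure β} {g : α → β} (h : MeasurePreserving g μ ν) {f : β → ℝ≥0∞}
    (hf : AEMeasurable f ν) : ∫⁻ a, f (g a) ∂μ = ∫⁻ b, f b ∂ν := by
  have h2 := lintegral_map' (h.map_eq.symm ▸ hf) h.measurable.aemeasurable
  rw [h.map_eq] at h2
  exact h2.symm

/-- The permutation is extended to `n + 1` photons by fixing the one that is integrated out; this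
extension is `Equiv.Perm.decomposeFin.symm (0, σ)`. -/
lemma annihilationFun_symm (F : Space → Electron →L[ℂ] Electron) {Ψ : Config → Electron}
    (hs : ∀ (n : ℕ) (σ : Equiv.Perm (Fin n)), ∀ᵐ k : Fin n → Space, Ψ ⟨n, k ∘ σ⟩ = Ψ ⟨n, k⟩)
    (n : ℕ) (σ : Equiv.Perm (Fin n)) :
    ∀ᵐ k : Fin n → Space, annihilationFun F Ψ ⟨n, k ∘ σ⟩ = annihilationFun F Ψ ⟨n, k⟩ := by
  filter_upwards [ae_cons (hs (n + 1) (Equiv.Perm.decomposeFin.symm (0, σ)))] with k hk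
  simp only [annihilationFun]
  congr 1
  refine integral_congr_ae ?_
  filter_upwards [hk] with q hq
  simp only [annihilationIntegrand]
  rw [← hq]
  congr 3
  funext i
  refine Fin.cases ?_ (fun j => ?_) i
  · simp
  · simp

lemma aesm_adjoint {α : Type*} [MeasurableSpace α] {μ : Measure α}
    {F : α → Electron →L[ℂ] Electron} (hF : AEStronglyMeasurable F μ) :
    AEStronglyMeasurable (fun k => ContinuousLinearMap.adjoint (F k)) μ :=
  (LinearIsometryEquiv.continuous _).comp_aestronglyMeasurable hF

lemma aesm_annihilationIntegrand {F : Space → Electron →L[ℂ] Electron}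
    (hF : AEStronglyMeasurable F volume) {Ψ : Config → Electron}
    (hΨ : AEStronglyMeasurable Ψ configMeasure) (n : ℕ) :
    AEStronglyMeasurable (fun p : (Fin n → Space) × Space => annihilationIntegrand F Ψ ⟨n, p.1⟩ p.2)
      (volume.prod volume) := by
  have h1 : AEStronglyMeasurable (fun p : (Fin n → Space) × Space =>
      ContinuousLinearMap.adjoint (F p.2)) (volume.prod volume) := (aesm_adjoint hF).comp_snd
  have h2 : AEStronglyMeasurable (fun p : (Fin n → Space) × Space =>
      Ψ ⟨n + 1, (Fin.cons p.2 p.1 : Fin (n + 1) → Space)⟩) (volume.prod volume) :=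
    (aestronglyMeasurable_config_iff.1 hΨ (n + 1)).comp_measurePreserving
      (measurePreserving_cons_swap n)
  have h3 := (ContinuousLinearMap.apply ℂ Electron).aestronglyMeasurable_comp₂ h2 h1
  simp only [annihilationIntegrand]
  exact h3

lemma aesm_annihilationFun {F : Space → Electron →L[ℂ] Electron}
    (hF : AEStronglyMeasurable F volume) {Ψ : Config → Electron}
    (hΨ : AEStronglyMeasurable Ψ configMeasure) :
    AEStronglyMeasurable (annihilationFun F Ψ) configMeasure := by
  rw [aestronglyMeasurable_config_iff]
  intro n
  exact (aesm_annihilationIntegrand hF hΨ n).integral_prod_right'.const_smul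
    (Real.sqrt (n + 1) : ℂ)

lemma lintegral_mul_sq_le {α : Type*} [MeasurableSpace α] {μ : Measure α} {f g : α → ℝ≥0∞}
    (hf : AEMeasurable f μ) (hg : AEMeasurable g μ) :
    (∫⁻ a, f a * g a ∂μ) ^ 2 ≤ (∫⁻ a, f a ^ 2 ∂μ) * ∫⁻ a, g a ^ 2 ∂μ := by
  have h := ENNReal.lintegral_mul_le_Lp_mul_Lq μ Real.HolderConjugate.two_two hf hg
  refine (pow_le_pow_left' h 2).trans (le_of_eq ?_)
  rw [mul_pow, ← ENNReal.rpow_natCast, ← ENNReal.rpow_natCast, ← ENNReal.rpow_mul,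
    ← ENNReal.rpow_mul]
  norm_num

lemma lintegral_mul_sq_le_weighted {α : Type*} [MeasurableSpace α] {μ : Measure α}
    {f g v : α → ℝ≥0∞} (hf : AEMeasurable f μ) (hg : AEMeasurable g μ) (hv : Measurable v)
    (hv0 : ∀ᵐ k ∂μ, v k ≠ 0 ∧ v k ≠ ⊤) :
    (∫⁻ a, f a * g a ∂μ) ^ 2 ≤ (∫⁻ a, f a ^ 2 * (v a)⁻¹ ∂μ) * ∫⁻ a, v a * g a ^ 2 ∂μ := by
  have hw : Measurable fun a => v a ^ (1 / 2 : ℝ) := hv.pow_const _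
  have h := lintegral_mul_sq_le (μ := μ) (f := fun a => f a * (v a ^ (1 / 2 : ℝ))⁻¹)
    (g := fun a => v a ^ (1 / 2 : ℝ) * g a) (hf.mul hw.inv.aemeasurable) (hw.aemeasurable.mul hg)
  have hsq : ∀ x : ℝ≥0∞, (x ^ (1 / 2 : ℝ)) ^ 2 = x := fun x => by
    rw [← ENNReal.rpow_natCast, ← ENNReal.rpow_mul]; norm_num
  have e1 : ∫⁻ a, f a * (v a ^ (1 / 2 : ℝ))⁻¹ * (v a ^ (1 / 2 : ℝ) * g a) ∂μ =
      ∫⁻ a, f a * g a ∂μ := by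
    refine lintegral_congr_ae ?_
    filter_upwards [hv0] with a ha
    calc _ = (v a ^ (1 / 2 : ℝ))⁻¹ * v a ^ (1 / 2 : ℝ) * (f a * g a) := by ring
      _ = _ := by
        rw [ENNReal.inv_mul_cancel, one_mul]
        · simp [ha.1]
        · simp [ha.2]
  rw [e1] at h
  refine h.trans (le_of_eq ?_)
  simp only [mul_pow, hsq]
  congr 1
  simp only [← ENNReal.inv_pow, hsq]

/-- By symmetry all photons carry the same share of the weight. The factor `n + 1` is the square of
the prefactor of the annihilation operator, so it is used up without loss. -/
lemma lintegral_weight_symm {v : Space → ℝ≥0∞} (hvm : Measurable v) {Ψ : Config → Electron}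
    (hΨ : AEStronglyMeasurable Ψ configMeasure)
    (hs : ∀ (n : ℕ) (σ : Equiv.Perm (Fin n)), ∀ᵐ k : Fin n → Space, Ψ ⟨n, k ∘ σ⟩ = Ψ ⟨n, k⟩)
    (n : ℕ) :
    ∫⁻ k : Fin (n + 1) → Space, weight v ⟨n + 1, k⟩ * ‖Ψ ⟨n + 1, k⟩‖ₑ ^ 2 =
      ((n + 1 : ℕ) : ℝ≥0∞) * ∫⁻ k : Fin (n + 1) → Space, v (k 0) * ‖Ψ ⟨n + 1, k⟩‖ₑ ^ 2 := by
  have hm : AEMeasurable (fun k : Fin (n + 1) → Space => ‖Ψ ⟨n + 1, k⟩‖ₑ ^ 2) volume :=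
    ((aestronglyMeasurable_config_iff.1 hΨ (n + 1)).enorm).pow_const 2
  have hm2 : ∀ j, AEMeasurable (fun k : Fin (n + 1) → Space => v (k j) * ‖Ψ ⟨n + 1, k⟩‖ₑ ^ 2)
      volume := fun j => (hvm.comp (measurable_pi_apply j)).aemeasurable.mul hm
  change ∫⁻ k : Fin (n + 1) → Space, (∑ i : Fin (n + 1), v (k i)) * ‖Ψ ⟨n + 1, k⟩‖ₑ ^ 2 = _
  simp only [Finset.sum_mul]
  rw [lintegral_finsetSum' _ fun j _ => hm2 j]
  have h : ∀ j : Fin (n + 1), ∫⁻ k : Fin (n + 1) → Space, v (k j) * ‖Ψ ⟨n + 1, k⟩‖ₑ ^ 2 =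
      ∫⁻ k : Fin (n + 1) → Space, v (k 0) * ‖Ψ ⟨n + 1, k⟩‖ₑ ^ 2 := by
    intro j
    rw [← lintegral_comp_measurePreserving (measurePreserving_perm (Equiv.swap 0 j)) (hm2 j)]
    refine lintegral_congr_ae ?_
    filter_upwards [hs (n + 1) (Equiv.swap 0 j)] with k hk
    simp only [hk, Function.comp_apply, Equiv.swap_apply_right]
  simp only [h, Finset.sum_const, Finset.card_univ, Fintype.card_fin, nsmul_eq_mul]

/-- The integral over `k` of the norm of the integrand of the annihilation operator. -/
lemma lintegral_annihilation_sector_le {F : Space → Electron →L[ℂ] Electron}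
    (hF : AEStronglyMeasurable F volume) {v : Space → ℝ≥0∞} (hvm : Measurable v)
    (hv : ∀ᵐ k, v k ≠ 0 ∧ v k ≠ ⊤) {Ψ : Config → Electron}
    (hΨ : AEStronglyMeasurable Ψ configMeasure)
    (hs : ∀ (n : ℕ) (σ : Equiv.Perm (Fin n)), ∀ᵐ k : Fin n → Space, Ψ ⟨n, k ∘ σ⟩ = Ψ ⟨n, k⟩)
    (n : ℕ) :
    ∫⁻ k : Fin n → Space, ((n + 1 : ℕ) : ℝ≥0∞) *
        (∫⁻ x, ‖annihilationIntegrand F Ψ ⟨n, k⟩ x‖ₑ) ^ 2 ≤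
      (∫⁻ k, ‖F k‖ₑ ^ 2 * (v k)⁻¹) *
        ∫⁻ k : Fin (n + 1) → Space, weight v ⟨n + 1, k⟩ * ‖Ψ ⟨n + 1, k⟩‖ₑ ^ 2 := by
  have hm := aestronglyMeasurable_config_iff.1 hΨ (n + 1)
  have hmp : AEStronglyMeasurable (fun p : (Fin n → Space) × Space =>
      Ψ ⟨n + 1, (Fin.cons p.2 p.1 : Fin (n + 1) → Space)⟩) (volume.prod volume) :=
    hm.comp_measurePreserving (measurePreserving_cons_swap n)
  have hg : AEMeasurable (fun K : Fin (n + 1) → Space => v (K 0) * ‖Ψ ⟨n + 1, K⟩‖ₑ ^ 2) volume :=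
    (hvm.comp (measurable_pi_apply 0)).aemeasurable.mul ((hm.enorm).pow_const 2)
  have hg' : AEMeasurable (fun p : (Fin n → Space) × Space =>
      v p.2 * ‖Ψ ⟨n + 1, (Fin.cons p.2 p.1 : Fin (n + 1) → Space)⟩‖ₑ ^ 2) (volume.prod volume) :=
    (hvm.comp measurable_snd).aemeasurable.mul ((hmp.enorm).pow_const 2)
  calc _ ≤ ∫⁻ k : Fin n → Space, ((n + 1 : ℕ) : ℝ≥0∞) * ((∫⁻ k, ‖F k‖ₑ ^ 2 * (v k)⁻¹) *
        ∫⁻ x, v x * ‖Ψ ⟨n + 1, (Fin.cons x k : Fin (n + 1) → Space)⟩‖ₑ ^ 2) := by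
        refine lintegral_mono_ae ?_
        filter_upwards [hmp.prodMk_left] with k hk
        gcongr
        refine le_trans ?_ (lintegral_mul_sq_le_weighted hF.enorm hk.enorm hvm hv)
        gcongr with x
        refine (ContinuousLinearMap.le_opENorm _ _).trans (le_of_eq ?_)
        congr 1
        rw [← ofReal_norm, ← ofReal_norm, LinearIsometryEquiv.norm_map]
    _ = (∫⁻ k, ‖F k‖ₑ ^ 2 * (v k)⁻¹) * (((n + 1 : ℕ) : ℝ≥0∞) * ∫⁻ k : Fin n → Space,
        ∫⁻ x, v x * ‖Ψ ⟨n + 1, (Fin.cons x k : Fin (n + 1) → Space)⟩‖ₑ ^ 2) := by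
        have hmi := hg'.lintegral_prod_right'
        rw [lintegral_const_mul' _ _ (by simp), lintegral_const_mul'' _ hmi]
        ring
    _ = _ := by
        rw [lintegral_weight_symm hvm hΨ hs]
        congr 2
        rw [← lintegral_prod _ hg']
        simpa using lintegral_comp_measurePreserving (measurePreserving_cons_swap n) hg

end

section

/-! ### Existence of `a*(F) Ψ` and `a(F) Ψ` -/

/-- `∫ (∑ᵢ v(kᵢ)) ‖Ψ(k₁, …, kₙ)‖²`. -/
def weightNorm (v : Space → ℝ≥0∞) (Ψ : Fock) : ℝ≥0∞ :=
  ∫⁻ q, weight v q * ‖val Ψ q‖ₑ ^ 2 ∂configMeasure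

lemma exists_creation {F : Space → Electron →L[ℂ] Electron}
    (hF : AEStronglyMeasurable F volume) {v : Space → ℝ≥0∞} (hvm : Measurable v)
    (hv : ∀ᵐ k, v k ≠ 0 ∧ v k ≠ ⊤) (h1 : ∫⁻ k, ‖F k‖ₑ ^ 2 ≠ ⊤)
    (h2 : ∫⁻ k, ‖F k‖ₑ ^ 2 * (v k)⁻¹ ≠ ⊤) {Ψ : Fock} (hΨ : weightNorm v Ψ ≠ ⊤) :
    ∃ Φ, (Ψ, Φ) ∈ (creation F).graph ∧ ‖Φ‖ₑ ^ 2 ≤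
      (∫⁻ k, ‖F k‖ₑ ^ 2) * ‖Ψ‖ₑ ^ 2 + (∫⁻ k, ‖F k‖ₑ ^ 2 * (v k)⁻¹) * weightNorm v Ψ := by
  have hle := lintegral_creationFun_le hF hvm hv (val_aesm Ψ)
  rw [← enorm_sq_fock] at hle
  obtain ⟨Φ, hΦ⟩ := exists_fock (aesm_creationFun hF (val_aesm Ψ))
    (creationFun_symm F (val_symm Ψ)) (ne_top_of_le_ne_top (ENNReal.add_ne_top.2
      ⟨ENNReal.mul_ne_top h1 (by simp), ENNReal.mul_ne_top h2 hΨ⟩) hle)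
  exact ⟨Φ, mem_creation_graph.2 hΦ, by rw [enorm_sq_fock_congr hΦ]; exact hle⟩

/-- In contrast to creation, only `v^(-1/2) F` has to be square integrable, since no photon is
added. -/
lemma exists_annihilation {F : Space → Electron →L[ℂ] Electron}
    (hF : AEStronglyMeasurable F volume) {v : Space → ℝ≥0∞} (hvm : Measurable v)
    (hv : ∀ᵐ k, v k ≠ 0 ∧ v k ≠ ⊤)
    (h2 : ∫⁻ k, ‖F k‖ₑ ^ 2 * (v k)⁻¹ ≠ ⊤) {Ψ : Fock} (hΨ : weightNorm v Ψ ≠ ⊤) :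
    ∃ Φ, (Ψ, Φ) ∈ (annihilation F).graph ∧ ‖Φ‖ₑ ^ 2 ≤
      (∫⁻ k, ‖F k‖ₑ ^ 2 * (v k)⁻¹) * weightNorm v Ψ := by
  have hsec := lintegral_annihilation_sector_le hF hvm hv (val_aesm Ψ) (val_symm Ψ)
  have hfin : ∀ n, ∫⁻ k : Fin (n + 1) → Space, weight v ⟨n + 1, k⟩ * ‖val Ψ ⟨n + 1, k⟩‖ₑ ^ 2 ≠ ⊤ := by
    intro n
    refine ne_top_of_le_ne_top hΨ ?_
    rw [weightNorm, lintegral_config]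
    exact ENNReal.le_tsum (n + 1)
  have hint : ∀ᵐ q ∂configMeasure, Integrable (annihilationIntegrand F (val Ψ) q) volume := by
    refine ae_config_iff.2 fun n => ?_
    have hm := aesm_annihilationIntegrand hF (val_aesm Ψ) n
    have hmi : AEMeasurable (fun k : Fin n → Space => ((n + 1 : ℕ) : ℝ≥0∞) *
        (∫⁻ x, ‖annihilationIntegrand F (val Ψ) ⟨n, k⟩ x‖ₑ) ^ 2) volume :=
      (hm.enorm.lintegral_prod_right'.pow_const 2).const_mul _
    -- Integrability is part of membership in the graph: a finite integral over the remaining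
    -- momenta forces the inner integral to be finite almost everywhere.
    have hlt := ae_lt_top' hmi
      (ne_top_of_le_ne_top (ENNReal.mul_ne_top h2 (hfin n)) (hsec n))
    filter_upwards [hlt, hm.prodMk_left] with k hk hmk
    refine ⟨hmk, ?_⟩
    rw [hasFiniteIntegral_iff_enorm]
    refine lt_top_iff_ne_top.2 fun h => ?_
    rw [h] at hk
    simp [ENNReal.mul_top] at hk
  have hle : ∫⁻ q, ‖annihilationFun F (val Ψ) q‖ₑ ^ 2 ∂configMeasure ≤
      (∫⁻ k, ‖F k‖ₑ ^ 2 * (v k)⁻¹) * weightNorm v Ψ := by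
    rw [weightNorm, lintegral_config, lintegral_config, ← ENNReal.tsum_mul_left,
      tsum_eq_zero_add' (f := fun n : ℕ => (∫⁻ k, ‖F k‖ₑ ^ 2 * (v k)⁻¹) *
        ∫⁻ k : Fin n → Space, weight v ⟨n, k⟩ * ‖val Ψ ⟨n, k⟩‖ₑ ^ 2) ENNReal.summable]
    refine le_trans (ENNReal.tsum_le_tsum fun n => ?_) le_add_self
    refine le_trans (lintegral_mono fun k => ?_) (hsec n)
    simp only [annihilationFun]
    rw [enorm_smul, mul_pow]
    gcongr
    · rw [← ofReal_norm, ← ENNReal.ofReal_pow (norm_nonneg _), Complex.norm_real,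
        Real.norm_of_nonneg (Real.sqrt_nonneg _), Real.sq_sqrt (by positivity)]
      exact_mod_cast (ENNReal.ofReal_natCast (n + 1)).le
    · exact enorm_integral_le_lintegral_enorm _
  obtain ⟨Φ, hΦ⟩ := exists_fock (aesm_annihilationFun hF (val_aesm Ψ))
    (annihilationFun_symm F (val_symm Ψ))
    (ne_top_of_le_ne_top (ENNReal.mul_ne_top h2 hΨ) hle)
  refine ⟨Φ, mem_annihilation_graph.2 ?_, by rw [enorm_sq_fock_congr hΦ]; exact hle⟩
  filter_upwards [hint, hΦ] with q h3 h4 using ⟨h3, h4⟩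

lemma pair_mem_creation_graph {F : Space → Electron →L[ℂ] Electron} {Ψ Φ : Fock} :
    (Ψ, Φ) ∈ (creation F).graph ↔ val Φ =ᵐ[configMeasure] creationFun F (val Ψ) :=
  mem_creation_graph

lemma pair_mem_annihilation_graph {F : Space → Electron →L[ℂ] Electron} {Ψ Φ : Fock} :
    (Ψ, Φ) ∈ (annihilation F).graph ↔
      ∀ᵐ q ∂configMeasure, Integrable (annihilationIntegrand F (val Ψ) q) volume ∧
        val Φ q = annihilationFun F (val Ψ) q :=
  mem_annihilation_graph

lemma creationFun_congr_coupling {F F' : Space → Electron →L[ℂ] Electron}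
    (h : F =ᵐ[volume] F') (Ψ : Config → Electron) :
    creationFun F Ψ =ᵐ[configMeasure] creationFun F' Ψ := by
  refine ae_config_iff.2 fun n => ?_
  cases n with
  | zero => exact Eventually.of_forall fun k => rfl
  | succ n =>
    filter_upwards [ae_eval h] with k hk
    simp only [creationFun, hk]

lemma annihilationIntegrand_congr_coupling {F F' : Space → Electron →L[ℂ] Electron}
    (h : F =ᵐ[volume] F') (Ψ : Config → Electron) (q : Config) :
    annihilationIntegrand F Ψ q =ᵐ[volume] annihilationIntegrand F' Ψ q := by
  filter_upwards [h] with k hk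
  simp only [annihilationIntegrand, hk]

lemma creation_graph_congr {F F' : Space → Electron →L[ℂ] Electron}
    (h : F =ᵐ[volume] F') {P : Fock × Fock} (hP : P ∈ (creation F).graph) :
    P ∈ (creation F').graph :=
  mem_creation_graph.2 ((mem_creation_graph.1 hP).trans (creationFun_congr_coupling h _))

lemma annihilation_graph_congr {F F' : Space → Electron →L[ℂ] Electron}
    (h : F =ᵐ[volume] F') {P : Fock × Fock} (hP : P ∈ (annihilation F).graph) :
    P ∈ (annihilation F').graph := by
  refine mem_annihilation_graph.2 ?_
  filter_upwards [mem_annihilation_graph.1 hP] with q hq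
  have h2 := annihilationIntegrand_congr_coupling h (val P.1) q
  exact ⟨hq.1.congr h2, by rw [hq.2, annihilationFun, annihilationFun, integral_congr_ae h2]⟩

lemma creation_congr {F F' : Space → Electron →L[ℂ] Electron}
    (h : F =ᵐ[volume] F') : creation F = creation F' :=
  LinearPMap.eq_of_eq_graph (Submodule.ext fun _ =>
    ⟨creation_graph_congr h, creation_graph_congr h.symm⟩)

lemma annihilation_congr {F F' : Space → Electron →L[ℂ] Electron}
    (h : F =ᵐ[volume] F') : annihilation F = annihilation F' :=
  LinearPMap.eq_of_eq_graph (Submodule.ext fun _ =>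
    ⟨annihilation_graph_congr h, annihilation_graph_congr h.symm⟩)

lemma creation_graph_unique {F : Space → Electron →L[ℂ] Electron} {Ψ Φ Φ' : Fock}
    (h : (Ψ, Φ) ∈ (creation F).graph) (h' : (Ψ, Φ') ∈ (creation F).graph) : Φ = Φ' :=
  (creation F).mem_graph_snd_inj h h' rfl

lemma annihilation_graph_unique {F : Space → Electron →L[ℂ] Electron} {Ψ Φ Φ' : Fock}
    (h : (Ψ, Φ) ∈ (annihilation F).graph) (h₂ : (Ψ, Φ') ∈ (annihilation F).graph) : Φ = Φ' :=
  (annihilation F).mem_graph_snd_inj h h₂ rfl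

/-! ### Truncation of the photon number -/

lemma exists_trunc (N : ℕ) :
    ∃ T : Fock →L[ℂ] Fock, (∀ Ψ, val (T Ψ) =ᵐ[configMeasure]
      fun q => (if q.1 ≤ N then (1 : ℂ) else 0) • val Ψ q) ∧ ∀ Ψ, ‖T Ψ‖ ≤ ‖Ψ‖ :=
  exists_mulOp (measurable_config_iff.2 fun n =>
      measurable_const (a := if n ≤ N then (1 : ℂ) else 0)) (fun _ _ _ => rfl)
    fun q => by split_ifs <;> simp

/-- The projection onto the vectors with at most `N` photons. -/
def trunc (N : ℕ) : Fock →L[ℂ] Fock := (exists_trunc N).choose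

lemma val_trunc (N : ℕ) (Ψ : Fock) : val (trunc N Ψ) =ᵐ[configMeasure]
    fun q => (if q.1 ≤ N then (1 : ℂ) else 0) • val Ψ q := (exists_trunc N).choose_spec.1 Ψ

lemma tendsto_trunc (Ψ : Fock) : Tendsto (fun N => trunc N Ψ) atTop (𝓝 Ψ) := by
  rw [tendsto_iff_norm_sub_tendsto_zero]
  have h1 : ∀ N, ‖trunc N Ψ - Ψ‖ₑ ^ 2 =
      ∫⁻ q, ‖(if q.1 ≤ N then (0 : ℂ) else 1) • val Ψ q‖ₑ ^ 2 ∂configMeasure := by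
    intro N
    rw [enorm_sq_fock]
    refine lintegral_congr_ae ?_
    filter_upwards [val_sub (trunc N Ψ) Ψ, val_trunc N Ψ] with q h1 h2
    simp only [h1, h2]
    split_ifs <;> simp
  have h2 : Tendsto (fun N => ‖trunc N Ψ - Ψ‖ₑ ^ 2) atTop (𝓝 0) := by
    simp only [h1]
    rw [show (0 : ℝ≥0∞) = ∫⁻ q : Config, 0 ∂configMeasure by simp]
    refine tendsto_lintegral_of_dominated_convergence' (fun q => ‖val Ψ q‖ₑ ^ 2) ?_ ?_ ?_ ?_
    · intro N
      have hm : Measurable fun q : Config => if q.1 ≤ N then (0 : ℂ) else 1 :=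
        measurable_config_iff.2 fun n => measurable_const (a := if n ≤ N then (0 : ℂ) else 1)
      exact ((hm.aestronglyMeasurable.smul (val_aesm Ψ)).enorm).pow_const 2
    · intro N
      refine Eventually.of_forall fun q => ?_
      refine pow_le_pow_left' ?_ 2
      split_ifs <;> simp
    · rw [← enorm_sq_fock]; simp
    · refine Eventually.of_forall fun q => ?_
      refine tendsto_const_nhds.congr' ?_
      filter_upwards [eventually_ge_atTop q.1] with N hN
      simp [hN]
  have h3 : Tendsto (fun N => ‖trunc N Ψ - Ψ‖ ^ 2) atTop (𝓝 0) := by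
    have h4 := (ENNReal.tendsto_toReal (by simp)).comp h2
    simpa [Function.comp_def] using h4
  have h5 := (Real.continuous_sqrt.tendsto 0).comp h3
  simpa [Function.comp_def, Real.sqrt_sq] using h5

/-- The vectors with at most `N` photons. -/
def particleLE (N : ℕ) : Submodule ℂ Fock where
  carrier := {Ψ | ∀ᵐ q ∂configMeasure, N < q.1 → val Ψ q = 0}
  zero_mem' := by
    filter_upwards [val_zero] with q h _ using h
  add_mem' := by
    intro Ψ Φ h h'
    filter_upwards [h, h', val_add Ψ Φ] with q h1 h2 h3 hq
    rw [h3, h1 hq, h2 hq, add_zero]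
  smul_mem' := by
    intro c Ψ h
    filter_upwards [h, val_smul c Ψ] with q h1 h3 hq
    rw [h3, h1 hq, smul_zero]

lemma mem_particleLE {N : ℕ} {Ψ : Fock} :
    Ψ ∈ particleLE N ↔ ∀ᵐ q ∂configMeasure, N < q.1 → val Ψ q = 0 := Iff.rfl

lemma particleLE_mono {N M : ℕ} (h : N ≤ M) : particleLE N ≤ particleLE M := by
  intro Ψ hΨ
  filter_upwards [mem_particleLE.1 hΨ] with q hq hM using hq (h.trans_lt hM)

lemma trunc_mem (N : ℕ) (Ψ : Fock) : trunc N Ψ ∈ particleLE N := by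
  filter_upwards [val_trunc N Ψ] with q h hq
  rw [h, if_neg (not_le.2 hq), zero_smul]

lemma weightNorm_one_le {N : ℕ} {Ψ : Fock} (h : Ψ ∈ particleLE N) :
    weightNorm (fun _ => 1) Ψ ≤ N * ‖Ψ‖ₑ ^ 2 := by
  rw [weightNorm, enorm_sq_fock, ← lintegral_const_mul' _ _ (by simp)]
  refine lintegral_mono_ae ?_
  filter_upwards [mem_particleLE.1 h] with q hq
  by_cases hN : N < q.1
  · simp [hq hN]
  · gcongr
    simp only [weight, Finset.sum_const, Finset.card_univ, Fintype.card_fin, nsmul_eq_mul, mul_one]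
    exact_mod_cast not_lt.1 hN

/-- The vectors with finitely many photons. -/
def finiteParticle : Submodule ℂ Fock where
  carrier := {Ψ | IsFiniteParticle Ψ}
  zero_mem' := ⟨0, (particleLE 0).zero_mem⟩
  add_mem' := by
    rintro Ψ Φ ⟨N, h⟩ ⟨M, h'⟩
    exact ⟨max N M, (particleLE (max N M)).add_mem (particleLE_mono (le_max_left _ _) h)
      (particleLE_mono (le_max_right _ _) h')⟩
  smul_mem' := by
    rintro c Ψ ⟨N, h⟩
    exact ⟨N, (particleLE N).smul_mem c h⟩

lemma mem_finiteParticle {Ψ : Fock} : Ψ ∈ finiteParticle ↔ ∃ N, Ψ ∈ particleLE N := Iff.rfl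

lemma particleLE_le_finiteParticle (N : ℕ) : particleLE N ≤ finiteParticle :=
  fun _ h => mem_finiteParticle.2 ⟨N, h⟩

/-! ### Creation and annihilation operators on the vectors with finitely many photons -/

lemma creation_mem_particleLE {F : Space → Electron →L[ℂ] Electron} {Ψ Φ : Fock} {N : ℕ}
    (h : (Ψ, Φ) ∈ (creation F).graph) (hΨ : Ψ ∈ particleLE N) : Φ ∈ particleLE (N + 1) := by
  have h1 : val Φ =ᵐ[configMeasure] creationFun F (val Ψ) := pair_mem_creation_graph.1 h
  refine ae_config_iff.2 fun n => ?_
  cases n with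
  | zero => exact Eventually.of_forall fun k hk => absurd hk (by simp)
  | succ n =>
    filter_upwards [ae_config_iff.1 h1 (n + 1), ae_all_iff.2 fun j : Fin (n + 1) =>
      ae_removeNth j (ae_config_iff.1 (mem_particleLE.1 hΨ) n)] with k hk hk2 hn
    rw [hk]
    simp only [creationFun]
    rw [Finset.sum_eq_zero, smul_zero]
    intro j _
    rw [hk2 j (by simpa using hn), map_zero]

lemma annihilation_mem_particleLE {F : Space → Electron →L[ℂ] Electron} {Ψ Φ : Fock} {N : ℕ}
    (h : (Ψ, Φ) ∈ (annihilation F).graph) (hΨ : Ψ ∈ particleLE (N + 1)) : Φ ∈ particleLE N := by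
  refine ae_config_iff.2 fun n => ?_
  filter_upwards [ae_config_iff.1 (pair_mem_annihilation_graph.1 h) n,
    ae_cons (ae_config_iff.1 (mem_particleLE.1 hΨ) (n + 1))] with k hk hk2 hn
  change val Φ ⟨n, k⟩ = 0
  rw [hk.2, annihilationFun]
  rw [integral_eq_zero_of_ae, smul_zero]
  filter_upwards [hk2] with x hx
  simp only [annihilationIntegrand]
  rw [hx (by simpa using hn), map_zero]
  rfl

lemma lintegral_enorm_sq_ne_top (F : Lp BOp 2 (volume : Measure Space)) :
    ∫⁻ k, ‖F k‖ₑ ^ 2 ≠ ⊤ := by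
  rw [← enorm_sq_Lp]; simp

lemma exists_creation_of_mem (F : Lp BOp 2 (volume : Measure Space)) {Ψ : Fock} {N : ℕ}
    (hΨ : Ψ ∈ particleLE N) :
    ∃ Φ, (Ψ, Φ) ∈ (creation F).graph ∧ ‖Φ‖ ≤ Real.sqrt (N + 1) * ‖F‖ * ‖Ψ‖ := by
  have hw := weightNorm_one_le hΨ
  have hN : (N : ℝ≥0∞) * ‖Ψ‖ₑ ^ 2 ≠ ⊤ := ENNReal.mul_ne_top (by simp) (by simp)
  obtain ⟨Φ, h1, h2⟩ := exists_creation (Lp.aestronglyMeasurable F) (v := fun _ => 1)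
    measurable_const (by simp) (lintegral_enorm_sq_ne_top F)
    (by simpa using lintegral_enorm_sq_ne_top F) (ne_top_of_le_ne_top hN hw)
  refine ⟨Φ, h1, enorm_le_of_sq_le (by positivity) (h2.trans ?_)⟩
  simp only [inv_one, mul_one, ← enorm_sq_Lp]
  calc ‖F‖ₑ ^ 2 * ‖Ψ‖ₑ ^ 2 + ‖F‖ₑ ^ 2 * weightNorm (fun _ => 1) Ψ
      ≤ ‖F‖ₑ ^ 2 * ‖Ψ‖ₑ ^ 2 + ‖F‖ₑ ^ 2 * (N * ‖Ψ‖ₑ ^ 2) := by gcongr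
    _ = ((N + 1 : ℕ) : ℝ≥0∞) * ‖F‖ₑ ^ 2 * ‖Ψ‖ₑ ^ 2 := by push_cast; ring
    _ = _ := by
      rw [mul_pow, Real.sq_sqrt (by positivity), ENNReal.ofReal_mul (by positivity),
        ENNReal.ofReal_pow (norm_nonneg _), ofReal_norm]
      congr 2
      exact_mod_cast (ENNReal.ofReal_natCast (N + 1)).symm

lemma exists_annihilation_of_mem (F : Lp BOp 2 (volume : Measure Space)) {Ψ : Fock} {N : ℕ}
    (hΨ : Ψ ∈ particleLE N) :
    ∃ Φ, (Ψ, Φ) ∈ (annihilation F).graph ∧ ‖Φ‖ ≤ Real.sqrt (N + 1) * ‖F‖ * ‖Ψ‖ := by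
  have hw := weightNorm_one_le hΨ
  have hN : (N : ℝ≥0∞) * ‖Ψ‖ₑ ^ 2 ≠ ⊤ := ENNReal.mul_ne_top (by simp) (by simp)
  obtain ⟨Φ, h1, h2⟩ := exists_annihilation (Lp.aestronglyMeasurable F) (v := fun _ => 1)
    measurable_const (by simp)
    (by simpa using lintegral_enorm_sq_ne_top F) (ne_top_of_le_ne_top hN hw)
  refine ⟨Φ, h1, enorm_le_of_sq_le (by positivity) (h2.trans ?_)⟩
  simp only [inv_one, mul_one, ← enorm_sq_Lp]
  calc ‖F‖ₑ ^ 2 * weightNorm (fun _ => 1) Ψ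
      ≤ ‖F‖ₑ ^ 2 * (((N + 1 : ℕ) : ℝ≥0∞) * ‖Ψ‖ₑ ^ 2) := by
        gcongr
        refine hw.trans ?_
        gcongr
        simp
    _ = ((N + 1 : ℕ) : ℝ≥0∞) * ‖F‖ₑ ^ 2 * ‖Ψ‖ₑ ^ 2 := by ring
    _ = _ := by
      rw [mul_pow, Real.sq_sqrt (by positivity), ENNReal.ofReal_mul (by positivity),
        ENNReal.ofReal_pow (norm_nonneg _), ofReal_norm]
      congr 2
      exact_mod_cast (ENNReal.ofReal_natCast (N + 1)).symm

lemma exists_creation_map (F : Lp BOp 2 (volume : Measure Space)) :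
    ∃ T : finiteParticle →ₗ[ℂ] finiteParticle,
      ∀ Ψ : finiteParticle, ((Ψ : Fock), (T Ψ : Fock)) ∈ (creation F).graph := by
  have h : ∀ Ψ : finiteParticle, ∃ Φ : finiteParticle,
      ((Ψ : Fock), (Φ : Fock)) ∈ (creation F).graph := by
    rintro ⟨Ψ, N, hN⟩
    obtain ⟨Φ, h1, -⟩ := exists_creation_of_mem F (N := N) hN
    exact ⟨⟨Φ, N + 1, creation_mem_particleLE h1 hN⟩, h1⟩
  choose f hf using h
  exact ⟨{ toFun := f
           map_add' := fun x y => Subtype.ext (creation_graph_unique (hf (x + y))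
            ((creation F).graph.add_mem (hf x) (hf y)))
           map_smul' := fun c x => Subtype.ext (creation_graph_unique (hf (c • x))
            ((creation F).graph.smul_mem c (hf x))) }, hf⟩

lemma exists_annihilation_map (F : Lp BOp 2 (volume : Measure Space)) :
    ∃ T : finiteParticle →ₗ[ℂ] finiteParticle,
      ∀ Ψ : finiteParticle, ((Ψ : Fock), (T Ψ : Fock)) ∈ (annihilation F).graph := by
  have h : ∀ Ψ : finiteParticle, ∃ Φ : finiteParticle,
      ((Ψ : Fock), (Φ : Fock)) ∈ (annihilation F).graph := by
    rintro ⟨Ψ, N, hN⟩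
    obtain ⟨Φ, h1, -⟩ := exists_annihilation_of_mem F (N := N) hN
    exact ⟨⟨Φ, N, annihilation_mem_particleLE h1 (particleLE_mono (Nat.le_succ N) hN)⟩, h1⟩
  choose f hf using h
  exact ⟨{ toFun := f
           map_add' := fun x y => Subtype.ext (annihilation_graph_unique (hf (x + y))
            ((annihilation F).graph.add_mem (hf x) (hf y)))
           map_smul' := fun c x => Subtype.ext (annihilation_graph_unique (hf (c • x))
            ((annihilation F).graph.smul_mem c (hf x))) }, hf⟩

/-- `a*(F)` on the vectors with finitely many photons. -/
def cr (F : Lp BOp 2 (volume : Measure Space)) : Module.End ℂ finiteParticle :=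
  (exists_creation_map F).choose

/-- `a(F)` on the vectors with finitely many photons. -/
def an (F : Lp BOp 2 (volume : Measure Space)) : Module.End ℂ finiteParticle :=
  (exists_annihilation_map F).choose

variable (F : Lp BOp 2 (volume : Measure Space))

lemma cr_graph (Ψ : finiteParticle) : ((Ψ : Fock), (cr F Ψ : Fock)) ∈ (creation F).graph :=
  (exists_creation_map F).choose_spec Ψ

lemma an_graph (Ψ : finiteParticle) : ((Ψ : Fock), (an F Ψ : Fock)) ∈ (annihilation F).graph :=
  (exists_annihilation_map F).choose_spec Ψ

lemma cr_mem {N : ℕ} {Ψ : finiteParticle} (h : (Ψ : Fock) ∈ particleLE N) :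
    (cr F Ψ : Fock) ∈ particleLE (N + 1) := creation_mem_particleLE (cr_graph F Ψ) h

lemma an_mem {N : ℕ} {Ψ : finiteParticle} (h : (Ψ : Fock) ∈ particleLE N) :
    (an F Ψ : Fock) ∈ particleLE N :=
  annihilation_mem_particleLE (an_graph F Ψ) (particleLE_mono (Nat.le_succ N) h)

lemma norm_cr_le {N : ℕ} {Ψ : finiteParticle} (h : (Ψ : Fock) ∈ particleLE N) :
    ‖(cr F Ψ : Fock)‖ ≤ Real.sqrt (N + 1) * ‖F‖ * ‖(Ψ : Fock)‖ := by
  obtain ⟨Φ, h1, h2⟩ := exists_creation_of_mem F h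
  have := creation_graph_unique h1 (cr_graph F Ψ)
  subst this
  exact h2

lemma norm_an_le {N : ℕ} {Ψ : finiteParticle} (h : (Ψ : Fock) ∈ particleLE N) :
    ‖(an F Ψ : Fock)‖ ≤ Real.sqrt (N + 1) * ‖F‖ * ‖(Ψ : Fock)‖ := by
  obtain ⟨Φ, h1, h2⟩ := exists_annihilation_of_mem F h
  have := annihilation_graph_unique h1 (an_graph F Ψ)
  subst this
  exact h2

lemma val_cr (Ψ : finiteParticle) :
    val (cr F Ψ : Fock) =ᵐ[configMeasure] creationFun F (val (Ψ : Fock)) :=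
  pair_mem_creation_graph.1 (cr_graph F Ψ)

lemma val_an (Ψ : finiteParticle) : ∀ᵐ q ∂configMeasure,
    Integrable (annihilationIntegrand F (val (Ψ : Fock)) q) volume ∧
      val (an F Ψ : Fock) q = annihilationFun F (val (Ψ : Fock)) q :=
  pair_mem_annihilation_graph.1 (an_graph F Ψ)

end

section

/-! ### Canonical commutation relations -/

/-- Both sides sum over pairs of successively removed photons, and the index pairs are matched by
the involution that exchanges the order of removal. One coupling is scalar, so no commutator of
electron operators arises. -/
lemma creationFun_comm (F : Space → Electron →L[ℂ] Electron) (x : Space → ℂ)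
    (Ψ : Config → Electron) (q : Config) :
    creationFun F (creationFun (scalarCoupling x) Ψ) q =
      creationFun (scalarCoupling x) (creationFun F Ψ) q := by
  rcases q with ⟨_ | _ | n, k⟩
  · rfl
  · simp [creationFun]
  · simp only [creationFun, scalarCoupling, map_smul, map_sum, ← Finset.smul_sum, smul_apply,
      ContinuousLinearMap.id_apply]
    congr 2
    simp only [Finset.smul_sum]
    rw [← Fintype.sum_prod_type', ← Fintype.sum_prod_type']
    let e : Fin (n + 1 + 1) × Fin (n + 1) ≃ Fin (n + 1 + 1) × Fin (n + 1) :=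
      Function.Involutive.toPerm (fun p => (p.1.succAbove p.2, p.2.predAbove p.1)) (by
        rintro ⟨j, i⟩
        simp [Fin.succAbove_succAbove_predAbove, Fin.predAbove_predAbove_succAbove])
    refine Fintype.sum_equiv e _ _ ?_
    rintro ⟨j, i⟩
    have he : e (j, i) = (j.succAbove i, i.predAbove j) := rfl
    simp only [he, Fin.succAbove_succAbove_predAbove, Fin.succAbove_succAbove_succAbove_predAbove]

/-- Scalar coupling functions. -/
def sc : Lp ℂ 2 (volume : Measure Space) →L[ℂ] Lp BOp 2 (volume : Measure Space) :=
  ((ContinuousLinearMap.id ℂ ℂ).smulRight (1 : BOp)).compLpL 2 volume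

lemma coeFn_sc (x : Lp ℂ 2 (volume : Measure Space)) :
    (sc x : Space → BOp) =ᵐ[volume] scalarCoupling x := by
  filter_upwards [((ContinuousLinearMap.id ℂ ℂ).smulRight (1 : BOp)).coeFn_compLpL
    (p := 2) (μ := volume) x] with k hk
  exact hk

lemma norm_sc_le (x : Lp ℂ 2 (volume : Measure Space)) : ‖sc x‖ ≤ ‖x‖ := by
  refine (((ContinuousLinearMap.id ℂ ℂ).smulRight (1 : BOp)).norm_compLp_le x).trans ?_
  refine mul_le_of_le_one_left (norm_nonneg _) ?_
  refine ContinuousLinearMap.opNorm_le_bound _ zero_le_one fun c => ?_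
  change ‖c • (1 : BOp)‖ ≤ 1 * ‖c‖
  rw [norm_smul, one_mul]
  exact mul_le_of_le_one_right (norm_nonneg _) ContinuousLinearMap.norm_id_le

variable (F : Lp BOp 2 (volume : Measure Space)) (x : Lp ℂ 2 (volume : Measure Space))

lemma cr_sc_graph (Ψ : finiteParticle) :
    ((Ψ : Fock), (cr (sc x) Ψ : Fock)) ∈ (creation (scalarCoupling x)).graph :=
  creation_graph_congr (coeFn_sc x) (cr_graph (sc x) Ψ)

lemma an_sc_graph (Ψ : finiteParticle) :
    ((Ψ : Fock), (an (sc x) Ψ : Fock)) ∈ (annihilation (scalarCoupling x)).graph :=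
  annihilation_graph_congr (coeFn_sc x) (an_graph (sc x) Ψ)

lemma val_cr_sc (Ψ : finiteParticle) :
    val (cr (sc x) Ψ : Fock) =ᵐ[configMeasure] creationFun (scalarCoupling x) (val (Ψ : Fock)) :=
  pair_mem_creation_graph.1 (cr_sc_graph x Ψ)

lemma val_an_sc (Ψ : finiteParticle) : ∀ᵐ q ∂configMeasure,
    Integrable (annihilationIntegrand (scalarCoupling x) (val (Ψ : Fock)) q) volume ∧
      val (an (sc x) Ψ : Fock) q = annihilationFun (scalarCoupling x) (val (Ψ : Fock)) q :=
  pair_mem_annihilation_graph.1 (an_sc_graph x Ψ)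

lemma cr_comm (Ψ : finiteParticle) : cr F (cr (sc x) Ψ) = cr (sc x) (cr F Ψ) := by
  refine Subtype.ext (fock_ext ?_)
  filter_upwards [val_cr F (cr (sc x) Ψ), val_cr_sc x (cr F Ψ),
    creationFun_congr F (val_cr_sc x Ψ), creationFun_congr (scalarCoupling x) (val_cr F Ψ)]
    with q h1 h2 h3 h4
  rw [h1, h2, h3, h4, creationFun_comm]

lemma val_liftBounded (B : BOp) (Ψ : Fock) :
    val (liftBounded B Ψ) =ᵐ[configMeasure] fun q => B (val Ψ q) :=
  B.coeFn_compLpL (p := 2) (μ := configMeasure) (Ψ : FullFock)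

lemma liftBounded_mem_particleLE (B : BOp) {N : ℕ} {Ψ : Fock} (h : Ψ ∈ particleLE N) :
    liftBounded B Ψ ∈ particleLE N := by
  refine mem_particleLE.2 ?_
  filter_upwards [mem_particleLE.1 h, val_liftBounded B Ψ] with q h1 h2 hq
  rw [h2, h1 hq, map_zero]

/-- `B ⊗ 1` on the vectors with finitely many photons. -/
def liftFin (B : BOp) : Module.End ℂ finiteParticle :=
  ((liftBounded B : Fock →ₗ[ℂ] Fock)).restrict (p := finiteParticle) (q := finiteParticle) (by
    intro Ψ hΨ
    obtain ⟨N, hN⟩ := mem_finiteParticle.1 hΨ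
    exact mem_finiteParticle.2 ⟨N, liftBounded_mem_particleLE B hN⟩)

lemma coe_liftFin (B : BOp) (Ψ : finiteParticle) :
    (liftFin B Ψ : Fock) = liftBounded B (Ψ : Fock) := rfl

lemma scalarCoupling_adjoint (f : Space → ℂ) (k : Space) (u : Electron) :
    ContinuousLinearMap.adjoint (scalarCoupling f k) u = starRingEnd ℂ (f k) • u := by
  simp only [scalarCoupling, map_smulₛₗ]
  rw [← ContinuousLinearMap.one_def, ← ContinuousLinearMap.star_eq_adjoint, star_one]
  rfl

lemma annihilationIntegrand_scalar (f : Space → ℂ) (Ψ : Config → Electron) (q : Config)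
    (p : Space) : annihilationIntegrand (scalarCoupling f) Ψ q p =
      starRingEnd ℂ (f p) • Ψ ⟨q.1 + 1, Fin.cons p q.2⟩ := scalarCoupling_adjoint _ _ _

lemma cons_succ_succAbove {n : ℕ} (p : Space) (k : Fin (n + 1) → Space) (j : Fin (n + 1)) :
    (fun i => (Fin.cons p k : Fin (n + 2) → Space) (j.succ.succAbove i)) =
      Fin.cons p fun i => k (j.succAbove i) := by
  funext i
  refine Fin.cases ?_ (fun i => ?_) i
  · simp
  · simp

lemma integrable_conj_smul (u : Electron) :
    Integrable (fun p => starRingEnd ℂ (x p) • F p u) volume := by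
  have h1 : MemLp (fun p => starRingEnd ℂ (x p)) 2 volume := (Lp.memLp x).star
  have h2 : MemLp (fun p => F p u) 2 volume :=
    (ContinuousLinearMap.apply ℂ Electron u).comp_memLp' (Lp.memLp F)
  exact memLp_one_iff_integrable.1 (h2.smul h1)

lemma integrable_conj_smul_op : Integrable (fun p => starRingEnd ℂ (x p) • F p) volume := by
  have h1 : MemLp (fun p => starRingEnd ℂ (x p)) 2 volume := (Lp.memLp x).star
  exact memLp_one_iff_integrable.1 ((Lp.memLp F).smul h1)

lemma couplingIntegral_apply_apply (u : Electron) :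
    couplingIntegral F x u = ∫ p, starRingEnd ℂ (x p) • F p u := by
  rw [couplingIntegral_apply, ContinuousLinearMap.integral_apply (integrable_conj_smul_op F x)]
  rfl

lemma sqrt_succ_ne_zero (n : ℕ) : (Real.sqrt (n + 1) : ℂ) ≠ 0 := by
  have : Real.sqrt (n + 1) ≠ 0 := by positivity
  exact_mod_cast this

lemma annihilationFun_creationFun_zero (Ψ : Config → Electron) (k : Fin 0 → Space) :
    annihilationFun (scalarCoupling x) (creationFun F Ψ) ⟨0, k⟩ =
      couplingIntegral F x (Ψ ⟨0, k⟩) := by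
  rw [annihilationFun, couplingIntegral_apply_apply]
  have h : ∀ p, annihilationIntegrand (scalarCoupling x) (creationFun F Ψ) ⟨0, k⟩ p =
      starRingEnd ℂ (x p) • F p (Ψ ⟨0, k⟩) := by
    intro p
    rw [annihilationIntegrand_scalar]
    simp only [creationFun, Fin.sum_univ_succ, Finset.univ_eq_empty, Finset.sum_empty, add_zero,
      Nat.cast_zero, zero_add, Real.sqrt_one, Complex.ofReal_one, inv_one, one_smul, Fin.cons_zero]
    congr 4
  simp only [h, Nat.cast_zero, zero_add, Real.sqrt_one, Complex.ofReal_one, one_smul]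

/-- The annihilated photon is either the one just created, which gives the contraction `∫ conj x F`,
or one that was there before, which gives creation after annihilation. This is the canonical
commutation relation on one sector. -/
lemma annihilationFun_creationFun_succ (Ψ : Config → Electron) {m : ℕ} (k : Fin (m + 1) → Space)
    (hk : ∀ j : Fin (m + 1), Integrable (annihilationIntegrand (scalarCoupling x) Ψ
      ⟨m, fun i => k (j.succAbove i)⟩) volume) :
    annihilationFun (scalarCoupling x) (creationFun F Ψ) ⟨m + 1, k⟩ =
      creationFun F (annihilationFun (scalarCoupling x) Ψ) ⟨m + 1, k⟩ +
        couplingIntegral F x (Ψ ⟨m + 1, k⟩) := by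
  have h1 : ∀ p, annihilationIntegrand (scalarCoupling x) (creationFun F Ψ) ⟨m + 1, k⟩ p =
      ((Real.sqrt ((m + 1 : ℕ) + 1) : ℂ))⁻¹ • (starRingEnd ℂ (x p) • F p (Ψ ⟨m + 1, k⟩) +
        ∑ j : Fin (m + 1), F (k j) (annihilationIntegrand (scalarCoupling x) Ψ
          ⟨m, fun i => k (j.succAbove i)⟩ p)) := by
    intro p
    simp only [annihilationIntegrand_scalar, creationFun]
    rw [smul_comm, Fin.sum_univ_succ, smul_add, Finset.smul_sum]
    simp only [cons_succ_succAbove, Fin.cons_zero, Fin.cons_succ, Fin.succAbove_zero, map_smul]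
  have hi : ∀ j : Fin (m + 1), Integrable (fun p => F (k j) (annihilationIntegrand
      (scalarCoupling x) Ψ ⟨m, fun i => k (j.succAbove i)⟩ p)) volume :=
    fun j => (F (k j)).integrable_comp (hk j)
  rw [annihilationFun]
  simp only [h1]
  rw [integral_smul, smul_smul, mul_inv_cancel₀ (sqrt_succ_ne_zero _), one_smul,
    integral_add (integrable_conj_smul F x _) (integrable_finsetSum _ fun j _ => hi j),
    integral_finsetSum _ fun j _ => hi j, ← couplingIntegral_apply_apply, add_comm]
  congr 1
  simp only [creationFun, annihilationFun, map_smul, ← Finset.smul_sum, smul_smul]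
  rw [inv_mul_cancel₀ (sqrt_succ_ne_zero _), one_smul]
  exact Finset.sum_congr rfl fun j _ => (F (k j)).integral_comp_comm (hk j)

lemma an_cr (Ψ : finiteParticle) :
    an (sc x) (cr F Ψ) = cr F (an (sc x) Ψ) + liftFin (couplingIntegral F x) Ψ := by
  refine Subtype.ext (fock_ext ?_)
  have h0 := annihilationIntegrand_congr (scalarCoupling x) (val_cr F Ψ)
  have hi := val_an_sc x Ψ
  have hi2 : val (an (sc x) Ψ : Fock) =ᵐ[configMeasure]
      annihilationFun (scalarCoupling x) (val (Ψ : Fock)) := hi.mono fun q hq => hq.2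
  have h1 : ∀ᵐ q ∂configMeasure,
      annihilationFun (scalarCoupling x) (creationFun F (val (Ψ : Fock))) q =
      creationFun F (annihilationFun (scalarCoupling x) (val (Ψ : Fock))) q +
        couplingIntegral F x (val (Ψ : Fock) q) := by
    refine ae_config_iff.2 fun n => ?_
    cases n with
    | zero =>
      refine Eventually.of_forall fun k => ?_
      rw [annihilationFun_creationFun_zero]
      simp [creationFun]
    | succ m =>
      filter_upwards [ae_all_iff.2 fun j : Fin (m + 1) =>
        ae_removeNth j (ae_config_iff.1 hi m)] with k hk
      exact annihilationFun_creationFun_succ F x _ k fun j => (hk j).1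
  filter_upwards [val_an_sc x (cr F Ψ), h0, h1, val_cr F (an (sc x) Ψ),
    creationFun_congr F hi2, val_liftBounded (couplingIntegral F x) (Ψ : Fock),
    val_add (cr F (an (sc x) Ψ) : Fock) (liftFin (couplingIntegral F x) Ψ : Fock)]
    with q g1 g2 g3 g4 g5 g6 g7
  rw [Submodule.coe_add, g7, g1.2, annihilationFun, integral_congr_ae g2, g4, g5, coe_liftFin, g6,
    ← g3, annihilationFun]

/-! ### Creation and annihilation operators are adjoint to each other -/

lemma memLp_val_sector (Ψ : Fock) (n : ℕ) :
    MemLp (fun k : Fin n → Space => val Ψ ⟨n, k⟩) 2 volume := by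
  refine memLp_two_of_lintegral (val_aesm_sector Ψ n) (ne_top_of_le_ne_top (b := ‖Ψ‖ₑ ^ 2)
    (by simp) ?_)
  rw [enorm_sq_fock, lintegral_config]
  exact ENNReal.le_tsum n

lemma memLp_coupling_removeNth (Ψ : Fock) {n : ℕ} (j : Fin (n + 1)) :
    MemLp (fun k : Fin (n + 1) → Space => F (k j) (val Ψ ⟨n, fun i => k (j.succAbove i)⟩)) 2
      volume := by
  have hΨ := memLp_val_sector Ψ n
  have hm : AEStronglyMeasurable (fun k : Fin (n + 1) → Space =>
      F (k j) (val Ψ ⟨n, fun i => k (j.succAbove i)⟩)) volume :=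
    (ContinuousLinearMap.apply ℂ Electron).aestronglyMeasurable_comp₂
      (aesm_removeNth j hΨ.1) (aesm_eval j (Lp.aestronglyMeasurable F))
  refine memLp_two_of_lintegral hm ?_
  have h1 : ∫⁻ k : Fin (n + 1) → Space, ‖F (k j)‖ₑ ^ 2 *
      ‖val Ψ ⟨n, fun i => k (j.succAbove i)⟩‖ₑ ^ 2 =
      (∫⁻ p, ‖F p‖ₑ ^ 2) * ∫⁻ k : Fin n → Space, ‖val Ψ ⟨n, k⟩‖ₑ ^ 2 := by
    rw [lintegral_removeNth j fun p => ‖F p.1‖ₑ ^ 2 * ‖val Ψ ⟨n, p.2⟩‖ₑ ^ 2,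
      lintegral_prod_mul ((Lp.aestronglyMeasurable F).enorm.pow_const 2) (hΨ.1.enorm.pow_const 2)]
  have h2 : ∫⁻ k : Fin n → Space, ‖val Ψ ⟨n, k⟩‖ₑ ^ 2 ≠ ⊤ := by
    refine ne_top_of_le_ne_top (b := ‖Ψ‖ₑ ^ 2) (by simp) ?_
    rw [enorm_sq_fock, lintegral_config]
    exact ENNReal.le_tsum n
  refine ne_top_of_le_ne_top (ENNReal.mul_ne_top (lintegral_enorm_sq_ne_top F) h2)
    (le_trans ?_ h1.le)
  refine lintegral_mono fun k => ?_
  rw [← mul_pow]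
  exact pow_le_pow_left' (ContinuousLinearMap.le_opENorm _ _) 2

lemma integrable_inner_memLp {α : Type*} [MeasurableSpace α] {μ : Measure α} {f g : α → Electron}
    (hf : MemLp f 2 μ) (hg : MemLp g 2 μ) : Integrable (fun a => inner ℂ (f a) (g a)) μ := by
  refine (L2.integrable_inner (𝕜 := ℂ) (hf.toLp f) (hg.toLp g)).congr ?_
  filter_upwards [hf.coeFn_toLp, hg.coeFn_toLp] with a h1 h2
  rw [h1, h2]

lemma integral_comp_measurePreserving {α β : Type*} [MeasurableSpace α] [MeasurableSpace β]
    {μ : Measure α} {ν : Measure β} {g : α → β} (h : MeasurePreserving g μ ν) {f : β → ℂ}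
    (hf : AEStronglyMeasurable f ν) : ∫ a, f (g a) ∂μ = ∫ b, f b ∂ν := by
  have h2 := integral_map (f := f) h.measurable.aemeasurable (h.map_eq.symm ▸ hf)
  rw [h.map_eq] at h2
  exact h2.symm

lemma inner_fock (Ψ Φ : Fock) :
    inner ℂ Ψ Φ = ∫ q, inner ℂ (val Ψ q) (val Φ q) ∂configMeasure :=
  L2.inner_def (𝕜 := ℂ) (Ψ : FullFock) (Φ : FullFock)

lemma integrable_inner_fock (Ψ Φ : Fock) :
    Integrable (fun q => (inner ℂ (val Ψ q) (val Φ q) : ℂ)) configMeasure :=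
  L2.integrable_inner (𝕜 := ℂ) (Ψ : FullFock) (Φ : FullFock)

/-- By symmetry the `n + 1` terms of `a* Ψ` contribute equally, and `(n + 1) / √(n + 1)` is the
prefactor of the annihilation operator. In the remaining term the created photon is split off by
Fubini. -/
lemma inner_creation_sector (Ψ Φ : Fock) (n : ℕ)
    (hi : ∀ᵐ k : Fin n → Space, Integrable (annihilationIntegrand F (val Φ) ⟨n, k⟩) volume) :
    ∫ k : Fin (n + 1) → Space, (inner ℂ (creationFun F (val Ψ) ⟨n + 1, k⟩) (val Φ ⟨n + 1, k⟩) : ℂ) =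
      ∫ k : Fin n → Space, inner ℂ (val Ψ ⟨n, k⟩) (annihilationFun F (val Φ) ⟨n, k⟩) := by
  let f : Fin (n + 1) → (Fin (n + 1) → Space) → ℂ := fun j k =>
    inner ℂ (F (k j) (val Ψ ⟨n, fun i => k (j.succAbove i)⟩)) (val Φ ⟨n + 1, k⟩)
  have hf : ∀ j, Integrable (f j) volume := fun j =>
    integrable_inner_memLp (memLp_coupling_removeNth F Ψ j) (memLp_val_sector Φ (n + 1))
  have hj : ∀ j, ∫ k, f j k = ∫ k, f 0 k := by
    intro j
    obtain ⟨τ, hτ⟩ := exists_perm_succAbove (Equiv.swap 0 j) j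
    rw [← integral_comp_measurePreserving (measurePreserving_perm (Equiv.swap 0 j)) (hf j).1]
    refine integral_congr_ae ?_
    filter_upwards [val_symm Φ (n + 1) (Equiv.swap 0 j), ae_removeNth 0 (val_symm Ψ n τ)]
      with k h1 h2
    simp only [f]
    rw [h1, ← h2]
    simp only [Function.comp_def, hτ, Equiv.swap_apply_right]
  have h1 : ∀ k : Fin (n + 1) → Space,
      (inner ℂ (creationFun F (val Ψ) ⟨n + 1, k⟩) (val Φ ⟨n + 1, k⟩) : ℂ) =
        ((Real.sqrt (n + 1) : ℂ))⁻¹ * ∑ j, f j k := by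
    intro k
    simp only [creationFun, inner_smul_left, sum_inner, f, map_inv₀, Complex.conj_ofReal]
  simp only [h1]
  rw [integral_const_mul, integral_finsetSum _ fun j _ => hf j]
  simp only [hj, Finset.sum_const, Finset.card_univ, Fintype.card_fin, nsmul_eq_mul]
  have h2 : ((Real.sqrt (n + 1) : ℂ))⁻¹ * (((n + 1 : ℕ) : ℂ) * ∫ k, f 0 k) =
      (Real.sqrt (n + 1) : ℂ) * ∫ k, f 0 k := by
    have h3 : ((n + 1 : ℕ) : ℂ) = (Real.sqrt (n + 1) : ℂ) * (Real.sqrt (n + 1) : ℂ) := by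
      rw [← Complex.ofReal_mul, Real.mul_self_sqrt (by positivity)]
      push_cast
      rfl
    rw [h3, mul_assoc, inv_mul_cancel_left₀ (sqrt_succ_ne_zero n)]
  have h4 : Integrable (fun a : (Fin n → Space) × Space =>
      f 0 (Fin.cons a.2 a.1 : Fin (n + 1) → Space)) (volume.prod volume) :=
    (measurePreserving_cons_swap n).integrable_comp_of_integrable (hf 0)
  rw [h2, ← integral_comp_measurePreserving (measurePreserving_cons_swap n) (hf 0).1,
    integral_prod _ h4,
    ← integral_const_mul]
  refine integral_congr_ae ?_
  filter_upwards [hi] with k hk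
  rw [annihilationFun, inner_smul_right, ← integral_inner hk]
  congr 1
  refine integral_congr_ae (Eventually.of_forall fun p => ?_)
  simp only [f, annihilationIntegrand, Fin.cons_zero, Fin.succAbove_zero, Fin.cons_succ]
  rw [ContinuousLinearMap.adjoint_inner_right]

lemma inner_cr (Ψ Φ : finiteParticle) :
    inner ℂ (cr F Ψ : Fock) (Φ : Fock) = inner ℂ (Ψ : Fock) (an F Φ : Fock) := by
  have h1 := hasSum_integral_config (integrable_inner_fock (cr F Ψ : Fock) (Φ : Fock))
  have h2 := hasSum_integral_config (integrable_inner_fock (Ψ : Fock) (an F Φ : Fock))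
  rw [← inner_fock] at h1 h2
  have hz : ∫ k : Fin 0 → Space, (inner ℂ (val (cr F Ψ : Fock) ⟨0, k⟩) (val (Φ : Fock) ⟨0, k⟩) : ℂ)
      = 0 := by
    refine integral_eq_zero_of_ae ?_
    filter_upwards [ae_config_iff.1 (val_cr F Ψ) 0] with k hk
    rw [hk]
    simp [creationFun]
  -- The zero-photon sector of `a* Ψ` is zero, so the two sums over sectors agree after an index
  -- shift.
  rw [← hasSum_nat_add_iff' 1, Finset.sum_range_one, hz, sub_zero] at h1
  refine h1.unique ?_
  suffices h : ∀ n : ℕ, ∫ k : Fin (n + 1) → Space,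
      (inner ℂ (val (cr F Ψ : Fock) ⟨n + 1, k⟩) (val (Φ : Fock) ⟨n + 1, k⟩) : ℂ) =
      ∫ k : Fin n → Space,
      (inner ℂ (val (Ψ : Fock) ⟨n, k⟩) (val (an F Φ : Fock) ⟨n, k⟩) : ℂ) by
    simpa only [h] using h2
  intro n
  have e1 : ∫ k : Fin (n + 1) → Space,
      (inner ℂ (val (cr F Ψ : Fock) ⟨n + 1, k⟩) (val (Φ : Fock) ⟨n + 1, k⟩) : ℂ) =
      ∫ k : Fin (n + 1) → Space,
      (inner ℂ (creationFun F (val (Ψ : Fock)) ⟨n + 1, k⟩) (val (Φ : Fock) ⟨n + 1, k⟩) : ℂ) := by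
    refine integral_congr_ae ?_
    filter_upwards [ae_config_iff.1 (val_cr F Ψ) (n + 1)] with k hk
    rw [hk]
  have e2 : ∫ k : Fin n → Space,
      (inner ℂ (val (Ψ : Fock) ⟨n, k⟩) (val (an F Φ : Fock) ⟨n, k⟩) : ℂ) =
      ∫ k : Fin n → Space,
      (inner ℂ (val (Ψ : Fock) ⟨n, k⟩) (annihilationFun F (val (Φ : Fock)) ⟨n, k⟩) : ℂ) := by
    refine integral_congr_ae ?_
    filter_upwards [ae_config_iff.1 (val_an F Φ) n] with k hk
    rw [hk.2]
  rw [e1, e2]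
  exact inner_creation_sector F Ψ Φ n ((ae_config_iff.1 (val_an F Φ) n).mono fun k hk => hk.1)

end

/-! ### Commutation relations obtained by taking adjoints. -/

section

variable (F : Lp BOp 2 (volume : Measure Space)) (x : Lp ℂ 2 (volume : Measure Space))

lemma inner_an (Ψ Φ : finiteParticle) :
    inner ℂ (an F Ψ : Fock) (Φ : Fock) = inner ℂ (Ψ : Fock) (cr F Φ : Fock) := by
  have h := congrArg (starRingEnd ℂ) (inner_cr F Φ Ψ)
  exact ((inner_conj_symm (𝕜 := ℂ) (E := Fock) _ _).symm.trans h.symm).trans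
    (inner_conj_symm (𝕜 := ℂ) (E := Fock) _ _)

lemma inner_liftBounded (B : BOp) (Ψ Φ : Fock) :
    inner ℂ (liftBounded B Ψ) Φ = inner ℂ Ψ (liftBounded (star B) Φ) := by
  rw [inner_fock, inner_fock]
  refine integral_congr_ae ?_
  filter_upwards [val_liftBounded B Ψ, val_liftBounded (star B) Φ] with q h1 h2
  rw [h1, h2, ContinuousLinearMap.star_eq_adjoint, ContinuousLinearMap.adjoint_inner_right]

lemma inner_liftFin (B : BOp) (Ψ Φ : finiteParticle) :
    inner ℂ (liftFin B Ψ : Fock) (Φ : Fock) = inner ℂ (Ψ : Fock) (liftFin (star B) Φ : Fock) :=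
  inner_liftBounded B (Ψ : Fock) (Φ : Fock)

lemma ext_inner_submodule {H : Type*} [NormedAddCommGroup H] [InnerProductSpace ℂ H]
    {D : Submodule ℂ H} {a b : D} (h : ∀ c : D, inner ℂ (c : H) (a : H) = inner ℂ (c : H) (b : H)) :
    a = b := ext_inner_left ℂ h

/-- The adjoint of `cr_comm`. Both sides lie in the space of test vectors, so no density argument is
needed; the other relations for annihilation operators follow in the same way. -/
lemma an_comm (Ψ : finiteParticle) : an F (an (sc x) Ψ) = an (sc x) (an F Ψ) := by
  refine ext_inner_submodule fun Φ => ?_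
  rw [← inner_cr, ← inner_cr, ← inner_cr, ← inner_cr, cr_comm]

lemma an_cr_sc (Ψ : finiteParticle) :
    an F (cr (sc x) Ψ) = cr (sc x) (an F Ψ) + liftFin (star (couplingIntegral F x)) Ψ := by
  refine ext_inner_submodule fun Φ => ?_
  rw [← inner_cr, ← inner_an, an_cr, Submodule.coe_add, Submodule.coe_add, inner_add_left, inner_cr,
    inner_an, inner_add_right, inner_liftFin]

lemma liftFin_cr (B : BOp) (Ψ : finiteParticle) :
    liftFin B (cr (sc x) Ψ) = cr (sc x) (liftFin B Ψ) := by
  refine Subtype.ext (fock_ext ?_)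
  have h2 : ∀ q, B (creationFun (scalarCoupling x) (val (Ψ : Fock)) q) =
      creationFun (scalarCoupling x) (fun q => B (val (Ψ : Fock) q)) q := by
    rintro ⟨_ | n, k⟩
    · simp [creationFun]
    · simp [creationFun, scalarCoupling]
  filter_upwards [val_liftBounded B (cr (sc x) Ψ : Fock), val_cr_sc x Ψ,
    val_cr_sc x (liftFin B Ψ), creationFun_congr (scalarCoupling x) (val_liftBounded B (Ψ : Fock))]
    with q g1 g2 g3 g4
  rw [coe_liftFin, g1, g2, g3, coe_liftFin, g4, h2]

lemma liftFin_an (B : BOp) (Ψ : finiteParticle) :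
    liftFin B (an (sc x) Ψ) = an (sc x) (liftFin B Ψ) := by
  refine ext_inner_submodule fun Φ => ?_
  rw [← star_star B, ← inner_liftFin, ← inner_cr, ← liftFin_cr, inner_liftFin, inner_cr]

/-! ### Dependence on the coupling function -/

lemma creationFun_add_coupling (F F' : Space → Electron →L[ℂ] Electron) (Ψ : Config → Electron)
    (q : Config) :
    creationFun (fun k => F k + F' k) Ψ q = creationFun F Ψ q + creationFun F' Ψ q := by
  rcases q with ⟨_ | n, k⟩
  · simp [creationFun]
  · simp [creationFun, Finset.sum_add_distrib]

lemma creationFun_smul_coupling (c : ℂ) (F : Space → Electron →L[ℂ] Electron)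
    (Ψ : Config → Electron) (q : Config) :
    creationFun (fun k => c • F k) Ψ q = c • creationFun F Ψ q := by
  rcases q with ⟨_ | n, k⟩
  · simp [creationFun]
  · simp only [creationFun, smul_apply, ← Finset.smul_sum]
    rw [smul_comm]

lemma creation_graph_add {F F' : Space → Electron →L[ℂ] Electron} {Ψ Φ Φ' : Fock}
    (h : (Ψ, Φ) ∈ (creation F).graph) (h' : (Ψ, Φ') ∈ (creation F').graph) :
    (Ψ, Φ + Φ') ∈ (creation fun k => F k + F' k).graph := by
  refine pair_mem_creation_graph.2 ?_
  filter_upwards [val_add Φ Φ', pair_mem_creation_graph.1 h, pair_mem_creation_graph.1 h']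
    with q h1 h2 h3
  rw [h1, h2, h3, creationFun_add_coupling]

lemma creation_graph_smul (c : ℂ) {F : Space → Electron →L[ℂ] Electron} {Ψ Φ : Fock}
    (h : (Ψ, Φ) ∈ (creation F).graph) : (Ψ, c • Φ) ∈ (creation fun k => c • F k).graph := by
  refine pair_mem_creation_graph.2 ?_
  filter_upwards [val_smul c Φ, pair_mem_creation_graph.1 h] with q h1 h2
  rw [h1, h2, creationFun_smul_coupling]

lemma annihilation_graph_add {F F' : Space → Electron →L[ℂ] Electron} {Ψ Φ Φ' : Fock}
    (h : (Ψ, Φ) ∈ (annihilation F).graph) (h' : (Ψ, Φ') ∈ (annihilation F').graph) :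
    (Ψ, Φ + Φ') ∈ (annihilation fun k => F k + F' k).graph := by
  refine pair_mem_annihilation_graph.2 ?_
  filter_upwards [val_add Φ Φ', pair_mem_annihilation_graph.1 h, pair_mem_annihilation_graph.1 h']
    with q h1 h2 h3
  have h4 : annihilationIntegrand (fun k => F k + F' k) (val Ψ) q = fun k =>
      annihilationIntegrand F (val Ψ) q k + annihilationIntegrand F' (val Ψ) q k := by
    funext k
    simp [annihilationIntegrand]
  rw [h1, h2.2, h3.2, annihilationFun, annihilationFun, annihilationFun, h4,
    integral_add h2.1 h3.1, smul_add]
  exact ⟨h2.1.add h3.1, rfl⟩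

lemma annihilation_graph_smul (c : ℂ) {F : Space → Electron →L[ℂ] Electron} {Ψ Φ : Fock}
    (h : (Ψ, Φ) ∈ (annihilation F).graph) :
    (Ψ, starRingEnd ℂ c • Φ) ∈ (annihilation fun k => c • F k).graph := by
  refine pair_mem_annihilation_graph.2 ?_
  filter_upwards [val_smul (starRingEnd ℂ c) Φ, pair_mem_annihilation_graph.1 h] with q h1 h2
  have h4 : annihilationIntegrand (fun k => c • F k) (val Ψ) q = fun k =>
      starRingEnd ℂ c • annihilationIntegrand F (val Ψ) q k := by
    funext k
    simp [annihilationIntegrand, map_smulₛₗ]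
  rw [h1, h2.2, annihilationFun, annihilationFun, h4, integral_smul, smul_comm]
  exact ⟨h2.1.smul (starRingEnd ℂ c), rfl⟩

lemma cr_add (F F' : Lp BOp 2 (volume : Measure Space)) : cr (F + F') = cr F + cr F' := by
  ext1 Ψ
  refine Subtype.ext (creation_graph_unique (cr_graph _ Ψ) ?_)
  exact creation_graph_congr (Lp.coeFn_add F F').symm
    (creation_graph_add (cr_graph F Ψ) (cr_graph F' Ψ))

lemma cr_smul (c : ℂ) : cr (c • F) = c • cr F := by
  ext1 Ψ
  refine Subtype.ext (creation_graph_unique (cr_graph _ Ψ) ?_)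
  exact creation_graph_congr (Lp.coeFn_smul c F).symm (creation_graph_smul c (cr_graph F Ψ))

lemma an_add (F F' : Lp BOp 2 (volume : Measure Space)) : an (F + F') = an F + an F' := by
  ext1 Ψ
  refine Subtype.ext (annihilation_graph_unique (an_graph _ Ψ) ?_)
  exact annihilation_graph_congr (Lp.coeFn_add F F').symm
    (annihilation_graph_add (an_graph F Ψ) (an_graph F' Ψ))

lemma an_smul (c : ℂ) : an (c • F) = starRingEnd ℂ c • an F := by
  ext1 Ψ
  refine Subtype.ext (annihilation_graph_unique (an_graph _ Ψ) ?_)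
  exact annihilation_graph_congr (Lp.coeFn_smul c F).symm
    (annihilation_graph_smul c (an_graph F Ψ))

/-! ### Field operators -/

/-- The field operator `a*(x) + a(x)` on the vectors with finitely many photons. -/
def fieldOp (x : Lp ℂ 2 (volume : Measure Space)) : Module.End ℂ finiteParticle :=
  cr (sc x) + an (sc x)

lemma fieldOp_apply (Ψ : finiteParticle) : fieldOp x Ψ = cr (sc x) Ψ + an (sc x) Ψ := rfl

lemma fieldOp_add (x y : Lp ℂ 2 (volume : Measure Space)) (Ψ : finiteParticle) :
    fieldOp (x + y) Ψ = fieldOp x Ψ + fieldOp y Ψ := by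
  simp only [fieldOp_apply, map_add, cr_add, an_add, LinearMap.add_apply]
  abel

/-- Real scalars only: creation is linear and annihilation conjugate linear in the coupling
function. -/
lemma fieldOp_smul (c : ℝ) (Ψ : finiteParticle) :
    fieldOp (c • x) Ψ = (c : ℂ) • fieldOp x Ψ := by
  rw [real_smul_Lp]
  simp only [fieldOp_apply, map_smul, cr_smul, an_smul, Complex.conj_ofReal, smul_add,
    LinearMap.smul_apply]

lemma inner_fieldOp (Ψ Φ : finiteParticle) :
    inner ℂ (fieldOp x Ψ : Fock) (Φ : Fock) = inner ℂ (Ψ : Fock) (fieldOp x Φ : Fock) := by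
  rw [fieldOp_apply, fieldOp_apply, Submodule.coe_add, Submodule.coe_add, inner_add_left,
    inner_add_right, inner_cr, inner_an, add_comm]

lemma fieldOp_mem {N : ℕ} {Ψ : finiteParticle} (h : (Ψ : Fock) ∈ particleLE N) :
    (fieldOp x Ψ : Fock) ∈ particleLE (N + 1) :=
  (particleLE (N + 1)).add_mem (cr_mem _ h) (particleLE_mono (Nat.le_succ N) (an_mem _ h))

lemma norm_fieldOp_le {N : ℕ} {Ψ : finiteParticle} (h : (Ψ : Fock) ∈ particleLE N) :
    ‖(fieldOp x Ψ : Fock)‖ ≤ 2 * Real.sqrt (N + 1) * ‖x‖ * ‖(Ψ : Fock)‖ := by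
  have h1 := norm_cr_le (sc x) h
  have h2 := norm_an_le (sc x) h
  have h3 : Real.sqrt (N + 1) * ‖sc x‖ * ‖(Ψ : Fock)‖ ≤
      Real.sqrt (N + 1) * ‖x‖ * ‖(Ψ : Fock)‖ := by
    gcongr
    exact norm_sc_le x
  rw [fieldOp_apply, Submodule.coe_add]
  refine (norm_add_le _ _).trans ?_
  linarith

lemma mem_add_graph {E : Type*} [AddCommGroup E] [Module ℂ E] {S T : E →ₗ.[ℂ] E} {u v : E} :
    (u, v) ∈ (S + T).graph ↔ ∃ a b, (u, a) ∈ S.graph ∧ (u, b) ∈ T.graph ∧ a + b = v := by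
  constructor
  · rw [LinearPMap.mem_graph_iff]
    rintro ⟨w, rfl, rfl⟩
    exact ⟨_, _, S.mem_graph ⟨w, w.2.1⟩, T.mem_graph ⟨w, w.2.2⟩, rfl⟩
  · rintro ⟨a, b, ha, hb, rfl⟩
    rw [LinearPMap.mem_graph_iff] at ha hb
    obtain ⟨⟨w, hw⟩, rfl, rfl⟩ := ha
    obtain ⟨⟨w', hw'⟩, h, rfl⟩ := hb
    obtain rfl : w' = w := h
    exact (S + T).mem_graph ⟨w', hw, hw'⟩

lemma fieldOp_graph (Ψ : finiteParticle) :
    ((Ψ : Fock), (fieldOp x Ψ : Fock)) ∈ (fieldOperator x).graph :=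
  mem_add_graph.2 ⟨_, _, cr_sc_graph x Ψ, an_sc_graph x Ψ, rfl⟩

lemma cr_fieldOp (Ψ : finiteParticle) :
    cr F (fieldOp x Ψ) = fieldOp x (cr F Ψ) - liftFin (couplingIntegral F x) Ψ := by
  rw [fieldOp_apply, fieldOp_apply, map_add, cr_comm, an_cr]
  abel

lemma an_fieldOp (Ψ : finiteParticle) :
    an F (fieldOp x Ψ) = fieldOp x (an F Ψ) + liftFin (star (couplingIntegral F x)) Ψ := by
  rw [fieldOp_apply, fieldOp_apply, map_add, an_comm, an_cr_sc]
  abel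

lemma liftFin_fieldOp (B : BOp) (Ψ : finiteParticle) :
    liftFin B (fieldOp x Ψ) = fieldOp x (liftFin B Ψ) := by
  rw [fieldOp_apply, fieldOp_apply, map_add, liftFin_cr, liftFin_an]

end

section

/-! ### Exponentials of field operators, abstractly -/

/-- A real-linear family of symmetric operators on a dense subspace filtered by levels, where the
norm of the operators on the level `N` grows like `√N`. -/
structure FieldSystem (X H : Type*) [NormedAddCommGroup X] [NormedSpace ℝ X]
    [NormedAddCommGroup H] [InnerProductSpace ℂ H] where
  D : Submodule ℂ H
  level : ℕ → Submodule ℂ H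
  mem_D : ∀ Ψ, Ψ ∈ D ↔ ∃ N, Ψ ∈ level N
  dense_D : Dense (D : Set H)
  op : X → D →ₗ[ℂ] D
  op_add : ∀ x y Ψ, op (x + y) Ψ = op x Ψ + op y Ψ
  op_smul : ∀ (c : ℝ) x Ψ, op (c • x) Ψ = (c : ℂ) • op x Ψ
  op_symm : ∀ x (Ψ Φ : D), inner ℂ (op x Ψ : H) (Φ : H) = inner ℂ (Ψ : H) (op x Φ : H)
  op_level : ∀ x N (Ψ : D), (Ψ : H) ∈ level N → (op x Ψ : H) ∈ level (N + 1)
  op_norm : ∀ x N (Ψ : D), (Ψ : H) ∈ level N →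
    ‖(op x Ψ : H)‖ ≤ 2 * Real.sqrt (N + 1) * ‖x‖ * ‖(Ψ : H)‖

/-- The norm of a product of `n` field operators on the level `N`. -/
def growth (N n : ℕ) : ℝ := ∏ i ∈ Finset.range n, 2 * Real.sqrt ((N + i : ℕ) + 1)

lemma growth_nonneg (N n : ℕ) : 0 ≤ growth N n := Finset.prod_nonneg fun _ _ => by positivity

/-- As `growth N n` is `2ⁿ √((N + n)! / N!)`, it grows only like the square root of a factorial, and
division by `n!` beats every geometric sequence. -/
lemma summable_growth (N : ℕ) (r : ℝ) (hr : 0 ≤ r) :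
    Summable fun n => growth N n / n.factorial * r ^ n := by
  refine summable_of_ratio_norm_eventually_le (r := 1 / 2) (by norm_num) ?_
  -- The ratio of consecutive terms is `2 r √(N + n + 1) / (n + 1)`. Since `N + n + 1 ≤ (N + 1)(n +
  -- 1)`, it is at most `1 / 2` as soon as `16 r² (N + 1) ≤ n + 1`.
  obtain ⟨m, hm⟩ := exists_nat_ge (16 * r ^ 2 * (N + 1))
  filter_upwards [eventually_ge_atTop m] with n hn
  have h1 : 4 * r * Real.sqrt ((N + n : ℕ) + 1) ≤ n + 1 := by
    refine abs_le_of_sq_le_sq' ?_ (by positivity) |>.2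
    rw [mul_pow, Real.sq_sqrt (by positivity)]
    have h2 : (m : ℝ) ≤ n := by exact_mod_cast hn
    have h3 : 16 * r ^ 2 * (N + 1) ≤ n + 1 := by linarith
    have h4 : (((N + n : ℕ) : ℝ) + 1) ≤ (N + 1) * (n + 1) := by
      push_cast
      nlinarith [Nat.cast_nonneg (α := ℝ) N, Nat.cast_nonneg (α := ℝ) n]
    calc (4 * r) ^ 2 * (((N + n : ℕ) : ℝ) + 1) ≤ (4 * r) ^ 2 * ((N + 1) * (n + 1)) := by gcongr
      _ = 16 * r ^ 2 * (N + 1) * (n + 1) := by ring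
      _ ≤ (n + 1) * (n + 1) := by gcongr
      _ = _ := by ring
  have h0 : 0 ≤ growth N n / n.factorial * r ^ n :=
    mul_nonneg (div_nonneg (growth_nonneg N n) (by positivity)) (by positivity)
  have h5 : growth N (n + 1) / (n + 1).factorial * r ^ (n + 1) =
      (2 * r * Real.sqrt ((N + n : ℕ) + 1) / (n + 1)) * (growth N n / n.factorial * r ^ n) := by
    rw [growth, Finset.prod_range_succ, ← growth, Nat.factorial_succ, pow_succ]
    push_cast
    field_simp
  rw [h5, norm_mul, Real.norm_of_nonneg (show 0 ≤ 2 * r * Real.sqrt ((N + n : ℕ) + 1) / (n + 1) by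
    positivity)]
  refine mul_le_mul_of_nonneg_right ?_ (norm_nonneg _)
  rw [div_le_div_iff₀ (by positivity) (by norm_num)]
  linarith

namespace FieldSystem

variable {X H : Type*} [NormedAddCommGroup X] [NormedSpace ℝ X]
    [NormedAddCommGroup H] [InnerProductSpace ℂ H] (S : FieldSystem X H)

/-- The family of operators, as a real-linear map. -/
def opLinear : X →ₗ[ℝ] Module.End ℂ S.D where
  toFun := S.op
  map_add' x y := LinearMap.ext fun Ψ => S.op_add x y Ψ
  map_smul' c x := LinearMap.ext fun Ψ => S.op_smul c x Ψ

lemma list_level {N n : ℕ} (f : Fin n → X) {Ψ : S.D} (hΨ : (Ψ : H) ∈ S.level N) :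
    (((List.ofFn fun i => S.opLinear (f i)).prod Ψ : S.D) : H) ∈ S.level (N + n) ∧
      ‖(((List.ofFn fun i => S.opLinear (f i)).prod Ψ : S.D) : H)‖ ≤
        growth N n * ‖(Ψ : H)‖ * ∏ i, ‖f i‖ := by
  induction n with
  | zero => simpa [growth] using hΨ
  | succ n ih =>
    obtain ⟨h1, h2⟩ := ih fun i => f i.succ
    rw [List.ofFn_succ, List.prod_cons, Module.End.mul_apply]
    refine ⟨S.op_level _ _ _ h1, (S.op_norm _ _ _ h1).trans ?_⟩
    rw [Fin.prod_univ_succ, growth, Finset.prod_range_succ, ← growth]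
    calc _ ≤ 2 * Real.sqrt ((N + n : ℕ) + 1) * ‖f 0‖ *
          (growth N n * ‖(Ψ : H)‖ * ∏ i : Fin n, ‖f i.succ‖) := by gcongr
      _ = _ := by ring

/-- The product of `n` field operators, applied to a vector. -/
def multilinear (Ψ : S.D) (n : ℕ) : MultilinearMap ℝ (fun _ : Fin n => X) H :=
  ((S.D.subtype.restrictScalars ℝ).comp
    ((LinearMap.applyₗ (R := ℂ) Ψ).restrictScalars ℝ)).compMultilinearMap
    ((MultilinearMap.mkPiAlgebraFin ℝ n (Module.End ℂ S.D)).compLinearMap fun _ => S.opLinear)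

lemma multilinear_apply (Ψ : S.D) (n : ℕ) (f : Fin n → X) :
    S.multilinear Ψ n f = (((List.ofFn fun i => S.opLinear (f i)).prod Ψ : S.D) : H) := by
  simp [multilinear, MultilinearMap.mkPiAlgebraFin_apply]

lemma multilinear_diag (Ψ : S.D) (n : ℕ) (x : X) :
    S.multilinear Ψ n (fun _ => x) = ((S.op x ^ n) Ψ : S.D) := by
  rw [multilinear_apply, List.ofFn_const, List.prod_replicate]
  rfl

lemma norm_pow_le {N : ℕ} {Ψ : S.D} (hΨ : (Ψ : H) ∈ S.level N) (x : X) (n : ℕ) :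
    ‖(((S.op x ^ n) Ψ : S.D) : H)‖ ≤ growth N n * ‖(Ψ : H)‖ * ‖x‖ ^ n := by
  rw [← multilinear_diag, multilinear_apply]
  simpa using (S.list_level (fun _ : Fin n => x) hΨ).2

/-- The coefficients of the exponential series of `i A`. -/
def expCoeff (n : ℕ) : ℂ := Complex.I ^ n / (n.factorial : ℂ)

lemma norm_expCoeff (n : ℕ) : ‖expCoeff n‖ = 1 / n.factorial := by
  simp [expCoeff]

lemma expCoeff_succ (n : ℕ) : expCoeff (n + 1) * ((n + 1 : ℕ) : ℂ) = Complex.I * expCoeff n := by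
  have h : ((n + 1 : ℕ) : ℂ) ≠ 0 := by exact_mod_cast Nat.succ_ne_zero n
  rw [expCoeff, expCoeff, Nat.factorial_succ, pow_succ]
  push_cast at h ⊢
  field_simp

lemma summable_norm_exp (x : X) (Ψ : S.D) :
    Summable fun n => ‖expCoeff n • (((S.op x ^ n) Ψ : S.D) : H)‖ := by
  obtain ⟨N, hN⟩ := (S.mem_D Ψ).1 Ψ.2
  refine Summable.of_nonneg_of_le (fun _ => norm_nonneg _) (fun n => ?_)
    ((summable_growth N ‖x‖ (norm_nonneg x)).mul_right ‖(Ψ : H)‖)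
  rw [norm_smul, norm_expCoeff]
  calc _ ≤ 1 / (n.factorial : ℝ) * (growth N n * ‖(Ψ : H)‖ * ‖x‖ ^ n) := by
        gcongr
        exact S.norm_pow_le hN x n
    _ = _ := by ring

variable [CompleteSpace H]

/-- `exp (i A(x))` on the dense subspace. -/
def expD (x : X) : S.D →ₗ[ℂ] H where
  toFun Ψ := ∑' n, expCoeff n • (((S.op x ^ n) Ψ : S.D) : H)
  map_add' Ψ Φ := by
    rw [← (S.summable_norm_exp x Ψ).of_norm.tsum_add (S.summable_norm_exp x Φ).of_norm]
    simp
  map_smul' c Ψ := by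
    rw [RingHom.id_apply, ← (S.summable_norm_exp x Ψ).of_norm.tsum_const_smul]
    simp only [map_smul, Submodule.coe_smul]
    exact tsum_congr fun n => smul_comm _ _ _

lemma hasSum_expD (x : X) (Ψ : S.D) :
    HasSum (fun n => expCoeff n • (((S.op x ^ n) Ψ : S.D) : H)) (S.expD x Ψ) :=
  (S.summable_norm_exp x Ψ).of_norm.hasSum

/-- The power series of `x ↦ exp (i A(x)) Ψ`. -/
def expSeries {N : ℕ} {Ψ : S.D} (hΨ : (Ψ : H) ∈ S.level N) : FormalMultilinearSeries ℝ X H :=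
  fun n => expCoeff n • (S.multilinear Ψ n).mkContinuous (growth N n * ‖(Ψ : H)‖) fun f => by
    rw [multilinear_apply]
    exact (S.list_level f hΨ).2

/-- The exponential series is itself a power series in the parameter, with the multilinear products
of field operators as coefficients, and `summable_growth` makes its radius infinite. -/
lemma analyticAt_expD (Ψ : S.D) (x : X) : AnalyticAt ℝ (fun y => S.expD y Ψ) x := by
  obtain ⟨N, hN⟩ := (S.mem_D Ψ).1 Ψ.2
  have hr : (S.expSeries hN).radius = ⊤ := by
    refine FormalMultilinearSeries.radius_eq_top_of_summable_norm _ fun r => ?_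
    refine Summable.of_nonneg_of_le (fun _ => by positivity) (fun n => ?_)
      ((summable_growth N r r.2).mul_right ‖(Ψ : H)‖)
    rw [expSeries, norm_smul, norm_expCoeff]
    have h2 := MultilinearMap.mkContinuous_norm_le (S.multilinear Ψ n)
      (mul_nonneg (growth_nonneg N n) (norm_nonneg (Ψ : H))) (fun f => by
        rw [multilinear_apply]; exact (S.list_level f hN).2)
    calc _ ≤ 1 / (n.factorial : ℝ) * (growth N n * ‖(Ψ : H)‖) * (r : ℝ) ^ n := by gcongr
      _ = _ := by ring
  have h := (S.expSeries hN).hasFPowerSeriesOnBall (by rw [hr]; simp)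
  rw [hr] at h
  have h2 := h.analyticAt_of_mem (y := x) (by simp)
  have h3 : (S.expSeries hN).sum = fun y => S.expD y Ψ := by
    funext y
    refine tsum_congr fun n => ?_
    change expCoeff n • S.multilinear Ψ n (fun _ => y) = _
    rw [multilinear_diag]
  rwa [h3] at h2

omit [CompleteSpace H] in
lemma op_zero_apply (Ψ : S.D) : S.op 0 Ψ = 0 := by
  have h := S.op_smul 0 0 Ψ
  simpa using h

omit [CompleteSpace H] in
lemma op_neg (x : X) : S.op (-x) = -S.op x := by
  refine LinearMap.ext fun Ψ => ?_
  rw [LinearMap.neg_apply]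
  refine eq_neg_of_add_eq_zero_left ?_
  rw [← S.op_add, neg_add_cancel, op_zero_apply]

omit [CompleteSpace H] in
lemma inner_pow (x : X) (n : ℕ) (Ψ Φ : S.D) :
    inner ℂ (((S.op x ^ n) Ψ : S.D) : H) (Φ : H) =
      inner ℂ (Ψ : H) (((S.op x ^ n) Φ : S.D) : H) := by
  induction n generalizing Ψ with
  | zero => rfl
  | succ n ih =>
    rw [pow_succ, Module.End.mul_apply, ih, S.op_symm, ← Module.End.mul_apply, ← pow_succ',
      pow_succ]

lemma conj_expCoeff (n : ℕ) : starRingEnd ℂ (expCoeff n) = (-1) ^ n * expCoeff n := by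
  simp only [expCoeff, map_div₀, map_pow, Complex.conj_I, map_natCast]
  rw [← neg_one_mul, mul_pow, mul_div_assoc]

lemma inner_expD (x : X) (Ψ Φ : S.D) :
    inner ℂ (S.expD x Ψ) (Φ : H) = inner ℂ (Ψ : H) (S.expD (-x) Φ) := by
  have h1 := (S.hasSum_expD (-x) Φ).mapL (innerSL ℂ (Ψ : H))
  have h2 := (S.hasSum_expD x Ψ).mapL (innerSL ℂ (Φ : H))
  simp only [innerSL_apply_apply, inner_smul_right] at h1 h2
  have h3 := h2.map (starRingEnd ℂ) Complex.continuous_conj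
  rw [inner_conj_symm] at h3
  refine h3.unique (h1.congr_fun fun n => ?_)
  simp only [Function.comp_apply, map_mul, inner_conj_symm]
  rw [inner_pow, conj_expCoeff, op_neg, ← neg_one_smul ℂ (S.op x), smul_pow, LinearMap.smul_apply,
    Submodule.coe_smul, inner_smul_right]
  ring

omit [CompleteSpace H] in
lemma inner_pow_pow (x : X) (m n : ℕ) (Ψ Φ : S.D) :
    inner ℂ (expCoeff m • (((S.op x ^ m) Ψ : S.D) : H))
      (expCoeff n • (((S.op x ^ n) Φ : S.D) : H)) =
      starRingEnd ℂ (expCoeff m) * expCoeff n *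
        inner ℂ (Ψ : H) (((S.op x ^ (m + n)) Φ : S.D) : H) := by
  rw [inner_smul_left, inner_smul_right, inner_pow, ← Module.End.mul_apply, ← pow_add]
  ring

/-- The binomial theorem for `(-i + i)^N / N!`. -/
lemma sum_antidiagonal_expCoeff (N : ℕ) :
    ∑ p ∈ Finset.HasAntidiagonal.antidiagonal N, starRingEnd ℂ (expCoeff p.1) * expCoeff p.2 =
      if N = 0 then 1 else 0 := by
  have h1 : ∀ p ∈ Finset.HasAntidiagonal.antidiagonal N, starRingEnd ℂ (expCoeff p.1) * expCoeff p.2 =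
      (N.factorial : ℂ)⁻¹ * ((-Complex.I) ^ p.1 * Complex.I ^ p.2 * (N.choose p.1 : ℂ)) := by
    intro p hp
    obtain rfl := Finset.HasAntidiagonal.mem_antidiagonal.1 hp
    have hc := Nat.add_choose_mul_factorial_mul_factorial p.1 p.2
    rw [← Nat.choose_symm_add] at hc
    have hc' : (((p.1 + p.2).choose p.1 : ℕ) : ℂ) * (p.1.factorial : ℂ) * (p.2.factorial : ℂ) =
        ((p.1 + p.2).factorial : ℂ) := by exact_mod_cast hc
    have f1 : ((p.1).factorial : ℂ) ≠ 0 := by exact_mod_cast Nat.factorial_ne_zero _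
    have f2 : ((p.2).factorial : ℂ) ≠ 0 := by exact_mod_cast Nat.factorial_ne_zero _
    have f3 : ((p.1 + p.2).factorial : ℂ) ≠ 0 := by exact_mod_cast Nat.factorial_ne_zero _
    rw [conj_expCoeff, expCoeff, expCoeff, ← hc']
    rw [← hc'] at f3
    have f4 : (((p.1 + p.2).choose p.1 : ℕ) : ℂ) ≠ 0 := by
      intro h; rw [h] at f3; simp at f3
    rw [show (-Complex.I) ^ p.1 = (-1) ^ p.1 * Complex.I ^ p.1 by rw [← mul_pow, neg_one_mul]]
    field_simp
  rw [Finset.sum_congr rfl h1, ← Finset.mul_sum]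
  have h2 := (Commute.all (-Complex.I) Complex.I).add_pow' N
  simp only [nsmul_eq_mul] at h2
  have h3 : ∑ p ∈ Finset.HasAntidiagonal.antidiagonal N,
      (-Complex.I) ^ p.1 * Complex.I ^ p.2 * (N.choose p.1 : ℂ) = (-Complex.I + Complex.I) ^ N := by
    rw [h2]
    exact Finset.sum_congr rfl fun p _ => mul_comm _ _
  rw [h3, neg_add_cancel]
  split_ifs with h
  · subst h; simp
  · rw [zero_pow h, mul_zero]

/-- The double series of inner products converges absolutely and may be summed along `m + n = N`. By
symmetry such a slice is `⟨Ψ, A^N Φ⟩` times a coefficient that vanishes for `N > 0`. Isometry thus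
needs no essential self-adjointness of `A`. -/
lemma inner_expD_expD (x : X) (Ψ Φ : S.D) :
    inner ℂ (S.expD x Ψ) (S.expD x Φ) = inner ℂ (Ψ : H) (Φ : H) := by
  let a : ℕ → H := fun n => expCoeff n • (((S.op x ^ n) Ψ : S.D) : H)
  let b : ℕ → H := fun n => expCoeff n • (((S.op x ^ n) Φ : S.D) : H)
  have hsum : Summable fun p : ℕ × ℕ => (inner ℂ (a p.1) (b p.2) : ℂ) := by
    refine Summable.of_norm_bounded ((S.summable_norm_exp x Ψ).mul_of_nonneg
      (S.summable_norm_exp x Φ) (fun _ => norm_nonneg _) fun _ => norm_nonneg _) fun p => ?_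
    exact norm_inner_le_norm _ _
  have h1 : ∑' p : ℕ × ℕ, (inner ℂ (a p.1) (b p.2) : ℂ) =
      inner ℂ (S.expD x Ψ) (S.expD x Φ) := by
    rw [hsum.tsum_prod]
    have e1 : ∀ m, ∑' n, (inner ℂ (a m) (b n) : ℂ) = inner ℂ (a m) (S.expD x Φ) := fun m =>
      ((S.hasSum_expD x Φ).mapL (innerSL ℂ (a m))).tsum_eq
    simp only [e1]
    have e2 := ((S.hasSum_expD x Ψ).mapL (innerSL ℂ (S.expD x Φ))).map
      (starRingEnd ℂ) Complex.continuous_conj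
    simp only [innerSL_apply_apply, inner_conj_symm] at e2
    rw [← e2.tsum_eq]
    refine tsum_congr fun m => ?_
    simp only [Function.comp_apply, inner_conj_symm, a]
  rw [← h1, ← (Finset.HasAntidiagonal.sigmaAntidiagonalEquivProd (A := ℕ)).tsum_eq]
  have hsum2 := (Finset.HasAntidiagonal.sigmaAntidiagonalEquivProd (A := ℕ)).summable_iff.2 hsum
  refine (hsum2.tsum_sigma' fun N => (hasSum_fintype _).summable).trans ?_
  simp only [Function.comp_apply]
  have key : ∀ N, ∑' c : Finset.HasAntidiagonal.antidiagonal N, (inner ℂ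
      (a (Finset.HasAntidiagonal.sigmaAntidiagonalEquivProd ⟨N, c⟩).1)
      (b (Finset.HasAntidiagonal.sigmaAntidiagonalEquivProd ⟨N, c⟩).2) : ℂ) =
      (if N = 0 then 1 else 0) * inner ℂ (Ψ : H) (((S.op x ^ N) Φ : S.D) : H) := by
    intro N
    have e3 : ∀ c : Finset.HasAntidiagonal.antidiagonal N, (inner ℂ
        (a (Finset.HasAntidiagonal.sigmaAntidiagonalEquivProd ⟨N, c⟩).1)
        (b (Finset.HasAntidiagonal.sigmaAntidiagonalEquivProd ⟨N, c⟩).2) : ℂ) =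
        starRingEnd ℂ (expCoeff (c : ℕ × ℕ).1) * expCoeff (c : ℕ × ℕ).2 *
          inner ℂ (Ψ : H) (((S.op x ^ N) Φ : S.D) : H) := by
      intro c
      have h := S.inner_pow_pow x (c : ℕ × ℕ).1 (c : ℕ × ℕ).2 Ψ Φ
      rw [Finset.HasAntidiagonal.mem_antidiagonal.1 c.2] at h
      exact h
    rw [tsum_fintype]
    simp only [e3]
    rw [← Finset.sum_mul, Finset.sum_coe_sort (Finset.HasAntidiagonal.antidiagonal N)
      fun p => starRingEnd ℂ (expCoeff p.1) * expCoeff p.2, sum_antidiagonal_expCoeff]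
  simp only [key]
  rw [tsum_eq_single 0 fun N hN => by rw [if_neg hN, zero_mul], if_pos rfl, one_mul]
  rfl

lemma norm_expD (x : X) (Ψ : S.D) : ‖S.expD x Ψ‖ = ‖(Ψ : H)‖ := by
  have h := S.inner_expD_expD x Ψ Ψ
  rw [inner_self_eq_norm_sq_to_K, inner_self_eq_norm_sq_to_K] at h
  have h2 : ‖S.expD x Ψ‖ ^ 2 = ‖(Ψ : H)‖ ^ 2 := by exact_mod_cast h
  exact (pow_left_inj₀ (norm_nonneg _) (norm_nonneg _) two_ne_zero).1 h2

lemma exists_exp_clm (x : X) :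
    ∃ T : H →L[ℂ] H, (∀ Ψ : S.D, T Ψ = S.expD x Ψ) ∧ ∀ Ψ, ‖T Ψ‖ = ‖Ψ‖ := by
  let T0 : S.D →L[ℂ] H := (S.expD x).mkContinuous 1 fun Ψ => by
    rw [one_mul]; exact (S.norm_expD x Ψ).le
  have hd : DenseRange (S.D.subtypeL : S.D → H) := by
    simpa [DenseRange] using S.dense_D
  have hu : IsUniformInducing (S.D.subtypeL : S.D → H) :=
    S.D.subtypeₗᵢ.isometry.isUniformInducing
  have hT : ∀ Ψ : S.D, T0.extend S.D.subtypeL Ψ = S.expD x Ψ := fun Ψ =>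
    ContinuousLinearMap.extend_eq T0 hd hu Ψ
  refine ⟨T0.extend S.D.subtypeL, hT, fun Ψ => ?_⟩
  refine S.dense_D.induction (P := fun Ψ => ‖T0.extend S.D.subtypeL Ψ‖ = ‖Ψ‖) ?_ ?_ Ψ
  · intro Ψ hΨ
    have h := hT ⟨Ψ, hΨ⟩
    simp only at h
    rw [h, norm_expD]
  · exact isClosed_eq (by fun_prop) (by fun_prop)

/-- `exp (i A(x))` as a bounded operator. -/
def expCLM (x : X) : H →L[ℂ] H := (S.exists_exp_clm x).choose

lemma expCLM_coe (x : X) (Ψ : S.D) : S.expCLM x Ψ = S.expD x Ψ :=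
  (S.exists_exp_clm x).choose_spec.1 Ψ

lemma norm_expCLM (x : X) (Ψ : H) : ‖S.expCLM x Ψ‖ = ‖Ψ‖ :=
  (S.exists_exp_clm x).choose_spec.2 Ψ

lemma inner_expCLM (x : X) (Ψ Φ : H) :
    inner ℂ (S.expCLM x Ψ) Φ = inner ℂ Ψ (S.expCLM (-x) Φ) := by
  refine S.dense_D.induction
    (P := fun Ψ => inner ℂ (S.expCLM x Ψ) Φ = inner ℂ Ψ (S.expCLM (-x) Φ)) ?_ ?_ Ψ
  · intro Ψ hΨ
    refine S.dense_D.induction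
      (P := fun Φ => inner ℂ (S.expCLM x Ψ) Φ = inner ℂ Ψ (S.expCLM (-x) Φ)) ?_ ?_ Φ
    · intro Φ hΦ
      rw [show S.expCLM x Ψ = _ from S.expCLM_coe x ⟨Ψ, hΨ⟩,
        show S.expCLM (-x) Φ = _ from S.expCLM_coe (-x) ⟨Φ, hΦ⟩]
      exact S.inner_expD x ⟨Ψ, hΨ⟩ ⟨Φ, hΦ⟩
    · exact isClosed_eq (by fun_prop) (by fun_prop)
  · exact isClosed_eq (by fun_prop) (by fun_prop)

/-- The exponential is isometric and its adjoint is the exponential with `-x`. Used for both signs,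
this gives unitarity without a group law. -/
lemma expCLM_neg_expCLM (x : X) (Ψ : H) : S.expCLM (-x) (S.expCLM x Ψ) = Ψ := by
  have hi : ∀ Ψ Φ, inner ℂ (S.expCLM x Ψ) (S.expCLM x Φ) = inner ℂ Ψ Φ :=
    (LinearMap.norm_map_iff_inner_map_map (S.expCLM x)).1 (S.norm_expCLM x)
  refine ext_inner_left ℂ fun Φ => ?_
  rw [← inner_expCLM, hi]

/-- The unitary operator `exp (i A(x))`. -/
def exp (x : X) : H ≃ₗᵢ[ℂ] H where
  toLinearEquiv := LinearEquiv.ofLinearMap (S.expCLM x : H →ₗ[ℂ] H) (S.expCLM (-x) : H →ₗ[ℂ] H)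
    (LinearMap.ext fun Ψ => by
      have h := S.expCLM_neg_expCLM (-x) Ψ
      rwa [neg_neg] at h)
    (LinearMap.ext fun Ψ => S.expCLM_neg_expCLM x Ψ)
  norm_map' := S.norm_expCLM x

lemma exp_symm (x : X) : (S.exp x).symm = S.exp (-x) := by
  ext Ψ
  rfl

lemma exp_coe (x : X) (Ψ : S.D) : S.exp x (Ψ : H) = S.expD x Ψ := S.expCLM_coe x Ψ

lemma hasSum_exp (x : X) (Ψ : S.D) :
    HasSum (fun n => expCoeff n • (((S.op x ^ n) Ψ : S.D) : H)) (S.exp x Ψ) := by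
  rw [exp_coe]
  exact S.hasSum_expD x Ψ

lemma analyticAt_exp (Ψ : S.D) (x : X) : AnalyticAt ℝ (fun y => S.exp y (Ψ : H)) x := by
  simp only [exp_coe]
  exact S.analyticAt_expD Ψ x

end FieldSystem

end

/-! ### Conjugation of closed operators by the exponentials. -/

section

namespace FieldSystem

variable {X H : Type*} [NormedAddCommGroup X] [NormedSpace ℝ X]
    [NormedAddCommGroup H] [InnerProductSpace ℂ H] [CompleteSpace H] (S : FieldSystem X H)

/-- An index shift in the exponential series, from `n · iⁿ / n! = i · iⁿ⁻¹ / (n - 1)!`. The factor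
`n` removes the term in which `n - 1` is truncated. -/
lemma hasSum_exp_shift (x : X) (Ψ : S.D) :
    HasSum (fun n : ℕ => expCoeff n • (n : ℂ) • (((S.op x ^ (n - 1)) Ψ : S.D) : H))
      (Complex.I • S.exp x Ψ) := by
  rw [← hasSum_nat_add_iff' 1]
  have h := (S.hasSum_exp x Ψ).const_smul Complex.I
  simp only [Finset.sum_range_one, Nat.cast_zero, zero_smul, smul_zero, sub_zero]
  refine h.congr_fun fun n => ?_
  rw [smul_smul, expCoeff_succ, smul_smul, Nat.add_sub_cancel]

lemma hasSum_exp_shift_two (x : X) (Ψ : S.D) :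
    HasSum (fun n : ℕ => expCoeff n • ((n : ℂ) * ((n : ℂ) - 1)) •
      (((S.op x ^ (n - 2)) Ψ : S.D) : H)) (-S.exp x Ψ) := by
  rw [← hasSum_nat_add_iff' 2]
  have h := (S.hasSum_exp x Ψ).neg
  simp only [Finset.sum_range_succ, Finset.sum_range_zero, Nat.cast_zero, zero_mul, zero_smul,
    smul_zero, Nat.cast_one, sub_self, mul_zero, add_zero, sub_zero]
  refine h.congr_fun fun n => ?_
  rw [smul_smul, Nat.add_sub_cancel]
  have h1 : expCoeff (n + 2) * (((n + 2 : ℕ) : ℂ) * (((n + 2 : ℕ) : ℂ) - 1)) = -expCoeff n := by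
    have e1 := expCoeff_succ (n + 1)
    have e2 := expCoeff_succ n
    calc _ = expCoeff (n + 2) * ((n + 2 : ℕ) : ℂ) * ((n + 1 : ℕ) : ℂ) := by push_cast; ring
      _ = Complex.I * (expCoeff (n + 1) * ((n + 1 : ℕ) : ℂ)) := by rw [e1]; ring
      _ = Complex.I * Complex.I * expCoeff n := by rw [e2]; ring
      _ = _ := by rw [Complex.I_mul_I]; ring
  rw [h1, neg_smul]

omit [CompleteSpace H] in
-- The Leibniz rule for a commutator `C` that itself commutes with the field operator.
lemma apply_pow {T C : S.D →ₗ[ℂ] S.D} {x : X}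
    (h : ∀ Ψ, T (S.op x Ψ) = S.op x (T Ψ) + C Ψ) (hC : ∀ Ψ, C (S.op x Ψ) = S.op x (C Ψ))
    (n : ℕ) (Ψ : S.D) :
    T ((S.op x ^ n) Ψ) = (S.op x ^ n) (T Ψ) + (n : ℂ) • (S.op x ^ (n - 1)) (C Ψ) := by
  have hCn : ∀ n : ℕ, C ((S.op x ^ n) Ψ) = (S.op x ^ n) (C Ψ) := by
    intro n
    induction n with
    | zero => rfl
    | succ n ih => rw [pow_succ', Module.End.mul_apply, hC, ih, Module.End.mul_apply]
  induction n with
  | zero => simp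
  | succ n ih =>
    rw [pow_succ', Module.End.mul_apply, h, ih, hCn, map_add, Module.End.mul_apply, map_smul,
      add_assoc]
    congr 1
    rw [Nat.add_sub_cancel]
    cases n with
    | zero => simp
    | succ n =>
      rw [Nat.add_sub_cancel, ← Module.End.mul_apply, ← pow_succ']
      push_cast
      module

/-- A closed operator `T` with `[T, A(x)] = C` is transformed into `T - i C` by `exp (i A(x))`. -/
lemma exp_mem_of_commutator {Γ : Submodule ℂ (H × H)} (hΓ : IsClosed (Γ : Set (H × H)))
    {T C : S.D →ₗ[ℂ] S.D} {x : X} (hT : ∀ Ψ : S.D, ((Ψ : H), (T Ψ : H)) ∈ Γ)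
    (h : ∀ Ψ, T (S.op x Ψ) = S.op x (T Ψ) + C Ψ) (hC : ∀ Ψ, C (S.op x Ψ) = S.op x (C Ψ))
    (Ψ : S.D) :
    (S.exp x Ψ, S.exp x ((T Ψ : H) + Complex.I • (C Ψ : H))) ∈ Γ := by
  have h1 := S.hasSum_exp x Ψ
  -- Partial sums of the exponential series stay in the graph; by the Leibniz rule their images are
  -- partial sums of this series, which produces the term `i C`. Closedness passes to the limit.
  have h2 := (S.hasSum_exp x (T Ψ)).add (S.hasSum_exp_shift x (C Ψ))
  rw [← map_smul, ← map_add] at h2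
  have h3 := h1.prodMk h2
  refine hΓ.mem_of_tendsto h3 (Eventually.of_forall fun s => Γ.sum_mem fun n _ => ?_)
  have h4 := Γ.smul_mem (expCoeff n) (hT ((S.op x ^ n) Ψ))
  rw [S.apply_pow h hC] at h4
  simpa [smul_add] using h4

/-- The transformation of a closed operator `T` whose second commutator with `A(x)` is a number. -/
lemma exp_mem_of_second_commutator {Γ : Submodule ℂ (H × H)} (hΓ : IsClosed (Γ : Set (H × H)))
    {P : S.D →ₗ[ℂ] S.D} {κ : ℂ} {x : X}
    (hT : ∀ Ψ Φ : S.D, ((Ψ : H), (Φ : H)) ∈ Γ →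
      ((S.op x Ψ : H), ((S.op x Φ + P Ψ : S.D) : H)) ∈ Γ)
    (hP : ∀ Ψ, P (S.op x Ψ) = S.op x (P Ψ) + κ • Ψ) {Ψ Φ : S.D}
    (hΨ : ((Ψ : H), (Φ : H)) ∈ Γ) :
    (S.exp x Ψ, S.exp x ((Φ : H) + Complex.I • (P Ψ : H) - (κ / 2) • (Ψ : H))) ∈ Γ := by
  have hs : ∀ (m : ℕ) (v : S.D), S.op x ((S.op x ^ m) v) = (S.op x ^ (m + 1)) v := fun m v => by
    rw [pow_succ', Module.End.mul_apply]
  -- The operator is known only through its graph and need not be defined on all of `S.D`, so the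
  -- induction carries the pair. The constant second commutator enters with the binomial coefficient
  -- `n (n - 1) / 2`.
  have key : ∀ n : ℕ, ((((S.op x ^ n) Ψ : S.D) : H),
      (((S.op x ^ n) Φ + (n : ℂ) • (S.op x ^ (n - 1)) (P Ψ) +
        (κ / 2) • ((n : ℂ) * ((n : ℂ) - 1)) • (S.op x ^ (n - 2)) Ψ : S.D) : H)) ∈ Γ := by
    intro n
    induction n with
    | zero => simpa using hΨ
    | succ n ih =>
      have h1 := hT _ _ ih
      have h2 := S.apply_pow (T := P) (C := κ • LinearMap.id) hP
        (fun Ψ => by simp) n Ψ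
      rw [← Module.End.mul_apply, ← pow_succ'] at h1
      convert h1 using 3
      rw [h2]
      simp only [map_add, map_smul, LinearMap.smul_apply, LinearMap.id_apply]
      rw [← Module.End.mul_apply (S.op x) (S.op x ^ n), ← pow_succ']
      rcases n with _ | _ | n
      · simp
      · simp
        module
      · simp only [Nat.add_sub_cancel]
        rw [hs, hs]
        simp only [show n + 1 + 1 + 1 - 2 = n + 1 from rfl, show n + 1 + 1 - 2 + 1 = n + 1 from rfl]
        push_cast
        module
  have h1 := S.hasSum_exp x Ψ
  have h2 := ((S.hasSum_exp x Φ).add (S.hasSum_exp_shift x (P Ψ))).add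
    ((S.hasSum_exp_shift_two x Ψ).const_smul (κ / 2))
  have h3 := h1.prodMk h2
  have h4 : S.exp x (Φ : H) + Complex.I • S.exp x (P Ψ : H) + (κ / 2) • -S.exp x (Ψ : H) =
      S.exp x ((Φ : H) + Complex.I • (P Ψ : H) - (κ / 2) • (Ψ : H)) := by
    rw [map_sub, map_add, map_smul, map_smul, smul_neg, sub_eq_add_neg]
  rw [h4] at h3
  refine hΓ.mem_of_tendsto h3 (Eventually.of_forall fun s => Γ.sum_mem fun n _ => ?_)
  have h5 := Γ.smul_mem (expCoeff n) (key n)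
  convert h5 using 1
  simp only [Prod.smul_mk, Submodule.coe_add, Submodule.coe_smul, smul_add]
  rw [smul_comm (κ / 2) (expCoeff n)]

end FieldSystem

end

section

/-! ### The field operators on the Fock space -/

/-- A convergent sequence has an almost everywhere convergent subsequence, and permutations of the
momenta preserve null sets, so the pointwise symmetry survives. -/
lemma isClosed_symmetricSubspace : IsClosed (symmetricSubspace : Set FullFock) := by
  refine IsSeqClosed.isClosed fun Ψ Φ hΨ hlim n σ => ?_
  obtain ⟨ns, -, hns⟩ := (tendstoInMeasure_of_tendsto_Lp hlim).exists_seq_tendsto_ae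
  have h1 := ae_config_iff.1 hns n
  have h2 : ∀ᵐ k : Fin n → Space, ∀ i, Ψ i ⟨n, k ∘ σ⟩ = Ψ i ⟨n, k⟩ :=
    ae_all_iff.2 fun i => hΨ i n σ
  filter_upwards [h1, ae_perm σ h1, h2] with k h3 h4 h5
  refine tendsto_nhds_unique h4 (h3.congr fun i => ?_)
  rw [h5]

instance : CompleteSpace Fock := isClosed_symmetricSubspace.completeSpace_coe

lemma dense_finiteParticle : Dense (finiteParticle : Set Fock) := fun Ψ =>
  mem_closure_of_tendsto (tendsto_trunc Ψ)
    (Eventually.of_forall fun N => particleLE_le_finiteParticle N (trunc_mem N Ψ))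

/-- The field operators `a*(x) + a(x)`. -/
def fockSystem : FieldSystem (Lp ℂ 2 (volume : Measure Space)) Fock where
  D := finiteParticle
  level := particleLE
  mem_D := fun _ => mem_finiteParticle
  dense_D := dense_finiteParticle
  op := fieldOp
  op_add := fieldOp_add
  op_smul := fun c x => fieldOp_smul x c
  op_symm := inner_fieldOp
  op_level := fun x _ _ h => fieldOp_mem x h
  op_norm := fun x _ _ h => norm_fieldOp_le x h

/-- The Weyl operator `exp (i (a*(x) + a(x)))`. -/
def weyl (x : Lp ℂ 2 (volume : Measure Space)) : Fock ≃ₗᵢ[ℂ] Fock := fockSystem.exp x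

/-! ### Truncations of creation and annihilation operators -/

lemma creationFun_trunc (F : Space → Electron →L[ℂ] Electron) (N : ℕ) (Ψ : Config → Electron)
    (q : Config) :
    creationFun F (fun q => (if q.1 ≤ N then (1 : ℂ) else 0) • Ψ q) q =
      (if q.1 ≤ N + 1 then (1 : ℂ) else 0) • creationFun F Ψ q := by
  rcases q with ⟨_ | n, k⟩
  · simp [creationFun]
  · simp only [creationFun, map_smul, add_le_add_iff_right]
    by_cases hn : n ≤ N
    · simp only [if_pos hn, one_smul]
    · simp only [if_neg hn, zero_smul, Finset.sum_const_zero, smul_zero]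

lemma annihilationIntegrand_trunc (F : Space → Electron →L[ℂ] Electron) (N : ℕ)
    (Ψ : Config → Electron) (q : Config) :
    annihilationIntegrand F (fun q => (if q.1 ≤ N + 1 then (1 : ℂ) else 0) • Ψ q) q =
      fun k => (if q.1 ≤ N then (1 : ℂ) else 0) • annihilationIntegrand F Ψ q k := by
  funext k
  simp only [annihilationIntegrand, map_smul, add_le_add_iff_right]

lemma creation_graph_trunc {F : Space → Electron →L[ℂ] Electron} {Ψ Φ : Fock}
    (h : (Ψ, Φ) ∈ (creation F).graph) (N : ℕ) :
    (trunc N Ψ, trunc (N + 1) Φ) ∈ (creation F).graph := by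
  refine pair_mem_creation_graph.2 ?_
  filter_upwards [pair_mem_creation_graph.1 h, val_trunc (N + 1) Φ,
    creationFun_congr F (val_trunc N Ψ)] with q h1 h2 h3
  rw [h2, h3, creationFun_trunc, h1]

/-- Each configuration has a finite number of photons, and the truncation at that number already
sees the values that matter there. -/
lemma creation_graph_of_trunc {F : Space → Electron →L[ℂ] Electron} {Ψ Φ : Fock}
    (h : ∀ N, (trunc N Ψ, trunc (N + 1) Φ) ∈ (creation F).graph) :
    (Ψ, Φ) ∈ (creation F).graph := by
  refine pair_mem_creation_graph.2 ?_
  filter_upwards [ae_all_iff.2 fun N => pair_mem_creation_graph.1 (h N),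
    ae_all_iff.2 fun N => val_trunc (N + 1) Φ,
    ae_all_iff.2 fun N => creationFun_congr F (val_trunc N Ψ)] with q h1 h2 h3
  have h4 := h1 q.1
  rw [h2, h3, creationFun_trunc, if_pos (Nat.le_succ _), one_smul, one_smul] at h4
  exact h4

lemma annihilation_graph_trunc {F : Space → Electron →L[ℂ] Electron} {Ψ Φ : Fock}
    (h : (Ψ, Φ) ∈ (annihilation F).graph) (N : ℕ) :
    (trunc (N + 1) Ψ, trunc N Φ) ∈ (annihilation F).graph := by
  refine pair_mem_annihilation_graph.2 ?_
  filter_upwards [pair_mem_annihilation_graph.1 h, val_trunc N Φ,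
    annihilationIntegrand_congr F (val_trunc (N + 1) Ψ)] with q h1 h2 h3
  rw [annihilationIntegrand_trunc] at h3
  refine ⟨(h1.1.smul (if q.1 ≤ N then (1 : ℂ) else 0)).congr h3.symm, ?_⟩
  rw [h2, annihilationFun, integral_congr_ae h3, integral_smul, h1.2, smul_comm, annihilationFun]

lemma annihilation_graph_of_trunc {F : Space → Electron →L[ℂ] Electron} {Ψ Φ : Fock}
    (h : ∀ N, (trunc (N + 1) Ψ, trunc N Φ) ∈ (annihilation F).graph) :
    (Ψ, Φ) ∈ (annihilation F).graph := by
  refine pair_mem_annihilation_graph.2 ?_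
  filter_upwards [ae_all_iff.2 fun N => pair_mem_annihilation_graph.1 (h N),
    ae_all_iff.2 fun N => val_trunc N Φ,
    ae_all_iff.2 fun N => annihilationIntegrand_congr F (val_trunc (N + 1) Ψ)] with q h1 h2 h3
  obtain ⟨h4, h5⟩ := h1 q.1
  have h6 := h3 q.1
  rw [annihilationIntegrand_trunc] at h6
  simp only [le_refl, if_true, one_smul] at h6
  refine ⟨h4.congr h6, ?_⟩
  rw [h2, if_pos le_rfl, one_smul, annihilationFun, integral_congr_ae h6] at h5
  exact h5

lemma inner_trunc {N : ℕ} {χ : Fock} (h : χ ∈ particleLE N) (Ψ : Fock) :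
    inner ℂ χ (trunc N Ψ) = inner ℂ χ Ψ := by
  rw [inner_fock, inner_fock]
  refine integral_congr_ae ?_
  filter_upwards [mem_particleLE.1 h, val_trunc N Ψ] with q h1 h2
  rw [h2]
  by_cases hN : q.1 ≤ N
  · rw [if_pos hN, one_smul]
  · rw [h1 (not_le.1 hN), inner_zero_left, inner_zero_left]

variable (F : Lp BOp 2 (volume : Measure Space))

/-- `trunc N Ψ`, as a vector with finitely many photons. -/
def truncFin (N : ℕ) (Ψ : Fock) : finiteParticle :=
  ⟨trunc N Ψ, particleLE_le_finiteParticle N (trunc_mem N Ψ)⟩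

lemma cr_truncFin {Ψ Φ : Fock} (h : (Ψ, Φ) ∈ (creation F).graph) (N : ℕ) :
    (cr F (truncFin N Ψ) : Fock) = trunc (N + 1) Φ :=
  creation_graph_unique (cr_graph F _) (creation_graph_trunc h N)

lemma an_truncFin {Ψ Φ : Fock} (h : (Ψ, Φ) ∈ (annihilation F).graph) (N : ℕ) :
    (an F (truncFin (N + 1) Ψ) : Fock) = trunc N Φ :=
  annihilation_graph_unique (an_graph F _) (annihilation_graph_trunc h N)

/-- The maximal creation operator is the adjoint of the annihilation operator on finitely many
photons. For the converse, the defect of each truncation again has finitely many photons and is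
tested against itself. Closedness of the graph follows, as an intersection of closed conditions. -/
lemma mem_creation_graph_iff_inner {Ψ Φ : Fock} : (Ψ, Φ) ∈ (creation F).graph ↔
    ∀ χ : finiteParticle, inner ℂ (an F χ : Fock) Ψ = inner ℂ (χ : Fock) Φ := by
  constructor
  · intro h χ
    obtain ⟨N, hN⟩ := mem_finiteParticle.1 χ.2
    have hN1 := particleLE_mono (Nat.le_succ N) hN
    have h2 := annihilation_mem_particleLE (an_graph F χ) hN1
    rw [← inner_trunc hN1, ← cr_truncFin F h, ← inner_an, ← inner_trunc h2]
    rfl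
  · intro h
    refine creation_graph_of_trunc fun N => ?_
    have hm : trunc (N + 1) Φ - (cr F (truncFin N Ψ) : Fock) ∈ particleLE (N + 1) :=
      (particleLE (N + 1)).sub_mem (trunc_mem _ _) (cr_mem F (trunc_mem N Ψ))
    let χ : finiteParticle := ⟨_, particleLE_le_finiteParticle _ hm⟩
    have h2 : (an F χ : Fock) ∈ particleLE N := annihilation_mem_particleLE (an_graph F χ) hm
    have h3 : inner ℂ (χ : Fock) (χ : Fock) = (0 : ℂ) := by
      have h4 : inner ℂ (χ : Fock) (trunc (N + 1) Φ - (cr F (truncFin N Ψ) : Fock)) = (0 : ℂ) := by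
        rw [inner_sub_right, inner_trunc hm, ← h χ, ← inner_an, ← inner_trunc h2]
        exact sub_self _
      exact h4
    have h5 : (χ : Fock) = 0 := inner_self_eq_zero.1 h3
    have h6 : trunc (N + 1) Φ = (cr F (truncFin N Ψ) : Fock) := sub_eq_zero.1 h5
    rw [h6]
    exact cr_graph F (truncFin N Ψ)

lemma mem_annihilation_graph_iff_inner {Ψ Φ : Fock} : (Ψ, Φ) ∈ (annihilation F).graph ↔
    ∀ χ : finiteParticle, inner ℂ (cr F χ : Fock) Ψ = inner ℂ (χ : Fock) Φ := by
  constructor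
  · intro h χ
    obtain ⟨N, hN⟩ := mem_finiteParticle.1 χ.2
    rw [← inner_trunc hN, ← an_truncFin F h, ← inner_cr, ← inner_trunc (cr_mem F hN)]
    rfl
  · intro h
    refine annihilation_graph_of_trunc fun N => ?_
    have hm : trunc N Φ - (an F (truncFin (N + 1) Ψ) : Fock) ∈ particleLE N :=
      (particleLE N).sub_mem (trunc_mem _ _)
        (annihilation_mem_particleLE (an_graph F _) (trunc_mem (N + 1) Ψ))
    let χ : finiteParticle := ⟨_, particleLE_le_finiteParticle _ hm⟩
    have h3 : inner ℂ (χ : Fock) (χ : Fock) = (0 : ℂ) := by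
      have h4 : inner ℂ (χ : Fock) (trunc N Φ - (an F (truncFin (N + 1) Ψ) : Fock)) = (0 : ℂ) := by
        rw [inner_sub_right, inner_trunc hm, ← h χ, ← inner_cr,
          ← inner_trunc (cr_mem F (Ψ := χ) hm)]
        exact sub_self _
      exact h4
    have h5 : (χ : Fock) = 0 := inner_self_eq_zero.1 h3
    have h6 : trunc N Φ = (an F (truncFin (N + 1) Ψ) : Fock) := sub_eq_zero.1 h5
    rw [h6]
    exact an_graph F (truncFin (N + 1) Ψ)

lemma isClosed_creation_graph : IsClosed ((creation F).graph : Set (Fock × Fock)) := by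
  have h : ((creation F).graph : Set (Fock × Fock)) = ⋂ χ : finiteParticle,
      {P | inner ℂ (an F χ : Fock) P.1 = inner ℂ (χ : Fock) P.2} := by
    ext ⟨Ψ, Φ⟩
    rw [Set.mem_iInter]
    exact mem_creation_graph_iff_inner F
  rw [h]
  exact isClosed_iInter fun χ => isClosed_eq
    ((innerSL ℂ (_ : Fock)).continuous.comp continuous_fst)
    ((innerSL ℂ (_ : Fock)).continuous.comp continuous_snd)

lemma isClosed_annihilation_graph : IsClosed ((annihilation F).graph : Set (Fock × Fock)) := by
  have h : ((annihilation F).graph : Set (Fock × Fock)) = ⋂ χ : finiteParticle,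
      {P | inner ℂ (cr F χ : Fock) P.1 = inner ℂ (χ : Fock) P.2} := by
    ext ⟨Ψ, Φ⟩
    rw [Set.mem_iInter]
    exact mem_annihilation_graph_iff_inner F
  rw [h]
  exact isClosed_iInter fun χ => isClosed_eq
    ((innerSL ℂ (_ : Fock)).continuous.comp continuous_fst)
    ((innerSL ℂ (_ : Fock)).continuous.comp continuous_snd)

end

section

variable (F : Lp BOp 2 (volume : Measure Space)) (x : Lp ℂ 2 (volume : Measure Space))

/-! ### Weyl transformation of creation and annihilation operators -/

lemma weyl_mem_of_tendsto {Γ : Submodule ℂ (Fock × Fock)} (hΓ : IsClosed (Γ : Set (Fock × Fock)))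
    {a b : ℕ → Fock} {Ψ Φ : Fock} (ha : Tendsto a atTop (𝓝 Ψ)) (hb : Tendsto b atTop (𝓝 Φ))
    (h : ∀ N, (weyl x (a N), weyl x (b N)) ∈ Γ) : (weyl x Ψ, weyl x Φ) ∈ Γ :=
  hΓ.mem_of_tendsto
    ((((weyl x).continuous.tendsto _).comp ha).prodMk_nhds
      (((weyl x).continuous.tendsto _).comp hb)) (Eventually.of_forall h)

lemma weyl_mem_of_commutator {Γ : Submodule ℂ (Fock × Fock)}
    (hΓ : IsClosed (Γ : Set (Fock × Fock))) {T C : Module.End ℂ finiteParticle}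
    (hT : ∀ Ψ : finiteParticle, ((Ψ : Fock), (T Ψ : Fock)) ∈ Γ)
    (h : ∀ Ψ, T (fieldOp x Ψ) = fieldOp x (T Ψ) + C Ψ)
    (hC : ∀ Ψ, C (fieldOp x Ψ) = fieldOp x (C Ψ)) (Ψ : finiteParticle) {Φ : Fock}
    (hΦ : (T Ψ : Fock) + Complex.I • (C Ψ : Fock) = Φ) :
    (weyl x (Ψ : Fock), weyl x Φ) ∈ Γ := by
  subst hΦ
  exact fockSystem.exp_mem_of_commutator hΓ hT h hC Ψ

lemma tendsto_trunc_add (m : ℕ) (Ψ : Fock) :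
    Tendsto (fun N => trunc (N + m) Ψ) atTop (𝓝 Ψ) :=
  (tendsto_trunc Ψ).comp (tendsto_add_atTop_nat m)

/-- On finitely many photons this is `exp_mem_of_commutator` for the commutator `-∫ conj x F` with
the field operator. In general one truncates, keeping one photon more in `Φ` than in `Ψ` so that the
truncated pair stays in the graph. -/
lemma weyl_creation_graph {Ψ Φ : Fock} (h : (Ψ, Φ) ∈ (creation F).graph) :
    (weyl x Ψ, weyl x (Φ - Complex.I • liftBounded (couplingIntegral F x) Ψ)) ∈
      (creation F).graph := by
  have hb : Tendsto (fun N => trunc (N + 1) Φ - Complex.I •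
      liftBounded (couplingIntegral F x) (trunc N Ψ)) atTop
      (𝓝 (Φ - Complex.I • liftBounded (couplingIntegral F x) Ψ)) :=
    (tendsto_trunc_add 1 Φ).sub ((((liftBounded _).continuous.tendsto _).comp
      (tendsto_trunc Ψ)).const_smul _)
  refine weyl_mem_of_tendsto x (isClosed_creation_graph F) (tendsto_trunc Ψ) hb fun N => ?_
  refine weyl_mem_of_commutator x (isClosed_creation_graph F) (T := cr F)
    (C := -liftFin (couplingIntegral F x)) (cr_graph F)
    (fun Ψ => (cr_fieldOp F x Ψ).trans (sub_eq_add_neg _ _))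
    (fun Ψ => (congrArg Neg.neg (liftFin_fieldOp x _ Ψ)).trans
      (map_neg (fieldOp x) _).symm) (truncFin N Ψ) ?_
  rw [cr_truncFin F h, sub_eq_add_neg, ← smul_neg]
  rfl

lemma weyl_annihilation_graph {Ψ Φ : Fock} (h : (Ψ, Φ) ∈ (annihilation F).graph) :
    (weyl x Ψ, weyl x (Φ + Complex.I • liftBounded (star (couplingIntegral F x)) Ψ)) ∈
      (annihilation F).graph := by
  have hb : Tendsto (fun N => trunc N Φ + Complex.I •
      liftBounded (star (couplingIntegral F x)) (trunc (N + 1) Ψ)) atTop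
      (𝓝 (Φ + Complex.I • liftBounded (star (couplingIntegral F x)) Ψ)) :=
    (tendsto_trunc Φ).add ((((liftBounded _).continuous.tendsto _).comp
      (tendsto_trunc_add 1 Ψ)).const_smul _)
  refine weyl_mem_of_tendsto x (isClosed_annihilation_graph F) (tendsto_trunc_add 1 Ψ) hb
    fun N => ?_
  refine weyl_mem_of_commutator x (isClosed_annihilation_graph F) (T := an F)
    (C := liftFin (star (couplingIntegral F x))) (an_graph F) (an_fieldOp F x)
    (liftFin_fieldOp x _) (truncFin (N + 1) Ψ) ?_
  rw [an_truncFin F h]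
  rfl

/-! ### Weyl transformation of operators of the electron -/

lemma weyl_liftBounded (B : BOp) (Ψ : Fock) :
    weyl x (liftBounded B Ψ) = liftBounded B (weyl x Ψ) := by
  have hc : IsClosed (((liftBounded B : Fock →ₗ[ℂ] Fock).graph : Submodule ℂ (Fock × Fock)) :
      Set (Fock × Fock)) :=
    isClosed_eq continuous_snd ((liftBounded B).continuous.comp continuous_fst)
  have h : ∀ Ψ : finiteParticle,
      weyl x (liftBounded B (Ψ : Fock)) = liftBounded B (weyl x (Ψ : Fock)) := by
    intro Ψ
    refine weyl_mem_of_commutator x hc (T := liftFin B) (C := 0)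
      (fun _ => rfl) (fun Ψ => (liftFin_fieldOp x B Ψ).trans (add_zero _).symm)
      (fun Ψ => (map_zero (fieldOp x)).symm) Ψ ?_
    have h0 : (((0 : Module.End ℂ finiteParticle) Ψ : finiteParticle) : Fock) = 0 := rfl
    rw [h0, smul_zero, add_zero]
    rfl
  refine congrFun (Continuous.ext_on dense_finiteParticle
    ((weyl x).continuous.comp (liftBounded B).continuous)
    ((liftBounded B).continuous.comp (weyl x).continuous) fun Ψ hΨ => h ⟨Ψ, hΨ⟩) Ψ

/-- The resolvent describes the graph of the unbounded `A ⊗ 1` by a bounded operator of the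
electron, so commutation with Weyl operators reduces to `weyl_liftBounded`. -/
lemma exists_resolvent_liftElectron {A : Electron →ₗ.[ℂ] Electron} (hA : IsSelfAdjoint A) {t : ℝ}
    (ht : (t : ℂ) ∉ opSpectrum A) : ∃ R : BOp, ∀ Ψ Φ : Fock,
      (Ψ, Φ) ∈ (liftElectron A).graph ↔ Ψ = liftBounded R (Φ - (t : ℂ) • Ψ) := by
  obtain ⟨R, -, hR⟩ := exists_resolvent hA ht
  refine ⟨R, fun Ψ Φ => ?_⟩
  have h1 : val (liftBounded R (Φ - (t : ℂ) • Ψ)) =ᵐ[configMeasure]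
      fun q => R (val Φ q - (t : ℂ) • val Ψ q) := by
    filter_upwards [val_liftBounded R (Φ - (t : ℂ) • Ψ), val_sub Φ ((t : ℂ) • Ψ),
      val_smul (t : ℂ) Ψ] with q h1 h2 h3
    rw [h1, h2, h3]
  rw [mem_liftElectron_graph]
  constructor
  · intro h
    refine fock_ext ?_
    filter_upwards [h, h1] with q h2 h3
    rw [h3]
    exact (hR _ _).1 h2
  · intro h
    filter_upwards [h1] with q h3
    refine (hR _ _).2 ?_
    rw [← h3]
    exact congrArg (fun Θ => val Θ q) h

lemma weyl_liftElectron_graph {A : Electron →ₗ.[ℂ] Electron} (hA : IsSelfAdjoint A) {t : ℝ}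
    (ht : (t : ℂ) ∉ opSpectrum A) {Ψ Φ : Fock} (h : (Ψ, Φ) ∈ (liftElectron A).graph) :
    (weyl x Ψ, weyl x Φ) ∈ (liftElectron A).graph := by
  obtain ⟨R, hR⟩ := exists_resolvent_liftElectron hA ht
  rw [hR] at h ⊢
  rw [← map_smul, ← map_sub, ← weyl_liftBounded, ← h]

lemma mem_liftElectron_addBounded {A : Electron →ₗ.[ℂ] Electron} (B : BOp) {Ψ Φ : Fock} :
    (Ψ, Φ) ∈ (liftElectron (addBounded A B)).graph ↔
      (Ψ, Φ - liftBounded B Ψ) ∈ (liftElectron A).graph := by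
  have h1 : val (Φ - liftBounded B Ψ) =ᵐ[configMeasure] fun q => val Φ q - B (val Ψ q) := by
    filter_upwards [val_liftBounded B Ψ, val_sub Φ (liftBounded B Ψ)] with q h1 h2
    rw [h2, h1]
  rw [mem_liftElectron_graph, mem_liftElectron_graph]
  refine eventually_congr ?_
  filter_upwards [h1] with q h1
  rw [mem_addBounded_graph]
  exact iff_of_eq (congrArg (fun u => (val Ψ q, u) ∈ A.graph) h1.symm)

end

section

/-! ### The field energy -/

lemma pair_mem_fieldEnergy_graph {Ψ Φ : Fock} : (Ψ, Φ) ∈ fieldEnergy.graph ↔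
    ∀ᵐ q ∂configMeasure, val Φ q = (photonEnergy q : ℂ) • val Ψ q := mem_fieldEnergy_graph

lemma photonEnergy_nonneg (q : Config) : 0 ≤ photonEnergy q :=
  Finset.sum_nonneg fun _ _ => norm_nonneg _

lemma measurable_photonEnergy : Measurable photonEnergy :=
  measurable_config_iff.2 fun n => by
    change Measurable fun k : Fin n → Space => ∑ i : Fin n, ‖k i‖
    fun_prop

lemma photonEnergy_perm (n : ℕ) (σ : Equiv.Perm (Fin n)) (k : Fin n → Space) :
    photonEnergy ⟨n, k ∘ σ⟩ = photonEnergy ⟨n, k⟩ :=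
  Equiv.sum_comp σ fun i => ‖k i‖

lemma photonEnergy_removeNth {n : ℕ} (k : Fin (n + 1) → Space) (j : Fin (n + 1)) :
    photonEnergy ⟨n + 1, k⟩ = ‖k j‖ + photonEnergy ⟨n, fun i => k (j.succAbove i)⟩ :=
  Fin.sum_univ_succAbove _ j

lemma photonEnergy_cons (q : Config) (p : Space) :
    photonEnergy ⟨q.1 + 1, Fin.cons p q.2⟩ = ‖p‖ + photonEnergy q := by
  simp only [photonEnergy, Fin.sum_univ_succ, Fin.cons_zero, Fin.cons_succ]

/-- The energy is nonnegative, so multiplication by `(1 + photonEnergy)⁻¹` is a bounded resolvent at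
`-1`; this is what makes the graph closed. -/
lemma exists_resolvent_fieldEnergy : ∃ R : Fock →L[ℂ] Fock, ∀ Ψ Φ : Fock,
    (Ψ, Φ) ∈ fieldEnergy.graph ↔ Ψ = R (Φ + Ψ) := by
  have hp : ∀ q : Config, (1 + photonEnergy q : ℂ) ≠ 0 := fun q => by
    have := photonEnergy_nonneg q
    exact_mod_cast (by positivity : (1 + photonEnergy q : ℝ) ≠ 0)
  obtain ⟨R, hR, -⟩ := exists_mulOp (m := fun q => (1 + photonEnergy q : ℂ)⁻¹)
    (by have := measurable_photonEnergy; fun_prop)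
    (fun n σ k => by rw [photonEnergy_perm])
    (fun q => by
      have h0 := photonEnergy_nonneg q
      have h1 : (1 + photonEnergy q : ℂ)⁻¹ = (((1 + photonEnergy q)⁻¹ : ℝ) : ℂ) := by push_cast; rfl
      rw [h1, Complex.norm_real, Real.norm_of_nonneg (by positivity)]
      exact inv_le_one_of_one_le₀ (by linarith))
  refine ⟨R, fun Ψ Φ => ?_⟩
  have h1 : val (R (Φ + Ψ)) =ᵐ[configMeasure]
      fun q => (1 + photonEnergy q : ℂ)⁻¹ • (val Φ q + val Ψ q) := by
    filter_upwards [hR (Φ + Ψ), val_add Φ Ψ] with q h1 h2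
    rw [h1, h2]
  rw [pair_mem_fieldEnergy_graph]
  constructor
  · intro h
    refine fock_ext ?_
    filter_upwards [h, h1] with q h2 h3
    rw [h3, h2, eq_inv_smul_iff₀ (hp q)]
    module
  · intro h
    have h2 : val Ψ =ᵐ[configMeasure] val (R (Φ + Ψ)) :=
      Eventually.of_forall fun q => congrArg (fun Θ => val Θ q) h
    filter_upwards [h1, h2] with q h3 h4
    have h5 := h4.trans h3
    rw [eq_inv_smul_iff₀ (hp q)] at h5
    have h6 : val Φ q = ((1 + photonEnergy q : ℂ) • val Ψ q) - val Ψ q := by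
      rw [h5, add_sub_cancel_right]
    rw [h6]
    module

lemma isClosed_fieldEnergy_graph : IsClosed (fieldEnergy.graph : Set (Fock × Fock)) := by
  obtain ⟨R, hR⟩ := exists_resolvent_fieldEnergy
  have h : (fieldEnergy.graph : Set (Fock × Fock)) = {P | P.1 = R (P.2 + P.1)} := by
    ext ⟨Ψ, Φ⟩
    exact hR Ψ Φ
  rw [h]
  exact isClosed_eq continuous_fst (R.continuous.comp (continuous_snd.add continuous_fst))

lemma fieldEnergy_graph_trunc {Ψ Φ : Fock} (h : (Ψ, Φ) ∈ fieldEnergy.graph) (N : ℕ) :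
    (trunc N Ψ, trunc N Φ) ∈ fieldEnergy.graph := by
  refine pair_mem_fieldEnergy_graph.2 ?_
  filter_upwards [pair_mem_fieldEnergy_graph.1 h, val_trunc N Ψ, val_trunc N Φ] with q h1 h2 h3
  rw [h3, h2, h1, smul_comm]

/-! ### Commutators with the field energy -/

/-- The energy of a configuration is that of the removed photon plus that of the others, which is
the commutator `[H_f, a*(f)] = a*(ωf)`. -/
lemma creationFun_photonEnergy (f : Space → ℂ) (Ψ : Config → Electron) (q : Config) :
    (photonEnergy q : ℂ) • creationFun (scalarCoupling f) Ψ q =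
      creationFun (scalarCoupling f) (fun r => (photonEnergy r : ℂ) • Ψ r) q +
        creationFun (scalarCoupling fun k => (‖k‖ : ℂ) * f k) Ψ q := by
  rcases q with ⟨_ | n, k⟩
  · simp [creationFun]
  · simp only [creationFun]
    rw [← smul_add, ← Finset.sum_add_distrib, smul_comm, Finset.smul_sum]
    congr 1
    refine Finset.sum_congr rfl fun j _ => ?_
    rw [photonEnergy_removeNth k j]
    simp only [scalarCoupling, smul_apply, ContinuousLinearMap.id_apply]
    push_cast
    module

lemma annihilationIntegrand_photonEnergy (f : Space → ℂ) (Ψ : Config → Electron) (q : Config)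
    (p : Space) :
    annihilationIntegrand (scalarCoupling f) (fun r => (photonEnergy r : ℂ) • Ψ r) q p =
      (photonEnergy q : ℂ) • annihilationIntegrand (scalarCoupling f) Ψ q p +
        annihilationIntegrand (scalarCoupling fun k => (‖k‖ : ℂ) * f k) Ψ q p := by
  simp only [annihilationIntegrand_scalar, photonEnergy_cons, map_mul, Complex.conj_ofReal]
  push_cast
  module

variable {x y : Lp ℂ 2 (volume : Measure Space)}

lemma scalarCoupling_ae (hy : (y : Space → ℂ) =ᵐ[volume] fun k => (‖k‖ : ℂ) * x k) :
    scalarCoupling y =ᵐ[volume] scalarCoupling fun k => (‖k‖ : ℂ) * x k := by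
  filter_upwards [hy] with k hk
  rw [scalarCoupling, hk, scalarCoupling]

lemma fieldEnergy_cr (hy : (y : Space → ℂ) =ᵐ[volume] fun k => (‖k‖ : ℂ) * x k)
    {Ψ Φ : finiteParticle} (h : ((Ψ : Fock), (Φ : Fock)) ∈ fieldEnergy.graph) :
    ((cr (sc x) Ψ : Fock), (cr (sc x) Φ : Fock) + (cr (sc y) Ψ : Fock)) ∈ fieldEnergy.graph := by
  refine pair_mem_fieldEnergy_graph.2 ?_
  filter_upwards [val_cr_sc x Ψ, val_cr_sc x Φ,
    creationFun_congr (scalarCoupling x) (pair_mem_fieldEnergy_graph.1 h),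
    val_add (cr (sc x) Φ : Fock) (cr (sc y) Ψ : Fock),
    pair_mem_creation_graph.1 (creation_graph_congr (scalarCoupling_ae hy) (cr_sc_graph y Ψ))]
    with q h1 h2 h3 h4 h5
  rw [h4, h1, h2, h5, h3, creationFun_photonEnergy]

lemma fieldEnergy_an (hy : (y : Space → ℂ) =ᵐ[volume] fun k => (‖k‖ : ℂ) * x k)
    {Ψ Φ : finiteParticle} (h : ((Ψ : Fock), (Φ : Fock)) ∈ fieldEnergy.graph) :
    ((an (sc x) Ψ : Fock), (an (sc x) Φ : Fock) - (an (sc y) Ψ : Fock)) ∈ fieldEnergy.graph := by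
  refine pair_mem_fieldEnergy_graph.2 ?_
  filter_upwards [val_an_sc x Ψ, val_an_sc x Φ,
    annihilationIntegrand_congr (scalarCoupling x) (pair_mem_fieldEnergy_graph.1 h),
    val_sub (an (sc x) Φ : Fock) (an (sc y) Ψ : Fock),
    pair_mem_annihilation_graph.1
      (annihilation_graph_congr (scalarCoupling_ae hy) (an_sc_graph y Ψ))]
    with q h1 h2 h3 h4 h5
  rw [h4, h1.2, h2.2, h5.2, annihilationFun, annihilationFun, annihilationFun,
    integral_congr_ae h3]
  have h6 : ∫ p, annihilationIntegrand (scalarCoupling x)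
      (fun r => (photonEnergy r : ℂ) • val (Ψ : Fock) r) q p =
      (photonEnergy q : ℂ) • (∫ p, annihilationIntegrand (scalarCoupling x) (val (Ψ : Fock)) q p) +
        ∫ p, annihilationIntegrand (scalarCoupling fun k => (‖k‖ : ℂ) * x k) (val (Ψ : Fock)) q p := by
    have hs : Integrable (fun p => (photonEnergy q : ℂ) •
        annihilationIntegrand (scalarCoupling x) (val (Ψ : Fock)) q p) volume :=
      (h1.1.smul (photonEnergy q : ℂ)).congr (Eventually.of_forall fun _ => rfl)
    rw [← integral_smul, ← integral_add hs h5.1]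
    exact integral_congr_ae (Eventually.of_forall
      (annihilationIntegrand_photonEnergy x (val (Ψ : Fock)) q))
  rw [h6]
  module

lemma fieldEnergy_fieldOp (hy : (y : Space → ℂ) =ᵐ[volume] fun k => (‖k‖ : ℂ) * x k)
    {Ψ Φ : finiteParticle}
    (h : ((Ψ : Fock), (Φ : Fock)) ∈ fieldEnergy.graph) :
    ((fieldOp x Ψ : Fock), ((fieldOp x Φ + (cr (sc y) - an (sc y)) Ψ : finiteParticle) : Fock)) ∈
      fieldEnergy.graph := by
  have h1 := fieldEnergy.graph.add_mem (fieldEnergy_cr hy h) (fieldEnergy_an hy h)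
  have h2 : (cr (sc x) Φ : Fock) + (cr (sc y) Ψ : Fock) +
      ((an (sc x) Φ : Fock) - (an (sc y) Ψ : Fock)) =
      ((fieldOp x Φ + (cr (sc y) - an (sc y)) Ψ : finiteParticle) : Fock) := by
    change _ = (cr (sc x) Φ : Fock) + (an (sc x) Φ : Fock) +
      ((cr (sc y) Ψ : Fock) - (an (sc y) Ψ : Fock))
    abel
  rw [← h2]
  exact h1

lemma couplingIntegral_sc : couplingIntegral (sc y) x = (inner ℂ x y : ℂ) • (1 : BOp) := by
  ext1 u
  rw [couplingIntegral_apply_apply, smul_apply, one_apply_eq_self, L2.inner_def,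
    ← integral_smul_const]
  refine integral_congr_ae ?_
  filter_upwards [coeFn_sc y] with k hk
  rw [hk, scalarCoupling, smul_apply, ContinuousLinearMap.id_apply, smul_smul, RCLike.inner_apply,
    mul_comm]

/-- Creation and annihilation each contribute `-⟨x, y⟩`, a real number because `y = ωx`. The second
commutator of `H_f` with the field operator is therefore the constant `-2 ⟨x, y⟩`. -/
lemma number_fieldOp (hy : (y : Space → ℂ) =ᵐ[volume] fun k => (‖k‖ : ℂ) * x k)
    (Ψ : finiteParticle) :
    (cr (sc y) - an (sc y)) (fieldOp x Ψ) =
      fieldOp x ((cr (sc y) - an (sc y)) Ψ) + (-2 * (inner ℂ x y : ℂ)) • Ψ := by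
  have h1 : star (couplingIntegral (sc y) x) = (inner ℂ x y : ℂ) • (1 : BOp) := by
    rw [couplingIntegral_sc, star_smul, star_one, inner_weighted hy]
    congr 1
    exact Complex.conj_ofReal _
  have h2 : ∀ c : ℂ, liftFin (c • (1 : BOp)) Ψ = c • Ψ := by
    intro c
    refine Subtype.ext (fock_ext ?_)
    filter_upwards [val_liftBounded (c • (1 : BOp)) (Ψ : Fock), val_smul c (Ψ : Fock)] with q h3 h4
    exact h3.trans h4.symm
  rw [LinearMap.sub_apply, LinearMap.sub_apply, cr_fieldOp, an_fieldOp, h1, couplingIntegral_sc,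
    h2, map_sub]
  module

lemma weyl_fieldEnergy_fin (hy : (y : Space → ℂ) =ᵐ[volume] fun k => (‖k‖ : ℂ) * x k)
    {Ψ Φ : finiteParticle}
    (h : ((Ψ : Fock), (Φ : Fock)) ∈ fieldEnergy.graph) :
    (weyl x (Ψ : Fock), weyl x ((Φ : Fock) +
      Complex.I • ((cr (sc y) Ψ : Fock) - (an (sc y) Ψ : Fock)) + (inner ℂ x y : ℂ) • (Ψ : Fock))) ∈
      fieldEnergy.graph := by
  have h1 := fockSystem.exp_mem_of_second_commutator isClosed_fieldEnergy_graph
    (P := cr (sc y) - an (sc y)) (x := x) (fun _ _ => fieldEnergy_fieldOp hy) (number_fieldOp hy) h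
  have h2 : ∀ a b : Fock, a - (-2 * (inner ℂ x y : ℂ) / 2) • b = a + (inner ℂ x y : ℂ) • b := by
    intro a b
    rw [sub_eq_add_neg, ← neg_smul]
    congr 2
    ring
  have h3 : (Φ : Fock) + Complex.I • ((cr (sc y) Ψ : Fock) - (an (sc y) Ψ : Fock)) +
      (inner ℂ x y : ℂ) • (Ψ : Fock) = (Φ : Fock) + Complex.I •
      (((cr (sc y) - an (sc y)) Ψ : finiteParticle) : Fock) -
        (-2 * (inner ℂ x y : ℂ) / 2) • (Ψ : Fock) := (h2 _ _).symm
  rw [h3]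
  exact h1

lemma weyl_fieldEnergy_graph (hy : (y : Space → ℂ) =ᵐ[volume] fun k => (‖k‖ : ℂ) * x k)
    {Ψ Φ Φ₁ Φ₂ : Fock} (h : (Ψ, Φ) ∈ fieldEnergy.graph)
    (h₁ : (Ψ, Φ₁) ∈ (creation (sc y)).graph) (h₂ : (Ψ, Φ₂) ∈ (annihilation (sc y)).graph) :
    (weyl x Ψ, weyl x (Φ + Complex.I • (Φ₁ - Φ₂) + (inner ℂ x y : ℂ) • Ψ)) ∈
      fieldEnergy.graph := by
  -- The cut-offs `N + 2` and `N` are those at which the truncations of `Φ₁` and `Φ₂` are exactly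
  -- the images of `trunc (N + 1) Ψ`.
  have hb : Tendsto (fun N => trunc (N + 1) Φ + Complex.I • (trunc (N + 2) Φ₁ - trunc N Φ₂) +
      (inner ℂ x y : ℂ) • trunc (N + 1) Ψ) atTop
      (𝓝 (Φ + Complex.I • (Φ₁ - Φ₂) + (inner ℂ x y : ℂ) • Ψ)) :=
    ((tendsto_trunc_add 1 Φ).add (((tendsto_trunc_add 2 Φ₁).sub
      (tendsto_trunc Φ₂)).const_smul _)).add ((tendsto_trunc_add 1 Ψ).const_smul _)
  refine weyl_mem_of_tendsto x isClosed_fieldEnergy_graph (tendsto_trunc_add 1 Ψ) hb fun N => ?_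
  have h1 := weyl_fieldEnergy_fin hy (Ψ := truncFin (N + 1) Ψ) (Φ := truncFin (N + 1) Φ)
    (fieldEnergy_graph_trunc h (N + 1))
  rw [cr_truncFin _ h₁, an_truncFin _ h₂] at h1
  exact h1

end

section

/-! ### Relative bounds with respect to the field energy -/

lemma enorm_photonEnergy (q : Config) : ‖photonEnergy q‖ₑ = weight (fun k => ‖k‖ₑ) q := by
  rw [Real.enorm_eq_ofReal (photonEnergy_nonneg q), photonEnergy,
    ENNReal.ofReal_sum_of_nonneg fun _ _ => norm_nonneg _]
  simp only [weight, ofReal_norm]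

/-- The weighted norm is the quadratic form of `H_f`, and `w ≤ 1 + w²`. -/
lemma weightNorm_norm_le {Ψ Φ : Fock} (h : (Ψ, Φ) ∈ fieldEnergy.graph) :
    weightNorm (fun k => ‖k‖ₑ) Ψ ≤ ‖Ψ‖ₑ ^ 2 + ‖Φ‖ₑ ^ 2 := by
  rw [weightNorm, enorm_sq_fock, enorm_sq_fock_congr (pair_mem_fieldEnergy_graph.1 h),
    ← lintegral_add_left' ((val_aesm Ψ).enorm.pow_const 2)]
  refine lintegral_mono fun q => ?_
  have h1 : ‖(photonEnergy q : ℂ)‖ₑ = weight (fun k => ‖k‖ₑ) q := by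
    rw [← enorm_photonEnergy, ← ofReal_norm, ← ofReal_norm, Complex.norm_real]
  rw [enorm_smul, h1, mul_pow]
  set w := weight (fun k => ‖k‖ₑ) q
  have h2 : w ≤ 1 + w ^ 2 := by
    rcases le_total w 1 with h | h
    · exact h.trans le_self_add
    · exact (le_self_pow₀ h two_ne_zero).trans le_add_self
  calc w * ‖val Ψ q‖ₑ ^ 2 ≤ (1 + w ^ 2) * ‖val Ψ q‖ₑ ^ 2 := by gcongr
    _ = _ := by rw [add_mul, one_mul]

variable {F F' : Lp BOp 2 (volume : Measure Space)}

/-- With `F = |k| F'` the integrand is `‖F‖ ‖F'‖`, so square integrability at the exponents `0` and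
`-1` gives the one at `-1/2`. -/
lemma lintegral_inv_norm_le (hF : (F : Space → BOp) =ᵐ[volume] fun k => (‖k‖ : ℂ) • F' k) :
    ∫⁻ k, ‖F k‖ₑ ^ 2 * ‖k‖ₑ⁻¹ ≤ ‖F‖ₑ ^ 2 + ‖F'‖ₑ ^ 2 := by
  rw [enorm_sq_Lp, enorm_sq_Lp,
    ← lintegral_add_left' ((Lp.aestronglyMeasurable F).enorm.pow_const 2)]
  refine lintegral_mono_ae ?_
  filter_upwards [hF, ae_norm_ne_zero] with k h1 h2
  have h3 : ‖k‖ₑ ≠ 0 := by simpa using h2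
  have h4 : ‖F k‖ₑ = ‖k‖ₑ * ‖F' k‖ₑ := by
    rw [h1, enorm_smul]
    congr 1
    rw [← ofReal_norm, Complex.norm_real, norm_norm, ofReal_norm]
  have h5 : ‖F k‖ₑ ^ 2 * ‖k‖ₑ⁻¹ = ‖F k‖ₑ * ‖F' k‖ₑ := by
    rw [pow_two, mul_assoc]
    nth_rewrite 2 [h4]
    rw [mul_comm ‖k‖ₑ, mul_assoc, ENNReal.mul_inv_cancel h3 enorm_ne_top, mul_one]
  rw [h5]
  rcases le_total ‖F k‖ₑ ‖F' k‖ₑ with h | h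
  · calc _ ≤ ‖F' k‖ₑ * ‖F' k‖ₑ := by gcongr
      _ ≤ _ := by rw [← pow_two]; exact le_add_self
  · calc _ ≤ ‖F k‖ₑ * ‖F k‖ₑ := by gcongr
      _ ≤ _ := by rw [← pow_two]; exact le_self_add

/-- The estimate with weight `v = |k|`. It puts the domain of `H_f` inside that of the creation
operator, so the interaction does not shrink the domain of the Hamiltonian. -/
lemma exists_creation_of_fieldEnergy
    (hF : (F : Space → BOp) =ᵐ[volume] fun k => (‖k‖ : ℂ) • F' k) {Ψ Φ : Fock}
    (h : (Ψ, Φ) ∈ fieldEnergy.graph) : ∃ Φ', (Ψ, Φ') ∈ (creation F).graph ∧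
      ‖Φ'‖ₑ ^ 2 ≤ (‖F‖ₑ ^ 2 + ‖F'‖ₑ ^ 2) * (2 * ‖Ψ‖ₑ ^ 2 + ‖Φ‖ₑ ^ 2) := by
  have h1 := lintegral_inv_norm_le hF
  have h2 := weightNorm_norm_le h
  obtain ⟨Φ', h3, h4⟩ := exists_creation (Lp.aestronglyMeasurable F) (v := fun k => ‖k‖ₑ)
    (by fun_prop) (by
      filter_upwards [ae_norm_ne_zero] with k hk
      exact ⟨by simpa using hk, enorm_ne_top⟩) (lintegral_enorm_sq_ne_top F)
    (ne_top_of_le_ne_top (by finiteness) h1) (ne_top_of_le_ne_top (by finiteness) h2)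
  refine ⟨Φ', h3, h4.trans ?_⟩
  rw [← enorm_sq_Lp]
  calc _ ≤ (‖F‖ₑ ^ 2 + ‖F'‖ₑ ^ 2) * ‖Ψ‖ₑ ^ 2 +
        (‖F‖ₑ ^ 2 + ‖F'‖ₑ ^ 2) * (‖Ψ‖ₑ ^ 2 + ‖Φ‖ₑ ^ 2) := by
        gcongr
        exact le_self_add
    _ = _ := by ring

lemma exists_annihilation_of_fieldEnergy
    (hF : (F : Space → BOp) =ᵐ[volume] fun k => (‖k‖ : ℂ) • F' k) {Ψ Φ : Fock}
    (h : (Ψ, Φ) ∈ fieldEnergy.graph) : ∃ Φ', (Ψ, Φ') ∈ (annihilation F).graph ∧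
      ‖Φ'‖ₑ ^ 2 ≤ (‖F‖ₑ ^ 2 + ‖F'‖ₑ ^ 2) * (2 * ‖Ψ‖ₑ ^ 2 + ‖Φ‖ₑ ^ 2) := by
  have h1 := lintegral_inv_norm_le hF
  have h2 := weightNorm_norm_le h
  obtain ⟨Φ', h3, h4⟩ := exists_annihilation (Lp.aestronglyMeasurable F) (v := fun k => ‖k‖ₑ)
    (by fun_prop) (by
      filter_upwards [ae_norm_ne_zero] with k hk
      exact ⟨by simpa using hk, enorm_ne_top⟩)
    (ne_top_of_le_ne_top (by finiteness) h1) (ne_top_of_le_ne_top (by finiteness) h2)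
  refine ⟨Φ', h3, h4.trans ?_⟩
  gcongr
  exact h2.trans (by rw [two_mul, add_assoc]; exact le_add_self)

lemma coeFn_sc_energy {x y : Lp ℂ 2 (volume : Measure Space)}
    (hy : (y : Space → ℂ) =ᵐ[volume] fun k => (‖k‖ : ℂ) * x k) :
    (sc y : Space → BOp) =ᵐ[volume] fun k => (‖k‖ : ℂ) • sc x k := by
  filter_upwards [hy, coeFn_sc x, coeFn_sc y] with k h1 h2 h3
  rw [h3, h2, scalarCoupling, h1, scalarCoupling, smul_smul]

/-! ### The interaction as a function of a scalar coupling -/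

lemma interaction_graph_add {K K' : Space → BOp} {Ψ Φ Φ' : Fock}
    (h : (Ψ, Φ) ∈ (interaction K).graph) (h' : (Ψ, Φ') ∈ (interaction K').graph) :
    (Ψ, Φ + Φ') ∈ (interaction fun k => K k + K' k).graph := by
  obtain ⟨a, b, ha, hb, rfl⟩ := mem_add_graph.1 h
  obtain ⟨a', b', ha', hb', rfl⟩ := mem_add_graph.1 h'
  exact mem_add_graph.2 ⟨a + a', b + b', creation_graph_add ha ha', annihilation_graph_add hb hb',
    by abel⟩

lemma interaction_graph_real_smul (c : ℝ) {K : Space → BOp} {Ψ Φ : Fock}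
    (h : (Ψ, Φ) ∈ (interaction K).graph) :
    (Ψ, c • Φ) ∈ (interaction fun k => (c : ℂ) • K k).graph := by
  obtain ⟨a, b, ha, hb, rfl⟩ := mem_add_graph.1 h
  have h1 := annihilation_graph_smul (c : ℂ) hb
  rw [Complex.conj_ofReal] at h1
  refine mem_add_graph.2 ⟨_, _, creation_graph_smul (c : ℂ) ha, h1, ?_⟩
  rw [← smul_add]
  rfl

lemma interaction_congr {K K' : Space → BOp} (h : K =ᵐ[volume] K') :
    interaction K = interaction K' := by
  rw [interaction, interaction, creation_congr h, annihilation_congr h]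

lemma exists_multiplier {m : Space → ℂ} (hm : Measurable m) (hb : ∀ k, ‖m k‖ ≤ 1) :
    ∃ T : Lp ℂ 2 (volume : Measure Space) →L[ℂ] Lp ℂ 2 (volume : Measure Space),
      (∀ u, (T u : Space → ℂ) =ᵐ[volume] fun k => m k * u k) ∧ ∀ u, ‖T u‖ ≤ ‖u‖ := by
  have hm' : MemLp m ∞ volume :=
    memLp_top_of_bound hm.aestronglyMeasurable 1 (Eventually.of_forall hb)
  have h1 : ∀ u, ((ContinuousLinearMap.mul ℂ ℂ).holderL (volume : Measure Space) ∞ 2 2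
      (hm'.toLp m) u : Space → ℂ) =ᵐ[volume] fun k => m k * u k := by
    intro u
    filter_upwards [(ContinuousLinearMap.mul ℂ ℂ).coeFn_holder (r := 2) (hm'.toLp m) u,
      hm'.coeFn_toLp] with k h1 h2
    refine h1.trans ?_
    rw [h2]
    rfl
  refine ⟨_, h1, fun u => Lp.norm_le_norm_of_ae_le ?_⟩
  filter_upwards [h1 u] with k hk
  rw [hk, norm_mul]
  exact mul_le_of_le_one_left (norm_nonneg _) (hb k)

lemma interaction_graph_unique {K : Space → BOp} {Ψ Φ Φ' : Fock}
    (h : (Ψ, Φ) ∈ (interaction K).graph) (h' : (Ψ, Φ') ∈ (interaction K).graph) : Φ = Φ' :=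
  (interaction K).mem_graph_snd_inj h h' rfl

lemma interaction_graph_sc_zero (Ψ : Fock) : (Ψ, 0) ∈ (interaction (sc 0)).graph := by
  have h1 : creationFun (0 : Space → BOp) (val Ψ) = fun _ => 0 := by
    funext q
    rcases q with ⟨_ | n, k⟩ <;> simp [creationFun]
  have h2 : ∀ q, annihilationIntegrand (0 : Space → BOp) (val Ψ) q = fun _ => 0 := by
    intro q
    funext k
    simp [annihilationIntegrand]
  have h3 : (Ψ, 0) ∈ (creation (0 : Space → BOp)).graph :=
    pair_mem_creation_graph.2 (h1 ▸ val_zero)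
  have h4 : (Ψ, 0) ∈ (annihilation (0 : Space → BOp)).graph := by
    refine pair_mem_annihilation_graph.2 ?_
    filter_upwards [val_zero] with q hq
    rw [annihilationFun, h2, hq, integral_zero, smul_zero]
    exact ⟨integrable_zero _ _ _, rfl⟩
  have h5 : (Ψ, (0 : Fock)) ∈ (interaction (0 : Space → BOp)).graph :=
    mem_add_graph.2 ⟨0, 0, h3, h4, add_zero 0⟩
  have h6 : (0 : Space → BOp) =ᵐ[volume] sc 0 := by
    rw [map_zero]
    exact (Lp.coeFn_zero _ _ _).symm
  rwa [interaction_congr h6] at h5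

variable {S T : Lp ℂ 2 (volume : Measure Space) →L[ℂ] Lp ℂ 2 (volume : Measure Space)}

/-- The relation `Φ = (a*(T u) + a(T u)) Ψ` between `u` and `Φ`. -/
def interactionRelation (T : Lp ℂ 2 (volume : Measure Space) →L[ℂ] Lp ℂ 2 (volume : Measure Space))
    (Ψ : Fock) : Submodule ℝ (Lp ℂ 2 (volume : Measure Space) × Fock) where
  carrier := {P | (Ψ, P.2) ∈ (interaction (sc (T P.1))).graph}
  zero_mem' := by
    change (Ψ, (0 : Fock)) ∈ (interaction (sc (T 0))).graph
    rw [map_zero]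
    exact interaction_graph_sc_zero Ψ
  add_mem' := by
    rintro ⟨u, a⟩ ⟨v, b⟩ ha hb
    have h1 := interaction_graph_add ha hb
    have h2 : (fun k => sc (T u) k + sc (T v) k) =ᵐ[volume] sc (T (u + v)) := by
      rw [map_add, map_add]
      exact (Lp.coeFn_add (sc (T u)) (sc (T v))).symm
    rwa [interaction_congr h2] at h1
  smul_mem' := by
    rintro c ⟨u, a⟩ ha
    have h1 := interaction_graph_real_smul c ha
    have h2 : (fun k => (c : ℂ) • sc (T u) k) =ᵐ[volume] sc (T (c • u)) := by
      rw [real_smul_Lp, map_smul, map_smul]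
      exact (Lp.coeFn_smul (c : ℂ) (sc (T u))).symm
    rwa [interaction_congr h2] at h1

lemma norm_le_of_energy_bound {Ψ Φ a : Fock} {F F' : Lp BOp 2 (volume : Measure Space)}
    {u : Lp ℂ 2 (volume : Measure Space)} (hF : ‖F‖ ≤ ‖u‖) (hF' : ‖F'‖ ≤ ‖u‖)
    (ha : ‖a‖ₑ ^ 2 ≤ (‖F‖ₑ ^ 2 + ‖F'‖ₑ ^ 2) * (2 * ‖Ψ‖ₑ ^ 2 + ‖Φ‖ₑ ^ 2)) :
    ‖a‖ ≤ Real.sqrt (2 * (2 * ‖Ψ‖ ^ 2 + ‖Φ‖ ^ 2)) * ‖u‖ := by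
  refine enorm_le_of_sq_le (Real.sqrt_nonneg _) (ha.trans ?_)
  have h1 : ‖F‖ₑ ≤ ‖u‖ₑ := enorm_le_iff_norm_le.2 hF
  have h2 : ‖F'‖ₑ ≤ ‖u‖ₑ := enorm_le_iff_norm_le.2 hF'
  have h3 : ENNReal.ofReal (Real.sqrt (2 * (2 * ‖Ψ‖ ^ 2 + ‖Φ‖ ^ 2)) ^ 2) =
      2 * (2 * ‖Ψ‖ₑ ^ 2 + ‖Φ‖ₑ ^ 2) := by
    rw [Real.sq_sqrt (by positivity), ENNReal.ofReal_mul (by positivity),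
      ENNReal.ofReal_add (by positivity) (by positivity), ENNReal.ofReal_mul (by positivity),
      ENNReal.ofReal_pow (norm_nonneg _), ENNReal.ofReal_pow (norm_nonneg _), ofReal_norm,
      ofReal_norm, ENNReal.ofReal_ofNat]
  rw [h3]
  calc _ ≤ (‖u‖ₑ ^ 2 + ‖u‖ₑ ^ 2) * (2 * ‖Ψ‖ₑ ^ 2 + ‖Φ‖ₑ ^ 2) := by gcongr
    _ = _ := by ring

/-- The energy bound is linear in the norm of `u`, so for fixed `Ψ` in the domain of `H_f` the
relation is the graph of a bounded map. It is real-linear only, because of the annihilation part. -/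
lemma exists_interaction_clm_of_multiplier
    (hST : ∀ u, (T u : Space → ℂ) =ᵐ[volume] fun k => (‖k‖ : ℂ) * S u k)
    (hS : ∀ u, ‖S u‖ ≤ ‖u‖) (hT : ∀ u, ‖T u‖ ≤ ‖u‖) {Ψ Φ : Fock}
    (hΨ : (Ψ, Φ) ∈ fieldEnergy.graph) : ∃ L : Lp ℂ 2 (volume : Measure Space) →L[ℝ] Fock,
      ∀ u, (Ψ, L u) ∈ (interaction (sc (T u))).graph := by
  obtain ⟨L, hL, -⟩ := exists_clm_of_graph (interactionRelation T Ψ)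
    (2 * Real.sqrt (2 * (2 * ‖Ψ‖ ^ 2 + ‖Φ‖ ^ 2))) (by
    intro a ha
    have h1 : (Ψ, a) ∈ (interaction (sc (T 0))).graph := ha
    rw [map_zero] at h1
    exact interaction_graph_unique h1 (interaction_graph_sc_zero Ψ)) (by
    intro u
    obtain ⟨a, ha, ha1⟩ := exists_creation_of_fieldEnergy (coeFn_sc_energy (hST u)) hΨ
    obtain ⟨b, hb, hb1⟩ := exists_annihilation_of_fieldEnergy (coeFn_sc_energy (hST u)) hΨ
    have h1 : ‖sc (T u)‖ ≤ ‖u‖ := (norm_sc_le _).trans (hT u)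
    have h2 : ‖sc (S u)‖ ≤ ‖u‖ := (norm_sc_le _).trans (hS u)
    have h3 := norm_le_of_energy_bound h1 h2 ha1
    have h4 := norm_le_of_energy_bound h1 h2 hb1
    refine ⟨a + b, mem_add_graph.2 ⟨a, b, ha, hb, rfl⟩, (norm_add_le _ _).trans ?_⟩
    linarith)
  exact ⟨L, hL⟩

/-- For `Ψ` in the domain of the field energy, `Φ(ω h) Ψ` depends continuously on `h + ω h`. -/
lemma exists_interaction_clm {Ψ Φ : Fock} (hΨ : (Ψ, Φ) ∈ fieldEnergy.graph) :
    ∃ L : Lp ℂ 2 (volume : Measure Space) →L[ℝ] Fock,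
      ∀ x y : Lp ℂ 2 (volume : Measure Space),
        ((y : Space → ℂ) =ᵐ[volume] fun k => (‖k‖ : ℂ) * x k) →
          (Ψ, L (x + y)) ∈ (interaction (sc y)).graph := by
  have hp : ∀ k : Space, (1 + ‖k‖ : ℂ) ≠ 0 := fun k => by
    exact_mod_cast (by positivity : (1 + ‖k‖ : ℝ) ≠ 0)
  have hn : ∀ k : Space, ‖(1 + ‖k‖ : ℂ)‖ = 1 + ‖k‖ := fun k => by
    rw [← Complex.ofReal_one, ← Complex.ofReal_add, Complex.norm_real,
      Real.norm_of_nonneg (by positivity)]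
  -- With `u = h + ωh`, the bounded multipliers `(1 + |k|)⁻¹` and `|k| (1 + |k|)⁻¹` recover `h` and
  -- `ωh`, so one variable `u` encodes the pair.
  obtain ⟨S, hS, hS1⟩ := exists_multiplier (m := fun k => (1 + ‖k‖ : ℂ)⁻¹) (by fun_prop) (by
    intro k
    rw [norm_inv, hn]
    exact inv_le_one_of_one_le₀ (by linarith [norm_nonneg k]))
  obtain ⟨T, hT, hT1⟩ := exists_multiplier (m := fun k => (1 + ‖k‖ : ℂ)⁻¹ * ‖k‖) (by fun_prop) (by
    intro k
    rw [norm_mul, norm_inv, hn, Complex.norm_real, norm_norm, inv_mul_le_one₀ (by positivity)]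
    linarith [norm_nonneg k])
  have hST : ∀ u, (T u : Space → ℂ) =ᵐ[volume] fun k => (‖k‖ : ℂ) * S u k := by
    intro u
    filter_upwards [hS u, hT u] with k h1 h2
    rw [h1, h2]
    ring
  obtain ⟨L, hL⟩ := exists_interaction_clm_of_multiplier hST hS1 hT1 hΨ
  refine ⟨L, fun x y hy => ?_⟩
  have h1 : T (x + y) = y := by
    refine Lp.ext ?_
    filter_upwards [hT (x + y), Lp.coeFn_add x y, hy] with k h1 h2 h3
    rw [h1, h2, Pi.add_apply, h3, mul_assoc, inv_mul_eq_iff_eq_mul₀ (hp k)]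
    ring
  have h2 := hL (x + y)
  rwa [h1] at h2

end

section

/-! ### Graphs -/

lemma mem_smul_graph {E : Type*} [AddCommGroup E] [Module ℂ E] {T : E →ₗ.[ℂ] E} {c : ℂ} {u v : E} :
    (u, v) ∈ (c • T).graph ↔ ∃ a, (u, a) ∈ T.graph ∧ c • a = v := by
  constructor
  · rw [LinearPMap.mem_graph_iff]
    rintro ⟨w, rfl, rfl⟩
    exact ⟨_, T.mem_graph w, rfl⟩
  · rintro ⟨a, ha, rfl⟩
    rw [LinearPMap.mem_graph_iff] at ha
    obtain ⟨w, rfl, rfl⟩ := ha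
    exact (c • T).mem_graph w

lemma mem_hamiltonian_graph {A : Electron →ₗ.[ℂ] Electron} {K : Space → BOp} {g : ℝ} {Ψ Φ : Fock} :
    (Ψ, Φ) ∈ (hamiltonian A K g).graph ↔ ∃ Φ₁ Φ₂ Φ₃ Φ₄, (Ψ, Φ₁) ∈ (liftElectron A).graph ∧
      (Ψ, Φ₂) ∈ fieldEnergy.graph ∧ (Ψ, Φ₃) ∈ (creation K).graph ∧
      (Ψ, Φ₄) ∈ (annihilation K).graph ∧ Φ₁ + Φ₂ + (g : ℂ) • (Φ₃ + Φ₄) = Φ := by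
  constructor
  · intro h
    obtain ⟨_, _, h1, h2, rfl⟩ := mem_add_graph.1 h
    obtain ⟨Φ₁, Φ₂, h3, h4, rfl⟩ := mem_add_graph.1 h1
    obtain ⟨_, h5, rfl⟩ := mem_smul_graph.1 h2
    obtain ⟨Φ₃, Φ₄, h6, h7, rfl⟩ := mem_add_graph.1 h5
    exact ⟨Φ₁, Φ₂, Φ₃, Φ₄, h3, h4, h6, h7, rfl⟩
  · rintro ⟨Φ₁, Φ₂, Φ₃, Φ₄, h1, h2, h3, h4, rfl⟩
    exact mem_add_graph.2 ⟨_, _, mem_add_graph.2 ⟨_, _, h1, h2, rfl⟩,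
      mem_smul_graph.2 ⟨_, mem_add_graph.2 ⟨_, _, h3, h4, rfl⟩, rfl⟩, rfl⟩

lemma mem_unitaryConj_graph {E : Type*} [NormedAddCommGroup E] [InnerProductSpace ℂ E]
    {U : E ≃ₗᵢ[ℂ] E} {T : E →ₗ.[ℂ] E} {u v : E} :
    (u, v) ∈ (unitaryConj U T).graph ↔ (U.symm u, U.symm v) ∈ T.graph := by
  constructor
  · rw [LinearPMap.mem_graph_iff]
    rintro ⟨w, rfl, rfl⟩
    have h : U.symm (unitaryConj U T w) = T ⟨U.symm (w : E), w.2⟩ := U.symm_apply_apply _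
    rw [h]
    exact T.mem_graph ⟨U.symm (w : E), w.2⟩
  · intro h
    rw [LinearPMap.mem_graph_iff] at h
    obtain ⟨⟨w, hw⟩, h1, h2⟩ := h
    obtain rfl : w = U.symm u := h1
    have h3 : unitaryConj U T ⟨u, hw⟩ = v := by
      change U (T ⟨U.symm u, hw⟩) = v
      rw [h2, U.apply_symm_apply]
    rw [← h3]
    exact (unitaryConj U T).mem_graph ⟨u, hw⟩

lemma liftBounded_add (B B' : BOp) (Ψ : Fock) :
    liftBounded (B + B') Ψ = liftBounded B Ψ + liftBounded B' Ψ := by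
  refine fock_ext ?_
  filter_upwards [val_liftBounded (B + B') Ψ, val_liftBounded B Ψ, val_liftBounded B' Ψ,
    val_add (liftBounded B Ψ) (liftBounded B' Ψ)] with q h1 h2 h3 h4
  rw [h1, h4, h2, h3]
  rfl

lemma liftBounded_smul (c : ℂ) (B : BOp) (Ψ : Fock) :
    liftBounded (c • B) Ψ = c • liftBounded B Ψ := by
  refine fock_ext ?_
  filter_upwards [val_liftBounded (c • B) Ψ, val_liftBounded B Ψ,
    val_smul c (liftBounded B Ψ)] with q h1 h2 h3
  rw [h1, h3, h2]
  rfl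

lemma liftBounded_one (Ψ : Fock) : liftBounded (1 : BOp) Ψ = Ψ :=
  fock_ext (val_liftBounded (1 : BOp) Ψ)

lemma couplingIntegral_smul (F : Lp BOp 2 (volume : Measure Space)) (c : ℂ)
    (x : Lp ℂ 2 (volume : Measure Space)) :
    couplingIntegral F (c • x) = starRingEnd ℂ c • couplingIntegral F x := by
  rw [couplingIntegral_apply, couplingIntegral_apply, ← integral_smul]
  refine integral_congr_ae ?_
  filter_upwards [Lp.coeFn_smul c x] with k hk
  rw [hk, Pi.smul_apply, smul_eq_mul, map_mul, mul_smul]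

/-! ### The dressing transformation -/

variable {G F : Lp BOp 2 (volume : Measure Space)} {f y : Lp ℂ 2 (volume : Measure Space)}

lemma coeFn_smul_weighted (hy : (y : Space → ℂ) =ᵐ[volume] fun k => (‖k‖ : ℂ) * f k) (c : ℂ) :
    ((c • y : Lp ℂ 2 (volume : Measure Space)) : Space → ℂ) =ᵐ[volume]
      fun k => (‖k‖ : ℂ) * (c • f : Lp ℂ 2 (volume : Measure Space)) k := by
  filter_upwards [hy, Lp.coeFn_smul c y, Lp.coeFn_smul c f] with k h1 h2 h3
  rw [h2, h3, Pi.smul_apply, Pi.smul_apply, h1, smul_eq_mul, smul_eq_mul]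
  ring

lemma creation_graph_sc_smul (c : ℂ) {Ψ Φ : Fock} (h : (Ψ, Φ) ∈ (creation (sc y)).graph) :
    (Ψ, c • Φ) ∈ (creation (sc (c • y))).graph := by
  refine creation_graph_congr ?_ (creation_graph_smul c h)
  rw [map_smul]
  exact (Lp.coeFn_smul c (sc y)).symm

lemma annihilation_graph_sc_smul (c : ℂ) {Ψ Φ : Fock} (h : (Ψ, Φ) ∈ (annihilation (sc y)).graph) :
    (Ψ, starRingEnd ℂ c • Φ) ∈ (annihilation (sc (c • y))).graph := by
  refine annihilation_graph_congr ?_ (annihilation_graph_smul c h)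
  rw [map_smul]
  exact (Lp.coeFn_smul c (sc y)).symm

/-- The correction terms of the transformed `H_f` are defined on its domain, so the Weyl operator
preserves this domain; with the opposite parameter the same holds for its inverse. -/
lemma weyl_fieldEnergy_domain (hy : (y : Space → ℂ) =ᵐ[volume] fun k => (‖k‖ : ℂ) * f k)
    {Ψ Φ : Fock} (h : (Ψ, Φ) ∈ fieldEnergy.graph) : ∃ Φ', (weyl f Ψ, Φ') ∈ fieldEnergy.graph := by
  obtain ⟨Φ₁, h1, -⟩ := exists_creation_of_fieldEnergy (coeFn_sc_energy hy) h
  obtain ⟨Φ₂, h2, -⟩ := exists_annihilation_of_fieldEnergy (coeFn_sc_energy hy) h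
  exact ⟨_, weyl_fieldEnergy_graph hy h h1 h2⟩

lemma imag_smul_conj_smul (g : ℝ) (Ψ : Fock) :
    Complex.I • starRingEnd ℂ ((g : ℂ) * Complex.I) • Ψ = (g : ℂ) • Ψ := by
  rw [smul_smul, map_mul, Complex.conj_ofReal, Complex.conj_I]
  congr 1
  linear_combination (-(g : ℂ)) * Complex.I_mul_I

lemma imag_smul_smul (g : ℝ) (Ψ : Fock) :
    Complex.I • ((g : ℂ) * Complex.I) • Ψ = -((g : ℂ) • Ψ) := by
  rw [smul_smul, ← neg_smul]
  congr 1
  linear_combination (g : ℂ) * Complex.I_mul_I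

/-- With the parameter `i g f`, the factor `i` of the exponential and the conjugate `-i g` from the
coupling integral combine to the real number `g`. -/
lemma weyl_creation_imag (g : ℝ) {Ψ Φ : Fock} (h : (Ψ, Φ) ∈ (creation G).graph) :
    (weyl (((g : ℂ) * Complex.I) • f) Ψ, weyl (((g : ℂ) * Complex.I) • f)
      (Φ - (g : ℂ) • liftBounded (couplingIntegral G f) Ψ)) ∈ (creation G).graph := by
  have h1 := weyl_creation_graph G (((g : ℂ) * Complex.I) • f) h
  rwa [couplingIntegral_smul, liftBounded_smul, imag_smul_conj_smul] at h1

lemma weyl_annihilation_imag (g : ℝ) {Ψ Φ : Fock} (h : (Ψ, Φ) ∈ (annihilation G).graph) :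
    (weyl (((g : ℂ) * Complex.I) • f) Ψ, weyl (((g : ℂ) * Complex.I) • f)
      (Φ - (g : ℂ) • liftBounded (star (couplingIntegral G f)) Ψ)) ∈ (annihilation G).graph := by
  have h1 := weyl_annihilation_graph G (((g : ℂ) * Complex.I) • f) h
  have h2 : star (starRingEnd ℂ ((g : ℂ) * Complex.I)) = (g : ℂ) * Complex.I :=
    star_star ((g : ℂ) * Complex.I)
  rwa [couplingIntegral_smul, star_smul, h2, liftBounded_smul, imag_smul_smul,
    ← sub_eq_add_neg] at h1

lemma weyl_fieldEnergy_imag (hy : (y : Space → ℂ) =ᵐ[volume] fun k => (‖k‖ : ℂ) * f k) (g : ℝ)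
    {Ψ Φ Φ₁ Φ₂ : Fock} (h : (Ψ, Φ) ∈ fieldEnergy.graph)
    (h₁ : (Ψ, Φ₁) ∈ (creation (sc y)).graph) (h₂ : (Ψ, Φ₂) ∈ (annihilation (sc y)).graph) :
    (weyl (((g : ℂ) * Complex.I) • f) Ψ, weyl (((g : ℂ) * Complex.I) • f)
      (Φ - (g : ℂ) • (Φ₁ + Φ₂) + ((g : ℂ) ^ 2 * inner ℂ f y) • Ψ)) ∈ fieldEnergy.graph := by
  have h1 := weyl_fieldEnergy_graph (coeFn_smul_weighted hy ((g : ℂ) * Complex.I)) h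
    (creation_graph_sc_smul _ h₁) (annihilation_graph_sc_smul _ h₂)
  have h2 : (inner ℂ (((g : ℂ) * Complex.I) • f) (((g : ℂ) * Complex.I) • y) : ℂ) =
      (g : ℂ) ^ 2 * inner ℂ f y := by
    rw [inner_smul_left, inner_smul_right, map_mul, Complex.conj_ofReal, Complex.conj_I]
    linear_combination (-(g : ℂ) ^ 2 * inner ℂ f y) * Complex.I_mul_I
  rwa [smul_sub, imag_smul_smul, imag_smul_conj_smul, h2, ← neg_add', ← smul_add,
    ← sub_eq_add_neg] at h1

/-- All corrections cancel. The scalars are `g² ⟨f, y⟩` from `D`, the same from `H_f`, and `-2 g²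
⟨f, y⟩` from the scalar part of the new coupling. The field operator of `y` appears with opposite
signs in `H_f` and in the new coupling, and the coupling integrals in `D` undo the shifts of `a*(G)`
and `a(G)`. -/
lemma weyl_hamiltonian_graph {A : Electron →ₗ.[ℂ] Electron} (hA : IsSelfAdjoint A) {t : ℝ}
    (ht : (t : ℂ) ∉ opSpectrum A) (hy : (y : Space → ℂ) =ᵐ[volume] fun k => (‖k‖ : ℂ) * f k)
    (g : ℝ) {D : BOp} (hD : D = (inner ℂ f y : ℂ) • (1 : BOp) +
      (couplingIntegral G f + star (couplingIntegral G f)))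
    {Ψ Φ : Fock} (h : (Ψ, Φ) ∈ (hamiltonian A G g).graph) :
    (weyl (((g : ℂ) * Complex.I) • f) Ψ, weyl (((g : ℂ) * Complex.I) • f) Φ) ∈
      (hamiltonian (addBounded A (((g ^ 2 : ℝ) : ℂ) • D))
        (fun k => G k + scalarCoupling y k) g).graph := by
  obtain ⟨Φ₁, Φ₂, Φ₃, Φ₄, h1, h2, h3, h4, rfl⟩ := mem_hamiltonian_graph.1 h
  obtain ⟨Φ₅, h5, -⟩ := exists_creation_of_fieldEnergy (coeFn_sc_energy hy) h2
  obtain ⟨Φ₆, h6, -⟩ := exists_annihilation_of_fieldEnergy (coeFn_sc_energy hy) h2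
  have hc : star (couplingIntegral (sc y) f) = couplingIntegral (sc y) f := by
    rw [couplingIntegral_sc, star_smul, star_one, inner_weighted hy]
    congr 1
    exact Complex.conj_ofReal _
  have hl : ∀ Ψ, liftBounded (couplingIntegral (sc y) f) Ψ = (inner ℂ f y : ℂ) • Ψ := fun Ψ => by
    rw [couplingIntegral_sc, liftBounded_smul, liftBounded_one]
  have w1 := weyl_liftElectron_graph (((g : ℂ) * Complex.I) • f) hA ht h1
  have w2 := weyl_fieldEnergy_imag hy g h2 h5 h6
  have w3 := weyl_creation_imag (f := f) g h3
  have w4 := weyl_annihilation_imag (f := f) g h4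
  have w5 := creation_graph_congr (coeFn_sc y) (weyl_creation_imag (f := f) g h5)
  have w6 := annihilation_graph_congr (coeFn_sc y) (weyl_annihilation_imag (f := f) g h6)
  rw [hl] at w5
  rw [hc, hl] at w6
  set W := weyl (((g : ℂ) * Complex.I) • f) with hW
  have hDΨ : liftBounded (((g ^ 2 : ℝ) : ℂ) • D) (W Ψ) = W (((g : ℂ) ^ 2) •
      ((inner ℂ f y : ℂ) • Ψ + (liftBounded (couplingIntegral G f) Ψ +
        liftBounded (star (couplingIntegral G f)) Ψ))) := by
    rw [hW, ← weyl_liftBounded, liftBounded_smul, hD, liftBounded_add, liftBounded_add,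
      liftBounded_smul, liftBounded_one, Complex.ofReal_pow]
  refine mem_hamiltonian_graph.2 ⟨W Φ₁ + liftBounded (((g ^ 2 : ℝ) : ℂ) • D) (W Ψ), _, _, _,
    (mem_liftElectron_addBounded _).2 (by rwa [add_sub_cancel_right]), w2,
    creation_graph_add w3 w5, annihilation_graph_add w4 w6, ?_⟩
  rw [hDΨ]
  generalize liftBounded (couplingIntegral G f) Ψ = m
  generalize liftBounded (star (couplingIntegral G f)) Ψ = m'
  simp only [← map_add, ← map_smul]
  congr 1
  module

end

section

variable {G F : Lp BOp 2 (volume : Measure Space)} {f y : Lp ℂ 2 (volume : Measure Space)}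

lemma exists_hamiltonian_graph (hG : (G : Space → BOp) =ᵐ[volume] fun k => (‖k‖ : ℂ) • F k)
    {A : Electron →ₗ.[ℂ] Electron} {g : ℝ} {Ψ Φ₁ Φ₂ : Fock} (h₁ : (Ψ, Φ₁) ∈ (liftElectron A).graph)
    (h₂ : (Ψ, Φ₂) ∈ fieldEnergy.graph) : ∃ Φ, (Ψ, Φ) ∈ (hamiltonian A G g).graph := by
  obtain ⟨Φ₃, h3, -⟩ := exists_creation_of_fieldEnergy hG h₂
  obtain ⟨Φ₄, h4, -⟩ := exists_annihilation_of_fieldEnergy hG h₂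
  exact ⟨_, mem_hamiltonian_graph.2 ⟨Φ₁, Φ₂, Φ₃, Φ₄, h₁, h₂, h3, h4, rfl⟩⟩

lemma weyl_symm (x : Lp ℂ 2 (volume : Measure Space)) : (weyl x).symm = weyl (-x) :=
  fockSystem.exp_symm x

/-- The dressing transformation of the Hamiltonian. -/
theorem unitaryConj_weyl_hamiltonian {A : Electron →ₗ.[ℂ] Electron} (hA : IsSelfAdjoint A) {t : ℝ}
    (ht : (t : ℂ) ∉ opSpectrum A) (hG : (G : Space → BOp) =ᵐ[volume] fun k => (‖k‖ : ℂ) • F k)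
    (hy : (y : Space → ℂ) =ᵐ[volume] fun k => (‖k‖ : ℂ) * f k)
    (g : ℝ) {D : BOp} (hD : D = (inner ℂ f y : ℂ) • (1 : BOp) +
      (couplingIntegral G f + star (couplingIntegral G f))) :
    unitaryConj (weyl (((g : ℂ) * Complex.I) • f)) (hamiltonian A G g) =
      hamiltonian (addBounded A (((g ^ 2 : ℝ) : ℂ) • D)) (fun k => G k + scalarCoupling y k) g := by
  set W := weyl (((g : ℂ) * Complex.I) • f) with hW
  refine LinearPMap.eq_of_eq_graph (Submodule.ext ?_)
  rintro ⟨Θ, Φ⟩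
  rw [mem_unitaryConj_graph]
  constructor
  · intro h
    have h1 := weyl_hamiltonian_graph hA ht hy g hD h
    rwa [← hW, W.apply_symm_apply, W.apply_symm_apply] at h1
  · intro h
    -- Only the domains of the first two terms are needed: the inverse Weyl operator preserves both,
    -- and `H_f` controls the interaction. So `W.symm Θ` lies in the domain of the original
    -- Hamiltonian, and uniqueness of values gives the equality.
    obtain ⟨Φ₁, Φ₂, Φ₃, Φ₄, h1, h2, -, -, -⟩ := mem_hamiltonian_graph.1 h
    have h3 : W.symm = weyl ((-((g : ℂ) * Complex.I)) • f) := by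
      rw [hW, weyl_symm, neg_smul]
    have h4 := weyl_liftElectron_graph ((-((g : ℂ) * Complex.I)) • f) hA ht
      ((mem_liftElectron_addBounded _).1 h1)
    obtain ⟨Φ₅, h5⟩ := weyl_fieldEnergy_domain
      (coeFn_smul_weighted hy (-((g : ℂ) * Complex.I))) h2
    rw [← h3] at h4 h5
    obtain ⟨Φ', h6⟩ := exists_hamiltonian_graph hG (g := g) h4 h5
    have h7 := weyl_hamiltonian_graph hA ht hy g hD h6
    rw [← hW, W.apply_symm_apply] at h7
    have h8 : W Φ' = Φ := LinearPMap.mem_graph_snd_inj _ h7 h rfl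
    rw [← h8, W.symm_apply_apply]
    exact h6

/-! ### The Weyl operator as an exponential series -/

lemma isWeylOperator_weyl (g : ℝ) (x : Lp ℂ 2 (volume : Measure Space)) :
    IsWeylOperator g x (weyl (g • x)) := by
  intro Ψ hΨ
  let v : finiteParticle := ⟨Ψ, hΨ⟩
  refine ⟨fun n => ((fieldOp x ^ n) v : finiteParticle), rfl, fun n => ?_, ?_⟩
  · have h1 := fieldOp_graph x ((fieldOp x ^ n) v)
    rwa [← Module.End.mul_apply, ← pow_succ'] at h1
  · refine (fockSystem.hasSum_exp (g • x) v).congr_fun fun n => ?_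
    have h1 : fieldOp (g • x) = (g : ℂ) • fieldOp x := LinearMap.ext (fieldOp_smul x g)
    have h2 : ((fieldOp (g • x) ^ n) v : finiteParticle) = (g : ℂ) ^ n • (fieldOp x ^ n) v := by
      rw [h1, smul_pow, LinearMap.smul_apply]
    change _ = FieldSystem.expCoeff n • ((fieldOp (g • x) ^ n) v : Fock)
    rw [h2, Submodule.coe_smul, smul_smul, FieldSystem.expCoeff, mul_pow]
    congr 1
    ring

lemma analyticAt_weyl (Ψ : finiteParticle) (x : Lp ℂ 2 (volume : Measure Space)) :
    AnalyticAt ℝ (fun x => weyl x (Ψ : Fock)) x := fockSystem.analyticAt_exp Ψ x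

/-! ### The projection of the interaction -/

lemma liftBounded_creation_eq_zero {K : Space → BOp} {P : BOp}
    (hK : ∀ᵐ k, ∀ u, P (K k (P u)) = 0) {Ψ Φ : Fock}
    (h : (liftBounded P Ψ, Φ) ∈ (creation K).graph) : liftBounded P Φ = 0 := by
  refine eq_zero_of_val ?_
  have h1 : ∀ᵐ q ∂configMeasure, P (creationFun K (fun r => P (val Ψ r)) q) = 0 := by
    refine ae_config_iff.2 fun n => ?_
    cases n with
    | zero => exact Eventually.of_forall fun k => map_zero P
    | succ n =>
      filter_upwards [ae_eval hK] with k hk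
      simp only [creationFun, map_smul, map_sum]
      rw [Finset.sum_eq_zero fun j _ => hk j _, smul_zero]
  filter_upwards [h1, val_liftBounded P Φ, pair_mem_creation_graph.1 h,
    creationFun_congr K (val_liftBounded P Ψ)] with q h2 h3 h4 h5
  rw [h3, h4, h5, h2]

lemma liftBounded_annihilation_eq_zero {K : Space → BOp} {P : BOp} (hP : IsSelfAdjoint P)
    (hK : ∀ᵐ k, ∀ u, P (K k (P u)) = 0) {Ψ Φ : Fock}
    (h : (liftBounded P Ψ, Φ) ∈ (annihilation K).graph) : liftBounded P Φ = 0 := by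
  have hK' : ∀ᵐ k, ∀ u, P (star (K k) (P u)) = 0 := by
    filter_upwards [hK] with k hk
    have h1 : P * K k * P = 0 := ContinuousLinearMap.ext hk
    have h2 : P * star (K k) * P = 0 := by
      have := congrArg star h1
      rwa [star_mul, star_mul, hP.star_eq, star_zero, ← mul_assoc] at this
    exact fun u => congrArg (fun T : BOp => T u) h2
  refine eq_zero_of_val ?_
  filter_upwards [val_liftBounded P Φ, pair_mem_annihilation_graph.1 h,
    annihilationIntegrand_congr K (val_liftBounded P Ψ)] with q h3 h4 h5
  rw [h3, h4.2, annihilationFun, map_smul, integral_congr_ae h5,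
    ← ContinuousLinearMap.integral_comp_comm P (h4.1.congr h5)]
  have h6 : ∀ᵐ k, P (annihilationIntegrand K (fun r => P (val Ψ r)) q k) = 0 := by
    filter_upwards [hK'] with k hk
    exact hk _
  rw [integral_eq_zero_of_ae h6, smul_zero]

lemma liftBounded_interaction_eq_zero {K : Space → BOp} {P : BOp} (hP : IsSelfAdjoint P)
    (hK : ∀ᵐ k, ∀ u, P (K k (P u)) = 0) (Ψ : Fock)
    (hΨ : liftBounded P Ψ ∈ (interaction K).domain) :
    liftBounded P (interaction K ⟨liftBounded P Ψ, hΨ⟩) = 0 := by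
  obtain ⟨a, b, ha, hb, hab⟩ := mem_add_graph.1 ((interaction K).mem_graph ⟨liftBounded P Ψ, hΨ⟩)
  have h1 : liftBounded P (a + b) = 0 := by
    rw [map_add, liftBounded_creation_eq_zero hK ha, liftBounded_annihilation_eq_zero hP hK hb,
      add_zero]
  rw [hab] at h1
  exact h1

/-- The operator `|x⟩⟨y|`. -/
def ketBra (x y : Electron) : BOp := (innerSL ℂ y).smulRight x

lemma ketBra_apply (x y u : Electron) : ketBra x y u = (inner ℂ y u : ℂ) • x := rfl

lemma ketBra_add_left (x₁ x₂ y : Electron) : ketBra (x₁ + x₂) y = ketBra x₁ y + ketBra x₂ y := by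
  ext1 u
  rw [add_apply, ketBra_apply, ketBra_apply, ketBra_apply, smul_add]

lemma ketBra_add_right (x y₁ y₂ : Electron) : ketBra x (y₁ + y₂) = ketBra x y₁ + ketBra x y₂ := by
  ext1 u
  rw [add_apply, ketBra_apply, ketBra_apply, ketBra_apply, inner_add_left, add_smul]

lemma ketBra_smul_left (c : ℝ) (x y : Electron) : ketBra (c • x) y = c • ketBra x y := by
  ext1 u
  rw [real_smul_bop, smul_apply, ketBra_apply, ketBra_apply, real_smul_electron, smul_comm]

lemma ketBra_smul_right (c : ℝ) (x y : Electron) : ketBra x (c • y) = c • ketBra x y := by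
  ext1 u
  rw [real_smul_bop, smul_apply, ketBra_apply, ketBra_apply, real_smul_electron, inner_smul_left,
    Complex.conj_ofReal, mul_smul]

lemma norm_ketBra_le (x y : Electron) : ‖ketBra x y‖ ≤ ‖x‖ * ‖y‖ := by
  refine ContinuousLinearMap.opNorm_le_bound _ (by positivity) fun u => ?_
  rw [ketBra_apply, norm_smul]
  calc ‖(inner ℂ y u : ℂ)‖ * ‖x‖ ≤ ‖y‖ * ‖u‖ * ‖x‖ := by
        gcongr
        exact norm_inner_le_norm y u
    _ = _ := by ring

/-- The orthogonal projection onto the line through `ψ`. -/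
def lineProjection (ψ : Electron) : BOp := (‖ψ‖ ^ 2)⁻¹ • ketBra ψ ψ

lemma lineProjection_apply (ψ u : Electron) :
    lineProjection ψ u = (((‖ψ‖ : ℂ) ^ 2)⁻¹ * inner ℂ ψ u) • ψ := by
  rw [lineProjection, real_smul_bop, smul_apply, ketBra_apply, smul_smul]
  push_cast
  rfl

lemma isSelfAdjoint_lineProjection (ψ : Electron) : IsSelfAdjoint (lineProjection ψ) := by
  rw [ContinuousLinearMap.isSelfAdjoint_iff_isSymmetric]
  intro u v
  change inner ℂ (lineProjection ψ u) v = inner ℂ u (lineProjection ψ v)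
  rw [lineProjection_apply, lineProjection_apply, inner_smul_left, inner_smul_right, map_mul,
    inner_conj_symm, map_inv₀, map_pow, Complex.conj_ofReal]
  ring

lemma isStarProjection_lineProjection {ψ : Electron} (hψ : ψ ≠ 0) :
    IsStarProjection (lineProjection ψ) := by
  refine ⟨?_, isSelfAdjoint_lineProjection ψ⟩
  have h0 : (‖ψ‖ : ℂ) ^ 2 ≠ 0 := by simpa using hψ
  refine ContinuousLinearMap.ext fun u => ?_
  change lineProjection ψ (lineProjection ψ u) = lineProjection ψ u
  rw [lineProjection_apply ψ u, map_smul, lineProjection_apply ψ ψ, inner_self_eq_norm_sq_to_K]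
  have h1 : ((‖ψ‖ : ℂ) ^ 2)⁻¹ * ((‖ψ‖ : ℂ) ^ 2) = 1 := inv_mul_cancel₀ h0
  exact congrArg _ ((congrArg (· • ψ) h1).trans (one_smul ℂ ψ))

lemma range_lineProjection {ψ : Electron} (hψ : ψ ≠ 0) :
    LinearMap.range (lineProjection ψ : Electron →ₗ[ℂ] Electron) = Submodule.span ℂ {ψ} := by
  have h0 : (‖ψ‖ : ℂ) ^ 2 ≠ 0 := by simpa using hψ
  refine le_antisymm ?_ ?_
  · rintro _ ⟨u, rfl⟩
    refine Submodule.mem_span_singleton.2 ⟨_, (lineProjection_apply ψ u).symm⟩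
  · rw [Submodule.span_singleton_le_iff_mem]
    refine ⟨ψ, (lineProjection_apply ψ ψ).trans ?_⟩
    rw [inner_self_eq_norm_sq_to_K]
    have h1 : ((‖ψ‖ : ℂ) ^ 2)⁻¹ * ((‖ψ‖ : ℂ) ^ 2) = 1 := inv_mul_cancel₀ h0
    exact (congrArg (· • ψ) h1).trans (one_smul ℂ ψ)

/-- The choice of `h` enters here: `ωh = -⟨ψ, G ψ⟩ / ‖ψ‖²` removes the diagonal matrix element of
the coupling, and a rank one projection sees nothing else. -/
lemma lineProjection_coupling (G : Lp BOp 2 (volume : Measure Space)) {ψ : Electron} (hψ : ψ ≠ 0) :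
    ∀ᵐ k, ∀ u, lineProjection ψ ((G k + scalarCoupling (formFactor G ψ) k)
      (lineProjection ψ u)) = 0 := by
  have h0 : (‖ψ‖ : ℂ) ^ 2 ≠ 0 := by simpa using hψ
  filter_upwards [coeFn_formFactor G ψ] with k hk u
  have h1 : (inner ℂ ψ ((G k + scalarCoupling (formFactor G ψ) k) ψ) : ℂ) = 0 := by
    have h2 : (inner ℂ ψ ψ : ℂ) = (‖ψ‖ : ℂ) ^ 2 := inner_self_eq_norm_sq_to_K ψ
    rw [add_apply, scalarCoupling, smul_apply, ContinuousLinearMap.id_apply, inner_add_right,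
      inner_smul_right, hk, h2]
    linear_combination (-inner ℂ ψ (G k ψ) : ℂ) * inv_mul_cancel₀ h0
  rw [lineProjection_apply ψ u, map_smul, map_smul, lineProjection_apply, h1, mul_zero, zero_smul,
    smul_zero]

/-- `|x⟩⟨y|` as a bounded real-bilinear function of `x`, `y`. -/
def ketBraReal : Electron →L[ℝ] Electron →L[ℝ] BOp :=
  LinearMap.mkContinuous₂ (LinearMap.mk₂ ℝ ketBra ketBra_add_left ketBra_smul_left ketBra_add_right
    ketBra_smul_right) 1 (fun x y => by rw [one_mul]; exact norm_ketBra_le x y)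

lemma contDiffAt_lineProjection {ψ : Electron} (hψ : ψ ≠ 0) :
    ContDiffAt ℝ ω lineProjection ψ := by
  have h1 : ContDiff ℝ ω fun ψ : Electron => (ketBra ψ ψ : BOp) := by
    exact ketBraReal.contDiff.clm_apply contDiff_id
  unfold lineProjection
  refine ContDiffAt.smul (ContDiffAt.inv (contDiffAt_id.norm_sq ℂ) ?_) h1.contDiffAt
  simpa using hψ

end

/-! ### Independence of representatives, and the proof of the theorem. -/

section

lemma hamiltonian_congr (A : Electron →ₗ.[ℂ] Electron) {K K' : Space → BOp} (h : K =ᵐ[volume] K')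
    (g : ℝ) : hamiltonian A K g = hamiltonian A K' g := by
  rw [hamiltonian, interaction_congr h, hamiltonian]

lemma IsWeylOperator.congr {g : ℝ} {f f' : Space → ℂ} {U : Fock ≃ₗᵢ[ℂ] Fock}
    (h : IsWeylOperator g f U) (hf : f =ᵐ[volume] f') : IsWeylOperator g f' U := by
  have h1 : fieldOperator f = fieldOperator f' := by
    refine interaction_congr ?_
    filter_upwards [hf] with k hk
    rw [scalarCoupling, hk, scalarCoupling]
  intro Ψ hΨ
  rw [← h1]
  exact h Ψ hΨ

lemma exists_not_mem_opSpectrum {A : Electron →ₗ.[ℂ] Electron} {e₀ : ℝ}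
    (h : HasSingleEigenvalueBelow A 0 e₀) : ∃ t : ℝ, (t : ℂ) ∉ opSpectrum A := by
  refine ⟨e₀ - 1, fun ht => ?_⟩
  have := (h.spectrum_below (e₀ - 1) (by linarith [h.lt])).1 ht
  linarith

end

end

end PhotonField

theorem theoremA1 (V : Space → ℝ) (Hel : Electron →ₗ.[ℂ] Electron)
    (hsa : IsSelfAdjoint Hel) (hV : ActsAsSchrodinger V Hel)
    (e₀ : ℝ) (he₀ : HasSingleEigenvalueBelow Hel 0 e₀)
    (G : Space → Electron →L[ℂ] Electron) (hG : MemLp G 2 volume)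
    (hG1 : ∫⁻ k, ENNReal.ofReal ((1 + (‖k‖ ^ 2)⁻¹) * ‖G k‖ ^ 2) ≤ 1) :
    ∃ g₀ : ℝ, 0 < g₀ ∧
    ∃ (U : ℝ → (Fock ≃ₗᵢ[ℂ] Fock)) (ΔV P : ℝ → (Electron →L[ℂ] Electron)) (e : ℝ → ℝ)
      (h ωh : ℝ → Lp ℂ 2 (volume : Measure Space)),
      -- the statements for each fixed coupling constant
      (∀ g ∈ Ioo (-g₀) g₀,
        -- `ωh g` is the square-integrable function `k ↦ |k| h_g(k)`
        ((ωh g : Space → ℂ) =ᵐ[volume] fun k => (‖k‖ : ℂ) * h g k) ∧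
        IsWeylOperator g (fun k => Complex.I * h g k) (U g) ∧
        unitaryConj (U g) (hamiltonian Hel G g) =
          hamiltonian (addBounded Hel (((g ^ 2 : ℝ) : ℂ) • ΔV g))
            (fun k => G k + scalarCoupling (ωh g) k) g ∧
        IsSelfAdjoint (ΔV g) ∧
        HasSingleEigenvalueBelow (addBounded Hel (((g ^ 2 : ℝ) : ℂ) • ΔV g)) (-g ^ 2) (e g) ∧
        IsStarProjection (P g) ∧
        LinearMap.range (P g : Electron →ₗ[ℂ] Electron) =
          opEigenspace (addBounded Hel (((g ^ 2 : ℝ) : ℂ) • ΔV g)) (e g : ℂ) ∧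
        (∀ (Ψ : Fock)
          (hΨ : liftBounded (P g) Ψ ∈
            (interaction fun k => G k + scalarCoupling (ωh g) k).domain),
          liftBounded (P g)
            ((interaction fun k => G k + scalarCoupling (ωh g) k) ⟨liftBounded (P g) Ψ, hΨ⟩) = 0) ∧
        -- the fixed point equation for `h_g`
        (∀ φ ∈ opEigenspace (addBounded Hel (((g ^ 2 : ℝ) : ℂ) • ΔV g)) (e g : ℂ), ‖φ‖ = 1 →
          (h g : Space → ℂ) =ᵐ[volume] fun k => -((‖k‖ : ℂ)⁻¹ * inner ℂ φ (G k φ)))) ∧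
      -- real analyticity in the coupling constant
      AnalyticOnNhd ℝ e (Ioo (-g₀) g₀) ∧
      AnalyticOnNhd ℝ ΔV (Ioo (-g₀) g₀) ∧
      AnalyticOnNhd ℝ P (Ioo (-g₀) g₀) ∧
      AnalyticOnNhd ℝ h (Ioo (-g₀) g₀) ∧
      AnalyticOnNhd ℝ ωh (Ioo (-g₀) g₀) ∧
      (∀ Ψ : Fock, IsFiniteParticle Ψ → AnalyticOnNhd ℝ (fun g => U g Ψ) (Ioo (-g₀) g₀)) ∧
      (∀ Ψ ∈ fieldEnergy.domain, ∃ Θ : ℝ → Fock, AnalyticOnNhd ℝ Θ (Ioo (-g₀) g₀) ∧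
        ∀ g ∈ Ioo (-g₀) g₀,
          (Ψ, Θ g) ∈ (interaction fun k => G k + scalarCoupling (ωh g) k).graph) ∧
      -- multiplication operators
      ((∀ᵐ k, IsMultiplication (G k)) → ∀ g ∈ Ioo (-g₀) g₀, IsPotential (ΔV g)) ∧
      -- no further negative eigenvalue
      (opEigenspace Hel 0 = ⊥ → (∀ᵐ k, IsRelCompact Hel (G k)) → ∀ g ∈ Ioo (-g₀) g₀,
        HasSingleEigenvalueBelow (addBounded Hel (((g ^ 2 : ℝ) : ℂ) • ΔV g)) 0 (e g)) := by
  have hF := memLp_inv_smul hG hG1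
  set G₂ : Lp BOp 2 (volume : Measure Space) := hG.toLp G with hG₂
  set F₂ : Lp BOp 2 (volume : Measure Space) := hF.toLp _ with hF₂
  have hGG : (G₂ : Space → BOp) =ᵐ[volume] G := hG.coeFn_toLp
  have hGF : (G₂ : Space → BOp) =ᵐ[volume] fun k => (‖k‖ : ℂ) • F₂ k := by
    filter_upwards [hGG, hF.coeFn_toLp, ae_norm_ne_zero] with k h1 h2 h3
    rw [h1, h2, smul_smul]
    push_cast
    rw [mul_inv_cancel₀ (by exact_mod_cast h3), one_smul]
  have hw : ∀ ψ, (formFactor G₂ ψ : Space → ℂ) =ᵐ[volume]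
      fun k => (‖k‖ : ℂ) * formFactor F₂ ψ k := formFactor_eq_norm_mul hG hF
  -- The scalar in `inducedPotential` is a real part; since `⟨h, ωh⟩` is real, it is the full inner
  -- product that the Weyl transformation produces.
  have hwr : ∀ ψ, (((inner ℂ (formFactor F₂ ψ) (formFactor G₂ ψ) : ℂ).re : ℝ) : ℂ) =
      inner ℂ (formFactor F₂ ψ) (formFactor G₂ ψ) := by
    intro ψ
    rw [inner_weighted (hw ψ), Complex.ofReal_re]
  have hKK : ∀ ψ, (fun k => G₂ k + scalarCoupling (formFactor G₂ ψ) k) =ᵐ[volume]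
      fun k => G k + scalarCoupling (formFactor G₂ ψ) k := by
    intro ψ
    filter_upwards [hGG] with k hk
    rw [hk]
  obtain ⟨t, ht⟩ := exists_not_mem_opSpectrum he₀
  obtain ⟨g₀, hg₀, ψ, e, hψa, hea, hψ0, hev, hspan, hthr⟩ := exists_dressed_ground_state hsa he₀
    G₂ F₂ (norm_couplingIntegral_formFactor_le hG hF hG1)
    (fun ψ => inner_weighted_re_nonneg (hw ψ)) (fun ψ => inner_weighted_re_pos (hw ψ))
  have hha : AnalyticOnNhd ℝ (fun g => formFactor F₂ (ψ g)) (Ioo (-g₀) g₀) := fun g hg =>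
    ((contDiffAt_formFactor F₂ (hψ0 g hg)).comp g (hψa g hg)).analyticAt
  have hωa : AnalyticOnNhd ℝ (fun g => formFactor G₂ (ψ g)) (Ioo (-g₀) g₀) := fun g hg =>
    ((contDiffAt_formFactor G₂ (hψ0 g hg)).comp g (hψa g hg)).analyticAt
  refine ⟨g₀, hg₀, fun g => weyl (g • Complex.I • formFactor F₂ (ψ g)),
    fun g => inducedPotential G₂ F₂ (ψ g), fun g => lineProjection (ψ g), e,
    fun g => formFactor F₂ (ψ g), fun g => formFactor G₂ (ψ g), ?_, ?_, ?_, ?_, hha, hωa, ?_, ?_,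
    ?_, ?_⟩
  · intro g hg
    refine ⟨hw _, ?_, ?_, isSelfAdjoint_inducedPotential G₂ F₂ (ψ g), hev g hg,
      isStarProjection_lineProjection (hψ0 g hg), ?_, ?_, ?_⟩
    · exact (isWeylOperator_weyl g _).congr (Lp.coeFn_smul Complex.I (formFactor F₂ (ψ g)))
    · have h1 := unitaryConj_weyl_hamiltonian hsa ht hGF (hw (ψ g)) g
        (D := inducedPotential G₂ F₂ (ψ g)) (by
          rw [inducedPotential, real_smul_bop, hwr])
      rw [hamiltonian_congr _ hGG, hamiltonian_congr _ (hKK (ψ g)), mul_smul] at h1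
      beta_reduce
      rw [real_smul_Lp]
      exact h1
    · rw [range_lineProjection (hψ0 g hg), hspan g hg]
    · intro Ψ hΨ
      refine liftBounded_interaction_eq_zero (isSelfAdjoint_lineProjection (ψ g)) ?_ Ψ hΨ
      filter_upwards [lineProjection_coupling G₂ (hψ0 g hg), hGG] with k h1 h2
      rwa [h2] at h1
    · intro φ hφ hφ1
      rw [hspan g hg] at hφ
      exact formFactor_eq_of_mem_span hF hφ hφ1
  · exact fun g hg => (hea g hg).analyticAt
  · exact fun g hg =>
      ((contDiffAt_inducedPotential G₂ F₂ (hψ0 g hg)).comp g (hψa g hg)).analyticAt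
  · exact fun g hg => ((contDiffAt_lineProjection (hψ0 g hg)).comp g (hψa g hg)).analyticAt
  · intro Ψ hΨ g hg
    have h1 : AnalyticAt ℝ (fun g => g • Complex.I • formFactor F₂ (ψ g)) g :=
      analyticAt_id.smul ((hha g hg).const_smul (c := Complex.I))
    exact (analyticAt_weyl ⟨Ψ, hΨ⟩ _).fun_comp h1
  · intro Ψ hΨ
    have h1 := fieldEnergy.mem_graph ⟨Ψ, hΨ⟩
    obtain ⟨L, hL⟩ := exists_interaction_clm h1
    obtain ⟨a, ha, -⟩ := exists_creation_of_fieldEnergy hGF h1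
    obtain ⟨b, hb, -⟩ := exists_annihilation_of_fieldEnergy hGF h1
    have h2 : (Ψ, a + b) ∈ (interaction G₂).graph := mem_add_graph.2 ⟨a, b, ha, hb, rfl⟩
    -- The part with coupling `G` does not depend on `g`; the scalar part is a continuous
    -- real-linear function of `h + ωh`, hence analytic.
    refine ⟨fun g => (a + b) + L (formFactor F₂ (ψ g) + formFactor G₂ (ψ g)), fun g hg =>
      analyticAt_const.add ((L.analyticAt _).fun_comp ((hha g hg).add (hωa g hg))), fun g hg => ?_⟩
    have h3 := interaction_graph_add h2 (hL _ _ (hw (ψ g)))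
    have h4 : (fun k => G₂ k + sc (formFactor G₂ (ψ g)) k) =ᵐ[volume]
        fun k => G k + scalarCoupling (formFactor G₂ (ψ g)) k := by
      filter_upwards [hGG, coeFn_sc (formFactor G₂ (ψ g))] with k h5 h6
      rw [h5, h6]
    rwa [interaction_congr h4] at h3
  · intro hmul g hg
    refine isPotential_inducedPotential ?_ (ψ g)
    filter_upwards [hmul, hGG] with k h1 h2
    rwa [h2]
  · intro h0 hc
    refine hthr h0 ?_
    filter_upwards [hc, hGG] with k h1 h2
    rwa [h2]
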